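/- Let $\Lambda=\mathbb Z^2$, let $r,n\ge 0$ be integers, let $m_1,\dots,m_n\in\Lambda$ be primitive vectors (repetitions allowed), and let $A_1,\dots,A_n\in\mathfrak{gl}(r,\mathbb C)$ be pairwise commuting matrices. *Extended tropical vertex group.* For a primitive $m=(a,b)\in\Lambda$ let $n_m=(-b,a)$ be the positively oriented primitive normal and let $\partial_{n}$ be the derivation $\partial_{n}z^{p}=\langle p,n\rangle z^{p}$. The extended tropical vertex group is the group of exponentials, with the Baker--Campbell--Hausdorff product, of the series (with coefficients in $(t_1,\dots,t_n)\subset\mathbb C[\![t_1,\dots,t_n]\!]$) of elements $(A,\partial_{q})z^{p}$, $A\in\mathfrak{gl}(r,\mathbb C)$, with Lie bracket $$[(A,\partial_q)z^p,(A',\partial_{q'})z^{p'}]=\big([A,A']+\langle p',q\rangle A'-\langle p,q'\rangle A,\ \partial_{\langle p',q\rangle q'-\langle p,q'\rangle q}\big)z^{p+p'};$$ equivalently $(A,\partial_q)z^p$ is the first order differential operator $z^p(A+\partial_q)$. A wall is a line $\mathbb R m$ or a ray $\mathbb R_{\ge0}m$, $m$ primitive, with a function $\overrightarrow f=(M,f)$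 whose components are congruent to $1$ modulo $(t_1,\dots,t_n)$ and otherwise contain only monomials $z^{lm}$, $l\ge1$; one puts $\log\overrightarrow f=(\log M,\log f\,\partial_{n_m})$ and $\theta=\exp(\log\overrightarrow f)$. A set of walls, finitely many of which are non-trivial modulo each power of $(t_1,\dots,t_n)$, is consistent if for every smooth immersed closed path in $\mathbb R^2\setminus\{0\}$ that starts off the walls and crosses them transversally, the ordered product $\theta_s^{\pm1}\circ\cdots\circ\theta_1^{\pm1}$ over its successive crossings (later crossings on the left, sign $+$ when the path crosses in the direction of $n_m$) is the identity. *Tropical counts.* For non-zero $w_1,\dots,w_s\in\Lambda$ with $w_{\mathrm{out}}=\sum_r w_r\ne0$ and generic $\xi\in(\mathbb R^2)^s$, let $T_{\mathbf w,\xi}$ be the finite set of isomorphism classes of rational parametrized tropical curves $h\colon\Gamma\to\mathbb R^2$ with exactly $s+1$ distinct unbounded edges $E_1,\dots,E_s,E_{\mathrm{out}}$ and all vertices of valency at least three, such that $h(E_r)$ asymptotically coincides with $\xi_r-\mathbb R_{\ge0}w_r$ and has as weight the index of $w_r$, and $h(E_{\mathrm{out}})$ points in the direction of $w_{\mathrm{out}}$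 and has as weight the index of $w_{\mathrm{out}}$. Let $N^{\mathrm{trop}}_{\mathbf w}=\sum_{h\in T_{\mathbf w,\xi}}\prod_V\mathrm{Mult}_V(h)$, where a trivalent vertex $V$ two of whose edges have weights $w,w'$ and primitive directions $m,m'$ has $\mathrm{Mult}_V(h)=ww'|m\wedge m'|$; this is independent of the generic $\xi$. (In particular $N^{\mathrm{trop}}_{\mathbf w}=0$ if $s=1$.) For $\mathbf P\in\mathbb Z_{\ge0}^n$ write $\mathbf k\vdash\mathbf P$ for a tuple of partitions $k_i$ of $P_i$ with $k_{il}$ parts equal to $l$, so $\sum_l lk_{il}=P_i$, and let $\mathbf w(\mathbf k)$ be the tuple containing the vector $lm_i$ exactly $k_{il}$ times. **Theorem.** Let $\mathfrak D$ consist of the lines $\mathbb R m_i$ with functions $\overrightarrow f_i=(1+A_it_iz^{m_i},\,1+t_iz^{m_i})$, $1\le i\le n$, and let $\mathfrak D^\infty\supseteq\mathfrak D$ be the minimal consistent scattering diagram such that $\mathfrak D^\infty\setminus\mathfrak D$ consists of rays (minimal: none of these rays is trivial and no two of them have the same support). Then for every ray $(\mathfrak d=\mathbb R_{\ge0}m_{\mathfrak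 d},\overrightarrow f_{\mathfrak d})\in\mathfrak D^\infty\setminus\mathfrak D$, $m_{\mathfrak d}$ primitive, $$\log\overrightarrow f_{\mathfrak d}=\sum_{l_{\mathfrak d}\ge1}\ \sum_{\mathbf P}\ \sum_{\mathbf k\vdash\mathbf P}N^{\mathrm{trop}}_{\mathbf w(\mathbf k)}\Big(\prod_{i=1}^n\prod_{l\ge1}\Big(\frac{(-1)^{l-1}}{l^2}\Big)^{k_{il}}\frac1{k_{il}!}\Big)\Big(\prod_{i=1}^nt_i^{P_i}\Big)\Big(\sum_{i=1}^n\sum_{l\ge1}l\,k_{il}A_i^l,\ l_{\mathfrak d}\,\partial_{n_{m_{\mathfrak d}}}\Big)z^{\sum_iP_im_i},$$ where the second sum is over all $\mathbf P\in\mathbb Z_{\ge0}^n$ with $\sum_iP_im_i=l_{\mathfrak d}m_{\mathfrak d}$. -/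

import Mathlib

open scoped BigOperators

noncomputable section

namespace ExtVertex

/-! ### The lattice `Λ = ℤ²` -/

/-- The lattice `Λ ≅ ℤ²`; the dual lattice is identified with `ℤ²` through the dual basis. -/
abbrev Lat : Type := ℤ × ℤ

/-- The pairing `⟨p, q⟩` of `p ∈ Λ` with `q ∈ Λ*`. -/
def pairing (p q : Lat) : ℤ := p.1 * q.1 + p.2 * q.2

/-- `u ∧ v`. -/
def wedge (u v : Lat) : ℤ := u.1 * v.2 - u.2 * v.1

/-- A primitive vector of `Λ` (in particular it is non-zero). -/
def IsPrimitive (p : Lat) : Prop := Int.gcd p.1 p.2 = 1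

/-- The positively oriented normal `n = (-m₂, m₁)` of `m`; it is primitive if `m` is. -/
def normal (p : Lat) : Lat := (-p.2, p.1)

/-- The inclusion `Λ ⊆ Λ_ℝ = ℝ²`. -/
def toPlane (p : Lat) : ℝ × ℝ := ((p.1 : ℝ), (p.2 : ℝ))

/-! ### Formal series `K[Λ][[t₁, …, t_n]]` -/

/-- `K[Λ][[t₁, …, t_n]]` for a possibly non-commutative ring `K`: formal power series in the central
variables `t₁, …, t_n` whose coefficients are Laurent polynomials `∑ a_q z^q`, `q ∈ Λ`. -/
abbrev Ser (K : Type) [Ring K] (n : ℕ) : Type := MvPowerSeries (Fin n) (AddMonoidAlgebra K Lat)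

/-- `gl(r, ℂ)`, as an associative algebra. -/
abbrev Mat (r : ℕ) : Type := Matrix (Fin r) (Fin r) ℂ

section Series

variable {K : Type} [Ring K] [Algebra ℂ K] {n : ℕ}

/-- The monomial `a t^P z^q`. -/
def mono (a : K) (P : Fin n →₀ ℕ) (q : Lat) : Ser K n :=
  MvPowerSeries.monomial P (AddMonoidAlgebra.single q a)

/-- The derivation `∂_q` of `K[Λ]`, `∂_q (a z^p) = ⟨p, q⟩ a z^p`. -/
def dLaurent (q : Lat) : AddMonoidAlgebra K Lat →ₗ[ℂ] AddMonoidAlgebra K Lat where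
  toFun a := AddMonoidAlgebra.ofCoeff
    (Finsupp.onFinset a.coeff.support (fun p => pairing p q • a.coeff p) (by
      intro p hp
      rw [Finsupp.mem_support_iff]
      intro h
      exact hp (by rw [h, smul_zero])))
  map_add' a b := by
    ext p
    simp [smul_add]
  map_smul' c a := by
    ext p
    simp [smul_comm]

/-- The `t`-linear derivation `∂_q` of `K[Λ][[t]]`. -/
def dSer (q : Lat) : Ser K n →ₗ[ℂ] Ser K n where
  toFun v := fun P => dLaurent q (MvPowerSeries.coeff P v)
  map_add' v w := by
    funext P
    exact (congrArg (dLaurent q) (map_add (MvPowerSeries.coeff P) v w)).trans (map_add _ _ _)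
  map_smul' c v := by
    funext P
    exact map_smul (dLaurent q) c (MvPowerSeries.coeff P v)

/-- The inclusion of scalar series `ℂ[Λ][[t]] → K[Λ][[t]]`. -/
def scal : Ser ℂ n →+* Ser K n :=
  MvPowerSeries.map (AddMonoidAlgebra.mapRingHom Lat (algebraMap ℂ K))

/-- The logarithm `∑_{j ≥ 1} (-1)^(j-1)/j (F - 1)^j` of a series `F` with `F ≡ 1` modulo
`(t₁, …, t_n)`; only the terms with `j ≤ |P|` contribute to the coefficient of `t^P`. -/
def slog (F : Ser K n) : Ser K n := fun P =>
  ∑ j ∈ Finset.Icc 1 P.degree,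
    ((-1 : ℂ) ^ (j - 1) / (j : ℂ)) • MvPowerSeries.coeff P ((F - 1) ^ j)

/-- The element `(B, g ∂_q)` as the first order differential operator `v ↦ B v + g ∂_q v`. -/
def act (B : Ser K n) (g : Ser ℂ n) (q : Lat) : Module.End ℂ (Ser K n) where
  toFun v := B * v + scal g * dSer q v
  map_add' v w := by
    rw [map_add, mul_add, mul_add]
    abel
  map_smul' c v := by
    rw [map_smul, mul_smul_comm, mul_smul_comm, ← smul_add]
    rfl

/-- The exponential `∑_j T^j / j!` of an operator `T` which raises the order in `t` by at least one;
only the terms with `j ≤ |P|` contribute to the coefficient of `t^P`. -/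
def sexp (T : Module.End ℂ (Ser K n)) : Module.End ℂ (Ser K n) where
  toFun v := fun P => ∑ j ∈ Finset.range (P.degree + 1),
    ((Nat.factorial j : ℂ)⁻¹) • MvPowerSeries.coeff P ((T ^ j) v)
  map_add' v w := by
    funext P
    have h : ∀ j : ℕ, ((Nat.factorial j : ℂ)⁻¹) • MvPowerSeries.coeff P ((T ^ j) (v + w))
        = ((Nat.factorial j : ℂ)⁻¹) • MvPowerSeries.coeff P ((T ^ j) v)
          + ((Nat.factorial j : ℂ)⁻¹) • MvPowerSeries.coeff P ((T ^ j) w) := fun j => by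
      rw [map_add, map_add, smul_add]
    exact (Finset.sum_congr rfl fun j _ => h j).trans Finset.sum_add_distrib
  map_smul' c v := by
    funext P
    have h : ∀ j : ℕ, ((Nat.factorial j : ℂ)⁻¹) • MvPowerSeries.coeff P ((T ^ j) (c • v))
        = c • (((Nat.factorial j : ℂ)⁻¹) • MvPowerSeries.coeff P ((T ^ j) v)) := fun j => by
      rw [map_smul, smul_comm]
      rfl
    exact (Finset.sum_congr rfl fun j _ => h j).trans Finset.smul_sum.symm

/-! The commutator of these operators is the Lie bracket of the extended tropical vertex Lie algebra,
`[(A, ∂_q) z^p, (A', ∂_{q'}) z^{p'}] = ([A, A'] + ⟨p', q⟩ A' - ⟨p, q'⟩ A, ∂_{⟨p', q⟩ q' - ⟨p, q'⟩ q}) z^{p + p'}`,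
so that the product of exponentials of operators is given by the Baker-Campbell-Hausdorff formula. -/

theorem dLaurent_coeff (q : Lat) (a : AddMonoidAlgebra K Lat) (p : Lat) :
    (dLaurent q a).coeff p = pairing p q • a.coeff p := rfl

theorem dLaurent_single (q p : Lat) (a : K) :
    dLaurent q (AddMonoidAlgebra.single p a) = pairing p q • AddMonoidAlgebra.single p a := by
  ext x
  rw [dLaurent_coeff]
  by_cases h : x = p
  · subst h; simp
  · simp [Ne.symm h]

theorem dLaurent_mul (q : Lat) (a b : AddMonoidAlgebra K Lat) :
    dLaurent q (a * b) = dLaurent q a * b + a * dLaurent q b := by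
  induction a using AddMonoidAlgebra.induction_linear with
  | zero => simp
  | add x y hx hy => simp only [add_mul, map_add, hx, hy]; abel
  | single p c =>
    induction b using AddMonoidAlgebra.induction_linear with
    | zero => simp
    | add x y hx hy => simp only [mul_add, map_add, hx, hy]; abel
    | single p' c' =>
      rw [AddMonoidAlgebra.single_mul_single, dLaurent_single, dLaurent_single, dLaurent_single,
        smul_mul_assoc, mul_smul_comm, AddMonoidAlgebra.single_mul_single, ← add_smul]
      congr 1
      simp only [pairing, Prod.fst_add, Prod.snd_add]
      ring

theorem dSer_mul (q : Lat) (x y : Ser K n) :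
    dSer q (x * y) = dSer q x * y + x * dSer q y := by
  ext1 P
  have h : ∀ (z : Ser K n) (Q : Fin n →₀ ℕ), MvPowerSeries.coeff Q (dSer q z)
      = dLaurent q (MvPowerSeries.coeff Q z) := fun _ _ => rfl
  rw [map_add, h]
  simp only [MvPowerSeries.coeff_mul, map_sum, h, dLaurent_mul, Finset.sum_add_distrib]

theorem dSer_mono (q p : Lat) (a : K) (P : Fin n →₀ ℕ) :
    dSer q (mono a P p) = pairing p q • mono a P p := by
  ext1 Q
  change dLaurent q (MvPowerSeries.coeff Q (mono a P p)) = _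
  rw [map_zsmul, mono, MvPowerSeries.coeff_monomial]
  split_ifs
  · exact dLaurent_single q p a
  · simp

theorem mono_mul (a b : K) (P Q : Fin n →₀ ℕ) (p q : Lat) :
    (mono a P p * mono b Q q : Ser K n) = mono (a * b) (P + Q) (p + q) := by
  rw [mono, mono, MvPowerSeries.monomial_mul_monomial, AddMonoidAlgebra.single_mul_single]
  rfl

theorem scal_mono (c : ℂ) (P : Fin n →₀ ℕ) (p : Lat) :
    scal (K := K) (mono c P p) = mono (algebraMap ℂ K c) P p := by
  rw [scal, mono, MvPowerSeries.map_monomial, AddMonoidAlgebra.mapRingHom_single]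
  rfl

theorem mono_one_comm (P : Fin n →₀ ℕ) (p : Lat) (v : Ser K n) :
    mono 1 P p * v = v * mono 1 P p := by
  classical
  ext1 Q
  rw [mono, MvPowerSeries.coeff_monomial_mul, MvPowerSeries.coeff_mul_monomial]
  split_ifs
  · exact (AddMonoidAlgebra.single_commute (fun q => add_comm p q) (fun b => Commute.one_left b) _)
  · rfl

theorem dSer_sub_smul (a b : ℤ) (q q' : Lat) (v : Ser K n) :
    dSer (a • q' - b • q) v = a • dSer q' v - b • dSer q v := by
  ext1 P
  rw [map_sub, map_zsmul, map_zsmul]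
  change dLaurent _ (MvPowerSeries.coeff P v) = a • dLaurent _ (MvPowerSeries.coeff P v)
    - b • dLaurent _ (MvPowerSeries.coeff P v)
  ext x
  simp only [AddMonoidAlgebra.coeff_sub, AddMonoidAlgebra.coeff_smul, Finsupp.sub_apply,
    Finsupp.smul_apply, dLaurent_coeff, smul_smul, ← sub_smul]
  congr 1
  simp only [pairing, Prod.fst_sub, Prod.snd_sub, Prod.smul_fst, Prod.smul_snd, smul_eq_mul]
  ring

theorem dSer_comm (q q' : Lat) (v : Ser K n) : dSer q (dSer q' v) = dSer q' (dSer q v) := by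
  ext1 P
  change dLaurent q (dLaurent q' (MvPowerSeries.coeff P v))
    = dLaurent q' (dLaurent q (MvPowerSeries.coeff P v))
  ext x
  simp only [dLaurent_coeff]
  rw [smul_comm]

theorem act_commutator (A A' : K) (P P' : Fin n →₀ ℕ) (p p' q q' : Lat) :
    act (mono A P p) (mono 1 P p) q * act (mono A' P' p') (mono 1 P' p') q'
        - act (mono A' P' p') (mono 1 P' p') q' * act (mono A P p) (mono 1 P p) q
      = act (mono (A * A' - A' * A + pairing p' q • A' - pairing p q' • A) (P + P') (p + p'))
          (mono 1 (P + P') (p + p')) (pairing p' q • q' - pairing p q' • q) := by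
  ext1 v
  have hm : (mono (A * A' - A' * A + pairing p' q • A' - pairing p q' • A) (P + P') (p + p') : Ser K n)
      = mono A P p * mono A' P' p' - mono A' P' p' * mono A P p
        + pairing p' q • (mono 1 P p * mono A' P' p')
        - pairing p q' • (mono 1 P' p' * mono A P p) := by
    rw [mono_mul, mono_mul, mono_mul, mono_mul, one_mul, one_mul, add_comm P' P, add_comm p' p]
    simp only [mono, AddMonoidAlgebra.single_sub, AddMonoidAlgebra.single_add, map_sub, map_add,
      ← map_zsmul, AddMonoidAlgebra.smul_single]
  simp only [LinearMap.sub_apply, Module.End.mul_apply, act, LinearMap.coe_mk, AddHom.coe_mk, hm,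
    scal_mono, map_one, dSer_sub_smul, map_add, dSer_mul, dSer_mono]
  rw [← one_mul (1 : K), ← mono_mul, one_mul, dSer_comm q' q]
  have e1 := mono_one_comm P p (mono A' P' p' : Ser K n)
  have e2 := mono_one_comm P' p' (mono A P p : Ser K n)
  have e3 := mono_one_comm P' p' (mono 1 P p : Ser K n)
  simp only [mul_add, add_mul, sub_mul, mul_sub, smul_mul_assoc, mul_smul_comm, ← mul_assoc, e1, e2,
    e3]
  abel

end Series

/-! ### Walls, scattering diagrams and consistency -/

/-- A wall through the origin, with its function `(M, f)`. The series `M` and `f` are congruent to `1`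
modulo `(t₁, …, t_n)` and the other monomials are `t^P z^(l m)` with `l ≥ 1`, where `m` is the
(primitive) direction; equivalently `log (M, f) = (log M, log f ∂_n)` is a series of elements
`(A, a ∂_n) t^P z^(l m)` with `P ≠ 0` and `l ≥ 1`. -/
structure Wall (r n : ℕ) where
  /-- the primitive direction `m` -/
  dir : Lat
  prim : IsPrimitive dir
  /-- whether the support is the line `ℝ m` or the ray `ℝ_{≥ 0} m` -/
  isLine : Prop
  /-- the matrix component -/
  M : Ser (Mat r) n
  /-- the scalar component -/
  f : Ser ℂ n
  M_mem : ∀ (P : Fin n →₀ ℕ) (q : Lat), (MvPowerSeries.coeff P (M - 1)).coeff q ≠ 0 →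
    P ≠ 0 ∧ ∃ l : ℕ, 1 ≤ l ∧ q = l • dir
  f_mem : ∀ (P : Fin n →₀ ℕ) (q : Lat), (MvPowerSeries.coeff P (f - 1)).coeff q ≠ 0 →
    P ≠ 0 ∧ ∃ l : ℕ, 1 ≤ l ∧ q = l • dir

variable {r n : ℕ}

/-- The support of a wall. -/
def Wall.support (w : Wall r n) : Set (ℝ × ℝ) :=
  {x | ∃ s : ℝ, (w.isLine ∨ 0 ≤ s) ∧ x = s • toPlane w.dir}

/-- The wall is trivial modulo the `(k + 1)`-st power of `(t₁, …, t_n)`. -/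
def Wall.TrivialMod (w : Wall r n) (k : ℕ) : Prop :=
  ∀ P : Fin n →₀ ℕ, P.degree ≤ k →
    MvPowerSeries.coeff P w.M = MvPowerSeries.coeff P 1 ∧
    MvPowerSeries.coeff P w.f = MvPowerSeries.coeff P 1

/-- The ambient monoid of the extended tropical vertex group: operators on the sections
`gl(r, ℂ)[Λ][[t]]` together with operators on the functions `ℂ[Λ][[t]]`. -/
abbrev Ambient (r n : ℕ) : Type := Module.End ℂ (Ser (Mat r) n) × Module.End ℂ (Ser ℂ n)

/-- `θ^ε = exp (ε (log M, log f ∂_n))` for a wall with function `(M, f)`. -/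
def Wall.theta (w : Wall r n) (ε : ℤ) : Ambient r n :=
  (sexp (ε • act (slog w.M) (slog w.f) (normal w.dir)),
    sexp (ε • act 0 (slog w.f) (normal w.dir)))

/-- `Θ` is the identity modulo the `(k + 1)`-st power of `(t₁, …, t_n)`. -/
def IsIdMod (k : ℕ) (Θ : Ambient r n) : Prop :=
  (∀ (v : Ser (Mat r) n) (P : Fin n →₀ ℕ), P.degree ≤ k →
    MvPowerSeries.coeff P (Θ.1 v) = MvPowerSeries.coeff P v) ∧
  (∀ (v : Ser ℂ n) (P : Fin n →₀ ℕ), P.degree ≤ k →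
    MvPowerSeries.coeff P (Θ.2 v) = MvPowerSeries.coeff P v)

/-- The pairing of the velocity of `γ` at time `τ` with the normal of the wall `w`. -/
def crossingSpeed (γ : ℝ → ℝ × ℝ) (τ : ℝ) (w : Wall r n) : ℝ :=
  (deriv γ τ).1 * (normal w.dir).1 + (deriv γ τ).2 * (normal w.dir).2

/-- A smooth immersed closed path in `ℝ² ∖ {0}` that starts off the walls of `D` and crosses them
transversally. -/
def IsGenericLoop (D : Set (Wall r n)) (γ : ℝ → ℝ × ℝ) : Prop :=
  ContDiff ℝ (⊤ : ℕ∞) γ ∧ γ 0 = γ 1 ∧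
  (∀ τ ∈ Set.Icc (0 : ℝ) 1, γ τ ≠ 0 ∧ deriv γ τ ≠ 0) ∧
  (∀ w ∈ D, γ 0 ∉ w.support) ∧
  (∀ w ∈ D, ∀ τ ∈ Set.Icc (0 : ℝ) 1, γ τ ∈ w.support → crossingSpeed γ τ w ≠ 0)

/-- `L` lists, in the order of time, the crossings of `γ` with the walls of `D` that are non-trivial
modulo the `(k + 1)`-st power of `(t₁, …, t_n)`. -/
def IsCrossingList (D : Set (Wall r n)) (γ : ℝ → ℝ × ℝ) (k : ℕ) (L : List (ℝ × Wall r n)) : Prop :=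
  L.Nodup ∧ L.Pairwise (fun a b => a.1 ≤ b.1) ∧
  ∀ (τ : ℝ) (w : Wall r n),
    (τ, w) ∈ L ↔ τ ∈ Set.Ioo (0 : ℝ) 1 ∧ w ∈ D ∧ ¬ w.TrivialMod k ∧ γ τ ∈ w.support

open Classical in
/-- The path ordered product `θ_s^{±1} ∘ ⋯ ∘ θ_1^{±1}` over a list of crossings; the sign is positive
if the path crosses in the direction of the normal `n = (-m₂, m₁)`, and the later crossings
stand on the left. -/
def pathProduct (γ : ℝ → ℝ × ℝ) (L : List (ℝ × Wall r n)) : Ambient r n :=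
  ((L.map fun c => c.2.theta (if 0 < crossingSpeed γ c.1 c.2 then 1 else -1)).reverse).prod

/-- Consistency: the path ordered product along every generic closed path is the identity. -/
def IsConsistent (D : Set (Wall r n)) : Prop :=
  ∀ γ : ℝ → ℝ × ℝ, IsGenericLoop D γ → ∀ (k : ℕ) (L : List (ℝ × Wall r n)),
    IsCrossingList D γ k L → IsIdMod k (pathProduct γ L)

/-- `D'` is the minimal consistent scattering diagram `D^∞` obtained from `D` by adding rays. -/
structure IsCompletion (D D' : Set (Wall r n)) : Prop where
  subset : D ⊆ D'
  isRay : ∀ w ∈ D' \ D, ¬ w.isLine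
  finite : ∀ k : ℕ, {w ∈ D' | ¬ w.TrivialMod k}.Finite
  nontrivial : ∀ w ∈ D' \ D, ∃ k : ℕ, ¬ w.TrivialMod k
  support_inj : ∀ w ∈ D' \ D, ∀ w' ∈ D' \ D, w.support = w'.support → w = w'
  consistent : IsConsistent D'

theorem mono_ne_zero_imp {K : Type} [Ring K] {n : ℕ} (a : K) (i : Fin n) (p : Lat)
    (P : Fin n →₀ ℕ) (q : Lat)
    (h : (MvPowerSeries.coeff P (1 + mono a (Finsupp.single i 1) p - 1 : Ser K n)).coeff q ≠ 0) :
    P ≠ 0 ∧ ∃ l : ℕ, 1 ≤ l ∧ q = l • p := by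
  rw [add_sub_cancel_left, mono, MvPowerSeries.coeff_monomial] at h
  split_ifs at h with hP
  · refine ⟨?_, 1, le_rfl, ?_⟩
    · rw [hP]; simp
    · rw [one_smul]
      by_contra hq
      exact h (by simp [Ne.symm hq])
  · simp at h

/-- The wall `(ℝ m, (1 + A t_i z^m, 1 + t_i z^m))`. -/
def initialWall (m : Lat) (hm : IsPrimitive m) (A : Mat r) (i : Fin n) : Wall r n where
  dir := m
  prim := hm
  isLine := True
  M := 1 + mono A (Finsupp.single i 1) m
  f := 1 + mono 1 (Finsupp.single i 1) m
  M_mem := mono_ne_zero_imp A i m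
  f_mem := mono_ne_zero_imp 1 i m

/-- The scattering diagram of the lines `ℝ m_i` with functions `(1 + A_i t_i z^{m_i}, 1 + t_i z^{m_i})`. -/
def initialDiagram (m : Fin n → Lat) (hm : ∀ i, IsPrimitive (m i)) (A : Fin n → Mat r) :
    Set (Wall r n) :=
  Set.range fun i => initialWall (m i) (hm i) (A i) i

/-! ### Tropical curves -/

section Tropical

variable {ι : Type} [Fintype ι]

open Classical in
/-- A rational parametrized tropical curve `h : Γ → ℝ²` of type `(w, ξ)`. The vertices of `Γ` are
`Fin N`, its bounded edges form a tree `G`, and its unbounded edges `E_r` (`r : ι`) and `E_out` are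
attached to the vertices `att (some r)` and `att none`. For a bounded edge from `u` to `v`, the vector
`vec u v` is the weight times the primitive direction of the edge emanating from `u`, so the
weight is the index of `vec u v`. The unbounded edge `E_r` is mapped to
`h (att (some r)) - ℝ_{≥ 0} w_r` with weight the index of `w_r`, and `E_out` to
`h (att none) + ℝ_{≥ 0} w_out` with weight the index of `w_out = ∑ w_r`. -/
structure TropicalCurve (w : ι → Lat) (ξ : ι → ℝ × ℝ) where
  N : ℕ
  G : SimpleGraph (Fin N)
  isTree : G.IsTree
  att : Option ι → Fin N
  h : Fin N → ℝ × ℝ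
  vec : Fin N → Fin N → Lat
  weight_ne_zero : ∀ r, w r ≠ 0
  out_ne_zero : ∑ r, w r ≠ 0
  vec_adj : ∀ u v, G.Adj u v → vec u v ≠ 0 ∧ ∃ s : ℝ, 0 < s ∧ h v - h u = s • toPlane (vec u v)
  vec_symm : ∀ u v, vec v u = -vec u v
  vec_not_adj : ∀ u v, ¬ G.Adj u v → vec u v = 0
  /-- there are no vertices of valency one or two among the vertices of `Γ` -/
  valency : ∀ v, 3 ≤ Fintype.card {u : Fin N // G.Adj v u} + Fintype.card {e : Option ι // att e = v}
  /-- the balancing condition -/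
  balanced : ∀ v, ∑ u, vec v u
    + ∑ e : Option ι, (if att e = v then e.elim (∑ r, w r) (fun r => -w r) else 0) = 0
  /-- `E_r` coincides asymptotically with `ξ_r - ℝ_{≥ 0} w_r` -/
  asymptotic : ∀ r, ∃ s : ℝ, h (att (some r)) = ξ r + s • toPlane (w r)

namespace TropicalCurve

variable {w : ι → Lat} {ξ : ι → ℝ × ℝ}

open Classical in
/-- The weighted direction in which an edge leaves the vertex `v` (zero if the edge does not contain
`v`): `Sum.inl u` stands for the bounded edge from `v` to `u`, `Sum.inr e` for an unbounded edge. -/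
def edgeDir (C : TropicalCurve w ξ) (v : Fin C.N) : Fin C.N ⊕ Option ι → Lat
  | Sum.inl u => C.vec v u
  | Sum.inr e => if C.att e = v then e.elim (∑ r, w r) (fun r => -w r) else 0

/-- The multiplicity `w₁ w₂ |m₁ ∧ m₂|` of a vertex. At a trivalent vertex any two of the three edges give
the same value, and an edge paired with itself gives `0`, so this common value is the
maximum over all pairs. -/
def vertexMult (C : TropicalCurve w ξ) (v : Fin C.N) : ℕ :=
  Finset.univ.sup fun p : (Fin C.N ⊕ Option ι) × (Fin C.N ⊕ Option ι) =>
    (wedge (C.edgeDir v p.1) (C.edgeDir v p.2)).natAbs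

/-- The multiplicity of a tropical curve. -/
def mult (C : TropicalCurve w ξ) : ℕ := ∏ v, C.vertexMult v

/-- Isomorphism of parametrized tropical curves. -/
def Iso (C C' : TropicalCurve w ξ) : Prop :=
  ∃ φ : Fin C.N ≃ Fin C'.N,
    (∀ u v, C'.G.Adj (φ u) (φ v) ↔ C.G.Adj u v) ∧ (∀ e, C'.att e = φ (C.att e)) ∧
    (∀ v, C'.h (φ v) = C.h v) ∧ (∀ u v, C'.vec (φ u) (φ v) = C.vec u v)

theorem Iso.mult_eq {C C' : TropicalCurve w ξ} (hC : Iso C C') : C.mult = C'.mult := by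
  obtain ⟨φ, -, hatt, -, hvec⟩ := hC
  have key : ∀ v x, C'.edgeDir (φ v) (Equiv.sumCongr φ (Equiv.refl (Option ι)) x) = C.edgeDir v x := by
    rintro v (u | e)
    · exact hvec v u
    · simp [edgeDir, hatt]
  refine Fintype.prod_equiv φ _ _ fun v => ?_
  refine le_antisymm (Finset.sup_le fun p _ => ?_) (Finset.sup_le fun p _ => ?_)
  · rw [← key v p.1, ← key v p.2]
    exact Finset.le_sup (f := fun p : (Fin C'.N ⊕ Option ι) × (Fin C'.N ⊕ Option ι) =>
      (wedge (C'.edgeDir (φ v) p.1) (C'.edgeDir (φ v) p.2)).natAbs)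
      (Finset.mem_univ (Equiv.sumCongr φ (Equiv.refl (Option ι)) p.1,
        Equiv.sumCongr φ (Equiv.refl (Option ι)) p.2))
  · obtain ⟨x, hx⟩ := (Equiv.sumCongr φ (Equiv.refl (Option ι))).surjective p.1
    obtain ⟨y, hy⟩ := (Equiv.sumCongr φ (Equiv.refl (Option ι))).surjective p.2
    rw [← hx, ← hy, key, key]
    exact Finset.le_sup (f := fun p : (Fin C.N ⊕ Option ι) × (Fin C.N ⊕ Option ι) =>
      (wedge (C.edgeDir v p.1) (C.edgeDir v p.2)).natAbs) (Finset.mem_univ (x, y))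

instance isoSetoid (w : ι → Lat) (ξ : ι → ℝ × ℝ) : Setoid (TropicalCurve w ξ) where
  r := Iso
  iseqv :=
    { refl := fun C => ⟨Equiv.refl _, fun _ _ => Iff.rfl, fun _ => rfl, fun _ => rfl,
        fun _ _ => rfl⟩
      symm := by
        rintro C C' ⟨φ, h1, h2, h3, h4⟩
        refine ⟨φ.symm, fun u v => ?_, fun e => ?_, fun v => ?_, fun u v => ?_⟩
        · simpa using (h1 (φ.symm u) (φ.symm v)).symm
        · simp [h2]
        · simpa using (h3 (φ.symm v)).symm
        · simpa using (h4 (φ.symm u) (φ.symm v)).symm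
      trans := by
        rintro C C' C'' ⟨φ, h1, h2, h3, h4⟩ ⟨ψ, k1, k2, k3, k4⟩
        refine ⟨φ.trans ψ, fun u v => ?_, fun e => ?_, fun v => ?_, fun u v => ?_⟩
        · simp [k1, h1]
        · simp [k2, h2]
        · simp [k3, h3]
        · simp [k4, h4] }

end TropicalCurve

/-- The set `T_{w, ξ}` of rational tropical curves of type `(w, ξ)`, i.e. of isomorphism classes of
parametrized ones. -/
def TropicalCurves (w : ι → Lat) (ξ : ι → ℝ × ℝ) : Type :=
  Quotient (TropicalCurve.isoSetoid w ξ)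

/-- The multiplicity on isomorphism classes. -/
def TropicalCurves.mult {w : ι → Lat} {ξ : ι → ℝ × ℝ} : TropicalCurves w ξ → ℕ :=
  Quotient.lift TropicalCurve.mult fun _ _ h => TropicalCurve.Iso.mult_eq h

/-- For generic `ξ`, i.e. off finitely many proper affine subspaces of `(ℝ²)^s`, the set `T_{w, ξ}` is
finite and `∑_{h ∈ T_{w, ξ}} Mult(h) = c`. -/
def IsTropicalCount (w : ι → Lat) (c : ℕ) : Prop :=
  ∃ S : Set (AffineSubspace ℝ (ι → ℝ × ℝ)), S.Finite ∧ (∀ H ∈ S, H ≠ ⊤) ∧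
    ∀ ξ : ι → ℝ × ℝ, (∀ H ∈ S, ξ ∉ H) →
      Finite (TropicalCurves w ξ) ∧ ∑ᶠ C : TropicalCurves w ξ, C.mult = c

open Classical in
/-- The number `N^trop_w` of rational tropical curves in `T_{w, ξ}`, `ξ` generic, counted with
multiplicity. -/
def tropicalCount (w : ι → Lat) : ℕ :=
  if h : ∃ c, IsTropicalCount w c then h.choose else 0

end Tropical

/-! ### The explicit series -/

/-- A tuple `k ⊢ P`: for every `i` a partition `k_i` of `P_i`, with `k_{il}` parts equal to `l`. -/
abbrev PartitionTuple (P : Fin n →₀ ℕ) : Type := (i : Fin n) → Nat.Partition (P i)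

/-- The number `k_{il}`. -/
def PartitionTuple.num {P : Fin n →₀ ℕ} (k : PartitionTuple P) (i : Fin n) (l : ℕ) : ℕ :=
  (k i).parts.count l

/-- The tuple `w(k)` of vectors, which contains `l m_i` exactly `k_{il}` times. It is indexed by the
triples `(i, l, c)` with `c < k_{il}`. -/
def weightVectors (m : Fin n → Lat) {P : Fin n →₀ ℕ} (k : PartitionTuple P) :
    ((i : Fin n) × (k i).parts.ToType) → Lat :=
  fun x => x.2.1 • m x.1

/-- `∏_i ∏_{l ≥ 1} ((-1)^(l-1) / l²)^{k_{il}} / k_{il}!`; note `k_{il} = 0` for `l > P_i`. -/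
def partitionWeight {P : Fin n →₀ ℕ} (k : PartitionTuple P) : ℂ :=
  ∏ i, ∏ l ∈ Finset.Icc 1 (P i),
    ((-1 : ℂ) ^ (l - 1) / (l : ℂ) ^ 2) ^ k.num i l / (Nat.factorial (k.num i l) : ℂ)

/-- `∑_i ∑_{l ≥ 1} l k_{il} A_i^l`. -/
def matrixWeight (A : Fin n → Mat r) {P : Fin n →₀ ℕ} (k : PartitionTuple P) : Mat r :=
  ∑ i, ∑ l ∈ Finset.Icc 1 (P i), ((l : ℂ) * (k.num i l : ℂ)) • A i ^ l

/-- The vector `∑ P_i m_i`. -/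
def totalVector (m : Fin n → Lat) (P : Fin n →₀ ℕ) : Lat := ∑ i, P i • m i

/-- The matrix component
`∑_{l_d ≥ 1} ∑_P ∑_{k ⊢ P} N_{w(k)} (∑ l A_i^l k_{il}) (∏ …) t^P z^{∑ P_i m_i}`, where `P` runs over the
tuples with `∑ P_i m_i = l_d m_d`. -/
def tropicalMatrixSeries (m : Fin n → Lat) (A : Fin n → Mat r) (d : Lat) : Ser (Mat r) n := fun P =>
  ∑ᶠ (l : ℕ) (_ : 1 ≤ l ∧ totalVector m P = l • d), ∑ k : PartitionTuple P,
    AddMonoidAlgebra.single (totalVector m P)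
      (((tropicalCount (weightVectors m k) : ℂ) * partitionWeight k) • matrixWeight A k)

/-- The scalar component
`∑_{l_d ≥ 1} ∑_P ∑_{k ⊢ P} N_{w(k)} l_d (∏ …) t^P z^{∑ P_i m_i}`, where `P` runs over the
tuples with `∑ P_i m_i = l_d m_d`. -/
def tropicalScalarSeries (m : Fin n → Lat) (d : Lat) : Ser ℂ n := fun P =>
  ∑ᶠ (l : ℕ) (_ : 1 ≤ l ∧ totalVector m P = l • d), ∑ k : PartitionTuple P,
    AddMonoidAlgebra.single (totalVector m P)
      ((l : ℂ) * ((tropicalCount (weightVectors m k) : ℂ) * partitionWeight k))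

end ExtVertex

end

set_option linter.unusedSectionVars false

noncomputable section

namespace ExtVertex

/-! ### Binary trees and the counting function -/

/-- The pairing `p ∧ x` of a lattice vector with a point of the plane. -/
def rwedge (p : Lat) (x : ℝ × ℝ) : ℝ := p.1 * x.2 - p.2 * x.1

theorem rwedge_add_left (p q : Lat) (x : ℝ × ℝ) : rwedge (p + q) x = rwedge p x + rwedge q x := by
  simp only [rwedge, Prod.fst_add, Prod.snd_add]; push_cast; ring

theorem rwedge_sub_right (p : Lat) (x y : ℝ × ℝ) : rwedge p (x - y) = rwedge p x - rwedge p y := by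
  simp only [rwedge, Prod.fst_sub, Prod.snd_sub]; ring

theorem rwedge_smul_right (p : Lat) (s : ℝ) (x : ℝ × ℝ) : rwedge p (s • x) = s * rwedge p x := by
  simp only [rwedge, Prod.smul_fst, Prod.smul_snd, smul_eq_mul]; ring

theorem rwedge_toPlane (p q : Lat) : rwedge p (toPlane q) = wedge p q := by
  simp only [rwedge, toPlane, wedge]; push_cast; ring

theorem wedge_comm (p q : Lat) : wedge q p = -wedge p q := by
  simp only [wedge]; ring

theorem wedge_self (p : Lat) : wedge p p = 0 := by
  simp only [wedge]; ring

theorem wedge_add_left (p q u : Lat) : wedge (p + q) u = wedge p u + wedge q u := by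
  simp only [wedge, Prod.fst_add, Prod.snd_add]; ring

theorem wedge_add_right (u p q : Lat) : wedge u (p + q) = wedge u p + wedge u q := by
  simp only [wedge, Prod.fst_add, Prod.snd_add]; ring

theorem wedge_neg_left (p q : Lat) : wedge (-p) q = -wedge p q := by
  simp only [wedge, Prod.fst_neg, Prod.snd_neg]; ring

theorem wedge_neg_right (p q : Lat) : wedge p (-q) = -wedge p q := by
  simp only [wedge, Prod.fst_neg, Prod.snd_neg]; ring

theorem wedge_zero_left (p : Lat) : wedge 0 p = 0 := by simp [wedge]

theorem wedge_zero_right (p : Lat) : wedge p 0 = 0 := by simp [wedge]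

/-- The intersection of the lines `p ∧ x = a` and `q ∧ x = b`. -/
def meet (p q : Lat) (a b : ℝ) : ℝ × ℝ :=
  ((a * q.1 - b * p.1) / wedge p q, (a * q.2 - b * p.2) / wedge p q)

theorem rwedge_meet_left {p q : Lat} (h : wedge p q ≠ 0) (a b : ℝ) :
    rwedge p (meet p q a b) = a := by
  have h' : (wedge p q : ℝ) ≠ 0 := by exact_mod_cast h
  simp only [rwedge, meet]
  field_simp
  simp only [wedge]; push_cast; ring

theorem rwedge_meet_right {p q : Lat} (h : wedge p q ≠ 0) (a b : ℝ) :
    rwedge q (meet p q a b) = b := by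
  have h' : (wedge p q : ℝ) ≠ 0 := by exact_mod_cast h
  simp only [rwedge, meet]
  field_simp
  simp only [wedge]; push_cast; ring

theorem eq_of_rwedge_eq {p q : Lat} (h : wedge p q ≠ 0) {x y : ℝ × ℝ}
    (hp : rwedge p x = rwedge p y) (hq : rwedge q x = rwedge q y) : x = y := by
  have h' : (wedge p q : ℝ) ≠ 0 := by exact_mod_cast h
  simp only [rwedge] at hp hq
  simp only [wedge] at h'
  push_cast at h'
  refine Prod.ext ?_ ?_
  · apply mul_left_cancel₀ h'
    linear_combination (q.1 : ℝ) * hp - (p.1 : ℝ) * hq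
  · apply mul_left_cancel₀ h'
    linear_combination (q.2 : ℝ) * hp - (p.2 : ℝ) * hq

theorem eq_meet {p q : Lat} (h : wedge p q ≠ 0) {x : ℝ × ℝ} :
    x = meet p q (rwedge p x) (rwedge q x) :=
  eq_of_rwedge_eq h (rwedge_meet_left h _ _).symm (rwedge_meet_right h _ _).symm

section Sums

variable {ι : Type}

/-- The sum of the vectors `w r`, `r ∈ I`. -/
def wsum (w : ι → Lat) (I : Finset ι) : Lat := ∑ r ∈ I, w r

/-- The sum of the moments `μ r`, `r ∈ I`. -/
def msum (μ : ι → ℝ) (I : Finset ι) : ℝ := ∑ r ∈ I, μ r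

/-- The intersection point of the lines `w_J ∧ x = μ_J` and `w_K ∧ x = μ_K`. -/
def meetPt (w : ι → Lat) (μ : ι → ℝ) (J K : Finset ι) : ℝ × ℝ :=
  meet (wsum w J) (wsum w K) (msum μ J) (msum μ K)

theorem wsum_union [DecidableEq ι] (w : ι → Lat) {J K : Finset ι} (h : Disjoint J K) :
    wsum w (J ∪ K) = wsum w J + wsum w K := Finset.sum_union h

theorem msum_union [DecidableEq ι] (μ : ι → ℝ) {J K : Finset ι} (h : Disjoint J K) :
    msum μ (J ∪ K) = msum μ J + msum μ K := Finset.sum_union h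

/-- The point `x` lies on the line `w_I ∧ x = μ_I`. -/
def OnLine (w : ι → Lat) (μ : ι → ℝ) (I : Finset ι) (x : ℝ × ℝ) : Prop :=
  rwedge (wsum w I) x = msum μ I

theorem onLine_meetPt_left {w : ι → Lat} {μ : ι → ℝ} {J K : Finset ι}
    (h : wedge (wsum w J) (wsum w K) ≠ 0) : OnLine w μ J (meetPt w μ J K) :=
  rwedge_meet_left h _ _

theorem onLine_meetPt_right {w : ι → Lat} {μ : ι → ℝ} {J K : Finset ι}
    (h : wedge (wsum w J) (wsum w K) ≠ 0) : OnLine w μ K (meetPt w μ J K) :=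
  rwedge_meet_right h _ _

theorem OnLine.union [DecidableEq ι] {w : ι → Lat} {μ : ι → ℝ} {J K : Finset ι} {x : ℝ × ℝ}
    (h : Disjoint J K) (hJ : OnLine w μ J x) (hK : OnLine w μ K x) : OnLine w μ (J ∪ K) x := by
  simp only [OnLine] at *
  rw [wsum_union w h, msum_union μ h, rwedge_add_left, hJ, hK]

theorem eq_meetPt {w : ι → Lat} {μ : ι → ℝ} {J K : Finset ι}
    (h : wedge (wsum w J) (wsum w K) ≠ 0) {x : ℝ × ℝ} (hJ : OnLine w μ J x) (hK : OnLine w μ K x) :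
    x = meetPt w μ J K := by
  rw [eq_meet h (x := x), meetPt, hJ, hK]

variable {ι' : Type}

theorem wsum_map (e : ι' ↪ ι) (w : ι → Lat) (I : Finset ι') :
    wsum w (I.map e) = wsum (w ∘ e) I := Finset.sum_map _ _ _

theorem msum_map (e : ι' ↪ ι) (μ : ι → ℝ) (I : Finset ι') :
    msum μ (I.map e) = msum (μ ∘ e) I := Finset.sum_map _ _ _

theorem sum_powerset_map (e : ι' ↪ ι) (I : Finset ι') (g : Finset ι → ℕ) :
    ∑ J ∈ (I.map e).powerset, g J = ∑ J ∈ I.powerset, g (J.map e) := by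
  symm
  refine Finset.sum_bij (fun J _ => J.map e) ?_ ?_ ?_ ?_
  · intro J hJ
    exact Finset.mem_powerset.2 (Finset.map_subset_map.2 (Finset.mem_powerset.1 hJ))
  · intro J _ J' _ h
    exact Finset.map_injective e h
  · intro J hJ
    obtain ⟨u, hu, rfl⟩ := Finset.subset_map_iff.1 (Finset.mem_powerset.1 hJ)
    exact ⟨u, Finset.mem_powerset.2 hu, rfl⟩
  · intro J _; rfl

theorem meetPt_map (e : ι' ↪ ι) (w : ι → Lat) (μ : ι → ℝ) (J K : Finset ι') :
    meetPt w μ (J.map e) (K.map e) = meetPt (w ∘ e) (μ ∘ e) J K := by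
  simp only [meetPt, wsum_map, msum_map]

end Sums

/-- Binary trees with leaves labelled by `ι`. -/
inductive BinTree (ι : Type) : Type
  | leaf (r : ι) : BinTree ι
  | node (a b : BinTree ι) : BinTree ι

namespace BinTree

variable {ι : Type} [DecidableEq ι]

/-- The set of leaves. -/
def leaves : BinTree ι → Finset ι
  | leaf r => {r}
  | node a b => leaves a ∪ leaves b

/-- The ray which leaves the root of the tree passes through the point `x` of its line. -/
def Emits (w : ι → Lat) (μ : ι → ℝ) : BinTree ι → ℝ × ℝ → Prop
  | leaf _, _ => True
  | node a _, x => msum μ a.leaves < rwedge (wsum w a.leaves) x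

/-- The tree is realized by a tropical curve for the lines with moments `μ`. -/
def Good (w : ι → Lat) (μ : ι → ℝ) : BinTree ι → Prop
  | leaf _ => True
  | node a b => Good w μ a ∧ Good w μ b ∧ Disjoint a.leaves b.leaves ∧
      0 < wedge (wsum w a.leaves) (wsum w b.leaves) ∧
      a.Emits w μ (meetPt w μ a.leaves b.leaves) ∧ b.Emits w μ (meetPt w μ a.leaves b.leaves)

/-- The multiplicity of a tree. -/
def mult (w : ι → Lat) : BinTree ι → ℕ
  | leaf _ => 1
  | node a b => (wedge (wsum w a.leaves) (wsum w b.leaves)).natAbs * (mult w a * mult w b)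

/-- The tree is not a single leaf. -/
def IsNode : BinTree ι → Prop
  | leaf _ => False
  | node _ _ => True

theorem leaves_nonempty : ∀ T : BinTree ι, T.leaves.Nonempty
  | leaf r => Finset.singleton_nonempty r
  | node a _ => (leaves_nonempty a).mono Finset.subset_union_left

theorem finite_good (w : ι → Lat) (μ : ι → ℝ) (I : Finset ι) :
    {T : BinTree ι | T.Good w μ ∧ T.leaves = I}.Finite := by
  induction I using Finset.strongInduction with
  | H I ih =>
    have h1 : (⋃ J ∈ I.ssubsets, ⋃ K ∈ I.ssubsets, Set.image2 node
        {T : BinTree ι | T.Good w μ ∧ T.leaves = J} {T | T.Good w μ ∧ T.leaves = K}).Finite :=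
      Set.Finite.biUnion (Finset.finite_toSet _) fun J hJ =>
        Set.Finite.biUnion (Finset.finite_toSet _) fun K hK =>
          Set.Finite.image2 _ (ih J (Finset.mem_ssubsets.1 hJ)) (ih K (Finset.mem_ssubsets.1 hK))
    refine (((Finset.finite_toSet I).image leaf).union h1).subset ?_
    rintro (r | ⟨a, b⟩) ⟨hT, rfl⟩
    · exact Or.inl ⟨r, by simp [leaves], rfl⟩
    · right
      obtain ⟨ha, hb, hd, -⟩ := hT
      have e1 : a.leaves ⊂ (node a b).leaves := by
        refine Finset.ssubset_iff_subset_ne.2 ⟨Finset.subset_union_left, fun h => ?_⟩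
        obtain ⟨x, hx⟩ := b.leaves_nonempty
        exact Finset.disjoint_left.1 hd (h ▸ Finset.mem_union_right _ hx) hx
      have e2 : b.leaves ⊂ (node a b).leaves := by
        refine Finset.ssubset_iff_subset_ne.2 ⟨Finset.subset_union_right, fun h => ?_⟩
        obtain ⟨x, hx⟩ := a.leaves_nonempty
        exact Finset.disjoint_left.1 hd hx (h ▸ Finset.mem_union_left _ hx)
      simp only [Set.mem_iUnion, Set.mem_image2]
      exact ⟨a.leaves, Finset.mem_ssubsets.2 e1, b.leaves, Finset.mem_ssubsets.2 e2,
        a, ⟨ha, rfl⟩, b, ⟨hb, rfl⟩, rfl⟩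

/-- The realized trees with set of leaves `I`. -/
def trees (w : ι → Lat) (μ : ι → ℝ) (I : Finset ι) : Finset (BinTree ι) :=
  (finite_good w μ I).toFinset

theorem mem_trees {w : ι → Lat} {μ : ι → ℝ} {I : Finset ι} {T : BinTree ι} :
    T ∈ trees w μ I ↔ T.Good w μ ∧ T.leaves = I := by
  simp [trees]

open Classical in
theorem sum_trees (w : ι → Lat) (μ : ι → ℝ) (I : Finset ι) (g : BinTree ι → ℕ) :
    ∑ T ∈ trees w μ I, g T = (∑ r ∈ I, if I = {r} then g (leaf r) else 0)
      + ∑ J ∈ I.powerset, ∑ a ∈ trees w μ J, ∑ b ∈ trees w μ (I \ J),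
        if 0 < wedge (wsum w J) (wsum w (I \ J)) ∧ a.Emits w μ (meetPt w μ J (I \ J)) ∧
          b.Emits w μ (meetPt w μ J (I \ J)) then g (node a b) else 0 := by
  have hsplit : trees w μ I = (I.filter fun r => I = {r}).image leaf ∪
      ((I.powerset.sigma fun J => trees w μ J ×ˢ trees w μ (I \ J)).filter fun x =>
        0 < wedge (wsum w x.1) (wsum w (I \ x.1)) ∧ x.2.1.Emits w μ (meetPt w μ x.1 (I \ x.1)) ∧
          x.2.2.Emits w μ (meetPt w μ x.1 (I \ x.1))).image fun x => node x.2.1 x.2.2 := by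
    ext T
    simp only [Finset.mem_union, Finset.mem_image, Finset.mem_filter, Finset.mem_sigma,
      Finset.mem_powerset, Finset.mem_product, mem_trees]
    constructor
    · rintro ⟨hT, rfl⟩
      cases T with
      | leaf r => exact Or.inl ⟨r, by simp [leaves], rfl⟩
      | node a b =>
        obtain ⟨ha, hb, hd, hw, h1, h2⟩ := hT
        have hK : (node a b).leaves \ a.leaves = b.leaves := by
          rw [leaves, Finset.union_sdiff_left, Finset.sdiff_eq_self_of_disjoint hd.symm]
        refine Or.inr ⟨⟨a.leaves, a, b⟩, ⟨⟨Finset.subset_union_left, ⟨ha, rfl⟩, hb, hK.symm⟩, ?_⟩, rfl⟩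
        dsimp only
        rw [hK]
        exact ⟨hw, h1, h2⟩
    · rintro (⟨r, ⟨-, h⟩, rfl⟩ | ⟨⟨J, a, b⟩, ⟨⟨hJ, ⟨ha, hJa⟩, hb, hKb⟩, hw, h1, h2⟩, rfl⟩)
      · exact ⟨trivial, h.symm⟩
      · dsimp only at *
        subst hJa
        rw [← hKb] at hw h1 h2
        have hd : Disjoint a.leaves b.leaves := by
          rw [hKb]; exact Finset.disjoint_sdiff
        exact ⟨⟨ha, hb, hd, hw, h1, h2⟩, by
          rw [leaves, hKb, Finset.union_sdiff_of_subset hJ]⟩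
  rw [hsplit, Finset.sum_union, Finset.sum_image, Finset.sum_image, Finset.sum_filter,
    Finset.sum_filter, Finset.sum_sigma]
  · simp only [Finset.sum_product]
  · rintro ⟨J, a, b⟩ h ⟨J', a', b'⟩ h' heq
    simp only [Finset.coe_filter, Finset.mem_sigma, Finset.mem_product, mem_trees,
      Set.mem_ofPred_eq] at h h' heq
    injection heq with h1 h2
    subst h1 h2
    obtain rfl : J = J' := h.1.2.1.2.symm.trans h'.1.2.1.2
    rfl
  · intro r _ r' _ h
    injection h
  · rw [Finset.disjoint_left]
    intro T hT hT'
    obtain ⟨r, -, rfl⟩ := Finset.mem_image.1 hT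
    obtain ⟨x, -, h⟩ := Finset.mem_image.1 hT'
    cases h

end BinTree

section Count

variable {ι : Type} [DecidableEq ι]

open Classical in
/-- The number of realized trees with leaves `I` whose outgoing ray passes through `x`. -/
def countAt (w : ι → Lat) (μ : ι → ℝ) (I : Finset ι) (x : ℝ × ℝ) : ℕ :=
  ∑ T ∈ BinTree.trees w μ I, if T.Emits w μ x then T.mult w else 0

/-- The number of realized trees with leaves `I`. -/
def countInf (w : ι → Lat) (μ : ι → ℝ) (I : Finset ι) : ℕ :=
  ∑ T ∈ BinTree.trees w μ I, T.mult w

open Classical in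
theorem countAt_eq (w : ι → Lat) (μ : ι → ℝ) (I : Finset ι) (x : ℝ × ℝ) :
    countAt w μ I x = (if I.card = 1 then 1 else 0) + ∑ J ∈ I.powerset,
      if 0 < wedge (wsum w J) (wsum w (I \ J)) ∧ msum μ J < rwedge (wsum w J) x then
        (wedge (wsum w J) (wsum w (I \ J))).natAbs * (countAt w μ J (meetPt w μ J (I \ J)) *
          countAt w μ (I \ J) (meetPt w μ J (I \ J))) else 0 := by
  rw [countAt, BinTree.sum_trees]
  congr 1
  · split_ifs with h
    · obtain ⟨r, rfl⟩ := Finset.card_eq_one.1 h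
      simp [BinTree.Emits, BinTree.mult]
    · refine Finset.sum_eq_zero fun r _ => if_neg ?_
      rintro rfl; simp at h
  · refine Finset.sum_congr rfl fun J _ => ?_
    split_ifs with h
    · rw [countAt, countAt, Finset.sum_mul_sum, Finset.mul_sum]
      refine Finset.sum_congr rfl fun a ha => ?_
      rw [Finset.mul_sum]
      refine Finset.sum_congr rfl fun b hb => ?_
      obtain ⟨-, rfl⟩ := BinTree.mem_trees.1 ha
      obtain ⟨-, hb⟩ := BinTree.mem_trees.1 hb
      rw [← hb] at h ⊢
      simp only [BinTree.Emits, h, BinTree.mult, true_and, if_true]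
      split_ifs <;> simp_all
    · refine Finset.sum_eq_zero fun a ha => Finset.sum_eq_zero fun b hb => ?_
      obtain ⟨-, rfl⟩ := BinTree.mem_trees.1 ha
      split_ifs with h1 h2
      · exact absurd ⟨h1.1, h2⟩ h
      · rfl
      · rfl

open Classical in
theorem countInf_eq (w : ι → Lat) (μ : ι → ℝ) (I : Finset ι) :
    countInf w μ I = (if I.card = 1 then 1 else 0) + ∑ J ∈ I.powerset,
      if 0 < wedge (wsum w J) (wsum w (I \ J)) then
        (wedge (wsum w J) (wsum w (I \ J))).natAbs * (countAt w μ J (meetPt w μ J (I \ J)) *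
          countAt w μ (I \ J) (meetPt w μ J (I \ J))) else 0 := by
  rw [countInf, BinTree.sum_trees]
  congr 1
  · split_ifs with h
    · obtain ⟨r, rfl⟩ := Finset.card_eq_one.1 h
      simp [BinTree.mult]
    · refine Finset.sum_eq_zero fun r _ => if_neg ?_
      rintro rfl; simp at h
  · refine Finset.sum_congr rfl fun J _ => ?_
    split_ifs with h
    · rw [countAt, countAt, Finset.sum_mul_sum, Finset.mul_sum]
      refine Finset.sum_congr rfl fun a ha => ?_
      rw [Finset.mul_sum]
      refine Finset.sum_congr rfl fun b hb => ?_
      obtain ⟨-, rfl⟩ := BinTree.mem_trees.1 ha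
      obtain ⟨-, hb⟩ := BinTree.mem_trees.1 hb
      rw [← hb] at h ⊢
      simp only [h, BinTree.mult, true_and]
      split_ifs <;> simp_all
    · refine Finset.sum_eq_zero fun a ha => Finset.sum_eq_zero fun b hb => ?_
      obtain ⟨-, rfl⟩ := BinTree.mem_trees.1 ha
      exact if_neg fun h1 => h h1.1

variable {ι' : Type} [DecidableEq ι']

theorem map_sdiff_map (e : ι' ↪ ι) (I J : Finset ι') : I.map e \ J.map e = (I \ J).map e := by
  ext x
  simp only [Finset.mem_sdiff, Finset.mem_map]
  constructor
  · rintro ⟨⟨y, hy, rfl⟩, h⟩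
    exact ⟨y, ⟨hy, fun h' => h ⟨y, h', rfl⟩⟩, rfl⟩
  · rintro ⟨y, ⟨hy, hy'⟩, rfl⟩
    refine ⟨⟨y, hy, rfl⟩, ?_⟩
    rintro ⟨z, hz, h⟩
    exact hy' (e.injective h ▸ hz)

theorem ssubset_of_wedge_ne {w : ι → Lat} {I J : Finset ι} (hJ : J ⊆ I)
    (h : wedge (wsum w J) (wsum w (I \ J)) ≠ 0) : J ⊂ I ∧ I \ J ⊂ I := by
  constructor
  · refine Finset.ssubset_iff_subset_ne.2 ⟨hJ, ?_⟩
    rintro rfl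
    simp [wsum, wedge_zero_right] at h
  · refine Finset.ssubset_iff_subset_ne.2 ⟨Finset.sdiff_subset, fun h' => h ?_⟩
    have : J = ∅ := by
      have h2 : Disjoint I J := by rw [← h']; exact Finset.sdiff_disjoint
      exact Finset.disjoint_self_iff_empty _ |>.1 (h2.mono_left hJ)
    rw [this]
    simp [wsum, wedge_zero_left]

theorem countAt_map (e : ι' ↪ ι) (w : ι → Lat) (μ : ι → ℝ) (I : Finset ι') :
    ∀ x, countAt w μ (I.map e) x = countAt (w ∘ e) (μ ∘ e) I x := by
  induction I using Finset.strongInduction with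
  | H I ih =>
    intro x
    rw [countAt_eq, countAt_eq, sum_powerset_map, Finset.card_map]
    congr 1
    refine Finset.sum_congr rfl fun J hJ => ?_
    rw [map_sdiff_map, wsum_map, wsum_map, msum_map, meetPt_map]
    split_ifs with h
    · have := ssubset_of_wedge_ne (Finset.mem_powerset.1 hJ) h.1.ne'
      rw [ih J this.1, ih (I \ J) this.2]
    · rfl

theorem countInf_map (e : ι' ↪ ι) (w : ι → Lat) (μ : ι → ℝ) (I : Finset ι') :
    countInf w μ (I.map e) = countInf (w ∘ e) (μ ∘ e) I := by
  rw [countInf_eq, countInf_eq, sum_powerset_map, Finset.card_map]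
  congr 1
  refine Finset.sum_congr rfl fun J hJ => ?_
  rw [map_sdiff_map, wsum_map, wsum_map, meetPt_map, countAt_map, countAt_map]

end Count

/-! ### Generic moments -/

section Generic

variable {ι : Type} [DecidableEq ι]

/-- Moments `μ` such that the lines `w_I ∧ x = μ_I` are in general position. -/
structure Generic (w : ι → Lat) (μ : ι → ℝ) : Prop where
  parallel : ∀ (I J : Finset ι) (x : ℝ × ℝ), wsum w I ≠ 0 → wsum w J ≠ 0 → I ≠ J →
    OnLine w μ I x → OnLine w μ J x → wedge (wsum w I) (wsum w J) ≠ 0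
  concurrent : ∀ (I J K : Finset ι) (x : ℝ × ℝ), wedge (wsum w I) (wsum w J) ≠ 0 →
    wedge (wsum w J) (wsum w K) ≠ 0 → wedge (wsum w I) (wsum w K) ≠ 0 →
    OnLine w μ I x → OnLine w μ J x → OnLine w μ K x →
    (I = J ∪ K ∧ Disjoint J K) ∨ (J = I ∪ K ∧ Disjoint I K) ∨ (K = I ∪ J ∧ Disjoint I J)

theorem nonempty_of_wsum_ne {w : ι → Lat} {I : Finset ι} (h : wsum w I ≠ 0) : I.Nonempty := by
  rw [Finset.nonempty_iff_ne_empty]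
  rintro rfl
  exact h rfl

theorem left_ne_zero_of_wedge {p q : Lat} (h : wedge p q ≠ 0) : p ≠ 0 := by
  rintro rfl; exact h (wedge_zero_left _)

theorem right_ne_zero_of_wedge {p q : Lat} (h : wedge p q ≠ 0) : q ≠ 0 := by
  rintro rfl; exact h (wedge_zero_right _)

theorem union_of_indicator_relation {I J K : Finset ι} {a b c : ℤ} (ha : a ≠ 0) (hb : b ≠ 0)
    (hc : c ≠ 0) (hI : I.Nonempty) (hJ : J.Nonempty) (hK : K.Nonempty) (hIJ : I ≠ J)
    (h : ∀ r, a * (if r ∈ I then 1 else 0) + b * (if r ∈ J then 1 else 0)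
      + c * (if r ∈ K then 1 else 0) = 0) :
    (I = J ∪ K ∧ Disjoint J K) ∨ (J = I ∪ K ∧ Disjoint I K) ∨ (K = I ∪ J ∧ Disjoint I J) := by
  have key : ∀ r, (r ∈ I ∧ r ∈ J ∧ r ∉ K ∧ a + b = 0) ∨ (r ∈ I ∧ r ∉ J ∧ r ∈ K ∧ a + c = 0) ∨
      (r ∉ I ∧ r ∈ J ∧ r ∈ K ∧ b + c = 0) ∨ (r ∈ I ∧ r ∈ J ∧ r ∈ K ∧ a + b + c = 0) ∨
      (r ∉ I ∧ r ∉ J ∧ r ∉ K) := by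
    intro r
    have := h r
    by_cases h1 : r ∈ I <;> by_cases h2 : r ∈ J <;> by_cases h3 : r ∈ K <;>
      simp only [h1, h2, h3, if_true, if_false, mul_one, mul_zero, add_zero, zero_add] at this <;>
      simp_all
  clear h
  simp only [Finset.ext_iff, Finset.mem_union, Finset.disjoint_left]
  obtain ⟨i, hi⟩ := hI
  obtain ⟨j, hj⟩ := hJ
  obtain ⟨k, hk⟩ := hK
  by_cases h1 : a + b = 0 <;> by_cases h2 : a + c = 0 <;> by_cases h3 : b + c = 0
  · omega
  · left; refine ⟨fun r => ?_, fun r => ?_⟩ <;> rcases key r with h | h | h | h | h <;> grind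
  · right; left; refine ⟨fun r => ?_, fun r => ?_⟩ <;> rcases key r with h | h | h | h | h <;> grind
  · rcases key k with h | h | h | h | h <;> grind
  · right; right; refine ⟨fun r => ?_, fun r => ?_⟩ <;> rcases key r with h | h | h | h | h <;> grind
  · rcases key j with h | h | h | h | h <;> [grind; grind; grind; skip; grind]
    exfalso; apply hIJ; ext r
    rcases key r with h' | h' | h' | h' | h' <;> grind
  · rcases key i with h | h | h | h | h <;> [grind; grind; grind; skip; grind]
    exfalso; apply hIJ; ext r
    rcases key r with h' | h' | h' | h' | h' <;> grind
  · exfalso; apply hIJ; ext r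
    rcases key r with h' | h' | h' | h' | h' <;> grind

variable [Fintype ι]

theorem msum_eq_sum (μ : ι → ℝ) (I : Finset ι) :
    msum μ I = ∑ r, (if r ∈ I then 1 else 0) * μ r := by
  simp [msum]

theorem sum_indicator₃ (μ : ι → ℝ) (I J K : Finset ι) (a b c : ℤ) :
    ∑ r, (((a * (if r ∈ I then 1 else 0) + b * (if r ∈ J then 1 else 0)
      + c * (if r ∈ K then 1 else 0) : ℤ)) : ℝ) * μ r = a * msum μ I + b * msum μ J + c * msum μ K := by
  simp only [msum_eq_sum, Finset.mul_sum, ← Finset.sum_add_distrib]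
  refine Finset.sum_congr rfl fun r _ => ?_
  push_cast
  ring

/-- Moments off finitely many hyperplanes are generic. -/
theorem exists_generic_functionals (w : ι → Lat) : ∃ C : Finset (ι → ℤ), (∀ c ∈ C, c ≠ 0) ∧
    ∀ μ : ι → ℝ, (∀ c ∈ C, ∑ r, (c r : ℝ) * μ r ≠ 0) → Generic w μ := by
  classical
  let f : (ℤ × ℤ × ℤ) × Finset ι × Finset ι × Finset ι → ι → ℤ := fun x r =>
    x.1.1 * (if r ∈ x.2.1 then 1 else 0) + x.1.2.1 * (if r ∈ x.2.2.1 then 1 else 0)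
      + x.1.2.2 * (if r ∈ x.2.2.2 then 1 else 0)
  let C : Finset (ι → ℤ) := (Finset.univ.biUnion fun S : Finset ι × Finset ι × Finset ι =>
    {f ((wedge (wsum w S.2.1) (wsum w S.2.2), wedge (wsum w S.2.2) (wsum w S.1),
        wedge (wsum w S.1) (wsum w S.2.1)), S),
      f (((wsum w S.2.1).1, -(wsum w S.1).1, 0), S),
      f (((wsum w S.2.1).2, -(wsum w S.1).2, 0), S)}).filter (· ≠ 0)
  refine ⟨C, fun c hc => (Finset.mem_filter.1 hc).2, fun μ hμ => ?_⟩
  have key : ∀ (x : (ℤ × ℤ × ℤ)) (S : Finset ι × Finset ι × Finset ι),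
      (x = (wedge (wsum w S.2.1) (wsum w S.2.2), wedge (wsum w S.2.2) (wsum w S.1),
        wedge (wsum w S.1) (wsum w S.2.1)) ∨ x = ((wsum w S.2.1).1, -(wsum w S.1).1, 0) ∨
        x = ((wsum w S.2.1).2, -(wsum w S.1).2, 0)) →
      x.1 * msum μ S.1 + x.2.1 * msum μ S.2.1 + x.2.2 * msum μ S.2.2 = 0 →
      ∀ r, f (x, S) r = 0 := by
    intro x S hx h r
    by_contra hr
    refine hμ (f (x, S)) (Finset.mem_filter.2 ⟨Finset.mem_biUnion.2 ⟨S, Finset.mem_univ _, ?_⟩, ?_⟩) ?_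
    · simp only [Finset.mem_insert, Finset.mem_singleton]
      rcases hx with rfl | rfl | rfl <;> simp
    · intro h0; exact hr (congrFun h0 r)
    · rw [sum_indicator₃, h]
  constructor
  · intro I J x hI hJ hIJ hIx hJx h0
    have h0' : ((wsum w I).1 : ℝ) * (wsum w J).2 - (wsum w I).2 * (wsum w J).1 = 0 := by
      exact_mod_cast h0
    have h1 := key _ (I, J, ∅) (Or.inr (Or.inl rfl)) (by
      rw [← show rwedge _ _ = _ from hIx, ← show rwedge _ _ = _ from hJx]
      simp only [rwedge]; push_cast
      linear_combination x.1 * h0')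
    have h2 := key _ (I, J, ∅) (Or.inr (Or.inr rfl)) (by
      rw [← show rwedge _ _ = _ from hIx, ← show rwedge _ _ = _ from hJx]
      simp only [rwedge]; push_cast
      linear_combination x.2 * h0')
    simp only [f, zero_mul, add_zero] at h1 h2
    apply hIJ
    ext r
    have e1 := h1 r
    have e2 := h2 r
    by_cases hrI : r ∈ I <;> by_cases hrJ : r ∈ J <;> simp only [hrI, hrJ, if_true, if_false] at e1 e2 ⊢
    · exact (hJ (Prod.ext (by simpa using e1) (by simpa using e2))).elim
    · exact (hI (Prod.ext (by simpa using e1) (by simpa using e2))).elim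
  · intro I J K x hIJ hJK hIK hI hJ hK
    have h := key _ (I, J, K) (Or.inl rfl) (by
      rw [← show rwedge _ _ = _ from hI, ← show rwedge _ _ = _ from hJ,
        ← show rwedge _ _ = _ from hK]
      simp only [rwedge, wedge]; push_cast; ring)
    refine union_of_indicator_relation hJK ?_ hIJ
      (nonempty_of_wsum_ne (left_ne_zero_of_wedge hIJ))
      (nonempty_of_wsum_ne (left_ne_zero_of_wedge hJK))
      (nonempty_of_wsum_ne (right_ne_zero_of_wedge hIK)) ?_ h
    · dsimp only
      rw [wedge_comm]; simpa using hIK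
    · rintro rfl; exact hIJ (wedge_self _)

end Generic

/-! ### Ordered products -/

section OrderedProduct

variable {α M : Type} [Monoid M]

/-- The elements of `s`, sorted by `key`. -/
def sortBy (s : Finset α) (key : α → ℝ) : List α :=
  s.toList.mergeSort fun a b => decide (key a ≤ key b)

theorem sortBy_perm (s : Finset α) (key : α → ℝ) : (sortBy s key).Perm s.toList :=
  List.mergeSort_perm _ _

theorem mem_sortBy {s : Finset α} {key : α → ℝ} {a : α} : a ∈ sortBy s key ↔ a ∈ s := by
  rw [(sortBy_perm s key).mem_iff, Finset.mem_toList]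

theorem nodup_sortBy (s : Finset α) (key : α → ℝ) : (sortBy s key).Nodup :=
  (sortBy_perm s key).nodup_iff.2 s.nodup_toList

theorem pairwise_sortBy (s : Finset α) (key : α → ℝ) :
    (sortBy s key).Pairwise fun a b => key a ≤ key b := by
  have := List.pairwise_mergeSort (le := fun a b => decide (key a ≤ key b))
    (fun a b c h1 h2 => by simp only [decide_eq_true_eq] at *; exact h1.trans h2)
    (fun a b => by simpa using le_total (key a) (key b)) s.toList
  exact this.imp fun h => by simpa using h

/-- The product of the `f a`, `a ∈ s`, in the order of increasing `key`. -/
def oprod (s : Finset α) (key : α → ℝ) (f : α → M) : M := ((sortBy s key).map f).prod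

theorem oprod_congr {s : Finset α} {key : α → ℝ} {f g : α → M} (h : ∀ a ∈ s, f a = g a) :
    oprod s key f = oprod s key g := by
  rw [oprod, oprod, List.map_congr_left fun a ha => h a (mem_sortBy.1 ha)]

theorem oprod_eq_of_list {s : Finset α} {key : α → ℝ} {f : α → M} (hinj : Set.InjOn key s)
    {L : List α} (hL : L.Nodup) (hmem : ∀ a, a ∈ L ↔ a ∈ s)
    (hpw : L.Pairwise fun a b => key a ≤ key b) : oprod s key f = (L.map f).prod := by
  have : sortBy s key = L := by
    refine List.Perm.eq_of_pairwise (le := fun a b => key a ≤ key b) ?_ (pairwise_sortBy s key) hpw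
      ((List.perm_ext_iff_of_nodup (nodup_sortBy s key) hL).2 fun a => ?_)
    · intro a b ha hb h1 h2
      exact hinj (mem_sortBy.1 ha) ((hmem b).1 hb) (le_antisymm h1 h2)
    · rw [mem_sortBy, hmem]
  rw [oprod, this]

theorem oprod_eq_prod_blocks [DecidableEq α] {s : Finset α} {key q : α → ℝ} {f : α → M}
    (hinj : Set.InjOn key s) {vs : List ℝ} (hvs : vs.Pairwise (· < ·)) (hq : ∀ a ∈ s, q a ∈ vs)
    (hk : ∀ a ∈ s, ∀ b ∈ s, q a < q b → key a < key b) :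
    oprod s key f = (vs.map fun v => oprod (s.filter fun a => q a = v) key f).prod := by
  rw [oprod_eq_of_list (L := vs.flatMap fun v => sortBy (s.filter fun a => q a = v) key) hinj]
  · rw [List.map_flatMap, List.flatMap, List.prod_flatten, List.map_map]
    rfl
  · rw [List.nodup_flatMap]
    refine ⟨fun v _ => nodup_sortBy _ _, hvs.imp fun {v v'} h => ?_⟩
    intro a ha ha'
    rw [mem_sortBy, Finset.mem_filter] at ha ha'
    exact h.ne (ha.2.symm.trans ha'.2)
  · intro a
    simp only [List.mem_flatMap, mem_sortBy, Finset.mem_filter]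
    exact ⟨fun ⟨v, _, h, _⟩ => h, fun h => ⟨q a, hq a h, h, rfl⟩⟩
  · rw [List.pairwise_flatMap]
    refine ⟨fun v _ => pairwise_sortBy _ _, hvs.imp fun {v v'} h a ha b hb => ?_⟩
    rw [mem_sortBy, Finset.mem_filter] at ha hb
    exact (hk a ha.1 b hb.1 (by rw [ha.2, hb.2]; exact h)).le

theorem list_prod_one_add {U : Type} [Ring U] (g : α → U) :
    ∀ (L : List α), (∀ a ∈ L, ∀ b ∈ L, g a * g b = 0) →
      (L.map fun a => 1 + g a).prod = 1 + (L.map g).sum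
  | [], _ => by simp
  | a :: L, h => by
    have ih := list_prod_one_add g L fun x hx y hy =>
      h x (List.mem_cons_of_mem _ hx) y (List.mem_cons_of_mem _ hy)
    have h0 : g a * (L.map g).sum = 0 := by
      rw [← List.sum_map_mul_left]
      refine List.sum_eq_zero fun x hx => ?_
      obtain ⟨b, hb, rfl⟩ := List.mem_map.1 hx
      exact h a List.mem_cons_self b (List.mem_cons_of_mem _ hb)
    rw [List.map_cons, List.prod_cons, ih, List.map_cons, List.sum_cons]
    simp only [mul_add, add_mul, one_mul, mul_one, h0, add_zero]
    abel

theorem sum_sortBy {U : Type} [AddCommMonoid U] (s : Finset α) (key : α → ℝ) (g : α → U) :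
    ((sortBy s key).map g).sum = ∑ a ∈ s, g a := by
  rw [((sortBy_perm s key).map g).sum_eq, Finset.sum_map_toList]

theorem oprod_one_add {U : Type} [Ring U] (s : Finset α) (key : α → ℝ) (g : α → U)
    (h : ∀ a ∈ s, ∀ b ∈ s, g a * g b = 0) : oprod s key (fun a => 1 + g a) = 1 + ∑ a ∈ s, g a := by
  rw [oprod, list_prod_one_add, sum_sortBy]
  intro a ha b hb
  exact h a (mem_sortBy.1 ha) b (mem_sortBy.1 hb)

theorem oprod_three {U : Type} [Ring U] [DecidableEq α] {j k i : α} {key : α → ℝ} {g : α → U}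
    (hjk : j ≠ k) (hji : j ≠ i) (hki : k ≠ i)
    (hlt : key j < key k) (h1 : g i * g j = 0) (h2 : g j * g i = 0) (h3 : g i * g k = 0)
    (h4 : g k * g i = 0) :
    oprod {j, k, i} key (fun a => 1 + g a) = 1 + g j + g k + g i + g j * g k := by
  have hperm : (sortBy {j, k, i} key).Perm [j, k, i] := by
    refine (List.perm_ext_iff_of_nodup (nodup_sortBy _ _) (by simp [hjk, hji, hki])).2 fun a => ?_
    rw [mem_sortBy]; simp
  have hpw := pairwise_sortBy {j, k, i} key
  rw [oprod]
  rw [← List.mem_permutations] at hperm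
  simp only [List.permutations, List.permutationsAux, List.permutationsAux.rec,
    List.permutationsAux2, List.foldr, List.mem_cons, List.not_mem_nil, or_false, id] at hperm
  rcases hperm with h | h | h | h | h | h <;> rw [h] at hpw ⊢ <;>
    simp only [List.pairwise_cons, List.mem_cons, List.not_mem_nil, or_false, forall_eq_or_imp,
      forall_eq] at hpw <;>
    first
    | (exfalso; linarith [hpw.1.1, hpw.1.2, hpw.2.1])
    | (simp only [List.map_cons, List.map_nil, List.prod_cons, List.prod_nil, mul_one, mul_add,
        add_mul, one_mul, h1, h2, h3, h4, ← mul_assoc, add_zero]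
       try simp only [mul_assoc, h1, h2, h3, h4, mul_zero, add_zero]
       abel)

end OrderedProduct

section

open Filter Topology

/-! ### The sweeping line -/

/-- `e ∧ p` for the irrational vector `e = (1, √2)`. -/
def yy (p : Lat) : ℝ := p.2 - √2 * p.1

/-- `e · p` for the irrational vector `e = (1, √2)`. -/
def xx (p : Lat) : ℝ := p.1 + √2 * p.2

theorem yy_neg (p : Lat) : yy (-p) = -yy p := by
  simp only [yy, Prod.fst_neg, Prod.snd_neg]; push_cast; ring

theorem xx_neg (p : Lat) : xx (-p) = -xx p := by
  simp only [xx, Prod.fst_neg, Prod.snd_neg]; push_cast; ring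

theorem yy_nsmul (l : ℕ) (p : Lat) : yy (l • p) = l * yy p := by
  simp only [yy, Prod.smul_fst, Prod.smul_snd]; simp only [nsmul_eq_mul]; push_cast; ring

theorem xx_nsmul (l : ℕ) (p : Lat) : xx (l • p) = l * xx p := by
  simp only [xx, Prod.smul_fst, Prod.smul_snd]; simp only [nsmul_eq_mul]; push_cast; ring

theorem yy_ne_zero {p : Lat} (hp : p ≠ 0) : yy p ≠ 0 := by
  intro h
  rw [yy, sub_eq_zero] at h
  by_cases h1 : p.1 = 0
  · refine hp (Prod.ext h1 ?_)
    rw [h1] at h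
    simpa using h
  · refine irrational_sqrt_two ⟨(p.2 : ℚ) / p.1, ?_⟩
    have : (p.1 : ℝ) ≠ 0 := by exact_mod_cast h1
    push_cast
    rw [h]
    field_simp

/-- The slope of `p` with respect to `e`. -/
def slope (p : Lat) : ℝ := xx p / yy p

theorem slope_neg (p : Lat) : slope (-p) = slope p := by
  rw [slope, slope, xx_neg, yy_neg, neg_div_neg_eq]

theorem slope_nsmul {l : ℕ} (hl : l ≠ 0) (p : Lat) : slope (l • p) = slope p := by
  rw [slope, slope, xx_nsmul, yy_nsmul, mul_div_mul_left]
  exact_mod_cast hl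

theorem sqrt_two_sq : √2 * √2 = (2 : ℝ) := Real.mul_self_sqrt (by norm_num)

theorem slope_sub_slope {p q : Lat} (hp : p ≠ 0) (hq : q ≠ 0) :
    slope p - slope q = 3 * wedge p q / (yy p * yy q) := by
  have h1 := yy_ne_zero hp
  have h2 := yy_ne_zero hq
  rw [slope, slope]
  field_simp
  simp only [xx, yy, wedge]
  push_cast
  linear_combination (p.1 * q.2 - p.2 * q.1 : ℝ) * sqrt_two_sq

theorem slope_eq_iff {p q : Lat} (hp : p ≠ 0) (hq : q ≠ 0) :
    slope p = slope q ↔ wedge p q = 0 := by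
  have h1 := yy_ne_zero hp
  have h2 := yy_ne_zero hq
  rw [← sub_eq_zero, slope_sub_slope hp hq]
  simp [h1, h2]

/-- The point at level `c` of the line `p ∧ x = a`. -/
def linePt (p : Lat) (a c : ℝ) : ℝ × ℝ :=
  ((p.1 * c - a) / yy p, c + √2 * ((p.1 * c - a) / yy p))

theorem rwedge_linePt {p : Lat} (hp : p ≠ 0) (q : Lat) (a c : ℝ) :
    rwedge q (linePt p a c) = (c * wedge q p + a * yy q) / yy p := by
  have h1 := yy_ne_zero hp
  simp only [rwedge, linePt, wedge]
  field_simp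
  simp only [yy]
  push_cast
  ring

theorem rwedge_linePt_self {p : Lat} (hp : p ≠ 0) (a c : ℝ) : rwedge p (linePt p a c) = a := by
  rw [rwedge_linePt hp, wedge_self]
  have h1 := yy_ne_zero hp
  field_simp
  simp

/-- The position along the level line. -/
def posAt (p : Lat) (a c : ℝ) : ℝ := slope p * c - 3 * a / yy p

theorem linePt_eq_of_posAt_eq {p q : Lat} (hp : p ≠ 0) (hq : q ≠ 0) {a b c : ℝ}
    (h : posAt p a c = posAt q b c) : linePt p a c = linePt q b c := by
  have key : ∀ (u : Lat), u ≠ 0 → ∀ t : ℝ,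
      (u.1 * c - t) / yy u = (posAt u t c - √2 * c) / 3 := by
    intro u hu t
    have h1 := yy_ne_zero hu
    rw [posAt, slope]
    field_simp
    simp only [yy, xx]
    linear_combination (-(u.1 * c) : ℝ) * sqrt_two_sq
  rw [linePt, linePt, key p hp, key q hq, h]

section Sweep

variable {ι : Type} [DecidableEq ι] {w : ι → Lat} {μ : ι → ℝ}

/-- The point at level `c` of the line of `I`. -/
def lineAt (w : ι → Lat) (μ : ι → ℝ) (I : Finset ι) (c : ℝ) : ℝ × ℝ :=
  linePt (wsum w I) (msum μ I) c

/-- The position at level `c` of the line of `I`. -/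
def posOf (w : ι → Lat) (μ : ι → ℝ) (c : ℝ) (I : Finset ι) : ℝ :=
  posAt (wsum w I) (msum μ I) c

theorem continuous_posOf (I : Finset ι) : Continuous fun c => posOf w μ c I := by
  unfold posOf posAt; fun_prop

theorem onLine_lineAt {I : Finset ι} (hI : wsum w I ≠ 0) (c : ℝ) :
    OnLine w μ I (lineAt w μ I c) := rwedge_linePt_self hI _ _

theorem posOf_sub {I J : Finset ι} (hI : wsum w I ≠ 0) (hJ : wsum w J ≠ 0) (c c₀ : ℝ) :
    posOf w μ c I - posOf w μ c J = (posOf w μ c₀ I - posOf w μ c₀ J)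
      + 3 * wedge (wsum w I) (wsum w J) / (yy (wsum w I) * yy (wsum w J)) * (c - c₀) := by
  rw [← slope_sub_slope hI hJ]
  simp only [posOf, posAt]
  ring

theorem Generic.posOf_ne_of_wedge_eq_zero (hμ : Generic w μ) {I J : Finset ι} (hI : wsum w I ≠ 0)
    (hJ : wsum w J ≠ 0) (hIJ : I ≠ J) (h0 : wedge (wsum w I) (wsum w J) = 0) (c : ℝ) :
    posOf w μ c I ≠ posOf w μ c J := by
  intro h
  have h1 : lineAt w μ I c = lineAt w μ J c := linePt_eq_of_posAt_eq hI hJ h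
  exact hμ.parallel I J (lineAt w μ I c) hI hJ hIJ (onLine_lineAt hI c)
    (h1 ▸ onLine_lineAt hJ c) h0

theorem Generic.eventually_posOf_ne (hμ : Generic w μ) {I J : Finset ι} (hI : wsum w I ≠ 0)
    (hJ : wsum w J ≠ 0) (hIJ : I ≠ J) (c₀ : ℝ) :
    ∀ᶠ c in 𝓝[≠] c₀, posOf w μ c I ≠ posOf w μ c J := by
  by_cases h0 : wedge (wsum w I) (wsum w J) = 0
  · exact Eventually.of_forall fun c => hμ.posOf_ne_of_wedge_eq_zero hI hJ hIJ h0 c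
  by_cases h1 : posOf w μ c₀ I = posOf w μ c₀ J
  · filter_upwards [self_mem_nhdsWithin] with c hc h
    have := posOf_sub (μ := μ) hI hJ c c₀
    rw [h, h1, sub_self, sub_self, zero_add] at this
    have h2 : (wedge (wsum w I) (wsum w J) : ℝ) ≠ 0 := by exact_mod_cast h0
    refine mul_ne_zero (div_ne_zero (mul_ne_zero three_ne_zero h2)
      (mul_ne_zero (yy_ne_zero hI) (yy_ne_zero hJ))) (sub_ne_zero.2 hc) this.symm
  · exact eventually_nhdsWithin_of_eventually_nhds
      ((((continuous_posOf I).sub (continuous_posOf J)).continuousAt.eventually_ne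
        (sub_ne_zero.2 h1)).mono fun c => sub_ne_zero.1)

theorem rwedge_lineAt_sub {I : Finset ι} (hI : wsum w I ≠ 0) (q : Lat) (c c₀ : ℝ) :
    rwedge q (lineAt w μ I c) - rwedge q (lineAt w μ I c₀)
      = (c - c₀) * (wedge q (wsum w I) / yy (wsum w I)) := by
  rw [lineAt, lineAt, rwedge_linePt hI, rwedge_linePt hI]
  ring

theorem continuous_rwedge_lineAt (q : Lat) (I : Finset ι) :
    Continuous fun c => rwedge q (lineAt w μ I c) := by
  unfold rwedge lineAt linePt; fun_prop

theorem wedge_union_right {J K : Finset ι} (h : Disjoint J K) :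
    wedge (wsum w J) (wsum w (J ∪ K)) = wedge (wsum w J) (wsum w K) := by
  rw [wsum_union w h, wedge_add_right, wedge_self, zero_add]

theorem wedge_sdiff {I A : Finset ι} (hA : A ⊆ I) :
    wedge (wsum w A) (wsum w I) = wedge (wsum w A) (wsum w (I \ A)) := by
  conv_lhs => rw [← Finset.union_sdiff_of_subset hA]
  exact wedge_union_right Finset.disjoint_sdiff

open Classical in
theorem eventually_countAt {I : Finset ι} (S : Finset (Finset ι)) (c₀ : ℝ)
    (h : ∀ A ∈ I.powerset \ S, 0 < wedge (wsum w A) (wsum w (I \ A)) →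
      ¬ OnLine w μ A (lineAt w μ I c₀)) :
    ∃ n₀ : ℕ, ∀ᶠ c in 𝓝 c₀, countAt w μ I (lineAt w μ I c) = n₀ +
      ∑ J ∈ I.powerset ∩ S,
      if 0 < wedge (wsum w J) (wsum w (I \ J)) ∧ msum μ J < rwedge (wsum w J) (lineAt w μ I c) then
        (wedge (wsum w J) (wsum w (I \ J))).natAbs * (countAt w μ J (meetPt w μ J (I \ J)) *
          countAt w μ (I \ J) (meetPt w μ J (I \ J))) else 0 := by
  have h1 : ∀ A ∈ I.powerset \ S, ∀ᶠ c in 𝓝 c₀, 0 < wedge (wsum w A) (wsum w (I \ A)) →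
      (msum μ A < rwedge (wsum w A) (lineAt w μ I c) ↔
        msum μ A < rwedge (wsum w A) (lineAt w μ I c₀)) := by
    intro A hA
    by_cases h0 : 0 < wedge (wsum w A) (wsum w (I \ A))
    · have hc := (continuous_rwedge_lineAt (w := w) (μ := μ) (wsum w A) I).continuousAt (x := c₀)
      rcases lt_or_gt_of_ne (h A hA h0) with h2 | h2
      · filter_upwards [hc.eventually (eventually_lt_nhds h2)] with c h3 _
        exact ⟨fun h4 => (lt_asymm h3 h4).elim, fun h4 => (lt_asymm h2 h4).elim⟩
      · filter_upwards [hc.eventually (eventually_gt_nhds h2)] with c h3 _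
        exact ⟨fun _ => h2, fun _ => h3⟩
    · exact Eventually.of_forall fun c h2 => (h0 h2).elim
  refine ⟨(if I.card = 1 then 1 else 0) + ∑ J ∈ I.powerset \ S,
      if 0 < wedge (wsum w J) (wsum w (I \ J)) ∧ msum μ J < rwedge (wsum w J) (lineAt w μ I c₀) then
        (wedge (wsum w J) (wsum w (I \ J))).natAbs * (countAt w μ J (meetPt w μ J (I \ J)) *
          countAt w μ (I \ J) (meetPt w μ J (I \ J))) else 0, ?_⟩
  filter_upwards [(Finset.eventually_all _).2 h1] with c hc
  rw [countAt_eq, ← Finset.sdiff_union_inter I.powerset S,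
    Finset.sum_union (Finset.disjoint_sdiff_inter _ _), ← add_assoc]
  simp only [Finset.sdiff_union_inter]
  congr 2
  refine Finset.sum_congr rfl fun A hA => ?_
  by_cases h0 : 0 < wedge (wsum w A) (wsum w (I \ A))
  · simp only [h0, true_and, hc A hA h0]
  · simp only [h0, false_and, if_false]

theorem eventually_countAt_const {I : Finset ι} (c₀ : ℝ)
    (h : ∀ A ⊆ I, 0 < wedge (wsum w A) (wsum w (I \ A)) → ¬ OnLine w μ A (lineAt w μ I c₀)) :
    ∀ᶠ c in 𝓝 c₀, countAt w μ I (lineAt w μ I c) = countAt w μ I (lineAt w μ I c₀) := by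
  obtain ⟨n₀, h1⟩ := eventually_countAt (I := I) (w := w) (μ := μ) ∅ c₀ (by
    intro A hA
    exact h A (Finset.mem_powerset.1 (Finset.mem_sdiff.1 hA).1))
  have h2 := h1.self_of_nhds
  filter_upwards [h1] with c hc
  rw [hc, h2]
  simp

theorem eventually_countAt_jump {J K : Finset ι} (hd : Disjoint J K)
    (hw : 0 < wedge (wsum w J) (wsum w K)) (hI : wsum w (J ∪ K) ≠ 0) (c₀ : ℝ)
    (hJ : OnLine w μ J (lineAt w μ (J ∪ K) c₀))
    (hK : OnLine w μ K (lineAt w μ (J ∪ K) c₀))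
    (h : ∀ A ⊆ J ∪ K, A ≠ J → 0 < wedge (wsum w A) (wsum w ((J ∪ K) \ A)) →
      ¬ OnLine w μ A (lineAt w μ (J ∪ K) c₀)) :
    ∃ n₀ : ℕ, ∀ᶠ c in 𝓝 c₀, countAt w μ (J ∪ K) (lineAt w μ (J ∪ K) c) =
      n₀ + if 0 < (c - c₀) / yy (wsum w (J ∪ K)) then
        (wedge (wsum w J) (wsum w K)).natAbs * (countAt w μ J (lineAt w μ (J ∪ K) c₀) *
          countAt w μ K (lineAt w μ (J ∪ K) c₀)) else 0 := by
  obtain ⟨n₀, h1⟩ := eventually_countAt (I := J ∪ K) (w := w) (μ := μ) {J} c₀ (by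
    intro A hA
    rw [Finset.mem_sdiff, Finset.mem_powerset, Finset.mem_singleton] at hA
    exact h A hA.1 hA.2)
  refine ⟨n₀, ?_⟩
  · filter_upwards [h1] with c hc
    rw [hc]
    congr 1
    have e1 : (J ∪ K).powerset ∩ {J} = {J} :=
      Finset.inter_eq_right.2
      (Finset.singleton_subset_iff.2 (Finset.mem_powerset.2 Finset.subset_union_left))
    have e2 : (J ∪ K) \ J = K := by
      rw [Finset.union_sdiff_left, Finset.sdiff_eq_self_of_disjoint hd.symm]
    rw [e1, Finset.sum_singleton, e2, ← eq_meetPt hw.ne' hJ hK]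
    have e3 : (0 < wedge (wsum w J) (wsum w K) ∧
        msum μ J < rwedge (wsum w J) (lineAt w μ (J ∪ K) c)) ↔
        0 < (c - c₀) / yy (wsum w (J ∪ K)) := by
      have e4 := rwedge_lineAt_sub (μ := μ) hI (wsum w J) c c₀
      rw [show rwedge (wsum w J) (lineAt w μ (J ∪ K) c₀) = _ from hJ, wedge_union_right hd] at e4
      have hw' : (0 : ℝ) < wedge (wsum w J) (wsum w K) := by exact_mod_cast hw
      rw [and_iff_right hw, ← sub_pos, e4, mul_div_left_comm, mul_pos_iff_of_pos_left hw']
    simp only [e3]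

open Classical in
theorem eventually_countAt_infty {I : Finset ι} (hI : wsum w I ≠ 0) {l : Filter ℝ}
    (b : Prop) (hl : if b then Tendsto (fun c : ℝ => c / yy (wsum w I)) l atTop
      else Tendsto (fun c : ℝ => c / yy (wsum w I)) l atBot) :
    ∀ᶠ c in l, countAt w μ I (lineAt w μ I c) =
      if b then countInf w μ I else if I.card = 1 then 1 else 0 := by
  have h1 : ∀ A ∈ I.powerset, ∀ᶠ c in l, 0 < wedge (wsum w A) (wsum w (I \ A)) →
      (msum μ A < rwedge (wsum w A) (lineAt w μ I c) ↔ b) := by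
    intro A hA
    by_cases h0 : 0 < wedge (wsum w A) (wsum w (I \ A))
    · have h0' : (0 : ℝ) < wedge (wsum w A) (wsum w (I \ A)) := by exact_mod_cast h0
      have e : ∀ c, rwedge (wsum w A) (lineAt w μ I c) = rwedge (wsum w A) (lineAt w μ I 0)
          + wedge (wsum w A) (wsum w (I \ A)) * (c / yy (wsum w I)) := by
        intro c
        have := rwedge_lineAt_sub (μ := μ) hI (wsum w A) c 0
        rw [wedge_sdiff (Finset.mem_powerset.1 hA)] at this
        rw [sub_eq_iff_eq_add'.1 this]
        ring
      by_cases hb : b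
      · rw [if_pos hb] at hl
        filter_upwards [(tendsto_atTop_add_const_left l (rwedge (wsum w A) (lineAt w μ I 0))
          (hl.const_mul_atTop h0')).eventually_gt_atTop (msum μ A)] with c hc _
        rw [e c]
        exact ⟨fun _ => hb, fun _ => hc⟩
      · rw [if_neg hb] at hl
        filter_upwards [(tendsto_atBot_add_const_left l (rwedge (wsum w A) (lineAt w μ I 0))
          (hl.const_mul_atBot h0')).eventually_lt_atBot (msum μ A)] with c hc _
        rw [e c]
        exact ⟨fun h => (lt_asymm h hc).elim, fun h => (hb h).elim⟩
    · exact Eventually.of_forall fun c h2 => (h0 h2).elim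
  filter_upwards [(Finset.eventually_all _).2 h1] with c hc
  by_cases hb : b
  · rw [if_pos hb, countAt_eq, countInf_eq]
    congr 1
    refine Finset.sum_congr rfl fun A hA => ?_
    by_cases h0 : 0 < wedge (wsum w A) (wsum w (I \ A))
    · simp only [h0, true_and, hc A hA h0, hb]
    · simp only [h0, false_and, if_false]
  · rw [if_neg hb, countAt_eq, add_eq_left]
    refine Finset.sum_eq_zero fun A hA => ?_
    by_cases h0 : 0 < wedge (wsum w A) (wsum w (I \ A))
    · simp only [h0, true_and, hc A hA h0, hb, if_false]
    · simp only [h0, false_and, if_false]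

end Sweep

end

section

open Filter Topology

theorem list_prod_one_add_eq_exp {α U : Type} [Ring U] [Module ℚ U] (g : α → U) :
    ∀ L : List α, (∀ a ∈ L, ∀ b ∈ L, Commute (g a) (g b)) → (∀ a ∈ L, g a * g a = 0) →
      IsNilpotent (L.map g).sum ∧
        (L.map fun a => 1 + g a).prod = IsNilpotent.exp (L.map g).sum
  | [], _, _ => ⟨by simp, by simp [IsNilpotent.exp_zero]⟩
  | a :: L, hc, hs => by
    obtain ⟨ih1, ih2⟩ := list_prod_one_add_eq_exp g L
      (fun x hx y hy => hc x (List.mem_cons_of_mem _ hx) y (List.mem_cons_of_mem _ hy))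
      (fun x hx => hs x (List.mem_cons_of_mem _ hx))
    have ha : IsNilpotent (g a) := ⟨2, by rw [pow_two]; exact hs a List.mem_cons_self⟩
    have hcomm : Commute (g a) (L.map g).sum := by
      refine Commute.list_sum_right _ _ fun x hx => ?_
      obtain ⟨b, hb, rfl⟩ := List.mem_map.1 hx
      exact hc a List.mem_cons_self b (List.mem_cons_of_mem _ hb)
    rw [List.map_cons, List.sum_cons, List.map_cons, List.prod_cons]
    refine ⟨hcomm.isNilpotent_add ha ih1, ?_⟩
    rw [IsNilpotent.exp_add_of_commute hcomm ha ih1, ih2]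
    congr 1
    rw [IsNilpotent.exp_eq_sum (k := 2) (by rw [pow_two]; exact hs a List.mem_cons_self)]
    simp [Finset.sum_range_succ]

theorem oprod_one_add_eq_exp {α U : Type} [Ring U] [Module ℚ U] (s : Finset α) (key : α → ℝ)
    (g : α → U) (hc : ∀ a ∈ s, ∀ b ∈ s, Commute (g a) (g b)) (hs : ∀ a ∈ s, g a * g a = 0) :
    oprod s key (fun a => 1 + g a) = IsNilpotent.exp (∑ a ∈ s, g a) := by
  rw [oprod, (list_prod_one_add_eq_exp g _ _ _).2, sum_sortBy]
  · exact fun a ha b hb => hc a (mem_sortBy.1 ha) b (mem_sortBy.1 hb)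
  · exact fun a ha => hs a (mem_sortBy.1 ha)

section Sweep

variable {ι : Type} [DecidableEq ι] {w : ι → Lat} {μ : ι → ℝ}

theorem OnLine.sdiff {I A : Finset ι} {x : ℝ × ℝ} (hA : A ⊆ I) (hI : OnLine w μ I x)
    (h : OnLine w μ A x) : OnLine w μ (I \ A) x := by
  simp only [OnLine] at *
  rw [← Finset.union_sdiff_of_subset hA, wsum_union w Finset.disjoint_sdiff,
    msum_union μ Finset.disjoint_sdiff, rwedge_add_left, h] at hI
  linarith

theorem posOf_eq_of_onLine {I J : Finset ι} (hI : wsum w I ≠ 0) (hJ : wsum w J ≠ 0) {c : ℝ}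
    (h : OnLine w μ I (lineAt w μ J c)) : posOf w μ c I = posOf w μ c J := by
  rw [OnLine, lineAt, rwedge_linePt hJ] at h
  have h1 := yy_ne_zero hI
  have h2 := yy_ne_zero hJ
  have h3 := slope_sub_slope hI hJ
  rw [posOf, posOf, posAt, posAt, sub_eq_iff_eq_add.1 h3, ← h]
  field_simp
  ring

/-- The sign with which the wall in direction `p` crosses the level lines. -/
def sgn (p : Lat) : ℤ := if 0 < yy p then 1 else -1

variable {U : Type} [Ring U]

/-- The exponent of the wall of `I` at level `c`. -/
def wallCoef (w : ι → Lat) (μ : ι → ℝ) (c : ℝ) (I : Finset ι) : ℤ :=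
  sgn (wsum w I) * countAt w μ I (lineAt w μ I c)

/-- The commutation relations of the elements attached to the walls. -/
structure WallRelations (w : ι → Lat) (E : Finset ι → U) : Prop where
  mul_eq_zero : ∀ I J, ¬ Disjoint I J → E I * E J = 0
  commutator : ∀ I J, Disjoint I J →
    E I * E J - E J * E I = wedge (wsum w I) (wsum w J) • E (I ∪ J)

variable {E : Finset ι → U}

theorem WallRelations.smul_mul_smul_eq_zero (hE : WallRelations w E) {I J : Finset ι}
    (h : ¬ Disjoint I J) (a b : ℤ) : a • E I * b • E J = 0 := by
  rw [smul_mul_smul_comm, hE.mul_eq_zero I J h, smul_zero]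

theorem WallRelations.three_walls (hE : WallRelations w E) (hμ : Generic w μ) {c₀ : ℝ}
    {s : Finset (Finset ι)} {J K : Finset ι} (hs : ∀ I ∈ s, wsum w I ≠ 0)
    (hpt : ∀ I ∈ s, lineAt w μ I c₀ = lineAt w μ J c₀)
    (hmem : ∀ I, wsum w I ≠ 0 → OnLine w μ I (lineAt w μ J c₀) → I ∈ s)
    (hJs : J ∈ s) (hKs : K ∈ s) (hd : Disjoint J K) (hw : 0 < wedge (wsum w J) (wsum w K)) :
    ∃ b : U, ∀ᶠ c in 𝓝[≠] c₀,
      oprod s (posOf w μ c) (fun I => 1 + wallCoef w μ c I • E I) = b := by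
  have hJ0 := hs J hJs
  have hK0 := hs K hKs
  have hJn := nonempty_of_wsum_ne hJ0
  have hKn := nonempty_of_wsum_ne hK0
  have hI0 : wsum w (J ∪ K) ≠ 0 := right_ne_zero_of_wedge (p := wsum w J) (by
    rw [wedge_union_right hd]; exact hw.ne')
  have hon : ∀ I ∈ s, OnLine w μ I (lineAt w μ J c₀) := fun I hI =>
    hpt I hI ▸ onLine_lineAt (hs I hI) c₀
  have hIs : J ∪ K ∈ s := hmem _ hI0 ((hon J hJs).union hd (hon K hKs))
  have hJK : J ≠ K := by rintro rfl; exact hw.ne' (wedge_self _)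
  have hJI : J ≠ J ∪ K := by
    intro h
    obtain ⟨x, hx⟩ := hKn
    exact Finset.disjoint_left.1 hd (h ▸ Finset.mem_union_right _ hx) hx
  have hKI : K ≠ J ∪ K := by
    intro h
    obtain ⟨x, hx⟩ := hJn
    exact Finset.disjoint_left.1 hd hx (h ▸ Finset.mem_union_left _ hx)
  have hs3 : s = {J, K, J ∪ K} := by
    ext M
    simp only [Finset.mem_insert, Finset.mem_singleton]
    refine ⟨fun hM => ?_, by rintro (rfl | rfl | rfl) <;> assumption⟩
    by_contra! hne
    have e1 := hμ.parallel M J _ (hs M hM) hJ0 hne.1 (hon M hM) (hon J hJs)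
    have e2 := hμ.parallel M K _ (hs M hM) hK0 hne.2.1 (hon M hM) (hon K hKs)
    rcases hμ.concurrent M J K _ e1 hw.ne' e2 (hon M hM) (hon J hJs) (hon K hKs) with
      ⟨h, -⟩ | ⟨h, -⟩ | ⟨h, -⟩
    · exact hne.2.2 h
    · obtain ⟨x, hx⟩ := hKn
      exact Finset.disjoint_left.1 hd (h ▸ Finset.mem_union_right _ hx) hx
    · obtain ⟨x, hx⟩ := hJn
      exact Finset.disjoint_left.1 hd hx (h ▸ Finset.mem_union_right _ hx)
  have hA : ∀ A, 0 < wedge (wsum w A) (wsum w (J \ A)) ∨ 0 < wedge (wsum w A) (wsum w (K \ A)) ∨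
      0 < wedge (wsum w A) (wsum w ((J ∪ K) \ A)) → OnLine w μ A (lineAt w μ J c₀) →
      A = J ∨ A = K ∨ A = J ∪ K := by
    intro A h hA
    have : A ∈ s := hmem A (by
      rcases h with h | h | h <;> exact left_ne_zero_of_wedge h.ne') hA
    simpa [hs3] using this
  have hself : ∀ B : Finset ι, ¬ 0 < wedge (wsum w B) (wsum w (B \ B)) := by
    intro B; simp [wsum, wedge_zero_right]
  have cJ := eventually_countAt_const (w := w) (μ := μ) (I := J) c₀ (by
    intro A hAJ h hA'
    rcases hA A (Or.inl h) hA' with rfl | rfl | rfl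
    · exact hself _ h
    · exact hKn.ne_empty (Finset.disjoint_self_iff_empty _ |>.1 (hd.mono_left hAJ))
    · exact hKn.ne_empty (Finset.disjoint_self_iff_empty _ |>.1
        (hd.mono_left (Finset.subset_union_right.trans hAJ))))
  have cK := eventually_countAt_const (w := w) (μ := μ) (I := K) c₀ (by
    rw [hpt K hKs]
    intro A hAK h hA'
    rcases hA A (Or.inr (Or.inl h)) hA' with rfl | rfl | rfl
    · exact hJn.ne_empty (Finset.disjoint_self_iff_empty _ |>.1 (hd.mono_right hAK))
    · exact hself _ h
    · exact hJn.ne_empty (Finset.disjoint_self_iff_empty _ |>.1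
        (hd.mono_right (Finset.subset_union_left.trans hAK))))
  obtain ⟨n₀, cI⟩ := eventually_countAt_jump (w := w) (μ := μ) hd hw hI0 c₀
    (by rw [hpt _ hIs]; exact hon J hJs) (by rw [hpt _ hIs]; exact hon K hKs) (by
    rw [hpt _ hIs]
    intro A hAI hne h hA'
    rcases hA A (Or.inr (Or.inr h)) hA' with rfl | rfl | rfl
    · exact hne rfl
    · rw [Finset.union_sdiff_right, Finset.sdiff_eq_self_of_disjoint hd, wedge_comm] at h
      linarith
    · exact hself _ h)
  rw [hpt _ hIs] at cI
  rw [hpt K hKs] at cK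
  set NJ := countAt w μ J (lineAt w μ J c₀)
  set NK := countAt w μ K (lineAt w μ J c₀)
  have hm : ((wedge (wsum w J) (wsum w K)).natAbs : ℤ) = wedge (wsum w J) (wsum w K) :=
    Int.natAbs_of_nonneg hw.le
  have hEJK := sub_eq_iff_eq_add.1 (hE.commutator J K hd)
  set m := wedge (wsum w J) (wsum w K) with hm_def
  refine ⟨1 + (sgn (wsum w J) * NJ) • E J + (sgn (wsum w K) * NK) • E K
    + (sgn (wsum w (J ∪ K)) * (n₀ + if sgn (wsum w (J ∪ K)) = 1 then m * (NJ * NK) else 0)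
      + if sgn (wsum w J) * sgn (wsum w K) = 1 then 0
        else (sgn (wsum w J) * NJ) * (sgn (wsum w K) * NK) * m) • E (J ∪ K)
    + ((sgn (wsum w J) * NJ) * (sgn (wsum w K) * NK)) • (E K * E J), ?_⟩
  filter_upwards [self_mem_nhdsWithin, eventually_nhdsWithin_of_eventually_nhds cJ,
    eventually_nhdsWithin_of_eventually_nhds cK, eventually_nhdsWithin_of_eventually_nhds cI]
    with c hc eJ eK eI
  have hdisj1 : ¬ Disjoint (J ∪ K) J := fun h =>
    hJn.ne_empty (Finset.disjoint_self_iff_empty _ |>.1 (h.mono_left Finset.subset_union_left))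
  have hdisj2 : ¬ Disjoint (J ∪ K) K := fun h =>
    hKn.ne_empty (Finset.disjoint_self_iff_empty _ |>.1 (h.mono_left Finset.subset_union_right))
  have z1 := hE.smul_mul_smul_eq_zero hdisj1
  have z2 := hE.smul_mul_smul_eq_zero (fun h => hdisj1 (Disjoint.symm h))
  have z3 := hE.smul_mul_smul_eq_zero hdisj2
  have z4 := hE.smul_mul_smul_eq_zero (fun h => hdisj2 (Disjoint.symm h))
  have hpos := posOf_sub (μ := μ) hJ0 hK0 c c₀
  rw [posOf_eq_of_onLine hK0 hJ0 (hon K hKs), sub_self, zero_add, ← hm_def] at hpos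
  have hm' : (0 : ℝ) < m := by exact_mod_cast hw
  have yJ := yy_ne_zero hJ0
  have yK := yy_ne_zero hK0
  have yI := yy_ne_zero hI0
  have hcc := sub_ne_zero.2 hc
  have oJK : posOf w μ c J < posOf w μ c K →
      oprod s (posOf w μ c) (fun I => 1 + wallCoef w μ c I • E I) = 1 + wallCoef w μ c J • E J
        + wallCoef w μ c K • E K + wallCoef w μ c (J ∪ K) • E (J ∪ K)
        + wallCoef w μ c J • E J * wallCoef w μ c K • E K := fun h => by
    rw [hs3, oprod_three hJK hJI hKI h (z1 _ _) (z2 _ _) (z3 _ _) (z4 _ _)]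
  have oKJ : posOf w μ c K < posOf w μ c J →
      oprod s (posOf w μ c) (fun I => 1 + wallCoef w μ c I • E I) = 1 + wallCoef w μ c K • E K
        + wallCoef w μ c J • E J + wallCoef w μ c (J ∪ K) • E (J ∪ K)
        + wallCoef w μ c K • E K * wallCoef w μ c J • E J := fun h => by
    rw [hs3, Finset.insert_comm, oprod_three hJK.symm hKI hJI h (z3 _ _) (z4 _ _) (z1 _ _) (z2 _ _)]
  have wJ : wallCoef w μ c J = sgn (wsum w J) * NJ := by rw [wallCoef, eJ]
  have wK : wallCoef w μ c K = sgn (wsum w K) * NK := by rw [wallCoef, eK]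
  have wI : wallCoef w μ c (J ∪ K) = sgn (wsum w (J ∪ K)) *
      (n₀ + if 0 < (c - c₀) / yy (wsum w (J ∪ K)) then m * (NJ * NK) else 0) := by
    rw [wallCoef, eI]; push_cast; rw [← hm]; norm_cast
  rw [wJ, wK, wI] at oJK oKJ
  rw [smul_mul_smul_comm, hEJK] at oJK
  rw [smul_mul_smul_comm] at oKJ
  have hI : (sgn (wsum w (J ∪ K)) = 1 ∧ (0 < (c - c₀) / yy (wsum w (J ∪ K)) ↔ 0 < c - c₀)) ∨
      (sgn (wsum w (J ∪ K)) = -1 ∧ (0 < (c - c₀) / yy (wsum w (J ∪ K)) ↔ c - c₀ < 0)) := by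
    rcases lt_or_gt_of_ne yI with h | h
    · refine Or.inr ⟨if_neg h.not_gt, ?_⟩
      rw [div_pos_iff]
      exact ⟨fun h' => h'.elim (fun h' => (h.not_gt h'.2).elim) fun h' => h'.1,
        fun h' => Or.inr ⟨h', h⟩⟩
    · exact Or.inl ⟨if_pos h, div_pos_iff_of_pos_right h⟩
  have hsg : ∀ p : Lat, yy p ≠ 0 → (sgn p = 1 ∧ 0 < yy p) ∨ (sgn p = -1 ∧ yy p < 0) := by
    intro p hp
    rcases lt_or_gt_of_ne hp with h | h
    · exact Or.inr ⟨if_neg h.not_gt, h⟩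
    · exact Or.inl ⟨if_pos h, h⟩
  have hord : (sgn (wsum w J) * sgn (wsum w K) = 1 ∧
        (c - c₀ < 0 → posOf w μ c J < posOf w μ c K) ∧
        (0 < c - c₀ → posOf w μ c K < posOf w μ c J)) ∨
      (sgn (wsum w J) * sgn (wsum w K) = -1 ∧ (0 < c - c₀ → posOf w μ c J < posOf w μ c K) ∧
        (c - c₀ < 0 → posOf w μ c K < posOf w μ c J)) := by
    have h3 := mul_pos three_pos hm'
    have pos : 0 < yy (wsum w J) * yy (wsum w K) →
        (c - c₀ < 0 → posOf w μ c J < posOf w μ c K) ∧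
        (0 < c - c₀ → posOf w μ c K < posOf w μ c J) := fun h =>
      ⟨fun h' => by linarith [mul_neg_of_pos_of_neg (div_pos h3 h) h'],
        fun h' => by linarith [mul_pos (div_pos h3 h) h']⟩
    have neg : yy (wsum w J) * yy (wsum w K) < 0 →
        (0 < c - c₀ → posOf w μ c J < posOf w μ c K) ∧
        (c - c₀ < 0 → posOf w μ c K < posOf w μ c J) := fun h =>
      ⟨fun h' => by linarith [mul_neg_of_neg_of_pos (div_neg_of_pos_of_neg h3 h) h'],
        fun h' => by linarith [mul_pos_of_neg_of_neg (div_neg_of_pos_of_neg h3 h) h']⟩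
    rcases hsg _ yJ with ⟨a1, a2⟩ | ⟨a1, a2⟩ <;> rcases hsg _ yK with ⟨b1, b2⟩ | ⟨b1, b2⟩
    · exact Or.inl ⟨by rw [a1, b1]; norm_num, pos (mul_pos a2 b2)⟩
    · exact Or.inr ⟨by rw [a1, b1]; norm_num, neg (mul_neg_of_pos_of_neg a2 b2)⟩
    · exact Or.inr ⟨by rw [a1, b1]; norm_num, neg (mul_neg_of_neg_of_pos a2 b2)⟩
    · exact Or.inl ⟨by rw [a1, b1]; norm_num, pos (mul_pos_of_neg_of_neg a2 b2)⟩
  have hxy : sgn (wsum w J) * NJ * (sgn (wsum w K) * NK)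
      = sgn (wsum w J) * sgn (wsum w K) * (NJ * NK) := by ring
  rw [mul_comm (sgn (wsum w K) * (NK : ℤ))] at oKJ
  rw [hxy] at oJK oKJ ⊢
  generalize sgn (wsum w J) * sgn (wsum w K) = σ at *
  have hne1 : ¬ (-1 : ℤ) = 1 := by decide
  rcases hI with ⟨i1, i2⟩ | ⟨i1, i2⟩ <;> rcases hord with ⟨o1, o2, o3⟩ | ⟨o1, o2, o3⟩ <;>
    rcases lt_or_gt_of_ne hcc with hc1 | hc1 <;>
    simp only [i1, i2, o1, hc1, hc1.not_gt, hne1, if_true, if_false] at oJK oKJ ⊢ <;>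
    first
    | (rw [oJK (o2 hc1)]; module)
    | (rw [oKJ (o3 hc1)]; module)

end Sweep

end

section

open Filter Topology

section Sweep

variable {ι : Type} [DecidableEq ι] {w : ι → Lat} {μ : ι → ℝ} {U : Type} [Ring U]
  {E : Finset ι → U}

theorem WallRelations.block (hE : WallRelations w E) (hμ : Generic w μ) {c₀ : ℝ}
    {s : Finset (Finset ι)} (hs : ∀ I ∈ s, wsum w I ≠ 0)
    (hpt : ∀ I ∈ s, ∀ J ∈ s, lineAt w μ I c₀ = lineAt w μ J c₀)
    (hmem : ∀ J ∈ s, ∀ I, wsum w I ≠ 0 → OnLine w μ I (lineAt w μ J c₀) → I ∈ s) :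
    ∃ b : U, ∀ᶠ c in 𝓝[≠] c₀,
      oprod s (posOf w μ c) (fun I => 1 + wallCoef w μ c I • E I) = b := by
  by_cases h : ∃ J ∈ s, ∃ K ∈ s, Disjoint J K
  · obtain ⟨J, hJ, K, hK, hd⟩ := h
    have hne : J ≠ K := by
      rintro rfl
      exact (nonempty_of_wsum_ne (hs J hJ)).ne_empty (Finset.disjoint_self_iff_empty _ |>.1 hd)
    have hw := hμ.parallel J K (lineAt w μ J c₀) (hs J hJ) (hs K hK) hne (onLine_lineAt (hs J hJ) c₀)
      (hpt J hJ K hK ▸ onLine_lineAt (hs K hK) c₀)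
    rcases lt_or_gt_of_ne hw with h | h
    · rw [wedge_comm, neg_lt_zero] at h
      exact hE.three_walls hμ hs (fun I hI => hpt I hI K hK) (hmem K hK) hK hJ hd.symm h
    · exact hE.three_walls hμ hs (fun I hI => hpt I hI J hJ) (hmem J hJ) hJ hK hd h
  · push Not at h
    have hc : ∀ I ∈ s, ∀ᶠ c in 𝓝 c₀,
        countAt w μ I (lineAt w μ I c) = countAt w μ I (lineAt w μ I c₀) := by
      refine fun I hI => eventually_countAt_const c₀ fun A hA hw hAl => ?_
      have h1 := hmem I hI A (left_ne_zero_of_wedge hw.ne') hAl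
      have h2 := hmem I hI (I \ A) (right_ne_zero_of_wedge hw.ne')
        (OnLine.sdiff hA (onLine_lineAt (hs I hI) c₀) hAl)
      exact h A h1 _ h2 Finset.disjoint_sdiff
    refine ⟨1 + ∑ I ∈ s, wallCoef w μ c₀ I • E I, ?_⟩
    refine eventually_nhdsWithin_of_eventually_nhds ?_
    filter_upwards [(Finset.eventually_all _).2 hc] with c hc
    rw [oprod_one_add]
    · congr 1
      refine Finset.sum_congr rfl fun I hI => ?_
      rw [wallCoef, wallCoef, hc I hI]
    · exact fun I hI J hJ => hE.smul_mul_smul_eq_zero (h I hI J hJ) _ _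

variable [Fintype ι]

/-- The sets `I` for which there is a line `w_I ∧ x = μ_I`. -/
def wallSets (w : ι → Lat) : Finset (Finset ι) := Finset.univ.filter fun I => wsum w I ≠ 0

theorem mem_wallSets {I : Finset ι} : I ∈ wallSets w ↔ wsum w I ≠ 0 := by simp [wallSets]

/-- The ordered product of the wall crossings along the level line at level `c`. -/
def levelProd (w : ι → Lat) (μ : ι → ℝ) (E : Finset ι → U) (c : ℝ) : U :=
  oprod (wallSets w) (posOf w μ c) fun I => 1 + wallCoef w μ c I • E I

theorem Generic.eventually_injOn (hμ : Generic w μ) (c₀ : ℝ) :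
    ∀ᶠ c in 𝓝[≠] c₀, Set.InjOn (posOf w μ c) (wallSets w : Set (Finset ι)) := by
  have : ∀ I ∈ wallSets w, ∀ J ∈ wallSets w, ∀ᶠ c in 𝓝[≠] c₀,
      I ≠ J → posOf w μ c I ≠ posOf w μ c J := by
    intro I hI J hJ
    by_cases hIJ : I = J
    · exact Eventually.of_forall fun c h => (h hIJ).elim
    · filter_upwards [hμ.eventually_posOf_ne (mem_wallSets.1 hI) (mem_wallSets.1 hJ) hIJ c₀] with c hc _
      exact hc
  filter_upwards [(Finset.eventually_all _).2 fun I hI => (Finset.eventually_all _).2 (this I hI)]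
    with c hc I hI J hJ h
  by_contra hne
  exact hc I hI J hJ hne h

theorem eventually_posOf_lt (c₀ : ℝ) :
    ∀ᶠ c in 𝓝 c₀, ∀ I ∈ wallSets w, ∀ J ∈ wallSets w, posOf w μ c₀ I < posOf w μ c₀ J →
      posOf w μ c I < posOf w μ c J := by
  refine (Finset.eventually_all _).2 fun I _ => (Finset.eventually_all _).2 fun J _ => ?_
  by_cases h : posOf w μ c₀ I < posOf w μ c₀ J
  · filter_upwards [(continuous_posOf I).continuousAt.eventually_lt (continuous_posOf J).continuousAt h]
      with c hc _
    exact hc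
  · exact Eventually.of_forall fun c h' => (h h').elim

theorem WallRelations.eventually_levelProd_eq (hE : WallRelations w E) (hμ : Generic w μ) (c₀ : ℝ) :
    ∃ b : U, ∀ᶠ c in 𝓝[≠] c₀, levelProd w μ E c = b := by
  have hb : ∀ v : ℝ, ∃ b : U, ∀ᶠ c in 𝓝[≠] c₀,
      oprod ((wallSets w).filter fun I => posOf w μ c₀ I = v) (posOf w μ c)
        (fun I => 1 + wallCoef w μ c I • E I) = b := by
    intro v
    refine hE.block hμ ?_ ?_ ?_
    · intro I hI
      exact mem_wallSets.1 (Finset.mem_filter.1 hI).1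
    · intro I hI J hJ
      rw [Finset.mem_filter, mem_wallSets] at hI hJ
      exact linePt_eq_of_posAt_eq hI.1 hJ.1 (hI.2.trans hJ.2.symm)
    · intro J hJ I hI hIJ
      rw [Finset.mem_filter, mem_wallSets] at hJ ⊢
      exact ⟨hI, (posOf_eq_of_onLine hI hJ.1 hIJ).trans hJ.2⟩
  choose b hb using hb
  set V := (wallSets w).image (posOf w μ c₀)
  refine ⟨((V.sort (· ≤ ·)).map b).prod, ?_⟩
  filter_upwards [(Finset.eventually_all V).2 fun v _ => hb v, hμ.eventually_injOn c₀,
    eventually_nhdsWithin_of_eventually_nhds (eventually_posOf_lt (w := w) (μ := μ) c₀)]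
    with c h1 h2 h3
  rw [levelProd, oprod_eq_prod_blocks h2 (vs := V.sort (· ≤ ·)) (q := posOf w μ c₀)]
  · congr 1
    refine List.map_congr_left fun v hv => h1 v ?_
    exact (Finset.mem_sort _).1 hv
  · exact (Finset.sortedLT_sort V).pairwise
  · intro I hI
    exact (Finset.mem_sort _).2 (Finset.mem_image_of_mem _ hI)
  · exact fun I hI J hJ => h3 I hI J hJ

theorem WallRelations.exists_levelProd_eq (hE : WallRelations w E) (hμ : Generic w μ) :
    ∃ b : U, ∀ c₀, ∀ᶠ c in 𝓝[≠] c₀, levelProd w μ E c = b := by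
  choose B hB using hE.eventually_levelProd_eq hμ
  have hloc : IsLocallyConstant B := by
    refine (IsLocallyConstant.iff_eventually_eq B).2 fun c₀ => ?_
    have h1 := eventually_eventually_nhdsWithin.2 (hB c₀)
    have h2 : ∀ᶠ c in 𝓝[≠] c₀, B c = B c₀ := by
      filter_upwards [h1, self_mem_nhdsWithin] with c hc hne
      have h3 : 𝓝[≠] c ≤ 𝓝[≠] c₀ ⊔ 𝓝[≠] c := le_sup_right
      have h4 : ∀ᶠ c' in 𝓝[≠] c, levelProd w μ E c' = B c₀ := by
        have : 𝓝[≠] c₀ ≤ 𝓝[≠] c₀ := le_rfl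
        rw [eventually_nhdsWithin_iff] at hc
        have hne' : ∀ᶠ c' in 𝓝 c, c' ∈ ({c₀}ᶜ : Set ℝ) := isOpen_compl_singleton.mem_nhds hne
        exact eventually_nhdsWithin_of_eventually_nhds (by
          filter_upwards [hc, hne'] with c' e1 e2
          exact e1 e2)
      obtain ⟨c', e1, e2⟩ := (h4.and (hB c)).exists
      exact e2.symm.trans e1
    rw [eventually_nhdsWithin_iff] at h2
    filter_upwards [h2] with c hc
    by_cases h : c = c₀
    · rw [h]
    · exact hc h
  refine ⟨B 0, fun c₀ => ?_⟩
  rw [hloc.apply_eq_of_isPreconnected isPreconnected_univ (Set.mem_univ 0) (Set.mem_univ c₀)]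
  exact hB c₀

open Classical in
/-- The exponents of the walls far above. -/
def topCoef (w : ι → Lat) (μ : ι → ℝ) (I : Finset ι) : ℤ :=
  if 0 < yy (wsum w I) then (countInf w μ I : ℤ) else if I.card = 1 then -1 else 0

open Classical in
/-- The exponents of the walls far below. -/
def botCoef (w : ι → Lat) (μ : ι → ℝ) (I : Finset ι) : ℤ :=
  if 0 < yy (wsum w I) then if I.card = 1 then 1 else 0 else -(countInf w μ I : ℤ)

theorem eventually_wallCoef_top :
    ∀ᶠ c in atTop, ∀ I ∈ wallSets w, wallCoef w μ c I = topCoef w μ I := by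
  refine (Finset.eventually_all _).2 fun I hI => ?_
  rw [mem_wallSets] at hI
  have := eventually_countAt_infty (w := w) (μ := μ) hI (l := atTop) (0 < yy (wsum w I)) (by
    split_ifs with h
    · exact tendsto_id.atTop_div_const h
    · exact tendsto_id.atTop_div_const_of_neg (lt_of_le_of_ne (not_lt.1 h) (yy_ne_zero hI)))
  filter_upwards [this] with c hc
  rw [wallCoef, hc, topCoef, sgn]
  split_ifs <;> simp

theorem eventually_wallCoef_bot :
    ∀ᶠ c in atBot, ∀ I ∈ wallSets w, wallCoef w μ c I = botCoef w μ I := by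
  refine (Finset.eventually_all _).2 fun I hI => ?_
  rw [mem_wallSets] at hI
  have := eventually_countAt_infty (w := w) (μ := μ) hI (l := atBot) (¬ 0 < yy (wsum w I)) (by
    rcases lt_or_gt_of_ne (yy_ne_zero hI) with h | h
    · rw [if_pos h.not_gt]
      simpa only [div_eq_mul_inv, id] using
        (tendsto_id (α := ℝ)).atBot_mul_const_of_neg (inv_lt_zero.2 h)
    · rw [if_neg (not_not.2 h)]
      exact tendsto_id.atBot_div_const h)
  filter_upwards [this] with c hc
  rw [wallCoef, hc, botCoef, sgn]
  split_ifs <;> simp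

theorem posOf_sub_eq {I J : Finset ι} (c : ℝ) : posOf w μ c I - posOf w μ c J =
    (slope (wsum w I) - slope (wsum w J)) * c + (posOf w μ 0 I - posOf w μ 0 J) := by
  simp only [posOf, posAt]; ring

theorem eventually_posOf_lt_top : ∀ᶠ c in atTop, ∀ I ∈ wallSets w, ∀ J ∈ wallSets w,
    slope (wsum w I) < slope (wsum w J) → posOf w μ c I < posOf w μ c J := by
  refine (Finset.eventually_all _).2 fun I _ => (Finset.eventually_all _).2 fun J _ => ?_
  by_cases h : slope (wsum w I) < slope (wsum w J)
  · filter_upwards [(tendsto_atBot_add_const_right atTop (posOf w μ 0 I - posOf w μ 0 J)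
      (tendsto_id.const_mul_atTop_of_neg (sub_neg.2 h))).eventually_lt_atBot 0] with c hc _
    rw [id, ← posOf_sub_eq] at hc
    linarith
  · exact Eventually.of_forall fun c h' => (h h').elim

theorem eventually_posOf_lt_bot : ∀ᶠ c in atBot, ∀ I ∈ wallSets w, ∀ J ∈ wallSets w,
    slope (wsum w J) < slope (wsum w I) → posOf w μ c I < posOf w μ c J := by
  refine (Finset.eventually_all _).2 fun I _ => (Finset.eventually_all _).2 fun J _ => ?_
  by_cases h : slope (wsum w J) < slope (wsum w I)
  · filter_upwards [(tendsto_atBot_add_const_right atBot (posOf w μ 0 I - posOf w μ 0 J)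
      (tendsto_id.const_mul_atBot (sub_pos.2 h))).eventually_lt_atBot 0] with c hc _
    rw [id, ← posOf_sub_eq] at hc
    linarith
  · exact Eventually.of_forall fun c h' => (h h').elim

theorem Generic.eventually_injOn_of_lt (hμ : Generic w μ) {c : ℝ}
    (h : ∀ I ∈ wallSets w, ∀ J ∈ wallSets w, slope (wsum w I) ≠ slope (wsum w J) →
      posOf w μ c I ≠ posOf w μ c J) : Set.InjOn (posOf w μ c) (wallSets w : Set (Finset ι)) := by
  intro I hI J hJ hIJ
  by_contra hne
  have hI' := mem_wallSets.1 hI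
  have hJ' := mem_wallSets.1 hJ
  by_cases hs : slope (wsum w I) = slope (wsum w J)
  · exact hμ.posOf_ne_of_wedge_eq_zero hI' hJ' hne ((slope_eq_iff hI' hJ').1 hs) c hIJ
  · exact h I hI J hJ hs hIJ

theorem WallRelations.commute (hE : WallRelations w E) {I J : Finset ι}
    (h : wedge (wsum w I) (wsum w J) = 0) : Commute (E I) (E J) := by
  by_cases hd : Disjoint I J
  · have := hE.commutator I J hd
    rw [h, zero_smul] at this
    exact sub_eq_zero.1 this
  · rw [Commute, SemiconjBy, hE.mul_eq_zero I J hd, hE.mul_eq_zero J I fun h => hd (Disjoint.symm h)]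

theorem WallRelations.mul_self (hE : WallRelations w E) {I : Finset ι} (hI : wsum w I ≠ 0) :
    E I * E I = 0 :=
  hE.mul_eq_zero I I fun h =>
    (nonempty_of_wsum_ne hI).ne_empty (Finset.disjoint_self_iff_empty _ |>.1 h)

variable [Module ℚ U]

/-- The exponential of the sum of the `z I • E I` over the sets `I` with slope `v`. -/
def slopeExp (w : ι → Lat) (E : Finset ι → U) (z : Finset ι → ℤ) (v : ℝ) : U :=
  IsNilpotent.exp (∑ I ∈ (wallSets w).filter fun I => slope (wsum w I) = v, z I • E I)

theorem WallRelations.oprod_slope (hE : WallRelations w E) (z : Finset ι → ℤ) (v : ℝ)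
    (key : Finset ι → ℝ) :
    oprod ((wallSets w).filter fun I => slope (wsum w I) = v) key (fun I => 1 + z I • E I)
      = slopeExp w E z v := by
  refine oprod_one_add_eq_exp _ _ _ ?_ ?_
  · intro I hI J hJ
    rw [Finset.mem_filter, mem_wallSets] at hI hJ
    exact ((hE.commute ((slope_eq_iff hI.1 hJ.1).1 (hI.2.trans hJ.2.symm))).smul_left _).smul_right _
  · intro I hI
    rw [Finset.mem_filter, mem_wallSets] at hI
    rw [smul_mul_smul_comm, hE.mul_self hI.1, smul_zero]

/-- The product of the walls far above equals the product of the walls far below. -/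
theorem WallRelations.top_eq_bot (hE : WallRelations w E) (hμ : Generic w μ) {vs : List ℝ}
    (hvs : vs.Pairwise (· < ·)) (hmem : ∀ I ∈ wallSets w, slope (wsum w I) ∈ vs) :
    (vs.map (slopeExp w E (topCoef w μ))).prod
      = (vs.reverse.map (slopeExp w E (botCoef w μ))).prod := by
  obtain ⟨b, hb⟩ := hE.exists_levelProd_eq hμ
  have htop : ∀ᶠ c in atTop, levelProd w μ E c = (vs.map (slopeExp w E (topCoef w μ))).prod := by
    filter_upwards [eventually_wallCoef_top (w := w) (μ := μ), eventually_posOf_lt_top (w := w) (μ := μ)]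
      with c h1 h2
    rw [levelProd, oprod_congr (fun I hI => by rw [h1 I hI]), oprod_eq_prod_blocks
      (hμ.eventually_injOn_of_lt ?_) hvs hmem h2]
    · simp only [hE.oprod_slope]
    · intro I hI J hJ hs
      rcases lt_or_gt_of_ne hs with h | h
      · exact (h2 I hI J hJ h).ne
      · exact (h2 J hJ I hI h).ne'
  have hbot : ∀ᶠ c in atBot, levelProd w μ E c
      = (vs.reverse.map (slopeExp w E (botCoef w μ))).prod := by
    filter_upwards [eventually_wallCoef_bot (w := w) (μ := μ), eventually_posOf_lt_bot (w := w) (μ := μ)]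
      with c h1 h2
    rw [levelProd, oprod_congr (fun I hI => by rw [h1 I hI]), oprod_eq_prod_blocks
      (q := fun I => -slope (wsum w I)) (vs := vs.reverse.map Neg.neg)
      (hμ.eventually_injOn_of_lt ?_)]
    · rw [List.map_map]
      congr 2
      funext v
      simp only [Function.comp, neg_inj, hE.oprod_slope]
    · rw [List.pairwise_map, List.pairwise_reverse]
      exact hvs.imp fun h => neg_lt_neg h
    · intro I hI
      exact List.mem_map_of_mem (List.mem_reverse.2 (hmem I hI))
    · exact fun I hI J hJ h => h2 I hI J hJ (neg_lt_neg_iff.1 h)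
    · intro I hI J hJ hs
      rcases lt_or_gt_of_ne hs with h | h
      · exact (h2 J hJ I hI h).ne'
      · exact (h2 I hI J hJ h).ne
  have e1 : (vs.map (slopeExp w E (topCoef w μ))).prod = b := by
    obtain ⟨a, ha⟩ := eventually_atTop.1 htop
    obtain ⟨c, h1, h2⟩ := ((hb (a + 1)).and (eventually_nhdsWithin_of_eventually_nhds
      (lt_mem_nhds (lt_add_one a)))).exists
    rw [← ha c h2.le, h1]
  have e2 : (vs.reverse.map (slopeExp w E (botCoef w μ))).prod = b := by
    obtain ⟨a, ha⟩ := eventually_atBot.1 hbot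
    obtain ⟨c, h1, h2⟩ := ((hb (a - 1)).and (eventually_nhdsWithin_of_eventually_nhds
      (gt_mem_nhds (sub_one_lt a)))).exists
    rw [← ha c h2.le, h1]
  rw [e1, e2]

end Sweep

end

/-! ### Operators on square-free series -/

section Place

variable {ι : Type} [DecidableEq ι] {V : Type} [AddCommGroup V] [Module ℂ V]

/-- The operator `u_I T` on square-free series with coefficients in `V`. -/
def plc (I : Finset ι) : Module.End ℂ V →ₗ[ℂ] Module.End ℂ (Finset ι → V) where
  toFun T :=
    { toFun := fun f S => if I ⊆ S then T (f (S \ I)) else 0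
      map_add' := fun f g => by
        funext S
        simp only [Pi.add_apply, map_add]
        split_ifs <;> simp
      map_smul' := fun c f => by
        funext S
        simp only [Pi.smul_apply, map_smul, RingHom.id_apply]
        split_ifs <;> simp }
  map_add' T T' := by
    ext1 f; funext S
    simp only [LinearMap.coe_mk, AddHom.coe_mk, LinearMap.add_apply, Pi.add_apply]
    split_ifs <;> simp
  map_smul' c T := by
    ext1 f; funext S
    simp only [LinearMap.coe_mk, AddHom.coe_mk, LinearMap.smul_apply, Pi.smul_apply,
      RingHom.id_apply]
    split_ifs <;> simp

theorem plc_apply (I : Finset ι) (T : Module.End ℂ V) (f : Finset ι → V) (S : Finset ι) :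
    plc I T f S = if I ⊆ S then T (f (S \ I)) else 0 := rfl

theorem plc_mul (I J : Finset ι) (T T' : Module.End ℂ V) :
    plc I T * plc J T' = if Disjoint I J then plc (I ∪ J) (T * T') else 0 := by
  ext1 f
  funext S
  rw [Module.End.mul_apply, plc_apply, plc_apply]
  split_ifs with h1 h2 h3 h3 h3
  · rw [plc_apply, if_pos (Finset.union_subset h1 (h2.trans Finset.sdiff_subset)),
      Module.End.mul_apply, sdiff_sdiff_left, Finset.sup_eq_union]
  · exact (h3 (Finset.disjoint_of_subset_right h2 Finset.disjoint_sdiff)).elim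
  · rw [plc_apply, if_neg, map_zero]
    exact fun h => h2 (Finset.subset_sdiff.2 ⟨Finset.union_subset_right h, h3.symm⟩)
  · simp
  · rw [plc_apply, if_neg]
    exact fun h => h1 (Finset.union_subset_left h)
  · rfl

theorem plc_empty_one : plc (∅ : Finset ι) (1 : Module.End ℂ V) = 1 := by
  ext1 f; funext S
  simp [plc_apply]

end Place

section Elementary

variable {K : Type} [Ring K] [Algebra ℂ K]

/-- The operator `z^p (b + ∂_{n_p})` on Laurent polynomials. -/
def elem (p : Lat) (b : K) : Module.End ℂ (AddMonoidAlgebra K Lat) :=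
  LinearMap.mulLeft ℂ (AddMonoidAlgebra.single p b) +
    LinearMap.mulLeft ℂ (AddMonoidAlgebra.single p 1) * dLaurent (normal p)

theorem elem_apply (p : Lat) (b : K) (v : AddMonoidAlgebra K Lat) :
    elem p b v = AddMonoidAlgebra.single p b * v +
      AddMonoidAlgebra.single p 1 * dLaurent (normal p) v := rfl

theorem pairing_normal (p q : Lat) : pairing q (normal p) = wedge p q := by
  simp only [pairing, normal, wedge]; ring

theorem elem_single (p q : Lat) (b k : K) :
    elem p b (AddMonoidAlgebra.single q k) =
      AddMonoidAlgebra.single (p + q) (b * k + wedge p q • k) := by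
  rw [elem_apply, dLaurent_single, pairing_normal, mul_smul_comm,
    AddMonoidAlgebra.single_mul_single, AddMonoidAlgebra.single_mul_single, AddMonoidAlgebra.smul_single,
    ← AddMonoidAlgebra.single_add, one_mul]

theorem end_ext {T T' : Module.End ℂ (AddMonoidAlgebra K Lat)}
    (h : ∀ q k, T (AddMonoidAlgebra.single q k) = T' (AddMonoidAlgebra.single q k)) : T = T' := by
  refine LinearMap.ext fun v => ?_
  induction v using AddMonoidAlgebra.induction_linear with
  | zero => simp
  | add x y hx hy => rw [map_add, map_add, hx, hy]
  | single q k => exact h q k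

theorem elem_commutator (p p' : Lat) (b b' : K) (h : b * b' = b' * b) :
    elem p b * elem p' b' - elem p' b' * elem p b = wedge p p' • elem (p + p') (b + b') := by
  refine end_ext fun q k => ?_
  rw [LinearMap.sub_apply, Module.End.mul_apply, Module.End.mul_apply, LinearMap.smul_apply]
  simp only [elem_single]
  rw [show p' + (p + q) = p + p' + q by abel, ← add_assoc p p' q, ← AddMonoidAlgebra.single_sub,
    AddMonoidAlgebra.smul_single]
  congr 1
  rw [wedge_add_right, wedge_add_right, wedge_add_left, wedge_comm p p']
  simp only [mul_add, mul_smul_comm, ← mul_assoc, h, add_mul, smul_add, smul_smul]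
  module

theorem elem_ne_zero {p : Lat} (hp : p ≠ 0) [Nontrivial K] [CharZero K] :
    ∃ q : Lat, elem p (0 : K) (AddMonoidAlgebra.single q 1) ≠ 0 := by
  refine ⟨normal p, ?_⟩
  rw [elem_single, zero_mul, zero_add, zsmul_one, Ne, AddMonoidAlgebra.single_eq_zero,
    Int.cast_eq_zero]
  simp only [wedge, normal]
  intro h
  apply hp
  have h1 : p.1 * p.1 + p.2 * p.2 = 0 := by linarith
  exact Prod.ext (by simp only [Prod.fst_zero]; nlinarith [mul_self_nonneg p.1, mul_self_nonneg p.2])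
    (by simp only [Prod.snd_zero]; nlinarith [mul_self_nonneg p.1, mul_self_nonneg p.2])

variable {ι : Type} [DecidableEq ι]

/-- The sum of the `b r`, `r ∈ I`. -/
def bsum (b : ι → K) (I : Finset ι) : K := ∑ r ∈ I, b r

theorem wallRelations_elem (w : ι → Lat) (b : ι → K) (hb : ∀ r s, b r * b s = b s * b r) :
    WallRelations w fun I => plc (V := AddMonoidAlgebra K Lat) I (elem (wsum w I) (bsum b I)) where
  mul_eq_zero I J h := by
    rw [plc_mul, if_neg h]
  commutator I J h := by
    rw [plc_mul, plc_mul, if_pos h, if_pos (Disjoint.symm h), Finset.union_comm J I, ← map_sub,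
      elem_commutator, map_zsmul, wsum_union w h, bsum, bsum, bsum, Finset.sum_union h]
    rw [bsum, bsum, Finset.sum_mul_sum, Finset.sum_mul_sum, Finset.sum_comm]
    exact Finset.sum_congr rfl fun r _ => Finset.sum_congr rfl fun s _ => hb _ _

end Elementary

/-! ### The counts do not depend on the moments -/

/-- The rational structure on the endomorphisms of a complex vector space. -/
abbrev endRatModule (V : Type) [AddCommGroup V] [Module ℂ V] : Module ℚ (Module.End ℂ V) :=
  Module.compHom _ (algebraMap ℚ ℂ)

attribute [local instance] endRatModule

section Invariance

variable {ι : Type} [DecidableEq ι] {V : Type} [AddCommGroup V] [Module ℂ V]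

/-- The series with constant coefficient `v`. -/
def constSeries (v : V) : Finset ι → V := fun S => if S = ∅ then v else 0

theorem prod_plc_difference (T : Finset ι → Module.End ℂ V) (z z' : Finset ι → ℤ) (v : V)
    (I₀ : Finset ι) (hI₀ : I₀.Nonempty) (hz : ∀ J, J ⊂ I₀ → z J = z' J) :
    ∀ L : List (Finset ι), L.Nodup → (∀ J ∈ L, J.Nonempty) →
      (∀ S, S ⊂ I₀ → (L.map fun J => 1 + z J • plc J (T J)).prod (constSeries v) S
        = (L.map fun J => 1 + z' J • plc J (T J)).prod (constSeries v) S) ∧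
      (L.map fun J => 1 + z J • plc J (T J)).prod (constSeries v) ∅ = v ∧
      (L.map fun J => 1 + z J • plc J (T J)).prod (constSeries v) I₀
        - (L.map fun J => 1 + z' J • plc J (T J)).prod (constSeries v) I₀
        = if I₀ ∈ L then (z I₀ - z' I₀) • T I₀ v else 0 := by
  have hstep : ∀ (c : ℤ) (J S : Finset ι) (X : Module.End ℂ (Finset ι → V)),
      ((1 + c • plc J (T J)) * X) (constSeries v) S = X (constSeries v) S
        + c • (if J ⊆ S then T J (X (constSeries v) (S \ J)) else 0) := by
    intro c J S X
    rw [Module.End.mul_apply, LinearMap.add_apply, LinearMap.smul_apply]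
    rfl
  intro L
  induction L with
  | nil => intro _ _; simp [constSeries]
  | cons J L ih =>
    intro hL hne
    obtain ⟨hJL, hL⟩ := List.nodup_cons.1 hL
    obtain ⟨h1, h2, h3⟩ := ih hL fun I hI => hne I (List.mem_cons_of_mem _ hI)
    have hJ := hne J List.mem_cons_self
    simp only [List.map_cons, List.prod_cons, hstep]
    have hsd : J ⊆ I₀ → I₀ \ J ⊂ I₀ := fun h => Finset.sdiff_ssubset h hJ
    refine ⟨fun S hS => ?_, ?_, ?_⟩
    · rw [h1 S hS]
      split_ifs with hJS
      · rw [hz J (hJS.trans_ssubset hS), h1 _ (Finset.sdiff_subset.trans_ssubset hS)]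
      · simp
    · rw [h2, if_neg fun h => hJ.ne_empty (Finset.subset_empty.1 h), smul_zero, add_zero]
    · rw [add_sub_add_comm, h3]
      by_cases hJI : J = I₀
      · subst hJI
        have e2 : (L.map fun J => 1 + z' J • plc J (T J)).prod (constSeries v) ∅ = v := by
          rw [← h1 ∅ (Finset.empty_ssubset.2 hJ), h2]
        simp only [subset_rfl, if_true, Finset.sdiff_self, h2, e2, List.mem_cons_self, if_neg hJL]
        rw [← sub_smul, zero_add]
      · have hm : (I₀ ∈ J :: L) ↔ I₀ ∈ L := by
          simp [Ne.symm hJI]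
        simp only [hm]
        rw [add_eq_left]
        split_ifs with hJS
        · rw [hz J (Finset.ssubset_iff_subset_ne.2 ⟨hJS, hJI⟩), h1 _ (hsd hJS), sub_self]
        · simp

variable [Fintype ι]

theorem WallRelations.exists_lists (w : ι → Lat) : ∃ L L' : List (Finset ι),
    (L.Nodup ∧ ∀ I, I ∈ L ↔ I ∈ wallSets w) ∧ (L'.Nodup ∧ ∀ I, I ∈ L' ↔ I ∈ wallSets w) ∧
    ∀ (E : Finset ι → Module.End ℂ V), WallRelations w E → ∀ μ, Generic w μ →
      (L.map fun I => 1 + topCoef w μ I • E I).prod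
        = (L'.map fun I => 1 + botCoef w μ I • E I).prod := by
  set vs := ((wallSets w).image fun I => slope (wsum w I)).sort (· ≤ ·) with hvs
  have hpw : vs.Pairwise (· < ·) := (Finset.sortedLT_sort _).pairwise
  have hmem : ∀ I ∈ wallSets w, slope (wsum w I) ∈ vs := fun I hI =>
    (Finset.mem_sort _).2 (Finset.mem_image_of_mem _ hI)
  set F : ℝ → List (Finset ι) := fun v =>
    sortBy ((wallSets w).filter fun I => slope (wsum w I) = v) fun _ => 0
  have hnd : ∀ us : List ℝ, us.Nodup → (us.flatMap F).Nodup := fun us hus => by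
    rw [List.nodup_flatMap]
    refine ⟨fun v _ => nodup_sortBy _ _, hus.imp fun {v v'} h => ?_⟩
    intro a ha ha'
    rw [mem_sortBy, Finset.mem_filter] at ha ha'
    exact h (ha.2.symm.trans ha'.2)
  have hF : ∀ (I : Finset ι) (us : List ℝ), (∀ I ∈ wallSets w, slope (wsum w I) ∈ us) →
      (I ∈ us.flatMap F ↔ I ∈ wallSets w) := by
    intro I us hus
    simp only [List.mem_flatMap, F, mem_sortBy, Finset.mem_filter]
    exact ⟨fun ⟨v, _, h, _⟩ => h, fun h => ⟨_, hus I h, h, rfl⟩⟩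
  refine ⟨vs.flatMap F, vs.reverse.flatMap F, ⟨hnd _ (hpw.imp fun h => h.ne), fun I => hF I _ hmem⟩,
    ⟨hnd _ (List.nodup_reverse.2 (hpw.imp fun h => h.ne)), fun I => hF I _ fun I hI =>
      List.mem_reverse.2 (hmem I hI)⟩, fun E hE μ hμ => ?_⟩
  have hprod : ∀ (us : List ℝ) (z : Finset ι → ℤ),
      ((us.flatMap F).map fun I => 1 + z I • E I).prod = (us.map (slopeExp w E z)).prod := by
    intro us z
    rw [List.map_flatMap, List.flatMap, List.prod_flatten, List.map_map]
    congr 1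
    refine List.map_congr_left fun v _ => ?_
    exact hE.oprod_slope z v fun _ => 0
  rw [hprod, hprod, hE.top_eq_bot hμ hpw hmem]

theorem countInf_eq_of_generic {w : ι → Lat} {μ μ' : ι → ℝ} (hμ : Generic w μ) (hμ' : Generic w μ')
    (I : Finset ι) (hI : wsum w I ≠ 0) : countInf w μ I = countInf w μ' I := by
  obtain ⟨L, L', ⟨hL, hLm⟩, ⟨hL', hLm'⟩, hprod⟩ :=
    WallRelations.exists_lists (V := Finset ι → AddMonoidAlgebra ℂ Lat) w
  have hE := wallRelations_elem w (fun _ => (0 : ℂ)) (fun _ _ => rfl)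
  have h1 := hprod _ hE μ hμ
  have h2 := hprod _ hE μ' hμ'
  induction I using Finset.strongInduction with
  | H I ih =>
    have hIn := nonempty_of_wsum_ne hI
    have hc : ∀ J, J ⊂ I → wsum w J ≠ 0 → countInf w μ J = countInf w μ' J := fun J hJ h0 => ih J hJ h0
    obtain ⟨q, hq⟩ := elem_ne_zero (K := ℂ) hI
    have key := fun (z : (ι → ℝ) → Finset ι → ℤ) => prod_plc_difference (ι := ι)
      (fun I => elem (wsum w I) (bsum (fun _ => (0 : ℂ)) I))
      (fun J => if wsum w J = 0 then 0 else z μ J) (fun J => if wsum w J = 0 then 0 else z μ' J)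
      (AddMonoidAlgebra.single q 1) I hIn
    have hne : ∀ l : List (Finset ι), (∀ I, I ∈ l ↔ I ∈ wallSets w) → ∀ J ∈ l, J.Nonempty :=
      fun l hl J hJ => nonempty_of_wsum_ne (mem_wallSets.1 ((hl J).1 hJ))
    have hmap : ∀ (l : List (Finset ι)), (∀ I, I ∈ l ↔ I ∈ wallSets w) → ∀ z : Finset ι → ℤ,
        (l.map fun J => 1 + (if wsum w J = 0 then 0 else z J) •
          plc J (elem (wsum w J) (bsum (fun _ => (0 : ℂ)) J)))
        = l.map fun J => 1 + z J • plc J (elem (wsum w J) (bsum (fun _ => (0 : ℂ)) J)) := by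
      intro l hl z
      refine List.map_congr_left fun J hJ => ?_
      rw [if_neg (mem_wallSets.1 ((hl J).1 hJ))]
    have k1 := (key (topCoef w) (by
      intro J hJ
      split_ifs with h0
      · rfl
      · rw [topCoef, topCoef, hc J hJ h0]) L hL (hne L hLm)).2.2
    have k2 := (key (botCoef w) (by
      intro J hJ
      split_ifs with h0
      · rfl
      · rw [botCoef, botCoef, hc J hJ h0]) L' hL' (hne L' hLm')).2.2
    rw [hmap L hLm, hmap L hLm, if_pos ((hLm I).2 (mem_wallSets.2 hI))] at k1
    rw [hmap L' hLm', hmap L' hLm', if_pos ((hLm' I).2 (mem_wallSets.2 hI)), ← h1, ← h2, k1,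
      ← sub_eq_zero, ← sub_smul] at k2
    have hb0 : bsum (fun _ => (0 : ℂ)) I = 0 := by simp [bsum]
    rw [hb0] at k2
    have k3 := (smul_eq_zero.1 k2).resolve_right hq
    simp only [if_neg hI, topCoef, botCoef] at k3
    split_ifs at k3 <;> omega

end Invariance

/-! ### Rooted trees -/

section Rooted

variable {V : Type}

/-- The tree `G` with root `root` in which the neighbour of `v` towards the root is `par v`. -/
structure IsRooted (G : SimpleGraph V) (root : V) (par : V → V) (dep : V → ℕ) : Prop where
  adj_iff : ∀ u v, G.Adj u v ↔ (u ≠ root ∧ par u = v) ∨ (v ≠ root ∧ par v = u)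
  dep_lt : ∀ v, v ≠ root → dep (par v) < dep v

theorem rooted_induction [Finite V] {root : V} {par : V → V} {dep : V → ℕ}
    (hd : ∀ v, v ≠ root → dep (par v) < dep v) {P : V → Prop}
    (h : ∀ v, (∀ c, c ≠ root → par c = v → P c) → P v) : ∀ v, P v := by
  obtain ⟨D, hD⟩ := (Set.finite_range dep).bddAbove
  have hD' : ∀ v, dep v ≤ D := fun v => hD ⟨v, rfl⟩
  have : ∀ k v, D - dep v < k → P v := by
    intro k
    induction k with
    | zero => intro v hv; omega
    | succ k ih =>
      intro v hv
      refine h v fun c hc hcv => ih c ?_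
      have h1 := hd c hc
      have h2 := hD' c
      rw [hcv] at h1
      omega
  exact fun v => this _ v (Nat.lt_succ_self _)

theorem IsRooted.isTree [Finite V] {G : SimpleGraph V} {root : V} {par : V → V} {dep : V → ℕ}
    (h : IsRooted G root par dep) : G.IsTree := by
  have hreach : ∀ k v, dep v < k → G.Reachable v root := by
    intro k
    induction k with
    | zero => intro v hv; omega
    | succ k ih =>
      intro v hv
      by_cases hr : v = root
      · rw [hr]
      · have h1 := h.dep_lt v hr
        exact ((h.adj_iff v (par v)).2 (Or.inl ⟨hr, rfl⟩)).reachable.trans (ih (par v) (by omega))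
  have hconn : G.Connected :=
    { preconnected := fun u v => (hreach _ u (Nat.lt_succ_self _)).trans
        (hreach _ v (Nat.lt_succ_self _)).symm
      nonempty := ⟨root⟩ }
  rw [SimpleGraph.isTree_iff_connected_and_card]
  refine ⟨hconn, le_antisymm ?_ hconn.card_vert_le_card_edgeSet_add_one⟩
  let f : {v : V // v ≠ root} → G.edgeSet := fun v =>
    ⟨s(v.1, par v.1), (h.adj_iff _ _).2 (Or.inl ⟨v.2, rfl⟩)⟩
  have hf : Function.Surjective f := by
    rintro ⟨e, he⟩
    induction e using Sym2.ind with
    | h u v =>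
      rcases (h.adj_iff u v).1 he with ⟨h1, h2⟩ | ⟨h1, h2⟩
      · exact ⟨⟨u, h1⟩, Subtype.ext (by show s(u, par u) = s(u, v); rw [h2])⟩
      · exact ⟨⟨v, h1⟩, Subtype.ext (by show s(v, par v) = s(u, v); rw [h2, Sym2.eq_swap])⟩
  have h1 := Nat.card_le_card_of_surjective f hf
  have h2 : Nat.card {v : V // v ≠ root} + 1 = Nat.card V := by
    classical
    have := Fintype.ofFinite V
    rw [Nat.card_eq_fintype_card, Nat.card_eq_fintype_card, Fintype.card_subtype_compl,
      Fintype.card_subtype_eq]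
    have : 0 < Fintype.card V := Fintype.card_pos_iff.2 ⟨root⟩
    omega
  omega

theorem exists_isRooted {G : SimpleGraph V} (hG : G.IsTree) (root : V) :
    ∃ par : V → V, IsRooted G root par (G.dist root) := by
  have huniq : ∀ v u u', G.Adj v u → G.Adj v u' → G.dist root u < G.dist root v →
      G.dist root u' < G.dist root v → u = u' := by
    have hpath : ∀ v u, (hvu : G.Adj v u) → G.dist root u < G.dist root v →
        ∃ q : G.Walk u root, (SimpleGraph.Walk.cons hvu q).IsPath := by
      intro v u hvu hlt
      obtain ⟨q, hq, hlen⟩ := hG.connected.exists_path_of_dist u root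
      refine ⟨q, SimpleGraph.Walk.cons_isPath_iff hvu q |>.2 ⟨hq, fun hv => ?_⟩⟩
      classical
      have h1 := SimpleGraph.dist_le (q.dropUntil v hv)
      have h2 := q.length_dropUntil_le_length hv
      rw [SimpleGraph.dist_comm] at h1 hlen
      omega
    intro v u u' hu hu' h h'
    obtain ⟨q, hq⟩ := hpath v u hu h
    obtain ⟨q', hq'⟩ := hpath v u' hu' h'
    have := (hG.existsUnique_path v root).unique hq hq'
    injection this
  have hex : ∀ v, v ≠ root → ∃ u, G.Adj v u ∧ G.dist root u < G.dist root v := by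
    intro v hv
    obtain ⟨p, hp⟩ := hG.connected.exists_walk_length_eq_dist v root
    cases p with
    | nil => exact (hv rfl).elim
    | cons h q =>
      refine ⟨_, h, ?_⟩
      have h1 := SimpleGraph.dist_le q
      rw [SimpleGraph.Walk.length_cons] at hp
      rw [SimpleGraph.dist_comm] at h1 hp
      omega
  classical
  refine ⟨fun v => if hv : v = root then v else (hex v hv).choose, ⟨fun u v => ?_, fun v hv => ?_⟩⟩
  · constructor
    · intro huv
      have hroot : ∀ a b, G.dist root b < G.dist root a → a ≠ root := by
        rintro a b hab rfl
        simp at hab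
      rcases hG.dist_eq_dist_add_one_of_adj root huv with h | h
      · have hu := hroot u v (by omega)
        refine Or.inl ⟨hu, ?_⟩
        rw [dif_neg hu]
        exact huniq u _ v (hex u hu).choose_spec.1 huv (hex u hu).choose_spec.2 (by omega)
      · have hv := hroot v u (by omega)
        refine Or.inr ⟨hv, ?_⟩
        rw [dif_neg hv]
        exact huniq v _ u (hex v hv).choose_spec.1 huv.symm (hex v hv).choose_spec.2 (by omega)
    · rintro (⟨h1, h2⟩ | ⟨h1, h2⟩)
      · rw [dif_neg h1] at h2
        exact h2 ▸ (hex u h1).choose_spec.1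
      · rw [dif_neg h1] at h2
        exact h2 ▸ (hex v h1).choose_spec.1.symm
  · simp only [dif_neg hv]
    exact (hex v hv).choose_spec.2

end Rooted

/-! ### Tropical curves as rooted trees -/

section RootedCurve

variable {ι : Type} [Fintype ι]

open Classical in
/-- A rational tropical curve of type `(w, ξ)`, rooted at the vertex of its outgoing edge. -/
structure RootedCurve (w : ι → Lat) (ξ : ι → ℝ × ℝ) (N : ℕ) where
  root : Fin N
  par : Fin N → Fin N
  dep : Fin N → ℕ
  att : ι → Fin N
  h : Fin N → ℝ × ℝ
  up : Fin N → Lat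
  dep_lt : ∀ v, v ≠ root → dep (par v) < dep v
  up_root : up root = ∑ r, w r
  up_ne_zero : ∀ v, v ≠ root → up v ≠ 0
  edge : ∀ v, v ≠ root → ∃ s : ℝ, 0 < s ∧ h (par v) - h v = s • toPlane (up v)
  balance : ∀ v, up v = ∑ c, (if c ≠ root ∧ par c = v then up c else 0)
    + ∑ r, if att r = v then w r else 0
  two_le : ∀ v, 2 ≤ ∑ c, (if c ≠ root ∧ par c = v then 1 else 0) + ∑ r, if att r = v then 1 else 0
  line : ∀ r, ∃ s : ℝ, h (att r) = ξ r + s • toPlane (w r)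

namespace RootedCurve

variable {w : ι → Lat} {ξ : ι → ℝ × ℝ} {N N' : ℕ}

theorem not_both (R : RootedCurve w ξ N) {u v : Fin N} (h1 : u ≠ R.root) (h2 : R.par u = v)
    (h3 : v ≠ R.root) (h4 : R.par v = u) : False := by
  have e1 := R.dep_lt u h1
  have e2 := R.dep_lt v h3
  rw [h2] at e1
  rw [h4] at e2
  omega

/-- The underlying graph. -/
def graph (R : RootedCurve w ξ N) : SimpleGraph (Fin N) where
  Adj u v := (u ≠ R.root ∧ R.par u = v) ∨ (v ≠ R.root ∧ R.par v = u)
  symm := ⟨fun _ _ h => h.symm⟩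
  loopless := ⟨fun v h => by
    have : v ≠ R.root ∧ R.par v = v := by tauto
    exact R.not_both this.1 this.2 this.1 this.2⟩

open Classical in
/-- The weighted direction of the edge from `u` to `v`. -/
def vec (R : RootedCurve w ξ N) (u v : Fin N) : Lat :=
  (if u ≠ R.root ∧ R.par u = v then R.up u else 0) - if v ≠ R.root ∧ R.par v = u then R.up v else 0

theorem vec_par (R : RootedCurve w ξ N) {v : Fin N} (hv : v ≠ R.root) :
    R.vec v (R.par v) = R.up v := by
  rw [vec, if_pos ⟨hv, rfl⟩, if_neg, sub_zero]
  exact fun h => R.not_both hv rfl h.1 h.2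

theorem vec_neg (R : RootedCurve w ξ N) (u v : Fin N) : R.vec v u = -R.vec u v := by
  rw [vec, vec, neg_sub]

open Classical in
theorem sum_vec (R : RootedCurve w ξ N) (v : Fin N) : ∑ u, R.vec v u
    = (if v ≠ R.root then R.up v else 0) - ∑ c, if c ≠ R.root ∧ R.par c = v then R.up c else 0 := by
  simp only [vec, Finset.sum_sub_distrib]
  congr 1
  by_cases hv : v = R.root
  · simp [hv]
  · simp [hv]

open Classical in
theorem card_adj (R : RootedCurve w ξ N) (v : Fin N) : Fintype.card {u : Fin N // R.graph.Adj v u}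
    = (if v ≠ R.root then 1 else 0) + ∑ c, if c ≠ R.root ∧ R.par c = v then 1 else 0 := by
  rw [Fintype.card_subtype, Finset.card_filter]
  have : ∀ u, (if R.graph.Adj v u then 1 else 0) = (if v ≠ R.root ∧ R.par v = u then 1 else 0)
      + if u ≠ R.root ∧ R.par u = v then 1 else 0 := by
    intro u
    by_cases h1 : v ≠ R.root ∧ R.par v = u
    · rw [if_pos h1, if_pos (show R.graph.Adj v u from Or.inl h1), if_neg]
      exact fun h2 => R.not_both h1.1 h1.2 h2.1 h2.2
    · rw [if_neg h1, zero_add]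
      refine if_congr ?_ rfl rfl
      exact ⟨fun h => h.resolve_left h1, Or.inr⟩
  simp only [this, Finset.sum_add_distrib]
  congr 1
  by_cases hv : v = R.root
  · simp [hv]
  · simp [hv]

/-- The tropical curve of a rooted curve. -/
def toCurve (R : RootedCurve w ξ N) (hw : ∀ r, w r ≠ 0) (hout : ∑ r, w r ≠ 0) :
    TropicalCurve w ξ where
  N := N
  G := R.graph
  isTree := IsRooted.isTree (dep := R.dep) ⟨fun _ _ => Iff.rfl, R.dep_lt⟩
  att := fun e => e.elim R.root R.att
  h := R.h
  vec := R.vec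
  weight_ne_zero := hw
  out_ne_zero := hout
  vec_adj := by
    have key : ∀ u, u ≠ R.root → R.vec u (R.par u) ≠ 0 ∧
        ∃ s : ℝ, 0 < s ∧ R.h (R.par u) - R.h u = s • toPlane (R.vec u (R.par u)) := by
      intro u hu
      rw [R.vec_par hu]
      exact ⟨R.up_ne_zero u hu, R.edge u hu⟩
    rintro u v (⟨h1, rfl⟩ | ⟨h1, rfl⟩)
    · exact key u h1
    · obtain ⟨e1, s, hs, e2⟩ := key v h1
      rw [R.vec_neg]
      refine ⟨neg_ne_zero.2 e1, s, hs, ?_⟩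
      rw [← neg_sub, e2]
      simp [toPlane]
  vec_symm := R.vec_neg
  vec_not_adj u v h := by
    rw [vec, if_neg fun h1 => h (Or.inl h1), if_neg fun h1 => h (Or.inr h1), sub_zero]
  valency v := by
    classical
    have h1 := R.two_le v
    have h2 := R.card_adj v
    have h3 : Fintype.card {e : Option ι // e.elim R.root R.att = v}
        = (if R.root = v then 1 else 0) + ∑ r, if R.att r = v then 1 else 0 := by
      rw [Fintype.card_subtype, Finset.card_filter, Fintype.sum_option]
      rfl
    have h4 : 1 ≤ (if v ≠ R.root then 1 else 0) + if R.root = v then 1 else 0 := by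
      by_cases h : v = R.root
      · simp [h]
      · simp [h]
    convert (show 3 ≤ Fintype.card {u : Fin N // R.graph.Adj v u}
      + Fintype.card {e : Option ι // e.elim R.root R.att = v} by rw [h2, h3]; omega) using 3
  balanced v := by
    classical
    have h1 := R.balance v
    have h0 : ∀ e : Option ι, (if e.elim R.root R.att = v then
        e.elim (∑ r, w r) (fun r => -w r) else 0) = e.elim (if R.root = v then ∑ r, w r else 0)
          (fun r => if R.att r = v then -w r else 0) := fun e => by cases e <;> rfl
    have h4 : ∑ e : Option ι, (if e.elim R.root R.att = v then
        e.elim (∑ r, w r) (fun r => -w r) else 0) = (if R.root = v then ∑ r, w r else 0)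
          + ∑ r, if R.att r = v then -w r else 0 := by
      rw [Finset.sum_congr rfl fun e _ => h0 e, Fintype.sum_option]
      rfl
    rw [R.sum_vec]
    refine (congrArg₂ (· + ·) rfl (Eq.trans ?_ h4)).trans ?_
    · exact Finset.sum_congr rfl fun e _ => if_congr Iff.rfl rfl rfl
    have h2 : ∑ r, (if R.att r = v then -w r else 0) = -∑ r, if R.att r = v then w r else 0 := by
      rw [← Finset.sum_neg_distrib]
      exact Finset.sum_congr rfl fun r _ => by split_ifs <;> simp
    have h3 : (if v ≠ R.root then R.up v else 0) + (if R.root = v then ∑ r, w r else 0) = R.up v := by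
      by_cases h : v = R.root
      · simp [h, R.up_root]
      · simp [h, Ne.symm h]
    rw [h2]
    calc _ = ((if v ≠ R.root then R.up v else 0) + (if R.root = v then ∑ r, w r else 0))
          - (∑ c, (if c ≠ R.root ∧ R.par c = v then R.up c else 0)
            + ∑ r, if R.att r = v then w r else 0) := by abel
      _ = 0 := by rw [h3, ← h1, sub_self]
  asymptotic := R.line

theorem toCurve_iso (R : RootedCurve w ξ N) (R' : RootedCurve w ξ N') (hw : ∀ r, w r ≠ 0)
    (hout : ∑ r, w r ≠ 0) (φ : Fin N ≃ Fin N') (hroot : φ R.root = R'.root)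
    (hpar : ∀ v, v ≠ R.root → φ (R.par v) = R'.par (φ v)) (hatt : ∀ r, R'.att r = φ (R.att r))
    (hh : ∀ v, R'.h (φ v) = R.h v) (hup : ∀ v, R'.up (φ v) = R.up v) :
    TropicalCurve.Iso (R.toCurve hw hout) (R'.toCurve hw hout) := by
  have key : ∀ u v, (φ u ≠ R'.root ∧ R'.par (φ u) = φ v) ↔ (u ≠ R.root ∧ R.par u = v) := by
    intro u v
    rw [← hroot, φ.injective.ne_iff]
    refine and_congr_right fun hu => ?_
    rw [← hpar u hu, φ.injective.eq_iff]
  have hvec : ∀ u v : Fin N, R'.vec (φ u) (φ v) = R.vec u v := fun u v => by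
    rw [vec, vec, hup, hup, if_congr (key u v) rfl rfl, if_congr (key v u) rfl rfl]
  refine ⟨φ, fun u v => ?_, fun e => ?_, hh, fun u v => ?_⟩
  · exact or_congr (key u v) (key v u)
  · cases e with
    | none => exact hroot.symm
    | some r => exact hatt r
  · exact hvec u v

end RootedCurve

open Classical in
theorem TropicalCurve.exists_rooted {w : ι → Lat} {ξ : ι → ℝ × ℝ} (C : TropicalCurve w ξ) :
    ∃ R : RootedCurve w ξ C.N, TropicalCurve.Iso C (R.toCurve C.weight_ne_zero C.out_ne_zero) := by
  obtain ⟨par, hpar⟩ := exists_isRooted C.isTree (C.att none)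
  set root := C.att none with hroot
  let up : Fin C.N → Lat := fun v => if v = root then ∑ r, w r else C.vec v (par v)
  have hup : ∀ v, v ≠ root → up v = C.vec v (par v) := fun v hv => if_neg hv
  have hadj : ∀ v, v ≠ root → C.G.Adj v (par v) := fun v hv => (hpar.adj_iff _ _).2 (Or.inl ⟨hv, rfl⟩)
  have hnb : ∀ u v, u ≠ root → par u = v → v ≠ root → par v = u → False := by
    intro u v h1 h2 h3 h4
    have e1 := hpar.dep_lt u h1
    have e2 := hpar.dep_lt v h3
    rw [h2] at e1
    rw [h4] at e2
    omega
  have hvec : ∀ u v, C.vec u v = (if u ≠ root ∧ par u = v then up u else 0)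
      - if v ≠ root ∧ par v = u then up v else 0 := by
    intro u v
    by_cases h1 : u ≠ root ∧ par u = v
    · rw [if_pos h1, if_neg fun h2 => hnb u v h1.1 h1.2 h2.1 h2.2, hup u h1.1, h1.2, sub_zero]
    · by_cases h2 : v ≠ root ∧ par v = u
      · rw [if_neg h1, if_pos h2, hup v h2.1, h2.2, zero_sub, C.vec_symm v u]
      · rw [if_neg h1, if_neg h2, sub_zero]
        exact C.vec_not_adj u v fun h => ((hpar.adj_iff u v).1 h).elim h1 h2
  have hsum : ∀ v, ∑ u, C.vec v u = (if v ≠ root then up v else 0)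
      - ∑ c, if c ≠ root ∧ par c = v then up c else 0 := by
    intro v
    simp only [hvec, Finset.sum_sub_distrib]
    congr 1
    by_cases hv : v = root
    · simp [hv]
    · simp [hv]
  have hbal : ∀ v, up v = ∑ c, (if c ≠ root ∧ par c = v then up c else 0)
      + ∑ r, if C.att (some r) = v then w r else 0 := by
    intro v
    have h1 := C.balanced v
    rw [hsum, Fintype.sum_option] at h1
    simp only [Option.elim] at h1
    have h2 : ∑ r, (if C.att (some r) = v then -w r else 0)
        = -∑ r, if C.att (some r) = v then w r else 0 := by
      rw [← Finset.sum_neg_distrib]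
      exact Finset.sum_congr rfl fun r _ => by split_ifs <;> simp
    have h3 : (if v ≠ root then up v else 0) + (if C.att none = v then ∑ r, w r else 0) = up v := by
      rw [← hroot]
      by_cases h : v = root
      · simp [h, up]
      · simp [h, Ne.symm h]
    rw [h2] at h1
    rw [← sub_eq_zero]
    refine Eq.trans ?_ h1
    nth_rewrite 1 [← h3]
    abel
  have hcard : ∀ v, 2 ≤ ∑ c, (if c ≠ root ∧ par c = v then 1 else 0)
      + ∑ r, if C.att (some r) = v then 1 else 0 := by
    intro v
    have h1 := C.valency v
    have h2 : Fintype.card {e : Option ι // C.att e = v}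
        = (if root = v then 1 else 0) + ∑ r, if C.att (some r) = v then 1 else 0 := by
      rw [Fintype.card_subtype, Finset.card_filter, Fintype.sum_option]
    have h3 : Fintype.card {u : Fin C.N // C.G.Adj v u} ≤ (if v ≠ root then 1 else 0)
        + ∑ c, if c ≠ root ∧ par c = v then 1 else 0 := by
      rw [Fintype.card_subtype, Finset.card_filter]
      have h4 : (if v ≠ root then 1 else 0) = ∑ u, if v ≠ root ∧ par v = u then 1 else 0 := by
        by_cases hv : v = root
        · simp [hv]
        · simp [hv]
      rw [h4, ← Finset.sum_add_distrib]
      refine Finset.sum_le_sum fun u _ => ?_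
      by_cases h : C.G.Adj v u
      · rw [if_pos h]
        rcases (hpar.adj_iff v u).1 h with h | h
        · rw [if_pos h]; omega
        · rw [if_pos h]; omega
      · rw [if_neg h]; omega
    have h5 : (if v ≠ root then 1 else 0) + (if root = v then 1 else 0) = 1 := by
      by_cases hv : v = root
      · simp [hv]
      · simp [hv, Ne.symm hv]
    have h1' : 3 ≤ Fintype.card {u : Fin C.N // C.G.Adj v u}
      + Fintype.card {e : Option ι // C.att e = v} := by convert h1 using 3
    omega
  let R : RootedCurve w ξ C.N :=
    { root := root
      par := par
      dep := C.G.dist root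
      att := fun r => C.att (some r)
      h := C.h
      up := up
      dep_lt := hpar.dep_lt
      up_root := if_pos rfl
      up_ne_zero := fun v hv => by
        rw [hup v hv]; exact (C.vec_adj _ _ (hadj v hv)).1
      edge := fun v hv => by
        rw [hup v hv]; exact (C.vec_adj _ _ (hadj v hv)).2
      balance := hbal
      two_le := hcard
      line := C.asymptotic }
  refine ⟨R, Equiv.refl _, fun u v => (hpar.adj_iff u v).symm, fun e => ?_, fun v => rfl, fun u v => ?_⟩
  · cases e <;> rfl
  · exact (hvec u v).symm

end RootedCurve

/-! ### Subtrees -/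

namespace BinTree

variable {ι : Type} [DecidableEq ι]

/-- The tree `x` is one of the two branches at the root of a tree. -/
def IsChild (x : BinTree ι) : BinTree ι → Prop
  | leaf _ => False
  | node a b => x = a ∨ x = b

/-- The number of inner vertices. -/
def size : BinTree ι → ℕ
  | leaf _ => 0
  | node a b => size a + size b + 1

open Classical in
/-- The subtrees which are not leaves. -/
def subs : BinTree ι → Finset (BinTree ι)
  | leaf _ => ∅
  | node a b => insert (node a b) (subs a ∪ subs b)

/-- The position of the inner vertex at the root. -/
def pt (w : ι → Lat) (μ : ι → ℝ) : BinTree ι → ℝ × ℝ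
  | leaf _ => 0
  | node a b => meetPt w μ a.leaves b.leaves

/-- The multiplicity of the inner vertex at the root. -/
def rootMult (w : ι → Lat) : BinTree ι → ℕ
  | leaf _ => 1
  | node a b => (wedge (wsum w a.leaves) (wsum w b.leaves)).natAbs

theorem IsChild.size_lt {x p : BinTree ι} (h : x.IsChild p) : x.size < p.size := by
  cases p with
  | leaf => exact h.elim
  | node a b => rcases h with rfl | rfl <;> simp only [size] <;> omega

theorem IsChild.leaves_subset {x p : BinTree ι} (h : x.IsChild p) : x.leaves ⊆ p.leaves := by
  cases p with
  | leaf => exact h.elim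
  | node a b =>
    rcases h with rfl | rfl
    · exact Finset.subset_union_left
    · exact Finset.subset_union_right

theorem self_mem_subs {T : BinTree ι} (h : T.IsNode) : T ∈ T.subs := by
  cases T with
  | leaf => exact h.elim
  | node a b => simp [subs]

theorem mem_subs_node {a b x : BinTree ι} :
    x ∈ (node a b).subs ↔ x = node a b ∨ x ∈ a.subs ∨ x ∈ b.subs := by simp [subs]

theorem isNode_of_mem_subs {T x : BinTree ι} (h : x ∈ T.subs) : x.IsNode := by
  induction T with
  | leaf => simp [subs] at h
  | node a b iha ihb =>
    rcases mem_subs_node.1 h with rfl | h | h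
    · trivial
    · exact iha h
    · exact ihb h

theorem size_le_of_mem_subs {T x : BinTree ι} (h : x ∈ T.subs) : x.size ≤ T.size := by
  induction T with
  | leaf => simp [subs] at h
  | node a b iha ihb =>
    rcases mem_subs_node.1 h with rfl | h | h
    · exact le_rfl
    · have := iha h; simp only [size]; omega
    · have := ihb h; simp only [size]; omega

theorem leaves_subset_of_mem_subs {T x : BinTree ι} (h : x ∈ T.subs) : x.leaves ⊆ T.leaves := by
  induction T with
  | leaf => simp [subs] at h
  | node a b iha ihb =>
    rcases mem_subs_node.1 h with rfl | h | h
    · exact subset_rfl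
    · exact (iha h).trans Finset.subset_union_left
    · exact (ihb h).trans Finset.subset_union_right

theorem mem_subs_of_isChild {T p x : BinTree ι} (hp : p ∈ T.subs) (h : x.IsChild p) (hx : x.IsNode) :
    x ∈ T.subs := by
  induction T with
  | leaf => simp [subs] at hp
  | node a b iha ihb =>
    rcases mem_subs_node.1 hp with rfl | hp | hp
    · refine mem_subs_node.2 (Or.inr ?_)
      rcases h with rfl | rfl
      · exact Or.inl (self_mem_subs hx)
      · exact Or.inr (self_mem_subs hx)
    · exact mem_subs_node.2 (Or.inr (Or.inl (iha hp)))
    · exact mem_subs_node.2 (Or.inr (Or.inr (ihb hp)))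

theorem exists_parent {T x : BinTree ι} (hx : x ∈ T.subs) (hne : x ≠ T) :
    ∃ p ∈ T.subs, x.IsChild p := by
  induction T with
  | leaf => simp [subs] at hx
  | node a b iha ihb =>
    rcases mem_subs_node.1 hx with rfl | h | h
    · exact (hne rfl).elim
    · by_cases hxa : x = a
      · exact ⟨node a b, self_mem_subs trivial, Or.inl hxa⟩
      · obtain ⟨p, hp, hc⟩ := iha h hxa
        exact ⟨p, mem_subs_node.2 (Or.inr (Or.inl hp)), hc⟩
    · by_cases hxb : x = b
      · exact ⟨node a b, self_mem_subs trivial, Or.inr hxb⟩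
      · obtain ⟨p, hp, hc⟩ := ihb h hxb
        exact ⟨p, mem_subs_node.2 (Or.inr (Or.inr hp)), hc⟩

theorem exists_parent_leaf {T : BinTree ι} (hT : T.IsNode) {r : ι} (hr : r ∈ T.leaves) :
    ∃ p ∈ T.subs, (leaf r).IsChild p := by
  have key : ∀ T : BinTree ι, r ∈ T.leaves → T = leaf r ∨ ∃ p ∈ T.subs, (leaf r).IsChild p := by
    intro T
    induction T with
    | leaf s => intro h; left; rw [Finset.mem_singleton.1 h]
    | node a b iha ihb =>
      intro h
      right
      rcases Finset.mem_union.1 h with h | h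
      · rcases iha h with rfl | ⟨p, hp, hc⟩
        · exact ⟨_, self_mem_subs trivial, Or.inl rfl⟩
        · exact ⟨p, mem_subs_node.2 (Or.inr (Or.inl hp)), hc⟩
      · rcases ihb h with rfl | ⟨p, hp, hc⟩
        · exact ⟨_, self_mem_subs trivial, Or.inr rfl⟩
        · exact ⟨p, mem_subs_node.2 (Or.inr (Or.inr hp)), hc⟩
  rcases key T hr with rfl | h
  · exact hT.elim
  · exact h

theorem Good.of_mem_subs {w : ι → Lat} {μ : ι → ℝ} {T x : BinTree ι} (hT : T.Good w μ)
    (hx : x ∈ T.subs) : x.Good w μ := by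
  induction T with
  | leaf => simp [subs] at hx
  | node a b iha ihb =>
    rcases mem_subs_node.1 hx with rfl | h | h
    · exact hT
    · exact iha hT.1 h
    · exact ihb hT.2.1 h

theorem disjoint_ne {a b x y : BinTree ι} (h : Disjoint a.leaves b.leaves) (hx : x.leaves ⊆ a.leaves)
    (hy : y.leaves ⊆ b.leaves) : x ≠ y := by
  rintro rfl
  obtain ⟨r, hr⟩ := x.leaves_nonempty
  exact Finset.disjoint_left.1 h (hx hr) (hy hr)

theorem Good.parent_unique {w : ι → Lat} {μ : ι → ℝ} {T x p q : BinTree ι} (hT : T.Good w μ)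
    (hp : p ∈ T.subs) (hq : q ∈ T.subs) (hxp : x.IsChild p) (hxq : x.IsChild q) : p = q := by
  induction T with
  | leaf => simp [subs] at hp
  | node a b iha ihb =>
    obtain ⟨ha, hb, hd, -⟩ := hT
    have key : ∀ y, y ∈ a.subs ∨ y ∈ b.subs → x.IsChild y → ¬ x.IsChild (node a b) := by
      clear hp hq hxp hxq
      rintro y (hy | hy) hxy (rfl | rfl)
      · exact absurd (hxy.size_lt.trans_le (size_le_of_mem_subs hy)) (lt_irrefl _)
      · exact disjoint_ne hd (hxy.leaves_subset.trans (leaves_subset_of_mem_subs hy)) subset_rfl rfl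
      · exact disjoint_ne hd subset_rfl (hxy.leaves_subset.trans (leaves_subset_of_mem_subs hy)) rfl
      · exact absurd (hxy.size_lt.trans_le (size_le_of_mem_subs hy)) (lt_irrefl _)
    rcases mem_subs_node.1 hp with rfl | hp | hp <;> rcases mem_subs_node.1 hq with rfl | hq | hq
    · rfl
    · exact (key q (Or.inl hq) hxq hxp).elim
    · exact (key q (Or.inr hq) hxq hxp).elim
    · exact (key p (Or.inl hp) hxp hxq).elim
    · exact iha ha hp hq
    · exact (disjoint_ne hd (hxp.leaves_subset.trans (leaves_subset_of_mem_subs hp))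
        (hxq.leaves_subset.trans (leaves_subset_of_mem_subs hq)) rfl).elim
    · exact (key p (Or.inr hp) hxp hxq).elim
    · exact (disjoint_ne hd (hxq.leaves_subset.trans (leaves_subset_of_mem_subs hq))
        (hxp.leaves_subset.trans (leaves_subset_of_mem_subs hp)) rfl).elim
    · exact ihb hb hp hq

open Classical in
theorem Good.mult_eq_prod {w : ι → Lat} {μ : ι → ℝ} {T : BinTree ι} (hT : T.Good w μ) :
    T.mult w = ∏ x ∈ T.subs, x.rootMult w := by
  induction T with
  | leaf => rfl
  | node a b iha ihb =>
    obtain ⟨ha, hb, hd, -⟩ := hT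
    have h1 : Disjoint a.subs b.subs := Finset.disjoint_left.2 fun x hx hx' =>
      disjoint_ne hd (leaves_subset_of_mem_subs hx) (leaves_subset_of_mem_subs hx') rfl
    have h2 : node a b ∉ a.subs ∪ b.subs := by
      intro h
      rcases Finset.mem_union.1 h with h | h
      all_goals
        have := size_le_of_mem_subs h
        simp only [size] at this
        omega
    rw [mult, subs, Finset.prod_insert h2, Finset.prod_union h1, iha ha, ihb hb]
    rfl

theorem Good.onLine_pt {w : ι → Lat} {μ : ι → ℝ} {T x : BinTree ι} (hT : T.Good w μ)
    (hx : x.IsChild T) : OnLine w μ x.leaves (T.pt w μ) := by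
  cases T with
  | leaf => exact hx.elim
  | node a b =>
    rcases hx with rfl | rfl
    · exact onLine_meetPt_left hT.2.2.2.1.ne'
    · exact onLine_meetPt_right hT.2.2.2.1.ne'

theorem Good.emits_pt {w : ι → Lat} {μ : ι → ℝ} {T x : BinTree ι} (hT : T.Good w μ)
    (hx : x.IsChild T) : x.Emits w μ (T.pt w μ) := by
  cases T with
  | leaf => exact hx.elim
  | node a b =>
    rcases hx with rfl | rfl
    · exact hT.2.2.2.2.1
    · exact hT.2.2.2.2.2

theorem Good.wsum_ne_zero {w : ι → Lat} {μ : ι → ℝ} {T x : BinTree ι} (hT : T.Good w μ)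
    (hx : x.IsChild T) : wsum w x.leaves ≠ 0 := by
  cases T with
  | leaf => exact hx.elim
  | node a b =>
    rcases hx with rfl | rfl
    · exact left_ne_zero_of_wedge hT.2.2.2.1.ne'
    · exact right_ne_zero_of_wedge hT.2.2.2.1.ne'

end BinTree

theorem exists_smul_of_rwedge_eq_zero {p : Lat} (hp : p ≠ 0) {x : ℝ × ℝ} (h : rwedge p x = 0) :
    ∃ s : ℝ, x = s • toPlane p := by
  simp only [rwedge] at h
  by_cases h1 : p.1 = 0
  · have h2 : (p.2 : ℝ) ≠ 0 := by
      intro h2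
      exact hp (Prod.ext h1 (by exact_mod_cast h2))
    refine ⟨x.2 / p.2, Prod.ext ?_ ?_⟩
    · rw [h1] at h
      have : x.1 = 0 := by simpa [h2] using h
      simp [toPlane, h1, this]
    · simp only [toPlane, Prod.smul_snd, smul_eq_mul]
      field_simp
  · have h2 : (p.1 : ℝ) ≠ 0 := by exact_mod_cast h1
    refine ⟨x.1 / p.1, Prod.ext ?_ ?_⟩
    · simp only [toPlane, Prod.smul_fst, smul_eq_mul]
      field_simp
    · simp only [toPlane, Prod.smul_snd, smul_eq_mul]
      field_simp
      linarith

theorem BinTree.Good.exists_pos_smul {ι : Type} [DecidableEq ι] {w : ι → Lat} {μ : ι → ℝ}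
    {T : BinTree ι} (hT : T.Good w μ) (hn : T.IsNode) (hw : wsum w T.leaves ≠ 0) {x : ℝ × ℝ}
    (hx : OnLine w μ T.leaves x) (he : T.Emits w μ x) :
    ∃ s : ℝ, 0 < s ∧ x - T.pt w μ = s • toPlane (wsum w T.leaves) := by
  cases T with
  | leaf => exact hn.elim
  | node a b =>
    have h1 := hT.onLine_pt (Or.inl rfl : a.IsChild (node a b))
    have h2 := hT.onLine_pt (Or.inr rfl : b.IsChild (node a b))
    have h3 := h1.union hT.2.2.1 h2
    obtain ⟨s, hs⟩ := exists_smul_of_rwedge_eq_zero hw (x := x - (node a b).pt w μ) (by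
      rw [rwedge_sub_right, show rwedge _ x = _ from hx]
      exact sub_eq_zero.2 h3.symm)
    refine ⟨s, ?_, hs⟩
    have h4 : rwedge (wsum w a.leaves) (x - (node a b).pt w μ)
        = s * wedge (wsum w a.leaves) (wsum w b.leaves) := by
      rw [hs, rwedge_smul_right, rwedge_toPlane, BinTree.leaves, wsum_union w hT.2.2.1,
        wedge_add_right, wedge_self, zero_add]
    rw [rwedge_sub_right, show rwedge _ ((node a b).pt w μ) = _ from h1] at h4
    have h5 : msum μ a.leaves < rwedge (wsum w a.leaves) x := he
    have h6 : (0 : ℝ) < wedge (wsum w a.leaves) (wsum w b.leaves) := by exact_mod_cast hT.2.2.2.1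
    by_contra hneg
    push Not at hneg
    nlinarith

/-! ### Encoding of rooted curves by trees -/

section Encode

variable {ι : Type} [Fintype ι] [DecidableEq ι] {w : ι → Lat} {ξ : ι → ℝ × ℝ} {N N' : ℕ}

/-- The moments of the lines `ξ_r + ℝ w_r`. -/
def moments (w : ι → Lat) (ξ : ι → ℝ × ℝ) : ι → ℝ := fun r => rwedge (w r) (ξ r)

open BinTree in
/-- The vertices of the rooted curve `R` correspond to the inner vertices of the tree `T`. -/
structure Encodes (R : RootedCurve w ξ N) (T : BinTree ι) (τ : Fin N → BinTree ι) : Prop where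
  root : τ R.root = T
  inj : Function.Injective τ
  isNode : ∀ v, (τ v).IsNode
  par : ∀ c, c ≠ R.root → (τ c).IsChild (τ (R.par c))
  att : ∀ r, (leaf r).IsChild (τ (R.att r))
  child : ∀ v x, x.IsChild (τ v) →
    (∃ r, x = leaf r ∧ R.att r = v) ∨ ∃ c, c ≠ R.root ∧ x = τ c ∧ R.par c = v
  up : ∀ v, R.up v = wsum w (τ v).leaves
  pos : ∀ v, R.h v = (τ v).pt w (moments w ξ)

namespace Encodes

variable {R : RootedCurve w ξ N} {R' : RootedCurve w ξ N'} {T T' : BinTree ι}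
  {τ : Fin N → BinTree ι} {τ' : Fin N' → BinTree ι}

open BinTree

theorem mem_subs (h : Encodes R T τ) (v : Fin N) : τ v ∈ T.subs := by
  have : ∀ k v, R.dep v < k → τ v ∈ T.subs := by
    intro k
    induction k with
    | zero => intro v hv; omega
    | succ k ih =>
      intro v hv
      by_cases hr : v = R.root
      · rw [hr, h.root]
        exact self_mem_subs (h.root ▸ h.isNode _)
      · have := R.dep_lt v hr
        exact mem_subs_of_isChild (ih (R.par v) (by omega)) (h.par v hr) (h.isNode v)
  exact this _ v (Nat.lt_succ_self _)

theorem exists_of_mem (h : Encodes R T τ) {x : BinTree ι} (hx : x ∈ T.subs) : ∃ v, τ v = x := by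
  have : ∀ y : BinTree ι, (∃ v, τ v = y) → ∀ x ∈ y.subs, ∃ v, τ v = x := by
    intro y
    induction y with
    | leaf => intro _ x hx; simp [subs] at hx
    | node a b iha ihb =>
      rintro ⟨v, hv⟩ x hx
      have hc : ∀ z : BinTree ι, z.IsChild (node a b) → ∀ x ∈ z.subs, ∃ v, τ v = z := by
        intro z hz x hx
        rw [← hv] at hz
        rcases h.child v z hz with ⟨r, rfl, -⟩ | ⟨c, -, rfl, -⟩
        · simp [subs] at hx
        · exact ⟨c, rfl⟩
      rcases mem_subs_node.1 hx with rfl | h1 | h1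
      · exact ⟨v, hv⟩
      · exact iha (hc a (Or.inl rfl) x h1) x h1
      · exact ihb (hc b (Or.inr rfl) x h1) x h1
  exact this T ⟨_, h.root⟩ x hx

theorem par_iff (h : Encodes R T τ) (hT : T.Good w (moments w ξ)) (c v : Fin N) :
    (c ≠ R.root ∧ R.par c = v) ↔ (τ c).IsChild (τ v) := by
  constructor
  · rintro ⟨h1, rfl⟩
    exact h.par c h1
  · intro hc
    have h1 : c ≠ R.root := by
      rintro rfl
      rw [h.root] at hc
      exact absurd (hc.size_lt.trans_le (size_le_of_mem_subs (h.mem_subs v))) (lt_irrefl _)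
    exact ⟨h1, h.inj (hT.parent_unique (h.mem_subs _) (h.mem_subs _) (h.par c h1) hc)⟩

theorem att_iff (h : Encodes R T τ) (hT : T.Good w (moments w ξ)) (r : ι) (v : Fin N) :
    R.att r = v ↔ (leaf r).IsChild (τ v) := by
  constructor
  · rintro rfl
    exact h.att r
  · intro hc
    exact h.inj (hT.parent_unique (h.mem_subs _) (h.mem_subs _) (h.att r) hc)

/-- Two rooted curves encoded by the same tree are isomorphic. -/
theorem iso (h : Encodes R T τ) (h' : Encodes R' T τ') (hT : T.Good w (moments w ξ))
    (hw : ∀ r, w r ≠ 0) (hout : ∑ r, w r ≠ 0) :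
    TropicalCurve.Iso (R.toCurve hw hout) (R'.toCurve hw hout) := by
  choose f hf using fun v => h'.exists_of_mem (h.mem_subs v)
  choose g hg using fun v => h.exists_of_mem (h'.mem_subs v)
  let φ : Fin N ≃ Fin N' := ⟨f, g, fun v => h.inj (by rw [hg, hf]), fun v => h'.inj (by rw [hf, hg])⟩
  have hφ : ∀ v, τ' (φ v) = τ v := hf
  have hroot : φ R.root = R'.root := h'.inj (by rw [hφ, h.root, h'.root])
  refine R.toCurve_iso R' hw hout φ hroot (fun v hv => ?_) (fun r => ?_) (fun v => ?_) (fun v => ?_)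
  · refine (((h'.par_iff hT (φ v) (φ (R.par v))).2 ?_).2).symm
    rw [hφ, hφ]
    exact h.par v hv
  · refine (h'.att_iff hT r _).2 ?_
    rw [hφ]
    exact h.att r
  · rw [h.pos, h'.pos, hφ]
  · rw [h.up, h'.up, hφ]

/-- Isomorphic rooted curves are encoded by the same tree. -/
theorem tree_unique (h : Encodes R T τ) (h' : Encodes R' T' τ') (hT : T.Good w (moments w ξ))
    (hT' : T'.Good w (moments w ξ)) {hw : ∀ r, w r ≠ 0} {hout : ∑ r, w r ≠ 0}
    (hiso : TropicalCurve.Iso (R.toCurve hw hout) (R'.toCurve hw hout)) : T = T' := by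
  obtain ⟨φ, hadj, hatt, -, -⟩ := hiso
  change Fin N ≃ Fin N' at φ
  have hroot : φ R.root = R'.root := (hatt none).symm
  have hatt' : ∀ r, R'.att r = φ (R.att r) := fun r => hatt (some r)
  have hpar : ∀ k v, R.dep v < k → v ≠ R.root → R'.par (φ v) = φ (R.par v) := by
    intro k
    induction k with
    | zero => intro v hv; omega
    | succ k ih =>
      intro v hv hr
      have h1 := R.dep_lt v hr
      rcases (hadj v (R.par v)).2 (Or.inl ⟨hr, rfl⟩) with h2 | h2
      · exact h2.2
      · have h3 : R.par v ≠ R.root := fun h3 => h2.1 ((congrArg φ h3).trans hroot)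
        have h4 := ih (R.par v) (by omega) h3
        have h5 : R.par (R.par v) = v := φ.injective (h4.symm.trans h2.2)
        have h6 := R.dep_lt _ h3
        rw [h5] at h6
        omega
  have key : ∀ v, τ' (φ v) = τ v := by
    refine rooted_induction R.dep_lt fun v ih => ?_
    have h1 : ∀ x : BinTree ι, x.IsChild (τ v) → x.IsChild (τ' (φ v)) := by
      intro x hx
      rcases h.child v x hx with ⟨r, rfl, hr⟩ | ⟨c, hc, rfl, hcv⟩
      · have := h'.att r
        rwa [hatt', hr] at this
      · have h2 : φ c ≠ R'.root := by
          rw [← hroot]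
          exact fun h3 => hc (φ.injective h3)
        have := h'.par (φ c) h2
        rwa [hpar _ c (Nat.lt_succ_self _) hc, hcv, ih c hc hcv] at this
    have h2 := h.isNode v
    have h3 := h'.isNode (φ v)
    have g1 := hT.of_mem_subs (h.mem_subs v)
    have g2 := hT'.of_mem_subs (h'.mem_subs (φ v))
    generalize τ v = x at *
    generalize τ' (φ v) = y at *
    cases x with
    | leaf => exact h2.elim
    | node a b =>
      cases y with
      | leaf => exact h3.elim
      | node a' b' =>
        have hne : a ≠ b := disjoint_ne g1.2.2.1 subset_rfl subset_rfl
        have hab := g1.2.2.2.1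
        have hab' := g2.2.2.2.1
        rcases h1 a (Or.inl rfl) with rfl | rfl <;> rcases h1 b (Or.inr rfl) with rfl | rfl
        · exact (hne rfl).elim
        · rfl
        · rw [wedge_comm] at hab'
          omega
        · exact (hne rfl).elim
  rw [← h.root, ← key, hroot, h'.root]

theorem edgeDir_eq (h : Encodes R T τ) (hT : T.Good w (moments w ξ)) {hw : ∀ r, w r ≠ 0}
    {hout : ∑ r, w r ≠ 0} (v : Fin N) (e : Fin N ⊕ Option ι) :
    (R.toCurve hw hout).edgeDir v e = 0 ∨ (R.toCurve hw hout).edgeDir v e = wsum w (τ v).leaves ∨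
      ∃ x : BinTree ι, x.IsChild (τ v) ∧ (R.toCurve hw hout).edgeDir v e = -wsum w x.leaves := by
  classical
  rcases e with u | e
  · change R.vec v u = 0 ∨ R.vec v u = _ ∨ ∃ x : BinTree ι, _ ∧ R.vec v u = _
    rw [RootedCurve.vec]
    by_cases h1 : v ≠ R.root ∧ R.par v = u
    · right; left
      rw [if_pos h1, if_neg fun h2 => R.not_both h1.1 h1.2 h2.1 h2.2, sub_zero, h.up]
    · by_cases h2 : u ≠ R.root ∧ R.par u = v
      · right; right
        refine ⟨τ u, (h.par_iff hT u v).1 h2, ?_⟩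
        rw [if_neg h1, if_pos h2, zero_sub, h.up]
      · left
        rw [if_neg h1, if_neg h2, sub_zero]
  · cases e with
    | none =>
      by_cases h1 : R.root = v
      · right; left
        refine (if_pos h1).trans ?_
        rw [← h1, ← h.up, R.up_root]
        rfl
      · exact Or.inl (if_neg h1)
    | some r =>
      by_cases h1 : R.att r = v
      · right; right
        refine ⟨leaf r, (h.att_iff hT r v).1 h1, (if_pos h1).trans ?_⟩
        simp [wsum, BinTree.leaves]
      · exact Or.inl (if_neg h1)

theorem exists_edge (h : Encodes R T τ) {hw : ∀ r, w r ≠ 0}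
    {hout : ∑ r, w r ≠ 0} {v : Fin N} {x : BinTree ι} (hx : x.IsChild (τ v)) :
    ∃ e, (R.toCurve hw hout).edgeDir v e = -wsum w x.leaves := by
  rcases h.child v x hx with ⟨r, rfl, hr⟩ | ⟨c, hc, rfl, hcv⟩
  · exact ⟨Sum.inr (some r), (if_pos hr).trans (by simp [wsum, BinTree.leaves])⟩
  · refine ⟨Sum.inl c, ?_⟩
    change R.vec v c = _
    rw [← hcv, R.vec_neg, R.vec_par hc, h.up]

theorem vertexMult_eq (h : Encodes R T τ) (hT : T.Good w (moments w ξ)) {hw : ∀ r, w r ≠ 0}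
    {hout : ∑ r, w r ≠ 0} (v : Fin N) :
    (R.toCurve hw hout).vertexMult v = (τ v).rootMult w := by
  have hdir := fun e => h.edgeDir_eq hT (hw := hw) (hout := hout) v e
  have hex := fun x hx => h.exists_edge (hw := hw) (hout := hout) (v := v) (x := x) hx
  have hg := hT.of_mem_subs (h.mem_subs v)
  have hn := h.isNode v
  generalize τ v = x at *
  cases x with
  | leaf => exact hn.elim
  | node a b =>
    have hl : wsum w (node a b).leaves = wsum w a.leaves + wsum w b.leaves :=
      wsum_union w hg.2.2.1
    rw [hl] at hdir
    generalize hp : wsum w a.leaves = p at *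
    generalize hq : wsum w b.leaves = q at *
    have hdir' : ∀ e, (R.toCurve hw hout).edgeDir v e = 0 ∨
        (R.toCurve hw hout).edgeDir v e = p + q ∨ (R.toCurve hw hout).edgeDir v e = -p ∨
        (R.toCurve hw hout).edgeDir v e = -q := by
      intro e
      rcases hdir e with h1 | h1 | ⟨x, rfl | rfl, h1⟩
      · exact Or.inl h1
      · exact Or.inr (Or.inl h1)
      · exact Or.inr (Or.inr (Or.inl (h1.trans (by rw [hp]))))
      · exact Or.inr (Or.inr (Or.inr (h1.trans (by rw [hq]))))
    have hr : (node a b).rootMult w = (wedge p q).natAbs := by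
      rw [rootMult, hp, hq]
    rw [hr]
    refine le_antisymm (Finset.sup_le fun e _ => ?_) ?_
    · rcases hdir' e.1 with h1 | h1 | h1 | h1 <;> rcases hdir' e.2 with h2 | h2 | h2 | h2 <;>
        rw [h1, h2] <;>
        simp only [wedge_zero_left, wedge_zero_right, wedge_add_left, wedge_add_right,
          wedge_neg_left, wedge_neg_right, wedge_self, wedge_comm p q] <;> omega
    · obtain ⟨e1, h1⟩ := hex a (Or.inl rfl)
      obtain ⟨e2, h2⟩ := hex b (Or.inr rfl)
      have h3 : (wedge p q).natAbs = (wedge ((R.toCurve hw hout).edgeDir v e1)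
          ((R.toCurve hw hout).edgeDir v e2)).natAbs := by
        rw [h1, h2, hp, hq, wedge_neg_left, wedge_neg_right, neg_neg]
      rw [h3]
      exact Finset.le_sup (f := fun e : (Fin N ⊕ Option ι) × (Fin N ⊕ Option ι) =>
        (wedge ((R.toCurve hw hout).edgeDir v e.1) ((R.toCurve hw hout).edgeDir v e.2)).natAbs)
        (Finset.mem_univ (e1, e2))

theorem mult_eq (h : Encodes R T τ) (hT : T.Good w (moments w ξ)) {hw : ∀ r, w r ≠ 0}
    {hout : ∑ r, w r ≠ 0} : (R.toCurve hw hout).mult = T.mult w := by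
  classical
  rw [hT.mult_eq_prod, TropicalCurve.mult]
  refine (Finset.prod_congr rfl fun v _ => h.vertexMult_eq hT v).trans ?_
  refine Finset.prod_bij (fun v _ => τ v) (fun v _ => h.mem_subs v) (fun u _ v _ e => h.inj e)
    (fun x hx => ?_) fun v _ => rfl
  obtain ⟨v, hv⟩ := h.exists_of_mem hx
  exact ⟨v, Finset.mem_univ _, hv⟩

end Encodes

end Encode

/-! ### The rooted curve of a tree -/

section Realize

variable {ι : Type} [Fintype ι] [DecidableEq ι] {w : ι → Lat} {ξ : ι → ℝ × ℝ} {N : ℕ}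

open BinTree

open Classical in
theorem sum_children {τ : Fin N → BinTree ι} (hinj : Function.Injective τ)
    (hn : ∀ v, (τ v).IsNode) {a b : BinTree ι} (hab : a ≠ b)
    (hch : ∀ x : BinTree ι, x.IsChild (node a b) → x.IsNode → ∃ c, τ c = x)
    {M : Type} [AddCommMonoid M] (g : BinTree ι → M) :
    ∑ c, (if (τ c).IsChild (node a b) then g (τ c) else 0)
      + ∑ r, (if (leaf r).IsChild (node a b) then g (leaf r) else 0) = g a + g b := by
  let F : Fin N ⊕ ι → BinTree ι := Sum.elim τ leaf
  have hF : Function.Injective F := by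
    rintro (c | r) (c' | r') h
    · exact congrArg Sum.inl (hinj h)
    · have := hn c
      rw [show τ c = leaf r' from h] at this
      exact this.elim
    · have := hn c'
      rw [← show leaf r = τ c' from h] at this
      exact this.elim
    · injection h with h
      rw [h]
  have hex : ∀ x : BinTree ι, x.IsChild (node a b) → x ∈ Finset.univ.image F := by
    intro x hx
    cases x with
    | leaf r => exact Finset.mem_image.2 ⟨Sum.inr r, Finset.mem_univ _, rfl⟩
    | node y z =>
      obtain ⟨c, hc⟩ := hch _ hx trivial
      exact Finset.mem_image.2 ⟨Sum.inl c, Finset.mem_univ _, hc⟩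
  have h1 := Fintype.sum_sum_type fun e => if (F e).IsChild (node a b) then g (F e) else 0
  refine h1.symm.trans ?_
  rw [← Finset.sum_image (f := fun x : BinTree ι => if x.IsChild (node a b) then g x else 0)
    (fun x _ y _ h => hF h), ← Finset.sum_filter]
  have h2 : (Finset.univ.image F).filter (fun x => x.IsChild (node a b)) = {a, b} := by
    ext x
    rw [Finset.mem_filter, Finset.mem_insert, Finset.mem_singleton]
    exact ⟨fun h => h.2, fun h => ⟨hex x h, h⟩⟩
  rw [h2, Finset.sum_pair hab]

/-- Every realized tree encodes a rooted curve. -/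
theorem exists_encodes {T : BinTree ι} (hT : T.Good w (moments w ξ)) (hn : T.IsNode)
    (hl : T.leaves = Finset.univ) (hw : ∀ r, w r ≠ 0) :
    ∃ (N : ℕ) (R : RootedCurve w ξ N) (τ : Fin N → BinTree ι), Encodes R T τ := by
  classical
  let e := T.subs.equivFin
  let τ : Fin T.subs.card → BinTree ι := fun v => (e.symm v).1
  have hinj : Function.Injective τ := fun u v h => e.symm.injective (Subtype.ext h)
  have hmem : ∀ v, τ v ∈ T.subs := fun v => (e.symm v).2
  have hsurj : ∀ x ∈ T.subs, ∃ v, τ v = x := fun x hx => ⟨e ⟨x, hx⟩, by simp [τ]⟩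
  have hnode : ∀ v, (τ v).IsNode := fun v => isNode_of_mem_subs (hmem v)
  obtain ⟨root, hroot⟩ := hsurj T (self_mem_subs hn)
  have hpar : ∀ v, ∃ p, v ≠ root → (τ v).IsChild (τ p) := by
    intro v
    by_cases hv : v = root
    · exact ⟨v, fun h => (h hv).elim⟩
    · obtain ⟨p, hp, hc⟩ := exists_parent (hmem v) fun h => hv (hinj (h.trans hroot.symm))
      obtain ⟨u, rfl⟩ := hsurj p hp
      exact ⟨u, fun _ => hc⟩
  choose par hpar using hpar
  have hatt : ∀ r, ∃ p, (leaf r).IsChild (τ p) := by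
    intro r
    obtain ⟨p, hp, hc⟩ := exists_parent_leaf hn (r := r) (by rw [hl]; exact Finset.mem_univ _)
    obtain ⟨u, rfl⟩ := hsurj p hp
    exact ⟨u, hc⟩
  choose att hatt using hatt
  have hne : ∀ c v, (τ c).IsChild (τ v) → c ≠ root := by
    rintro c v hc rfl
    rw [hroot] at hc
    exact absurd (hc.size_lt.trans_le (size_le_of_mem_subs (hmem v))) (lt_irrefl _)
  have hpar_iff : ∀ c v, (c ≠ root ∧ par c = v) ↔ (τ c).IsChild (τ v) := by
    intro c v
    constructor
    · rintro ⟨h1, rfl⟩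
      exact hpar c h1
    · intro hc
      exact ⟨hne c v hc, hinj (hT.parent_unique (hmem _) (hmem _) (hpar c (hne c v hc)) hc)⟩
  have hatt_iff : ∀ r v, att r = v ↔ (leaf r).IsChild (τ v) := by
    intro r v
    constructor
    · rintro rfl
      exact hatt r
    · intro hc
      exact hinj (hT.parent_unique (hmem _) (hmem _) (hatt r) hc)
  have hchild : ∀ v (x : BinTree ι), x.IsChild (τ v) → x.IsNode → ∃ c, τ c = x := fun v x hx hxn =>
    hsurj x (mem_subs_of_isChild (hmem v) hx hxn)
  have hsum : ∀ {M : Type} [AddCommMonoid M] (g : BinTree ι → M) (v : Fin T.subs.card) (a b : BinTree ι),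
      τ v = node a b → ∑ c, (if c ≠ root ∧ par c = v then g (τ c) else 0)
        + ∑ r, (if att r = v then g (leaf r) else 0) = g a + g b := by
    intro M _ g v a b hv
    have hgv := hT.of_mem_subs (hmem v)
    rw [hv] at hgv
    rw [← sum_children hinj hnode (disjoint_ne hgv.2.2.1 subset_rfl subset_rfl)
      (fun x hx => hchild v x (hv ▸ hx)) g, ← hv]
    congr 1
    · exact Finset.sum_congr rfl fun c _ => if_congr (hpar_iff c v) rfl rfl
    · exact Finset.sum_congr rfl fun r _ => if_congr (hatt_iff r v) rfl rfl
  have hcases : ∀ v, ∃ a b, τ v = node a b := by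
    intro v
    have := hnode v
    cases h : τ v with
    | leaf => rw [h] at this; exact this.elim
    | node a b => exact ⟨a, b, rfl⟩
  let R : RootedCurve w ξ T.subs.card :=
    { root := root
      par := par
      dep := fun v => T.size - (τ v).size
      att := att
      h := fun v => (τ v).pt w (moments w ξ)
      up := fun v => wsum w (τ v).leaves
      dep_lt := fun v hv => by
        have h1 := (hpar v hv).size_lt
        have h2 := size_le_of_mem_subs (hmem (par v))
        omega
      up_root := by rw [hroot, hl]; rfl
      up_ne_zero := fun v hv => (hT.of_mem_subs (hmem (par v))).wsum_ne_zero (hpar v hv)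
      edge := fun v hv => by
        have h1 := hT.of_mem_subs (hmem (par v))
        exact (hT.of_mem_subs (hmem v)).exists_pos_smul (hnode v) (h1.wsum_ne_zero (hpar v hv))
          (h1.onLine_pt (hpar v hv)) (h1.emits_pt (hpar v hv))
      balance := fun v => by
        obtain ⟨a, b, hv⟩ := hcases v
        have h1 := hT.of_mem_subs (hmem v)
        rw [hv] at h1
        have h2 := hsum (fun x => wsum w x.leaves) v a b hv
        rw [hv]
        refine (wsum_union w h1.2.2.1).trans (h2.symm.trans ?_)
        simp [BinTree.leaves, wsum]
      two_le := fun v => by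
        obtain ⟨a, b, hv⟩ := hcases v
        exact (hsum (fun _ => 1) v a b hv).ge
      line := fun r => by
        have h1 := (hT.of_mem_subs (hmem (att r))).onLine_pt (hatt r)
        obtain ⟨s, hs⟩ := exists_smul_of_rwedge_eq_zero (hw r)
          (x := (τ (att r)).pt w (moments w ξ) - ξ r) (by
            rw [rwedge_sub_right]
            have h2 : rwedge (wsum w {r}) _ = msum (moments w ξ) {r} := h1
            simp only [wsum, msum, Finset.sum_singleton] at h2
            rw [h2, moments, sub_self])
        exact ⟨s, by rw [← hs]; abel⟩ }
  refine ⟨_, R, τ, hroot, hinj, hnode, fun c hc => hpar c hc, hatt, fun v x hx => ?_, fun _ => rfl,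
    fun _ => rfl⟩
  cases x with
  | leaf r => exact Or.inl ⟨r, rfl, (hatt_iff r v).2 hx⟩
  | node a b =>
    obtain ⟨c, hc⟩ := hchild v _ hx trivial
    rw [← hc] at hx ⊢
    have := (hpar_iff c v).2 hx
    exact Or.inr ⟨c, this.1, rfl, this.2⟩

end Realize

/-! ### The tree of a rooted curve -/

section Tree

variable {ι : Type} [Fintype ι] [DecidableEq ι] {w : ι → Lat} {ξ : ι → ℝ × ℝ} {N : ℕ}

open BinTree

/-- The pairing with the point `x` as a homomorphism. -/
def rwedgeHom (x : ℝ × ℝ) : Lat →+ ℝ where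
  toFun p := rwedge p x
  map_zero' := by simp [rwedge]
  map_add' p q := rwedge_add_left p q x

namespace RootedCurve

variable (R : RootedCurve w ξ N)

/-- The vertex `v` is the next one on the way from `c` to the root. -/
def Step (c v : Fin N) : Prop := c ≠ R.root ∧ R.par c = v

theorem step_unique : Relator.RightUnique R.Step := fun _ _ _ h h' => h.2.symm.trans h'.2

theorem dep_le_of_reach {u v : Fin N} (h : Relation.ReflTransGen R.Step u v) : R.dep v ≤ R.dep u := by
  induction h with
  | refl => exact le_rfl
  | tail _ h ih =>
    have := R.dep_lt _ h.1
    rw [h.2] at this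
    omega

open Classical in
/-- The unbounded edges which lie behind the vertex `v`. -/
def below (v : Fin N) : Finset ι :=
  Finset.univ.filter fun r => Relation.ReflTransGen R.Step (R.att r) v

theorem mem_below {v : Fin N} {r : ι} :
    r ∈ R.below v ↔ Relation.ReflTransGen R.Step (R.att r) v := by simp [below]

theorem mem_below_iff {v : Fin N} {r : ι} :
    r ∈ R.below v ↔ R.att r = v ∨ ∃ c, R.Step c v ∧ r ∈ R.below c := by
  simp only [mem_below]
  constructor
  · intro h
    rcases Relation.ReflTransGen.cases_tail h with h | ⟨c, hc, hcv⟩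
    · exact Or.inl h.symm
    · exact Or.inr ⟨c, hcv, hc⟩
  · rintro (h | ⟨c, hcv, hc⟩)
    · rw [h]
    · exact hc.tail hcv

theorem not_mem_below_of_step {c v : Fin N} (h : R.Step c v) {r : ι} (hr : R.att r = v) :
    r ∉ R.below c := by
  intro h1
  have h2 := R.dep_le_of_reach (R.mem_below.1 h1)
  have h3 := R.dep_lt c h.1
  rw [h.2] at h3
  rw [hr] at h2
  omega

theorem disjoint_below {c c' v : Fin N} (h : R.Step c v) (h' : R.Step c' v) (hne : c ≠ c') :
    Disjoint (R.below c) (R.below c') := by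
  rw [Finset.disjoint_left]
  intro r hr hr'
  have key : ∀ a b, R.Step a v → R.Step b v → a ≠ b → ¬ Relation.ReflTransGen R.Step a b := by
    intro a b ha hb hab hreach
    rcases Relation.ReflTransGen.cases_head hreach with h1 | ⟨x, hx, hxb⟩
    · exact hab h1
    · have h1 := R.dep_le_of_reach hxb
      rw [R.step_unique hx ha] at h1
      have h2 := R.dep_lt b hb.1
      rw [hb.2] at h2
      omega
  rcases Relation.ReflTransGen.total_of_right_unique R.step_unique (R.mem_below.1 hr)
    (R.mem_below.1 hr') with h1 | h1
  · exact key c c' h h' hne h1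
  · exact key c' c h' h hne.symm h1

open Classical in
theorem sum_below {M : Type} [AddCommMonoid M] (g : ι → M) (v : Fin N) :
    ∑ r ∈ R.below v, g r = ∑ c, (if R.Step c v then ∑ r ∈ R.below c, g r else 0)
      + ∑ r, if R.att r = v then g r else 0 := by
  have h1 : ∀ v, ∑ r ∈ R.below v, g r = ∑ r, if r ∈ R.below v then g r else 0 := by
    intro v
    rw [← Finset.sum_filter, Finset.filter_mem_eq_inter, Finset.univ_inter]
  have h2 : ∑ c, (if R.Step c v then ∑ r ∈ R.below c, g r else 0)
      = ∑ r, ∑ c, if R.Step c v ∧ r ∈ R.below c then g r else 0 := by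
    rw [Finset.sum_comm]
    refine Finset.sum_congr rfl fun c _ => ?_
    by_cases hc : R.Step c v
    · simp only [hc, if_true, true_and, h1]
    · simp [hc]
  rw [h1, h2, ← Finset.sum_add_distrib]
  refine Finset.sum_congr rfl fun r _ => ?_
  by_cases hr : R.att r = v
  · rw [if_pos (R.mem_below_iff.2 (Or.inl hr)), if_pos hr, Finset.sum_eq_zero, zero_add]
    exact fun c _ => if_neg fun h => R.not_mem_below_of_step h.1 hr h.2
  · rw [if_neg hr, add_zero]
    by_cases hb : r ∈ R.below v
    · obtain ⟨c, hc, hrc⟩ := (R.mem_below_iff.1 hb).resolve_left hr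
      rw [if_pos hb, Finset.sum_eq_single c, if_pos ⟨hc, hrc⟩]
      · intro c' _ hne
        refine if_neg fun h => ?_
        exact Finset.disjoint_left.1 (R.disjoint_below h.1 hc hne) h.2 hrc
      · simp
    · rw [if_neg hb, Finset.sum_eq_zero]
      exact fun c _ => if_neg fun h => hb (R.mem_below_iff.2 (Or.inr ⟨c, h⟩))

theorem wsum_below (v : Fin N) : wsum w (R.below v) = R.up v := by
  classical
  revert v
  refine rooted_induction R.dep_lt fun v ih => ?_
  rw [wsum, R.sum_below, R.balance]
  congr 1
  · refine Finset.sum_congr rfl fun c _ => ?_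
    by_cases hc : R.Step c v
    · rw [if_pos hc, if_pos (show c ≠ R.root ∧ R.par c = v from hc)]
      exact ih c hc.1 hc.2
    · rw [if_neg hc, if_neg (show ¬ (c ≠ R.root ∧ R.par c = v) from hc)]

theorem rwedge_up_par {c v : Fin N} (h : R.Step c v) :
    rwedge (R.up c) (R.h v) = rwedge (R.up c) (R.h c) := by
  obtain ⟨s, -, hs⟩ := R.edge c h.1
  rw [h.2] at hs
  rw [← sub_eq_zero, ← rwedge_sub_right, hs, rwedge_smul_right, rwedge_toPlane, wedge_self]
  simp

theorem rwedge_att (r : ι) : rwedge (w r) (R.h (R.att r)) = moments w ξ r := by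
  obtain ⟨s, hs⟩ := R.line r
  rw [hs, ← sub_eq_zero, moments, ← rwedge_sub_right, add_sub_cancel_left, rwedge_smul_right,
    rwedge_toPlane, wedge_self]
  simp

theorem onLine_below (v : Fin N) : OnLine w (moments w ξ) (R.below v) (R.h v) := by
  classical
  revert v
  refine rooted_induction R.dep_lt fun v ih => ?_
  rw [OnLine, msum, R.sum_below, R.wsum_below, R.balance]
  change rwedgeHom (R.h v) _ = _
  rw [map_add, map_sum, map_sum]
  congr 1
  · refine Finset.sum_congr rfl fun c _ => ?_
    by_cases hc : R.Step c v
    · have h1 := ih c hc.1 hc.2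
      rw [OnLine, R.wsum_below] at h1
      rw [if_pos hc, if_pos (show c ≠ R.root ∧ R.par c = v from hc)]
      exact (R.rwedge_up_par hc).trans h1
    · rw [if_neg hc, if_neg (show ¬ (c ≠ R.root ∧ R.par c = v) from hc), map_zero]
  · refine Finset.sum_congr rfl fun r _ => ?_
    split_ifs with hr
    · rw [← hr]
      exact R.rwedge_att r
    · exact map_zero _

/-- The edges which end in `v`. -/
def IsItem (v : Fin N) : Fin N ⊕ ι → Prop
  | Sum.inl c => R.Step c v
  | Sum.inr r => R.att r = v

/-- The unbounded edges behind an edge. -/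
def itemLeaves : Fin N ⊕ ι → Finset ι := Sum.elim R.below fun r => {r}

variable {R}

theorem IsItem.onLine {v : Fin N} {x : Fin N ⊕ ι} (h : R.IsItem v x) :
    OnLine w (moments w ξ) (R.itemLeaves x) (R.h v) := by
  cases x with
  | inl c =>
    have h1 := R.onLine_below c
    rw [OnLine, R.wsum_below, ← R.rwedge_up_par h] at h1
    change OnLine w _ (R.below c) _
    rw [OnLine, R.wsum_below, h1]
  | inr r =>
    have h1 := R.rwedge_att r
    rw [show R.att r = v from h] at h1
    simpa [itemLeaves, OnLine, wsum, msum] using h1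

theorem IsItem.wsum_ne_zero (hw : ∀ r, w r ≠ 0) {v : Fin N} {x : Fin N ⊕ ι} (h : R.IsItem v x) :
    wsum w (R.itemLeaves x) ≠ 0 := by
  cases x with
  | inl c =>
    change wsum w (R.below c) ≠ 0
    rw [R.wsum_below]
    exact R.up_ne_zero c h.1
  | inr r => simpa [itemLeaves, wsum] using hw r

theorem IsItem.disjoint {v : Fin N} {x y : Fin N ⊕ ι} (hx : R.IsItem v x) (hy : R.IsItem v y)
    (hxy : x ≠ y) : Disjoint (R.itemLeaves x) (R.itemLeaves y) := by
  cases x with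
  | inl c =>
    cases y with
    | inl c' => exact R.disjoint_below hx hy fun h => hxy (congrArg _ h)
    | inr r => exact Finset.disjoint_singleton_right.2 (R.not_mem_below_of_step hx hy)
  | inr r =>
    cases y with
    | inl c => exact Finset.disjoint_singleton_left.2 (R.not_mem_below_of_step hy hx)
    | inr r' => exact Finset.disjoint_singleton.2 fun h => hxy (congrArg _ h)

theorem IsItem.wedge_ne_zero (hμ : Generic w (moments w ξ)) (hw : ∀ r, w r ≠ 0) {v : Fin N}
    {x y : Fin N ⊕ ι} (hx : R.IsItem v x) (hy : R.IsItem v y) (hxy : x ≠ y) :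
    wedge (wsum w (R.itemLeaves x)) (wsum w (R.itemLeaves y)) ≠ 0 := by
  refine hμ.parallel _ _ _ (hx.wsum_ne_zero hw) (hy.wsum_ne_zero hw) (fun h => ?_) hx.onLine hy.onLine
  have h1 := hx.disjoint hy hxy
  rw [← h, Finset.disjoint_self_iff_empty] at h1
  exact (nonempty_of_wsum_ne (hx.wsum_ne_zero hw)).ne_empty h1

theorem IsItem.not_three (hμ : Generic w (moments w ξ)) (hw : ∀ r, w r ≠ 0) {v : Fin N}
    {x y z : Fin N ⊕ ι} (hx : R.IsItem v x) (hy : R.IsItem v y) (hz : R.IsItem v z) (hxy : x ≠ y)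
    (hyz : y ≠ z) (hxz : x ≠ z) : False := by
  have key : ∀ I J K : Finset ι, I.Nonempty → Disjoint I J → Disjoint I K → I ≠ J ∪ K := by
    rintro I J K ⟨r, hr⟩ h1 h2 rfl
    rcases Finset.mem_union.1 hr with h | h
    · exact Finset.disjoint_left.1 h1 hr h
    · exact Finset.disjoint_left.1 h2 hr h
  have nx := nonempty_of_wsum_ne (hx.wsum_ne_zero hw)
  have ny := nonempty_of_wsum_ne (hy.wsum_ne_zero hw)
  have nz := nonempty_of_wsum_ne (hz.wsum_ne_zero hw)
  have dxy := hx.disjoint hy hxy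
  have dyz := hy.disjoint hz hyz
  have dxz := hx.disjoint hz hxz
  rcases hμ.concurrent _ _ _ _ (hx.wedge_ne_zero hμ hw hy hxy) (hy.wedge_ne_zero hμ hw hz hyz)
    (hx.wedge_ne_zero hμ hw hz hxz) hx.onLine hy.onLine hz.onLine with h | h | h
  · exact key _ _ _ nx dxy dxz h.1
  · exact key _ _ _ ny dxy.symm dyz h.1
  · exact key _ _ _ nz dxz.symm dyz.symm h.1

theorem exists_items (hμ : Generic w (moments w ξ)) (hw : ∀ r, w r ≠ 0) (v : Fin N) :
    ∃ x y, R.IsItem v x ∧ R.IsItem v y ∧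
      0 < wedge (wsum w (R.itemLeaves x)) (wsum w (R.itemLeaves y)) ∧
      ∀ z, R.IsItem v z → z = x ∨ z = y := by
  classical
  have h1 := R.two_le v
  have h2 : ∑ c, (if c ≠ R.root ∧ R.par c = v then 1 else 0) + ∑ r, (if R.att r = v then 1 else 0)
      = (Finset.univ.filter fun x => R.IsItem v x).card := by
    rw [Finset.card_filter, Fintype.sum_sum_type]
    congr 1
    · exact Finset.sum_congr rfl fun c _ => if_congr Iff.rfl rfl rfl
    · exact Finset.sum_congr rfl fun r _ => if_congr Iff.rfl rfl rfl
  have h3 : 1 < (Finset.univ.filter fun x => R.IsItem v x).card := by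
    rw [← h2]
    exact Nat.lt_of_succ_le (by convert h1)
  obtain ⟨x, hx, y, hy, hxy⟩ := Finset.one_lt_card.1 h3
  replace hx := (Finset.mem_filter.1 hx).2
  replace hy := (Finset.mem_filter.1 hy).2
  have h4 : ∀ z, R.IsItem v z → z = x ∨ z = y := by
    intro z hz
    by_contra h
    push Not at h
    exact hx.not_three hμ hw hy hz hxy (Ne.symm h.2) (Ne.symm h.1)
  rcases lt_or_gt_of_ne (hx.wedge_ne_zero hμ hw hy hxy) with h5 | h5
  · refine ⟨y, x, hy, hx, ?_, fun z hz => (h4 z hz).symm⟩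
    rw [wedge_comm]
    omega
  · exact ⟨x, y, hx, hy, h5, h4⟩

variable (R)

theorem exists_fixed_tree [Nonempty ι] (a b : Fin N → Fin N ⊕ ι) (ha : ∀ v, R.IsItem v (a v))
    (hb : ∀ v, R.IsItem v (b v)) : ∃ τ : Fin N → BinTree ι, ∀ v,
      τ v = node (Sum.elim τ leaf (a v)) (Sum.elim τ leaf (b v)) := by
  classical
  obtain ⟨r₀⟩ := ‹Nonempty ι›
  have hwf : WellFounded R.Step := by
    refine ⟨rooted_induction R.dep_lt fun v ih => ⟨v, fun c hc => ih c hc.1 hc.2⟩⟩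
  let F : (v : Fin N) → ((c : Fin N) → R.Step c v → BinTree ι) → BinTree ι := fun v rec =>
    node (Sum.elim (fun c => if h : R.Step c v then rec c h else leaf r₀) leaf (a v))
      (Sum.elim (fun c => if h : R.Step c v then rec c h else leaf r₀) leaf (b v))
  refine ⟨hwf.fix F, fun v => ?_⟩
  rw [hwf.fix_eq F v]
  have key : ∀ x, R.IsItem v x →
      Sum.elim (fun c => if _h : R.Step c v then hwf.fix F c else leaf r₀) leaf x
        = Sum.elim (hwf.fix F) leaf x := by
    rintro (c | r) h
    · exact dif_pos h
    · rfl
  change node _ _ = _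
  rw [key _ (ha v), key _ (hb v)]

theorem below_root : R.below R.root = Finset.univ := by
  have h : ∀ k v, R.dep v < k → Relation.ReflTransGen R.Step v R.root := by
    intro k
    induction k with
    | zero => intro v hv; omega
    | succ k ih =>
      intro v hv
      by_cases hr : v = R.root
      · rw [hr]
      · have := R.dep_lt v hr
        exact (ih (R.par v) (by omega)).head ⟨hr, rfl⟩
  ext r
  simp only [mem_below, Finset.mem_univ, iff_true]
  exact h _ _ (Nat.lt_succ_self _)

/-- For generic moments every rooted curve is encoded by a realized tree. -/
theorem exists_tree (hμ : Generic w (moments w ξ)) (hw : ∀ r, w r ≠ 0) (hout : ∑ r, w r ≠ 0) :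
    ∃ (T : BinTree ι) (τ : Fin N → BinTree ι), T.Good w (moments w ξ) ∧ T.IsNode ∧
      T.leaves = Finset.univ ∧ Encodes R T τ := by
  have hne : Nonempty ι := by
    by_contra h
    rw [not_nonempty_iff] at h
    exact hout (by simp)
  choose a b ha hb hab huniq using fun v => R.exists_items hμ hw v
  obtain ⟨τ, hτ⟩ := R.exists_fixed_tree a b ha hb
  let E : Fin N ⊕ ι → BinTree ι := Sum.elim τ leaf
  have hτ' : ∀ v, τ v = node (E (a v)) (E (b v)) := hτ
  have hnode : ∀ v, (τ v).IsNode := fun v => by rw [hτ']; trivial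
  have hdis : ∀ v, Disjoint (R.itemLeaves (a v)) (R.itemLeaves (b v)) := by
    intro v
    refine (ha v).disjoint (hb v) fun h => ?_
    have := hab v
    rw [h, wedge_self] at this
    omega
  have hbelow : ∀ v, R.below v = R.itemLeaves (a v) ∪ R.itemLeaves (b v) := by
    intro v
    have hmem : ∀ r, r ∈ R.below v ↔ ∃ x, R.IsItem v x ∧ r ∈ R.itemLeaves x := by
      intro r
      rw [mem_below_iff]
      constructor
      · rintro (h | ⟨c, hc, hr⟩)
        · exact ⟨Sum.inr r, h, Finset.mem_singleton_self r⟩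
        · exact ⟨Sum.inl c, hc, hr⟩
      · rintro ⟨c | r', h, hr⟩
        · exact Or.inr ⟨c, h, hr⟩
        · have hr' : r = r' := Finset.mem_singleton.1 hr
          exact Or.inl (hr' ▸ h)
    ext r
    rw [hmem, Finset.mem_union]
    constructor
    · rintro ⟨x, hx, hr⟩
      rcases huniq v x hx with rfl | rfl
      · exact Or.inl hr
      · exact Or.inr hr
    · rintro (h | h)
      · exact ⟨_, ha v, h⟩
      · exact ⟨_, hb v, h⟩
  have hEleaves : ∀ v, (∀ c, R.Step c v → (τ c).leaves = R.below c) → ∀ x, R.IsItem v x →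
      (E x).leaves = R.itemLeaves x := by
    rintro v ih (c | r) h
    · exact ih c h
    · rfl
  have hleaves : ∀ v, (τ v).leaves = R.below v := by
    refine rooted_induction R.dep_lt fun v ih => ?_
    rw [hτ', BinTree.leaves, hEleaves v (fun c hc => ih c hc.1 hc.2) _ (ha v),
      hEleaves v (fun c hc => ih c hc.1 hc.2) _ (hb v), hbelow]
  have hE : ∀ v x, R.IsItem v x → (E x).leaves = R.itemLeaves x := fun v =>
    hEleaves v fun c _ => hleaves c
  have hpt : ∀ v, R.h v = (τ v).pt w (moments w ξ) := by
    intro v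
    rw [hτ', pt, hE v _ (ha v), hE v _ (hb v)]
    exact eq_meetPt (hab v).ne' (ha v).onLine (hb v).onLine
  have hgood : ∀ v, (τ v).Good w (moments w ξ) := by
    refine rooted_induction R.dep_lt fun v ih => ?_
    have h1 : ∀ x, R.IsItem v x → (E x).Good w (moments w ξ) := by
      rintro (c | r) h
      · exact ih c h.1 h.2
      · trivial
    have h2 : ∀ x, R.IsItem v x → (E x).Emits w (moments w ξ) (R.h v) := by
      rintro (c | r) h
      · change (τ c).Emits _ _ _
        have hc := h1 _ h
        change (τ c).Good _ _ at hc
        obtain ⟨s, hs, e⟩ := R.edge c h.1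
        rw [h.2, hpt c, ← R.wsum_below, ← hleaves] at e
        rw [hτ'] at hc e ⊢
        change msum _ _ < rwedge _ _
        have h3 := hc.onLine_pt (Or.inl rfl)
        have h4 : rwedge (wsum w (E (a c)).leaves) (R.h v) = msum (moments w ξ) (E (a c)).leaves
            + s * wedge (wsum w (E (a c)).leaves) (wsum w (E (b c)).leaves) := by
          rw [← show rwedge _ _ = msum _ _ from h3, ← sub_eq_iff_eq_add', ← rwedge_sub_right, e,
            rwedge_smul_right, rwedge_toPlane, BinTree.leaves, wsum_union w hc.2.2.1,
            wedge_add_right, wedge_self, zero_add]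
        have h5 : (0 : ℝ) < wedge (wsum w (E (a c)).leaves) (wsum w (E (b c)).leaves) := by
          exact_mod_cast hc.2.2.2.1
        rw [h4]
        nlinarith [mul_pos hs h5]
      · trivial
    have h3 := hpt v
    rw [hτ'] at h3 ⊢
    have h4 := hE v _ (ha v)
    have h5 := hE v _ (hb v)
    refine ⟨h1 _ (ha v), h1 _ (hb v), ?_, ?_, ?_, ?_⟩
    · rw [h4, h5]; exact hdis v
    · rw [h4, h5]; exact hab v
    · have := h2 _ (ha v)
      rwa [h3] at this
    · have := h2 _ (hb v)
      rwa [h3] at this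
  have hchild : ∀ v x, R.IsItem v x → (E x).IsChild (τ v) := by
    intro v x hx
    rw [hτ']
    rcases huniq v x hx with rfl | rfl
    · exact Or.inl rfl
    · exact Or.inr rfl
  have hsize : ∀ u v, Relation.ReflTransGen R.Step u v → u = v ∨ (τ u).size < (τ v).size := by
    intro u v h
    induction h with
    | refl => exact Or.inl rfl
    | tail _ h ih =>
      have h1 := (hchild _ (Sum.inl _) h).size_lt
      rcases ih with rfl | ih
      · exact Or.inr h1
      · exact Or.inr (ih.trans h1)
  refine ⟨τ R.root, τ, hgood _, hnode _, by rw [hleaves, R.below_root], rfl, ?_, hnode,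
    fun c hc => hchild _ (Sum.inl c) ⟨hc, rfl⟩, fun r => hchild _ (Sum.inr r) rfl, fun v x hx => ?_,
    fun v => by rw [hleaves, R.wsum_below], hpt⟩
  · intro u v h
    obtain ⟨r, hr⟩ := (τ u).leaves_nonempty
    have hr' : r ∈ (τ v).leaves := h ▸ hr
    rw [hleaves, mem_below] at hr hr'
    rcases Relation.ReflTransGen.total_of_right_unique R.step_unique hr hr' with h1 | h1
    · rcases hsize _ _ h1 with h2 | h2
      · exact h2
      · rw [h] at h2
        exact (lt_irrefl _ h2).elim
    · rcases hsize _ _ h1 with h2 | h2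
      · exact h2.symm
      · rw [h] at h2
        exact (lt_irrefl _ h2).elim
  · have key : ∀ y, R.IsItem v y → x = E y →
        (∃ r, x = leaf r ∧ R.att r = v) ∨ ∃ c, c ≠ R.root ∧ x = τ c ∧ R.par c = v := by
      rintro (c | r) hy rfl
      · exact Or.inr ⟨c, hy.1, rfl, hy.2⟩
      · exact Or.inl ⟨r, rfl, hy⟩
    rw [hτ'] at hx
    rcases hx with h | h
    · exact key _ (ha v) h
    · exact key _ (hb v) h

end RootedCurve

end Tree

/-! ### The tropical count -/

section TropicalCount

variable {ι : Type} [Fintype ι] [DecidableEq ι] {w : ι → Lat}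

open BinTree

open Classical in
/-- The tropical curves of type `(w, ξ)`, `ξ` generic, are the realized trees with all leaves. -/
theorem tropicalCurves_sum {ξ : ι → ℝ × ℝ} (hμ : Generic w (moments w ξ)) (hw : ∀ r, w r ≠ 0)
    (hout : ∑ r, w r ≠ 0) : Finite (TropicalCurves w ξ) ∧ ∑ᶠ C : TropicalCurves w ξ, C.mult
      = ∑ T ∈ (trees w (moments w ξ) Finset.univ).filter IsNode, T.mult w := by
  let X := {T // T ∈ (trees w (moments w ξ) Finset.univ).filter IsNode}
  have hX : ∀ T : X, T.1.Good w (moments w ξ) ∧ T.1.leaves = Finset.univ ∧ T.1.IsNode := fun T => by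
    have h := Finset.mem_filter.1 T.2
    exact ⟨(mem_trees.1 h.1).1, (mem_trees.1 h.1).2, h.2⟩
  choose N R τ hτ using fun T : X => exists_encodes (hX T).1 (hX T).2.2 (hX T).2.1 hw
  let F : X → TropicalCurves w ξ := fun T => Quotient.mk _ ((R T).toCurve hw hout)
  have hF : Function.Bijective F := by
    constructor
    · intro T T' h
      exact Subtype.ext ((hτ T).tree_unique (hτ T') (hX T).1 (hX T').1 (Quotient.exact h))
    · intro C
      induction C using Quotient.inductionOn with
      | h C =>
        obtain ⟨R', hR'⟩ := C.exists_rooted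
        obtain ⟨T, σ, hT, hn, hl, hσ⟩ := R'.exists_tree hμ hw hout
        refine ⟨⟨T, Finset.mem_filter.2 ⟨mem_trees.2 ⟨hT, hl⟩, hn⟩⟩, ?_⟩
        exact ((Quotient.sound hR').trans (Quotient.sound (hσ.iso (hτ _) hT hw hout))).symm
  let e := Equiv.ofBijective F hF
  have hmult : ∀ T, (F T).mult = T.1.mult w := fun T => (hτ T).mult_eq (hX T).1
  refine ⟨Finite.of_equiv X e, ?_⟩
  rw [← finsum_comp_equiv e, finsum_eq_sum_of_fintype]
  refine (Finset.sum_congr rfl fun T _ => hmult T).trans ?_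
  exact Finset.sum_coe_sort _ fun T : BinTree ι => T.mult w

open Classical in
theorem countInf_eq_sum_node (w : ι → Lat) (μ : ι → ℝ) :
    countInf w μ Finset.univ = ∑ T ∈ (trees w μ Finset.univ).filter IsNode, T.mult w
      + if Fintype.card ι = 1 then 1 else 0 := by
  rw [countInf, ← Finset.sum_filter_add_sum_filter_not _ IsNode]
  congr 1
  split_ifs with h
  · obtain ⟨r, hr⟩ := Fintype.card_eq_one_iff.1 h
    have hu : (Finset.univ : Finset ι) = {r} := by
      ext x; simp [hr x]
    have : (trees w μ Finset.univ).filter (fun T => ¬ IsNode T) = {leaf r} := by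
      ext T
      rw [Finset.mem_filter, mem_trees, Finset.mem_singleton]
      constructor
      · rintro ⟨-, h⟩
        cases T with
        | leaf s => rw [hr s]
        | node => exact (h trivial).elim
      · rintro rfl
        exact ⟨⟨trivial, hu.symm⟩, fun h => h⟩
    rw [this, Finset.sum_singleton, mult]
  · refine Finset.sum_eq_zero fun T hT => ?_
    rw [Finset.mem_filter, mem_trees] at hT
    cases T with
    | leaf s =>
      refine (h ?_).elim
      rw [← Finset.card_univ, ← hT.1.2, BinTree.leaves, Finset.card_singleton]
    | node => exact (hT.2 trivial).elim

/-- Finitely many proper affine subspaces do not cover the space. -/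
theorem exists_not_mem_affineSubspaces {S : Set (AffineSubspace ℝ (ι → ℝ × ℝ))} (hS : S.Finite)
    (h : ∀ H ∈ S, H ≠ ⊤) : ∃ ξ : ι → ℝ × ℝ, ∀ H ∈ S, ξ ∉ H := by
  by_contra hcon
  push Not at hcon
  have h1 : MeasureTheory.volume (⋃ H ∈ S, (H : Set (ι → ℝ × ℝ))) = 0 :=
    (MeasureTheory.measure_biUnion_null_iff hS.countable).2 fun H hH =>
      MeasureTheory.Measure.addHaar_affineSubspace _ H (h H hH)
  have h2 : (⋃ H ∈ S, (H : Set (ι → ℝ × ℝ))) = Set.univ := by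
    refine Set.eq_univ_of_forall fun ξ => ?_
    obtain ⟨H, hH, hξ⟩ := hcon ξ
    exact Set.mem_biUnion hH hξ
  rw [h2] at h1
  exact (MeasureTheory.Measure.measure_univ_ne_zero.2 (NeZero.ne _)) h1

theorem exists_generic_subspaces (hw : ∀ r, w r ≠ 0) :
    ∃ S : Set (AffineSubspace ℝ (ι → ℝ × ℝ)), S.Finite ∧ (∀ H ∈ S, H ≠ ⊤) ∧
      ∀ ξ : ι → ℝ × ℝ, (∀ H ∈ S, ξ ∉ H) → Generic w (moments w ξ) := by
  obtain ⟨C, hC, hgen⟩ := exists_generic_functionals w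
  let f : (ι → ℤ) → (ι → ℝ × ℝ) →ₗ[ℝ] ℝ := fun c =>
    { toFun := fun ξ => ∑ r, (c r : ℝ) * rwedge (w r) (ξ r)
      map_add' := fun ξ ξ' => by
        rw [← Finset.sum_add_distrib]
        refine Finset.sum_congr rfl fun r _ => ?_
        simp only [rwedge, Pi.add_apply, Prod.fst_add, Prod.snd_add]
        ring
      map_smul' := fun s ξ => by
        rw [RingHom.id_apply, smul_eq_mul, Finset.mul_sum]
        refine Finset.sum_congr rfl fun r _ => ?_
        rw [Pi.smul_apply, rwedge_smul_right]
        ring }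
  refine ⟨(fun c => (LinearMap.ker (f c)).toAffineSubspace) '' C, C.finite_toSet.image _, ?_, ?_⟩
  · rintro _ ⟨c, hc, rfl⟩ htop
    refine hC c hc (funext fun r => ?_)
    have h1 : (Pi.single r (-((w r).2 : ℝ), ((w r).1 : ℝ)) : ι → ℝ × ℝ) ∈
        (LinearMap.ker (f c)).toAffineSubspace := by
      rw [show (LinearMap.ker (f c)).toAffineSubspace = ⊤ from htop]
      trivial
    have h2 : ∑ s, (c s : ℝ) * rwedge (w s)
        ((Pi.single r (-((w r).2 : ℝ), ((w r).1 : ℝ)) : ι → ℝ × ℝ) s) = 0 := h1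
    rw [Finset.sum_eq_single r (fun s _ hs => by simp [Pi.single_eq_of_ne hs, rwedge]) (by simp),
      Pi.single_eq_same] at h2
    rcases mul_eq_zero.1 h2 with h3 | h3
    · exact_mod_cast h3
    · refine (hw r ?_).elim
      simp only [rwedge] at h3
      have h4 : ((w r).1 : ℝ) ^ 2 + ((w r).2 : ℝ) ^ 2 = 0 := by linarith
      have h5 : ((w r).1 : ℝ) = 0 := by nlinarith [sq_nonneg ((w r).1 : ℝ), sq_nonneg ((w r).2 : ℝ)]
      have h6 : ((w r).2 : ℝ) = 0 := by nlinarith [sq_nonneg ((w r).1 : ℝ), sq_nonneg ((w r).2 : ℝ)]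
      exact Prod.ext (by exact_mod_cast h5) (by exact_mod_cast h6)
  · intro ξ hξ
    exact hgen _ fun c hc h => hξ _ ⟨c, hc, rfl⟩ h

theorem exists_generic (hw : ∀ r, w r ≠ 0) : ∃ μ : ι → ℝ, Generic w μ := by
  obtain ⟨S, hS, hS', h⟩ := exists_generic_subspaces hw
  obtain ⟨ξ, hξ⟩ := exists_not_mem_affineSubspaces hS hS'
  exact ⟨_, h ξ hξ⟩

theorem tropicalCount_eq (hw : ∀ r, w r ≠ 0) (hout : ∑ r, w r ≠ 0) {μ : ι → ℝ} (hμ : Generic w μ) :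
    countInf w μ Finset.univ = tropicalCount w + if Fintype.card ι = 1 then 1 else 0 := by
  classical
  obtain ⟨S, hS, hS', hgen⟩ := exists_generic_subspaces hw
  let c : ℕ := ∑ T ∈ (trees w μ Finset.univ).filter IsNode, T.mult w
  have hc : ∀ ξ : ι → ℝ × ℝ, (∀ H ∈ S, ξ ∉ H) →
      Finite (TropicalCurves w ξ) ∧ ∑ᶠ C : TropicalCurves w ξ, C.mult = c := by
    intro ξ hξ
    have h1 := tropicalCurves_sum (hgen ξ hξ) hw hout
    refine ⟨h1.1, h1.2.trans ?_⟩
    have h2 := countInf_eq_of_generic hμ (hgen ξ hξ) Finset.univ hout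
    rw [countInf_eq_sum_node, countInf_eq_sum_node] at h2
    exact (Nat.add_right_cancel h2).symm
  have hex : ∃ c, IsTropicalCount w c := ⟨c, S, hS, hS', hc⟩
  have huniq : ∀ c', IsTropicalCount w c' → c' = c := by
    rintro c' ⟨S', hf, hne, h⟩
    obtain ⟨ξ, hξ⟩ := exists_not_mem_affineSubspaces (hS.union hf) fun H hH =>
      hH.elim (hS' H) (hne H)
    rw [← (h ξ fun H hH => hξ H (Or.inr hH)).2, (hc ξ fun H hH => hξ H (Or.inl hH)).2]
  rw [countInf_eq_sum_node, tropicalCount, dif_pos hex, huniq _ hex.choose_spec]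

end TropicalCount

/-! ### Exponentials of power series -/

section PowerSeries

open MvPowerSeries

variable {σ : Type} {A : Type} [Ring A]

/-- The coefficients of `x` of degree less than `D` vanish. -/
def Vanish (D : ℕ) (x : MvPowerSeries σ A) : Prop := ∀ P : σ →₀ ℕ, P.degree < D → coeff P x = 0

theorem Vanish.mono {D D' : ℕ} {x : MvPowerSeries σ A} (h : Vanish D x) (hD : D' ≤ D) : Vanish D' x :=
  fun P hP => h P (hP.trans_le hD)

theorem vanish_zero (x : MvPowerSeries σ A) : Vanish 0 x := fun P hP => absurd hP (by omega)

theorem vanish_one_iff {x : MvPowerSeries σ A} : Vanish 1 x ↔ coeff 0 x = 0 := by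
  constructor
  · intro h
    exact h 0 (by simp)
  · intro h P hP
    rw [Nat.lt_one_iff, Finsupp.degree_eq_zero_iff] at hP
    rw [hP, h]

theorem Vanish.add {D : ℕ} {x y : MvPowerSeries σ A} (hx : Vanish D x) (hy : Vanish D y) :
    Vanish D (x + y) := fun P hP => by rw [map_add, hx P hP, hy P hP, add_zero]

theorem Vanish.neg {D : ℕ} {x : MvPowerSeries σ A} (hx : Vanish D x) :
    Vanish D (-x) := fun P hP => by rw [map_neg, hx P hP, neg_zero]

theorem Vanish.mul {a b : ℕ} {x y : MvPowerSeries σ A} (hx : Vanish a x) (hy : Vanish b y) :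
    Vanish (a + b) (x * y) := by
  classical
  intro P hP
  rw [coeff_mul]
  refine Finset.sum_eq_zero fun Q hQ => ?_
  have h1 := congrArg Finsupp.degree (Finset.HasAntidiagonal.mem_antidiagonal.1 hQ)
  rw [map_add] at h1
  by_cases h : Q.1.degree < a
  · rw [hx _ h, zero_mul]
  · rw [hy _ (by omega), mul_zero]

theorem Vanish.pow {x : MvPowerSeries σ A} (hx : Vanish 1 x) (j : ℕ) : Vanish j (x ^ j) := by
  induction j with
  | zero => exact vanish_zero _
  | succ j ih => rw [pow_succ]; exact ih.mul hx

theorem Vanish.list_sum {D : ℕ} {l : List (MvPowerSeries σ A)} (h : ∀ x ∈ l, Vanish D x) :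
    Vanish D l.sum := by
  induction l with
  | nil => intro P _; simp
  | cons x l ih =>
    rw [List.sum_cons]
    exact (h x List.mem_cons_self).add (ih fun y hy => h y (List.mem_cons_of_mem _ hy))

/-- The leading coefficient of a product whose second factor has constant coefficient `1`. -/
theorem coeff_mul_of_vanish_left {D : ℕ} {x y : MvPowerSeries σ A} (hx : Vanish D x)
    {P : σ →₀ ℕ} (hP : P.degree = D) : coeff P (x * y) = coeff P x * coeff 0 y := by
  classical
  rw [coeff_mul, Finset.sum_eq_single (P, 0)]
  · intro Q hQ hne
    have h1 := Finset.HasAntidiagonal.mem_antidiagonal.1 hQ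
    have h2 := congrArg Finsupp.degree h1
    rw [map_add] at h2
    rw [hx _ ?_, zero_mul]
    by_contra h3
    have h4 : Q.2 = 0 := (Finsupp.degree_eq_zero_iff _).1 (by omega)
    rw [h4, add_zero] at h1
    exact hne (Prod.ext h1 h4)
  · intro h
    exact (h (Finset.HasAntidiagonal.mem_antidiagonal.2 (add_zero P))).elim

theorem coeff_mul_of_vanish_right {D : ℕ} {x y : MvPowerSeries σ A} (hy : Vanish D y)
    {P : σ →₀ ℕ} (hP : P.degree = D) : coeff P (x * y) = coeff 0 x * coeff P y := by
  classical
  rw [coeff_mul, Finset.sum_eq_single (0, P)]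
  · intro Q hQ hne
    have h1 := Finset.HasAntidiagonal.mem_antidiagonal.1 hQ
    have h2 := congrArg Finsupp.degree h1
    rw [map_add] at h2
    rw [hy _ ?_, mul_zero]
    by_contra h3
    have h4 : Q.1 = 0 := (Finsupp.degree_eq_zero_iff _).1 (by omega)
    rw [h4, zero_add] at h1
    exact hne (Prod.ext h4 h1)
  · intro h
    exact (h (Finset.HasAntidiagonal.mem_antidiagonal.2 (zero_add P))).elim

theorem coeff_zero_list_prod {l : List (MvPowerSeries σ A)} (h : ∀ x ∈ l, coeff 0 x = 1) :
    coeff 0 l.prod = 1 := by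
  induction l with
  | nil => simp
  | cons x l ih =>
    rw [List.prod_cons, coeff_mul_of_vanish_left (vanish_zero x) (by simp),
      h x List.mem_cons_self, ih fun y hy => h y (List.mem_cons_of_mem _ hy), one_mul]

/-- Two products whose factors agree in degree less than `D`: the difference in degree `D`. -/
theorem list_prod_difference {X : Type} {D : ℕ} (f g : X → MvPowerSeries σ A) (l : List X)
    (hf : ∀ x ∈ l, coeff 0 (f x) = 1) (hg : ∀ x ∈ l, coeff 0 (g x) = 1)
    (h : ∀ x ∈ l, Vanish D (f x - g x)) :
    Vanish D ((l.map f).prod - (l.map g).prod) ∧ ∀ P : σ →₀ ℕ, P.degree = D →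
      coeff P ((l.map f).prod - (l.map g).prod) = (l.map fun x => coeff P (f x - g x)).sum := by
  induction l with
  | nil => exact ⟨fun P _ => by simp, fun P _ => by simp⟩
  | cons x l ih =>
    obtain ⟨h1, h2⟩ := ih (fun y hy => hf y (List.mem_cons_of_mem _ hy))
      (fun y hy => hg y (List.mem_cons_of_mem _ hy)) fun y hy => h y (List.mem_cons_of_mem _ hy)
    have hx := h x List.mem_cons_self
    have hsplit : ((x :: l).map f).prod - ((x :: l).map g).prod
        = (f x - g x) * (l.map f).prod + g x * ((l.map f).prod - (l.map g).prod) := by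
      rw [List.map_cons, List.map_cons, List.prod_cons, List.prod_cons, sub_mul, mul_sub]
      abel
    rw [hsplit]
    refine ⟨?_, fun P hP => ?_⟩
    · exact (hx.mul (vanish_zero _)).add ((Vanish.mul (vanish_zero (g x)) h1).mono (by omega))
    · have h3 : coeff 0 (l.map f).prod = 1 := coeff_zero_list_prod fun y hy => by
        obtain ⟨z, hz, rfl⟩ := List.mem_map.1 hy
        exact hf z (List.mem_cons_of_mem _ hz)
      rw [map_add, coeff_mul_of_vanish_left hx hP, coeff_mul_of_vanish_right h1 hP, h2 P hP, h3,
        hg x List.mem_cons_self, mul_one, one_mul, List.map_cons, List.sum_cons]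

variable [Algebra ℂ A]

theorem coeff_complex_smul (c : ℂ) (P : σ →₀ ℕ) (x : MvPowerSeries σ A) :
    coeff P (c • x) = c • coeff P x := rfl

/-- The exponential of a power series without constant coefficient. -/
def pexp (x : MvPowerSeries σ A) : MvPowerSeries σ A := fun P =>
  ∑ j ∈ Finset.range (P.degree + 1), ((Nat.factorial j : ℂ)⁻¹) • coeff P (x ^ j)

theorem coeff_pexp {x : MvPowerSeries σ A} (hx : Vanish 1 x) {P : σ →₀ ℕ} {M : ℕ}
    (hM : P.degree < M) :
    coeff P (pexp x) = ∑ j ∈ Finset.range M, ((Nat.factorial j : ℂ)⁻¹) • coeff P (x ^ j) := by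
  refine Finset.sum_subset (Finset.range_mono (by omega)) fun j _ hj => ?_
  rw [(hx.pow j) P (by simpa using hj), smul_zero]

theorem coeff_zero_pexp (x : MvPowerSeries σ A) : coeff 0 (pexp x) = 1 := by
  change ∑ j ∈ Finset.range ((0 : σ →₀ ℕ).degree + 1), _ = _
  simp

theorem pexp_zero : pexp (0 : MvPowerSeries σ A) = 1 := by
  ext P
  change ∑ j ∈ Finset.range (P.degree + 1), _ = _
  rw [Finset.sum_range_succ', Finset.sum_eq_zero]
  · simp
  · intro j _
    rw [zero_pow (Nat.succ_ne_zero j), map_zero, smul_zero]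

theorem sum_antidiagonal_range {M : Type} [AddCommMonoid M] (N : ℕ) (f : ℕ × ℕ → M)
    (hf : ∀ a b, N ≤ a + b → f (a, b) = 0) :
    ∑ j ∈ Finset.range N, ∑ m ∈ Finset.HasAntidiagonal.antidiagonal j, f m
      = ∑ m ∈ Finset.range N ×ˢ Finset.range N, f m := by
  rw [Finset.sum_sigma']
  refine Finset.sum_bij_ne_zero (fun x _ _ => x.2) ?_ ?_ ?_ ?_
  · rintro ⟨j, a, b⟩ h1 -
    simp only [Finset.mem_sigma, Finset.mem_range, Finset.HasAntidiagonal.mem_antidiagonal] at h1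
    simp only [Finset.mem_product, Finset.mem_range]
    omega
  · rintro ⟨j, a, b⟩ h1 - ⟨j', a', b'⟩ h2 - h
    simp only [Finset.mem_sigma, Finset.mem_range, Finset.HasAntidiagonal.mem_antidiagonal, Prod.mk.injEq] at h1 h2 h
    obtain ⟨rfl, rfl⟩ := h
    obtain rfl : j = j' := h1.2.symm.trans h2.2
    rfl
  · rintro ⟨a, b⟩ h1 h2
    refine ⟨⟨a + b, a, b⟩, ?_, h2, rfl⟩
    simp only [Finset.mem_sigma, Finset.mem_range, Finset.HasAntidiagonal.mem_antidiagonal, and_true]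
    by_contra h3
    exact h2 (hf a b (by omega))
  · intros; rfl

theorem pexp_add_of_commute {x y : MvPowerSeries σ A} (hx : Vanish 1 x) (hy : Vanish 1 y)
    (h : Commute x y) : pexp (x + y) = pexp x * pexp y := by
  classical
  ext P
  set N := P.degree + 1 with hN
  let f : ℕ × ℕ → A := fun m =>
    (((Nat.factorial m.1 : ℂ)⁻¹) * ((Nat.factorial m.2 : ℂ)⁻¹)) • coeff P (x ^ m.1 * y ^ m.2)
  have h1 : coeff P (pexp (x + y)) = ∑ j ∈ Finset.range N, ∑ m ∈ Finset.HasAntidiagonal.antidiagonal j, f m := by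
    rw [coeff_pexp (hx.add hy) (show P.degree < N by omega)]
    refine Finset.sum_congr rfl fun j _ => ?_
    rw [h.add_pow', map_sum, Finset.smul_sum]
    refine Finset.sum_congr rfl fun m hm => ?_
    have hm' := Finset.HasAntidiagonal.mem_antidiagonal.1 hm
    rw [map_nsmul, ← Nat.cast_smul_eq_nsmul ℂ, smul_smul]
    congr 1
    have h2 := Nat.add_choose_mul_factorial_mul_factorial m.2 m.1
    rw [add_comm m.2, hm', mul_right_comm] at h2
    have h3 : (j.factorial : ℂ) ≠ 0 := by exact_mod_cast j.factorial_ne_zero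
    have h4 : (m.1.factorial : ℂ) ≠ 0 := by exact_mod_cast m.1.factorial_ne_zero
    have h5 : (m.2.factorial : ℂ) ≠ 0 := by exact_mod_cast m.2.factorial_ne_zero
    have h6 : (j.choose m.1 : ℂ) * m.1.factorial * m.2.factorial = j.factorial := by
      exact_mod_cast h2
    field_simp
    linear_combination h6
  have h2 : coeff P (pexp x * pexp y) = ∑ m ∈ Finset.range N ×ˢ Finset.range N, f m := by
    have h3 : ∀ Q ∈ Finset.HasAntidiagonal.antidiagonal P, coeff Q.1 (pexp x) * coeff Q.2 (pexp y)
        = ∑ m ∈ Finset.range N ×ˢ Finset.range N,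
          (((Nat.factorial m.1 : ℂ)⁻¹) * ((Nat.factorial m.2 : ℂ)⁻¹)) •
            (coeff Q.1 (x ^ m.1) * coeff Q.2 (y ^ m.2)) := by
      intro Q hQ
      have h4 := congrArg Finsupp.degree (Finset.HasAntidiagonal.mem_antidiagonal.1 hQ)
      rw [map_add] at h4
      rw [coeff_pexp hx (show Q.1.degree < N by omega), coeff_pexp hy (show Q.2.degree < N by omega),
        Finset.sum_mul_sum, Finset.sum_product]
      refine Finset.sum_congr rfl fun a _ => Finset.sum_congr rfl fun b _ => ?_
      rw [smul_mul_smul_comm]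
    rw [coeff_mul, Finset.sum_congr rfl h3, Finset.sum_comm]
    refine Finset.sum_congr rfl fun m _ => ?_
    rw [← Finset.smul_sum, ← coeff_mul]
  rw [h1, h2, sum_antidiagonal_range N f fun a b hab => ?_]
  change _ • _ = _
  rw [((hx.pow a).mul (hy.pow b)) P (by omega), smul_zero]

theorem pexp_list_sum {l : List (MvPowerSeries σ A)} (h : ∀ x ∈ l, Vanish 1 x)
    (hc : ∀ x ∈ l, ∀ y ∈ l, Commute x y) : pexp l.sum = (l.map pexp).prod := by
  induction l with
  | nil => exact pexp_zero
  | cons x l ih =>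
    have h1 := fun y hy => h y (List.mem_cons_of_mem x hy)
    rw [List.sum_cons, List.map_cons, List.prod_cons, pexp_add_of_commute (h x List.mem_cons_self)
      (Vanish.list_sum h1) ?_, ih h1 fun y hy z hz => hc y (List.mem_cons_of_mem _ hy) z
        (List.mem_cons_of_mem _ hz)]
    exact Commute.list_sum_right _ _ fun y hy => hc x List.mem_cons_self y (List.mem_cons_of_mem _ hy)

/-- Exponentials of series which agree in degree less than `D`. -/
theorem pexp_difference {D : ℕ} {x y : MvPowerSeries σ A} (hx : Vanish 1 x) (hy : Vanish 1 y)
    (h : Vanish D (x - y)) : Vanish D (pexp x - pexp y) ∧ ∀ P : σ →₀ ℕ, P.degree = D →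
      coeff P (pexp x - pexp y) = coeff P (x - y) := by
  have hpow : ∀ j : ℕ, Vanish (D + 1) (x ^ (j + 2) - y ^ (j + 2)) := by
    intro j
    induction j with
    | zero =>
      have : x ^ (0 + 2) - y ^ (0 + 2) = (x - y) * x + y * (x - y) := by
        rw [zero_add, pow_two, pow_two, sub_mul, mul_sub]; abel
      rw [this]
      exact (h.mul hx).add ((hy.mul h).mono (by omega))
    | succ j ih =>
      have : x ^ (j + 1 + 2) - y ^ (j + 1 + 2) = (x - y) * x ^ (j + 2)
          + y * (x ^ (j + 2) - y ^ (j + 2)) := by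
        rw [show j + 1 + 2 = (j + 2) + 1 by ring, pow_succ', pow_succ' y, sub_mul, mul_sub]; abel
      rw [this]
      exact ((h.mul (hx.pow (j + 2))).mono (by omega)).add ((hy.mul ih).mono (by omega))
  have key : ∀ P : σ →₀ ℕ, P.degree ≤ D → coeff P (pexp x - pexp y) = coeff P (x - y) := by
    intro P hP
    rw [map_sub, coeff_pexp hx (show P.degree < D + 2 by omega),
      coeff_pexp hy (show P.degree < D + 2 by omega), ← Finset.sum_sub_distrib,
      Finset.sum_range_succ', Finset.sum_range_succ', Finset.sum_eq_zero]
    · simp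
    · intro j _
      rw [← smul_sub, ← map_sub, hpow j P (by omega), smul_zero]
  exact ⟨fun P hP => by rw [key P hP.le, h P hP], fun P hP => key P hP.le⟩

end PowerSeries

/-! ### Counts of multisets of vectors -/

section CountMultiset

theorem exists_equiv_of_map_eq {ι ι' α : Type} [Fintype ι] [Fintype ι'] {f : ι → α} {g : ι' → α}
    (h : Finset.univ.val.map f = Finset.univ.val.map g) : ∃ e : ι ≃ ι', g ∘ e = f := by
  classical
  have hc : ∀ a, Fintype.card {x // f x = a} = Fintype.card {x // g x = a} := by
    intro a
    have h1 := congrArg (Multiset.count a) h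
    rw [Multiset.count_map, Multiset.count_map] at h1
    rw [Fintype.card_subtype, Fintype.card_subtype, Finset.card, Finset.card, Finset.filter_val,
      Finset.filter_val]
    simpa only [eq_comm] using h1
  let e := (Equiv.sigmaFiberEquiv f).symm.trans ((Equiv.sigmaCongrRight fun a =>
    Fintype.equivOfCardEq (hc a)).trans (Equiv.sigmaFiberEquiv g))
  exact ⟨e, funext fun x => (Fintype.equivOfCardEq (hc (f x)) ⟨x, rfl⟩).2⟩

theorem Generic.comp {ι ι' : Type} [DecidableEq ι] [DecidableEq ι'] {w : ι → Lat} {μ : ι → ℝ}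
    (h : Generic w μ) (e : ι' ↪ ι) : Generic (w ∘ e) (μ ∘ e) := by
  have hl : ∀ {I x}, OnLine (w ∘ e) (μ ∘ e) I x → OnLine w μ (I.map e) x := fun {I x} h => by
    rw [OnLine, wsum_map, msum_map]; exact h
  constructor
  · intro I J x hI hJ hIJ h1 h2
    have := h.parallel (I.map e) (J.map e) x (by rwa [wsum_map]) (by rwa [wsum_map])
      (fun h => hIJ (Finset.map_injective e h)) (hl h1) (hl h2)
    rwa [wsum_map, wsum_map] at this
  · intro I J K x hIJ hJK hIK h1 h2 h3
    have := h.concurrent (I.map e) (J.map e) (K.map e) x (by rwa [wsum_map, wsum_map])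
      (by rwa [wsum_map, wsum_map]) (by rwa [wsum_map, wsum_map]) (hl h1) (hl h2) (hl h3)
    simpa only [← Finset.map_union, Finset.map_inj, Finset.disjoint_map] using this

open Classical in
/-- The number of realized trees for the lines with directions in `M`, in general position. -/
def countM (M : Multiset Lat) : ℕ :=
  if h : ∃ μ : M → ℝ, Generic (fun x : M => x.1) μ then
    countInf (fun x : M => x.1) h.choose Finset.univ else 0

theorem countInf_eq_countM {ι : Type} [Fintype ι] [DecidableEq ι] {w : ι → Lat} {μ : ι → ℝ}
    (hμ : Generic w μ) {I : Finset ι} (hI : wsum w I ≠ 0) :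
    countInf w μ I = countM (I.val.map w) := by
  classical
  set M := I.val.map w with hM
  have h1 : (Finset.univ : Finset M).val.map (fun x : M => x.1)
      = (Finset.univ : Finset I).val.map fun x : I => w x.1 := by
    rw [Multiset.map_univ_coe, hM]
    change _ = I.attach.val.map (w ∘ Subtype.val)
    rw [← Multiset.map_map, Finset.attach_val, Multiset.attach_map_val]
  obtain ⟨e, he⟩ := exists_equiv_of_map_eq h1
  let j : M ↪ ι := e.toEmbedding.trans (Function.Embedding.subtype _)
  have hj : w ∘ j = fun x : M => x.1 := he
  have hI' : Finset.univ.map j = I := by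
    rw [← Finset.map_map, Finset.map_univ_equiv]
    exact Finset.attach_map_val
  have hgen := hμ.comp j
  rw [hj] at hgen
  have hex : ∃ μ : M → ℝ, Generic (fun x : M => x.1) μ := ⟨_, hgen⟩
  have h2 : wsum (fun x : M => x.1) Finset.univ ≠ 0 := by
    rwa [← hj, ← wsum_map, hI']
  rw [countM, dif_pos hex]
  nth_rewrite 1 [← hI']
  rw [countInf_map, hj]
  convert countInf_eq_of_generic hgen hex.choose_spec Finset.univ h2

theorem countM_eq_tropicalCount {ι : Type} [Fintype ι] {w : ι → Lat} (hw : ∀ r, w r ≠ 0)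
    (hout : ∑ r, w r ≠ 0) :
    countM (Finset.univ.val.map w) = tropicalCount w + if Fintype.card ι = 1 then 1 else 0 := by
  classical
  obtain ⟨μ, hμ⟩ := exists_generic hw
  rw [← tropicalCount_eq hw hout hμ, countInf_eq_countM hμ hout]

end CountMultiset

/-! ### Power series and square-free series -/

section Phi

open MvPowerSeries

variable {σ : Type}

/-- The product of the factorials of the exponents. -/
def kfact (k : σ →₀ ℕ) : ℕ := k.prod fun _ n => n.factorial

theorem kfact_ne_zero (k : σ →₀ ℕ) : kfact k ≠ 0 :=
  Finset.prod_ne_zero_iff.2 fun _ _ => Nat.factorial_ne_zero _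

theorem kfact_zero : kfact (0 : σ →₀ ℕ) = 1 := Finsupp.prod_zero_index

theorem kfact_add_single (k : σ →₀ ℕ) (s : σ) :
    kfact (k + Finsupp.single s 1) = (k s + 1) * kfact k := by
  have h0 : ∀ k : σ →₀ ℕ, kfact k = (k s).factorial * kfact (k.erase s) := fun k =>
    (Finsupp.mul_prod_erase' k s _ fun _ => Nat.factorial_zero).symm
  rw [h0, h0 k, Finsupp.erase_add, Finsupp.erase_single, add_zero, Finsupp.add_apply,
    Finsupp.single_eq_same, Nat.factorial_succ, mul_assoc]

variable {M : Type} [AddCommMonoid M]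

theorem sum_antidiagonal_add_single_left [DecidableEq σ] (k : σ →₀ ℕ) (s : σ)
    (G : (σ →₀ ℕ) → (σ →₀ ℕ) → M) :
    ∑ x ∈ (Finset.HasAntidiagonal.antidiagonal (k + Finsupp.single s 1) :
        Finset ((σ →₀ ℕ) × (σ →₀ ℕ))), x.1 s • G x.1 x.2
      = ∑ x ∈ Finset.HasAntidiagonal.antidiagonal k,
        (x.1 s + 1) • G (x.1 + Finsupp.single s 1) x.2 := by
  symm
  refine Finset.sum_bij_ne_zero (fun x _ _ => (x.1 + Finsupp.single s 1, x.2)) ?_ ?_ ?_ ?_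
  · intro x hx _
    rw [Finset.HasAntidiagonal.mem_antidiagonal] at hx ⊢
    rw [← hx, add_right_comm]
  · intro x _ _ y _ _ h
    simp only [Prod.mk.injEq, add_left_inj] at h
    exact Prod.ext h.1 h.2
  · intro x hx hne
    have hs : x.1 s ≠ 0 := by
      intro h
      rw [h, zero_smul] at hne
      exact hne rfl
    have hle : Finsupp.single s 1 ≤ x.1 := by
      rw [Finsupp.single_le_iff]
      omega
    rw [Finset.HasAntidiagonal.mem_antidiagonal] at hx
    have hx1 : x.1 - Finsupp.single s 1 + Finsupp.single s 1 = x.1 := tsub_add_cancel_of_le hle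
    refine ⟨(x.1 - Finsupp.single s 1, x.2), ?_, ?_, ?_⟩
    · rw [Finset.HasAntidiagonal.mem_antidiagonal]
      apply add_right_cancel (b := Finsupp.single s 1)
      rw [← hx, add_right_comm, hx1]
    · dsimp only
      rw [hx1]
      have : (x.1 - Finsupp.single s 1 : σ →₀ ℕ) s + 1 = x.1 s := by
        rw [Finsupp.tsub_apply, Finsupp.single_eq_same]
        omega
      rwa [this]
    · exact Prod.ext hx1 rfl
  · intro x _ _
    simp

theorem sum_antidiagonal_add_single [DecidableEq σ] (k : σ →₀ ℕ) (s : σ)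
    (G : (σ →₀ ℕ) → (σ →₀ ℕ) → M) :
    (k s + 1) • ∑ x ∈ Finset.HasAntidiagonal.antidiagonal (k + Finsupp.single s 1), G x.1 x.2
      = ∑ x ∈ Finset.HasAntidiagonal.antidiagonal k,
        ((x.1 s + 1) • G (x.1 + Finsupp.single s 1) x.2
          + (x.2 s + 1) • G x.1 (x.2 + Finsupp.single s 1)) := by
  have h2 := sum_antidiagonal_add_single_left k s fun a b => G b a
  replace h2 := (Finsupp.sum_antidiagonal_swap (k + Finsupp.single s 1) fun a b => b s • G a b).trans
    (h2.trans (Finsupp.sum_antidiagonal_swap k fun a b =>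
      (b s + 1) • G a (b + Finsupp.single s 1)).symm)
  rw [Finset.sum_add_distrib, ← sum_antidiagonal_add_single_left k s]
  refine Eq.trans ?_ (congrArg₂ (· + ·) rfl h2)
  rw [Finset.smul_sum]
  rw [← Finset.sum_add_distrib]
  refine Finset.sum_congr rfl fun x hx => ?_
  rw [Finset.HasAntidiagonal.mem_antidiagonal] at hx
  have := DFunLike.congr_fun hx s
  simp only [Finsupp.add_apply, Finsupp.single_eq_same] at this
  rw [← this, add_smul]

variable {ι : Type} [DecidableEq ι]

/-- The exponent of the monomial of a set of indices. -/
def kappa (typ : ι → σ) (I : Finset ι) : σ →₀ ℕ := ∑ r ∈ I, Finsupp.single (typ r) 1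

theorem kappa_insert (typ : ι → σ) {I : Finset ι} {r : ι} (h : r ∉ I) :
    kappa typ (insert r I) = kappa typ I + Finsupp.single (typ r) 1 := by
  rw [kappa, Finset.sum_insert h, add_comm]; rfl

theorem degree_kappa (typ : ι → σ) (I : Finset ι) : (kappa typ I).degree = I.card := by
  rw [kappa, map_sum]
  simp [Finsupp.degree_single]

theorem kappa_mono (typ : ι → σ) {I J : Finset ι} (h : I ⊆ J) : kappa typ I ≤ kappa typ J :=
  Finset.sum_le_sum_of_subset h

theorem sum_powerset_kappa [DecidableEq σ] (typ : ι → σ) (S : Finset ι) :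
    ∀ G : (σ →₀ ℕ) → (σ →₀ ℕ) → M,
    ∑ I ∈ S.powerset, (kfact (kappa typ I) * kfact (kappa typ (S \ I))) •
        G (kappa typ I) (kappa typ (S \ I))
      = kfact (kappa typ S) • ∑ x ∈ Finset.HasAntidiagonal.antidiagonal (kappa typ S), G x.1 x.2 := by
  induction S using Finset.induction_on with
  | empty => intro G; simp [kappa, kfact_zero]
  | insert r S hr ih =>
    intro G
    rw [Finset.sum_powerset_insert hr, ← Finset.sum_add_distrib, kappa_insert typ hr,
      kfact_add_single, mul_comm, mul_smul, sum_antidiagonal_add_single,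
      ← ih fun a b => (a (typ r) + 1) • G (a + Finsupp.single (typ r) 1) b
          + (b (typ r) + 1) • G a (b + Finsupp.single (typ r) 1)]
    refine Finset.sum_congr rfl fun I hI => ?_
    have hI' := Finset.mem_powerset.1 hI
    have h1 : r ∉ I := fun h => hr (hI' h)
    have h2 : insert r S \ I = insert r (S \ I) := Finset.insert_sdiff_of_notMem _ h1
    have h3 : insert r S \ insert r I = S \ I := by
      rw [Finset.insert_sdiff_insert, Finset.sdiff_insert_of_notMem hr]
    have h4 : r ∉ S \ I := fun h => hr (Finset.mem_sdiff.1 h).1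
    rw [h2, h3, kappa_insert typ h1, kappa_insert typ h4, kfact_add_single, kfact_add_single,
      smul_add, smul_smul, smul_smul, add_comm]
    congr 2 <;> ring

variable [Fintype ι] {V : Type} [AddCommGroup V] [Module ℂ V]

theorem kappa_eq_zero_iff (typ : ι → σ) {I : Finset ι} : kappa typ I = 0 ↔ I = ∅ := by
  rw [← Finsupp.degree_eq_zero_iff, degree_kappa, Finset.card_eq_zero]

/-- The homomorphism which replaces every variable by a sum of variables with square zero. -/
def phi (typ : ι → σ) : MvPowerSeries σ (Module.End ℂ V) →+* Module.End ℂ (Finset ι → V) where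
  toFun F := ∑ I : Finset ι, plc I (kfact (kappa typ I) • coeff (kappa typ I) F)
  map_zero' := by simp
  map_one' := by
    classical
    rw [Finset.sum_eq_single ∅]
    · rw [(kappa_eq_zero_iff typ).2 rfl, coeff_zero_one, kfact_zero, one_smul, plc_empty_one]
    · intro I _ hI
      rw [coeff_one, if_neg fun h => hI ((kappa_eq_zero_iff typ).1 h), smul_zero, map_zero]
    · simp
  map_add' F G := by
    simp only [map_add, smul_add, Finset.sum_add_distrib]
  map_mul' F G := by
    classical
    rw [Finset.sum_mul_sum]
    have h1 : ∀ S : Finset ι, plc (V := V) S (kfact (kappa typ S) • coeff (kappa typ S) (F * G))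
        = ∑ I ∈ S.powerset, plc I (kfact (kappa typ I) • coeff (kappa typ I) F) *
          plc (S \ I) (kfact (kappa typ (S \ I)) • coeff (kappa typ (S \ I)) G) := by
      intro S
      rw [coeff_mul, ← sum_powerset_kappa typ S fun a b => coeff a F * coeff b G, map_sum]
      refine Finset.sum_congr rfl fun I hI => ?_
      rw [plc_mul, if_pos Finset.disjoint_sdiff,
        Finset.union_sdiff_of_subset (Finset.mem_powerset.1 hI), smul_mul_smul_comm]
    simp only [h1]
    rw [Finset.sum_sigma', ← Finset.sum_product']
    symm
    refine Finset.sum_bij_ne_zero (fun x _ _ => ⟨x.1 ∪ x.2, x.1⟩) ?_ ?_ ?_ ?_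
    · intro x _ _
      rw [Finset.mem_sigma]
      exact ⟨Finset.mem_univ _, Finset.mem_powerset.2 Finset.subset_union_left⟩
    · rintro ⟨I, J⟩ _ h ⟨I', J'⟩ _ h' heq
      simp only [Sigma.mk.injEq, heq_eq_eq] at heq
      obtain ⟨h2, rfl⟩ := heq
      rw [plc_mul] at h h'
      have d1 : Disjoint I J := by by_contra hd; exact h (if_neg hd)
      have d2 : Disjoint I J' := by by_contra hd; exact h' (if_neg hd)
      have : J = J' := by
        rw [← Finset.union_sdiff_cancel_left d1, h2, Finset.union_sdiff_cancel_left d2]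
      rw [this]
    · rintro ⟨S, I⟩ h hne
      have hI : I ⊆ S := by simpa using h
      exact ⟨(I, S \ I), Finset.mem_univ _, hne, by
        simp only [Finset.union_sdiff_of_subset hI]⟩
    · rintro ⟨I, J⟩ _ h
      rw [plc_mul] at h
      have d1 : Disjoint I J := by by_contra hd; exact h (if_neg hd)
      simp only [Finset.union_sdiff_cancel_left d1]

theorem phi_apply (typ : ι → σ) (F : MvPowerSeries σ (Module.End ℂ V)) :
    phi typ F = ∑ I : Finset ι, plc I (kfact (kappa typ I) • coeff (kappa typ I) F) := rfl

theorem phi_smul (typ : ι → σ) (c : ℂ) (F : MvPowerSeries σ (Module.End ℂ V)) :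
    phi typ (c • F) = c • phi typ F := by
  rw [phi_apply, phi_apply, Finset.smul_sum]
  refine Finset.sum_congr rfl fun I _ => ?_
  rw [coeff_complex_smul, smul_comm, map_smul]

theorem coeff_eq_of_phi_eq (typ : ι → σ) {F G : MvPowerSeries σ (Module.End ℂ V)}
    (h : phi typ F = phi typ G) :
    coeff (kappa typ Finset.univ) F = coeff (kappa typ Finset.univ) G := by
  have key : ∀ (F : MvPowerSeries σ (Module.End ℂ V)) (v : V),
      phi typ F (constSeries v) Finset.univ
        = kfact (kappa typ Finset.univ) • coeff (kappa typ Finset.univ) F v := by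
    intro F v
    rw [phi_apply, LinearMap.sum_apply, Finset.sum_apply, Finset.sum_eq_single Finset.univ]
    · rw [plc_apply, if_pos subset_rfl, Finset.sdiff_self, constSeries, if_pos rfl]
      rfl
    · intro I _ hI
      rw [plc_apply, if_pos (Finset.subset_univ _), constSeries, if_neg, map_zero]
      intro h
      exact hI (Finset.univ_subset_iff.1 (Finset.sdiff_eq_empty_iff_subset.1 h))
    · simp
  ext1 v
  have h1 := key F v
  rw [h, key G v, ← Nat.cast_smul_eq_nsmul ℂ, ← Nat.cast_smul_eq_nsmul ℂ] at h1
  exact (smul_right_injective V (Nat.cast_ne_zero.2 (kfact_ne_zero _)) h1).symm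

attribute [local instance] endRatModule

theorem phi_pexp (typ : ι → σ) {y : MvPowerSeries σ (Module.End ℂ V)} (hy : Vanish 1 y) :
    phi typ (pexp y) = IsNilpotent.exp (phi typ y) := by
  set N := Fintype.card ι + 1 with hN
  have hdeg : ∀ I : Finset ι, (kappa typ I).degree < N := fun I => by
    rw [degree_kappa]
    have := Finset.card_le_univ I
    omega
  have hnil : phi typ y ^ N = 0 := by
    rw [← map_pow, phi_apply]
    refine Finset.sum_eq_zero fun I _ => ?_
    rw [(hy.pow N) _ (hdeg I), smul_zero, map_zero]
  rw [IsNilpotent.exp_eq_sum hnil]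
  have h1 : phi typ (pexp y) = phi typ (∑ j ∈ Finset.range N, ((j.factorial : ℂ)⁻¹) • y ^ j) := by
    rw [phi_apply, phi_apply]
    refine Finset.sum_congr rfl fun I _ => ?_
    rw [coeff_pexp hy (hdeg I), map_sum]
    rfl
  rw [h1, map_sum]
  refine Finset.sum_congr rfl fun j _ => ?_
  rw [phi_smul, map_pow]
  have h2 : algebraMap ℚ ℂ ((j.factorial : ℚ)⁻¹) = (j.factorial : ℂ)⁻¹ := by simp
  exact congrArg (· • phi typ y ^ j) h2.symm

end Phi

/-! ### The consistent family of logarithms -/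

section LogSeries

open MvPowerSeries

variable {σ : Type} {K : Type} [Ring K] [Algebra ℂ K]

theorem pexp_mul_pexp_neg {A : Type} [Ring A] [Algebra ℂ A] {x : MvPowerSeries σ A}
    (hx : Vanish 1 x) : pexp x * pexp (-x) = 1 := by
  rw [← pexp_add_of_commute hx hx.neg (Commute.neg_right (Commute.refl x)), add_neg_cancel, pexp_zero]

theorem pexp_prod_neg {X A : Type} [Ring A] [Algebra ℂ A] (f : X → MvPowerSeries σ A) (l : List X)
    (h : ∀ d ∈ l, Vanish 1 (f d)) :
    (l.map fun d => pexp (f d)).prod * (l.reverse.map fun d => pexp (-f d)).prod = 1 := by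
  induction l with
  | nil => simp
  | cons d l ih =>
    rw [List.map_cons, List.prod_cons, List.reverse_cons, List.map_append, List.prod_append,
      List.map_cons, List.map_nil, List.prod_singleton, mul_assoc, ← mul_assoc _ _ (pexp _),
      ih fun d hd => h d (List.mem_cons_of_mem _ hd), one_mul,
      pexp_mul_pexp_neg (h d List.mem_cons_self)]

/-- The value `∑ k_s f_s` at the exponent `k`. -/
abbrev ktot {M : Type} [AddCommMonoid M] (f : σ → M) : (σ →₀ ℕ) →ₗ[ℕ] M :=
  Finsupp.linearCombination ℕ f

theorem ktot_kappa {ι : Type} {M : Type} [AddCommMonoid M] (f : σ → M) (typ : ι → σ)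
    (I : Finset ι) : ktot f (kappa typ I) = ∑ r ∈ I, f (typ r) := by
  rw [kappa, map_sum]
  exact Finset.sum_congr rfl fun r _ => by rw [Finsupp.linearCombination_single, one_smul]

/-- The vector `p` is a positive multiple of `d`. -/
def InRay (d p : Lat) : Prop := ∃ l : ℕ, 1 ≤ l ∧ p = l • d

theorem InRay.yy_eq {d p : Lat} (h : InRay d p) : ∃ l : ℕ, 1 ≤ l ∧ yy p = l * yy d := by
  obtain ⟨l, hl, rfl⟩ := h
  exact ⟨l, hl, yy_nsmul _ _⟩

theorem InRay.yy_pos {d p : Lat} (h : InRay d p) (hd : 0 < yy d) : 0 < yy p := by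
  obtain ⟨l, hl, h⟩ := h.yy_eq
  rw [h]
  have : (0 : ℝ) < l := by exact_mod_cast hl
  positivity

theorem InRay.yy_neg {d p : Lat} (h : InRay (-d) p) (hd : 0 < yy d) : yy p < 0 := by
  obtain ⟨l, hl, h⟩ := h.yy_eq
  rw [h, ExtVertex.yy_neg]
  have : (0 : ℝ) < l := by exact_mod_cast hl
  nlinarith

theorem InRay.slope_eq {d p : Lat} (h : InRay d p) : slope p = slope d := by
  obtain ⟨l, hl, rfl⟩ := h
  exact slope_nsmul (Nat.one_le_iff_ne_zero.1 hl) d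

open Classical in
/-- The coefficient of the logarithm in the direction `d` at the exponent `k`. -/
def logCoef (w : σ → Lat) (d : Lat) (k : σ →₀ ℕ) : ℂ :=
  if InRay d (ktot w k) then (countM (k.toMultiset.map w) : ℂ) / kfact k
  else if k.degree = 1 ∧ InRay (-d) (ktot w k) then -1 else 0

/-- The logarithm in the direction `d` of the consistent family of functions. -/
def logSeries (w : σ → Lat) (b : σ → K) (d : Lat) :
    MvPowerSeries σ (Module.End ℂ (AddMonoidAlgebra K Lat)) := fun k =>
  logCoef w d k • elem (ktot w k) (ktot b k)

theorem coeff_logSeries (w : σ → Lat) (b : σ → K) (d : Lat) (k : σ →₀ ℕ) :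
    coeff k (logSeries w b d) = logCoef w d k • elem (ktot w k) (ktot b k) := rfl

theorem not_inRay_zero {d : Lat} (hd : d ≠ 0) : ¬ InRay d 0 := by
  rintro ⟨l, hl, h⟩
  rcases smul_eq_zero.1 h.symm with h | h
  · omega
  · exact hd h

theorem vanish_logSeries (w : σ → Lat) (b : σ → K) {d : Lat} (hd : d ≠ 0) :
    Vanish 1 (logSeries w b d) := by
  rw [vanish_one_iff, coeff_logSeries, logCoef, map_zero, if_neg (not_inRay_zero hd), if_neg, zero_smul]
  exact fun h => not_inRay_zero (neg_ne_zero.2 hd) h.2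

theorem toMultiset_kappa {ι : Type} (w : σ → Lat) (typ : ι → σ) (I : Finset ι) :
    (kappa typ I).toMultiset.map w = I.val.map (w ∘ typ) := by
  rw [kappa, map_sum]
  simp only [Finsupp.toMultiset_single, one_smul]
  rw [← Multiset.map_map]
  congr 1
  rw [← Multiset.sum_map_singleton (I.val.map typ), Multiset.map_map]
  rfl

theorem exists_kappa_eq (k : σ →₀ ℕ) : ∃ (N : ℕ) (typ : Fin N → σ), kappa typ Finset.univ = k := by
  induction k using Finsupp.induction_linear with
  | zero => exact ⟨0, Fin.elim0, by simp [kappa]⟩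
  | add f g hf hg =>
    obtain ⟨N, t, rfl⟩ := hf
    obtain ⟨N', t', rfl⟩ := hg
    refine ⟨N + N', Fin.append t t', ?_⟩
    simp [kappa, Fin.sum_univ_add]
  | single s m => exact ⟨m, fun _ => s, by simp [kappa]⟩

attribute [local instance] endRatModule

section Local

variable {ι : Type} [Fintype ι] [DecidableEq ι] {w : σ → Lat} {b : σ → K} {typ : ι → σ}
  {μ : ι → ℝ} {l : List Lat}

theorem phi_logSeries_summand {d : Lat} (I : Finset ι) :
    plc I (kfact (kappa typ I) • coeff (kappa typ I) (logSeries w b d))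
      = ((kfact (kappa typ I) : ℂ) * logCoef w d (kappa typ I)) •
        plc I (elem (wsum (w ∘ typ) I) (bsum (b ∘ typ) I)) := by
  rw [coeff_logSeries, ← Nat.cast_smul_eq_nsmul ℂ, smul_smul, map_smul, ktot_kappa, ktot_kappa]
  rfl

theorem kfact_mul_logCoef_of_inRay (hμ : Generic (w ∘ typ) μ) {d : Lat} {I : Finset ι}
    (hI : wsum (w ∘ typ) I ≠ 0) (h : InRay d (wsum (w ∘ typ) I)) :
    (kfact (kappa typ I) : ℂ) * logCoef w d (kappa typ I) = countInf (w ∘ typ) μ I := by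
  rw [logCoef, ktot_kappa, if_pos (show InRay d (∑ r ∈ I, w (typ r)) from h), toMultiset_kappa,
    countInf_eq_countM hμ hI]
  have : (kfact (kappa typ I) : ℂ) ≠ 0 := Nat.cast_ne_zero.2 (kfact_ne_zero _)
  field_simp

theorem kfact_mul_logCoef_of_inRay_neg {d : Lat} {I : Finset ι}
    (hn : ¬ InRay d (wsum (w ∘ typ) I)) (h : InRay (-d) (wsum (w ∘ typ) I)) :
    (kfact (kappa typ I) : ℂ) * logCoef w d (kappa typ I) = if I.card = 1 then -1 else 0 := by
  rw [logCoef, ktot_kappa, if_neg (show ¬ InRay d (∑ r ∈ I, w (typ r)) from hn), degree_kappa]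
  split_ifs with h1 h2 h2
  · obtain ⟨r, rfl⟩ := Finset.card_eq_one.1 h2
    have : kfact (kappa typ {r}) = 1 := by
      have := kfact_add_single 0 (typ r)
      rw [kfact_zero] at this
      simpa [kappa] using this
    rw [this]
    simp
  · exact (h2 h1.1).elim
  · exact (h1 ⟨h2, h⟩).elim
  · rw [mul_zero]

theorem logCoef_eq_zero {d : Lat} {k : σ →₀ ℕ} (h : ¬ InRay d (ktot w k))
    (h' : ¬ InRay (-d) (ktot w k)) : logCoef w d k = 0 := by
  rw [logCoef, if_neg h, if_neg fun h => h' h.2]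

variable (hμ : Generic (w ∘ typ) μ) (hl : ∀ d ∈ l, 0 < yy d) (hs : l.Pairwise fun d d' => slope d < slope d')
  (hc : ∀ j ≤ kappa typ Finset.univ, ktot w j ≠ 0 →
    ∃ d ∈ l, InRay d (ktot w j) ∨ InRay (-d) (ktot w j))

include hμ hl hs hc

theorem inRay_cases {d : Lat} (hd : d ∈ l) {I : Finset ι} (hI : wsum (w ∘ typ) I ≠ 0) :
    slope (wsum (w ∘ typ) I) = slope d ↔ InRay d (wsum (w ∘ typ) I) ∨ InRay (-d) (wsum (w ∘ typ) I) := by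
  constructor
  · intro h
    have h1 := hc (kappa typ I) (kappa_mono typ (Finset.subset_univ I))
    rw [ktot_kappa] at h1
    obtain ⟨d', hd', h2⟩ := h1 hI
    have h3 : slope d' = slope d := by
      rw [← h]
      rcases h2 with h2 | h2
      · exact h2.slope_eq.symm
      · rw [← slope_neg]; exact h2.slope_eq.symm
    have h4 : d' = d := List.inj_on_of_nodup_map
      (List.pairwise_map.2 (hs.imp fun h => h.ne)) hd' hd h3
    rw [← h4]
    exact h2
  · rintro (h | h)
    · exact h.slope_eq
    · rw [h.slope_eq, slope_neg]

theorem phi_logSeries {d : Lat} (hd : d ∈ l) :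
    phi typ (logSeries w b d) = ∑ I ∈ (wallSets (w ∘ typ)).filter
      (fun I => slope (wsum (w ∘ typ) I) = slope d), topCoef (w ∘ typ) μ I •
        plc I (elem (wsum (w ∘ typ) I) (bsum (b ∘ typ) I)) := by
  have hyd := hl d hd
  have hd0 : d ≠ 0 := by rintro rfl; simp [yy] at hyd
  rw [phi_apply, Finset.sum_filter, wallSets, Finset.sum_filter]
  refine Finset.sum_congr rfl fun I _ => ?_
  rw [phi_logSeries_summand, ← Int.cast_smul_eq_zsmul ℂ]
  by_cases hI : wsum (w ∘ typ) I = 0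
  · rw [if_neg (not_not.2 hI), logCoef_eq_zero, mul_zero, zero_smul]
    · rw [ktot_kappa]
      exact fun h => not_inRay_zero hd0 (hI ▸ h)
    · rw [ktot_kappa]
      exact fun h => not_inRay_zero (neg_ne_zero.2 hd0) (hI ▸ h)
  rw [if_pos hI]
  have hcases := inRay_cases hμ hl hs hc hd hI
  by_cases hsl : slope (wsum (w ∘ typ) I) = slope d
  · rw [if_pos hsl]
    congr 1
    by_cases h1 : InRay d (wsum (w ∘ typ) I)
    · rw [kfact_mul_logCoef_of_inRay hμ hI h1, topCoef, if_pos (h1.yy_pos hyd)]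
      simp
    · have h2 := (hcases.1 hsl).resolve_left h1
      rw [kfact_mul_logCoef_of_inRay_neg h1 h2, topCoef, if_neg (h2.yy_neg hyd).le.not_gt]
      split_ifs <;> simp
  · have h3 := not_or.1 fun h => hsl (hcases.2 h)
    rw [if_neg hsl, logCoef_eq_zero, mul_zero, zero_smul]
    · rw [ktot_kappa]; exact h3.1
    · rw [ktot_kappa]; exact h3.2

theorem phi_neg_logSeries {d : Lat} (hd : d ∈ l) :
    phi typ (-logSeries w b (-d)) = ∑ I ∈ (wallSets (w ∘ typ)).filter
      (fun I => slope (wsum (w ∘ typ) I) = slope d), botCoef (w ∘ typ) μ I •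
        plc I (elem (wsum (w ∘ typ) I) (bsum (b ∘ typ) I)) := by
  have hyd := hl d hd
  have hd0 : d ≠ 0 := by rintro rfl; simp [yy] at hyd
  rw [map_neg, phi_apply, Finset.sum_filter, wallSets, Finset.sum_filter, ← Finset.sum_neg_distrib]
  refine Finset.sum_congr rfl fun I _ => ?_
  have hneg : ∀ (c : ℂ) (T : Module.End ℂ (Finset ι → AddMonoidAlgebra K Lat)),
      -(c • T) = (-c) • T := fun c T => (neg_smul c T).symm
  rw [phi_logSeries_summand, ← Int.cast_smul_eq_zsmul ℂ, hneg]
  by_cases hI : wsum (w ∘ typ) I = 0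
  · rw [if_neg (not_not.2 hI), logCoef_eq_zero, mul_zero, neg_zero, zero_smul]
    · rw [ktot_kappa]
      exact fun h => not_inRay_zero (neg_ne_zero.2 hd0) (hI ▸ h)
    · rw [ktot_kappa, neg_neg]
      exact fun h => not_inRay_zero hd0 (hI ▸ h)
  rw [if_pos hI]
  have hcases := inRay_cases hμ hl hs hc hd hI
  by_cases hsl : slope (wsum (w ∘ typ) I) = slope d
  · rw [if_pos hsl]
    congr 1
    by_cases h1 : InRay (-d) (wsum (w ∘ typ) I)
    · rw [kfact_mul_logCoef_of_inRay hμ hI h1, botCoef, if_neg (h1.yy_neg hyd).le.not_gt]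
      simp
    · have h2 := (hcases.1 hsl).resolve_right h1
      rw [kfact_mul_logCoef_of_inRay_neg h1 (by rwa [neg_neg]), botCoef, if_pos (h2.yy_pos hyd)]
      split_ifs <;> simp
  · have h3 := not_or.1 fun h => hsl (hcases.2 h)
    rw [if_neg hsl, logCoef_eq_zero, mul_zero, neg_zero, zero_smul]
    · rw [ktot_kappa]; exact h3.2
    · rw [ktot_kappa, neg_neg]; exact h3.1

theorem phi_consistent (hb : ∀ s t, b s * b t = b t * b s) :
    phi typ ((l.map fun d => pexp (logSeries w b (-d))).prod *
      (l.map fun d => pexp (logSeries w b d)).prod) = 1 := by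
  have hd0 : ∀ d ∈ l, d ≠ 0 := by
    rintro d hd rfl
    have := hl 0 hd
    simp [yy] at this
  have hE := wallRelations_elem (w ∘ typ) (b ∘ typ) fun r s => hb (typ r) (typ s)
  have h1 := hE.top_eq_bot hμ (vs := l.map slope) (List.pairwise_map.2 hs) (by
    intro I hI
    obtain ⟨d, hd, h⟩ : ∃ d ∈ l, InRay d (wsum (w ∘ typ) I) ∨ InRay (-d) (wsum (w ∘ typ) I) := by
      have := hc (kappa typ I) (kappa_mono typ (Finset.subset_univ I))
      rw [ktot_kappa] at this
      exact this (mem_wallSets.1 hI)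
    refine List.mem_map.2 ⟨d, hd, ?_⟩
    exact ((inRay_cases hμ hl hs hc hd (mem_wallSets.1 hI)).2 h).symm)
  rw [← List.map_reverse, List.map_map, List.map_map] at h1
  have h2 : ∀ d ∈ l, slopeExp (w ∘ typ) (fun I => plc I (elem (wsum (w ∘ typ) I) (bsum (b ∘ typ) I)))
      (topCoef (w ∘ typ) μ) (slope d) = phi typ (pexp (logSeries w b d)) := by
    intro d hd
    rw [phi_pexp typ (vanish_logSeries w b (hd0 d hd)), phi_logSeries hμ hl hs hc hd]
    rfl
  have h3 : ∀ d ∈ l, slopeExp (w ∘ typ) (fun I => plc I (elem (wsum (w ∘ typ) I) (bsum (b ∘ typ) I)))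
      (botCoef (w ∘ typ) μ) (slope d) = phi typ (pexp (-logSeries w b (-d))) := by
    intro d hd
    rw [phi_pexp typ (vanish_logSeries w b (neg_ne_zero.2 (hd0 d hd))).neg,
      phi_neg_logSeries hμ hl hs hc hd]
    rfl
  have h4 : phi typ (l.map fun d => pexp (logSeries w b d)).prod
      = phi typ (l.reverse.map fun d => pexp (-logSeries w b (-d))).prod := by
    rw [map_list_prod, map_list_prod, List.map_map, List.map_map]
    refine Eq.trans (congrArg _ ?_) (h1.trans (congrArg _ ?_))
    · exact List.map_congr_left fun d hd => (h2 d hd).symm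
    · exact List.map_congr_left fun d hd => h3 d (List.mem_reverse.1 hd)
  rw [map_mul, h4, ← map_mul, pexp_prod_neg (fun d => logSeries w b (-d)) l fun d hd =>
    vanish_logSeries w b (neg_ne_zero.2 (hd0 d hd)), map_one]

end Local

/-- The product of the functions of the consistent family around the origin is trivial. -/
theorem coeff_logSeries_prod {w : σ → Lat} {b : σ → K} (hw : ∀ s, w s ≠ 0)
    (hb : ∀ s t, b s * b t = b t * b s) {l : List Lat} (hl : ∀ d ∈ l, 0 < yy d)
    (hs : l.Pairwise fun d d' => slope d < slope d') (k : σ →₀ ℕ)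
    (hc : ∀ j ≤ k, ktot w j ≠ 0 → ∃ d ∈ l, InRay d (ktot w j) ∨ InRay (-d) (ktot w j)) :
    coeff k ((l.map fun d => pexp (logSeries w b (-d))).prod *
      (l.map fun d => pexp (logSeries w b d)).prod) = coeff k 1 := by
  obtain ⟨N, typ, rfl⟩ := exists_kappa_eq k
  obtain ⟨μ, hμ⟩ := exists_generic (w := w ∘ typ) fun r => hw (typ r)
  refine coeff_eq_of_phi_eq typ ?_
  rw [phi_consistent hμ hl hs hc hb, map_one]

end LogSeries

/-! ### Specialization of the variables -/

section Specialize

open MvPowerSeries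

variable {n : ℕ} {A : Type} [Ring A] [Algebra ℂ A]

/-- The degree in the variables `t` of a monomial in the variables `s_{i, l}`, `l = j + 1`, where
`s_{i, l}` has the degree of `t_i^l`. -/
def wt : ((Fin n × ℕ) →₀ ℕ) →ₗ[ℕ] (Fin n →₀ ℕ) := ktot fun s => Finsupp.single s.1 (s.2 + 1)

theorem wt_single (s : Fin n × ℕ) (a : ℕ) : wt (Finsupp.single s a) = Finsupp.single s.1 (a * (s.2 + 1)) := by
  rw [wt, Finsupp.linearCombination_single, Finsupp.smul_single, smul_eq_mul]

theorem degree_le_degree_wt (k : (Fin n × ℕ) →₀ ℕ) : k.degree ≤ (wt k).degree := by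
  induction k using Finsupp.induction_linear with
  | zero => simp
  | add f g hf hg => rw [map_add, map_add, map_add]; exact add_le_add hf hg
  | single s a =>
    rw [wt_single, Finsupp.degree_single, Finsupp.degree_single]
    exact Nat.le_mul_of_pos_right _ (Nat.succ_pos _)

theorem wt_mono {j k : (Fin n × ℕ) →₀ ℕ} (h : j ≤ k) : wt j ≤ wt k := by
  obtain ⟨c, rfl⟩ := le_iff_exists_add.1 h
  rw [map_add]
  exact le_self_add

theorem mul_le_wt (k : (Fin n × ℕ) →₀ ℕ) (s : Fin n × ℕ) : k s * (s.2 + 1) ≤ wt k s.1 := by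
  have h := wt_mono (Finsupp.single_le_iff.2 (le_refl (k s)) : Finsupp.single s (k s) ≤ k) s.1
  rwa [wt_single, Finsupp.single_eq_same] at h

theorem finite_wt_fiber (P : Fin n →₀ ℕ) : {k : (Fin n × ℕ) →₀ ℕ | wt k = P}.Finite := by
  classical
  let S : Finset (Fin n × ℕ) := Finset.univ ×ˢ Finset.range (P.degree)
  let kmax : (Fin n × ℕ) →₀ ℕ := Finsupp.indicator S fun _ _ => P.degree
  refine (Set.finite_Icc 0 kmax).subset ?_
  rintro k rfl
  refine ⟨fun s => Nat.zero_le _, fun s => ?_⟩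
  by_cases hs : k s = 0
  · rw [hs]; exact Nat.zero_le _
  · have h1 := mul_le_wt k s
    have h2 : wt k s.1 ≤ (wt k).degree := Finsupp.le_degree s.1 _
    have h3 : s.2 + 1 ≤ k s * (s.2 + 1) := Nat.le_mul_of_pos_left _ (Nat.pos_of_ne_zero hs)
    have h4 : k s ≤ k s * (s.2 + 1) := Nat.le_mul_of_pos_right _ (Nat.succ_pos _)
    have h5 : s ∈ S := Finset.mem_product.2 ⟨Finset.mem_univ _, Finset.mem_range.2 (by omega)⟩
    rw [Finsupp.indicator_of_mem h5]
    omega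

/-- The monomials in the variables `s_{i, l}` which specialize to the monomial `t^P`. -/
def fiber (P : Fin n →₀ ℕ) : Finset ((Fin n × ℕ) →₀ ℕ) := (finite_wt_fiber P).toFinset

theorem mem_fiber {P : Fin n →₀ ℕ} {k : (Fin n × ℕ) →₀ ℕ} : k ∈ fiber P ↔ wt k = P := by
  simp [fiber]

/-- The value of a monomial at `c`. -/
def cpow {σ : Type} (c : σ → ℂ) (k : σ →₀ ℕ) : ℂ := k.prod fun s a => c s ^ a

theorem cpow_add {σ : Type} (c : σ → ℂ) (j k : σ →₀ ℕ) : cpow c (j + k) = cpow c j * cpow c k := by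
  classical
  exact Finsupp.prod_add_index' (fun s => pow_zero _) fun s a b => pow_add _ _ _

/-- The function underlying the specialization `s_{i, l} ↦ c_{i, l} t_i^l`. -/
def psiFun (c : Fin n × ℕ → ℂ) (F : MvPowerSeries (Fin n × ℕ) A) : MvPowerSeries (Fin n) A :=
  fun P => ∑ k ∈ fiber P, cpow c k • coeff k F

theorem coeff_psiFun (c : Fin n × ℕ → ℂ) (F : MvPowerSeries (Fin n × ℕ) A) (P : Fin n →₀ ℕ) :
    coeff P (psiFun c F) = ∑ k ∈ fiber P, cpow c k • coeff k F := rfl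

/-- The specialization `s_{i, l} ↦ c_{i, l} t_i^l`. -/
def psi (c : Fin n × ℕ → ℂ) : MvPowerSeries (Fin n × ℕ) A →+* MvPowerSeries (Fin n) A where
  toFun := psiFun c
  map_zero' := by
    funext P
    exact Finset.sum_eq_zero fun k _ => by rw [map_zero, smul_zero]
  map_one' := by
    classical
    ext P
    change ∑ k ∈ fiber P, cpow c k • coeff k 1 = _
    rw [coeff_one]
    split_ifs with hP
    · rw [Finset.sum_eq_single 0]
      · simp [cpow]
      · intro k _ hk
        rw [coeff_one, if_neg hk, smul_zero]
      · intro h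
        exact (h (mem_fiber.2 (by rw [hP, map_zero]))).elim
    · refine Finset.sum_eq_zero fun k hk => ?_
      rw [coeff_one, if_neg, smul_zero]
      rintro rfl
      exact hP (by rw [← mem_fiber.1 hk, map_zero])
  map_add' F G := by
    funext P
    change ∑ k ∈ fiber P, cpow c k • coeff k (F + G)
      = ∑ k ∈ fiber P, cpow c k • coeff k F + ∑ k ∈ fiber P, cpow c k • coeff k G
    rw [← Finset.sum_add_distrib]
    exact Finset.sum_congr rfl fun k _ => by rw [map_add, smul_add]
  map_mul' F G := by
    classical
    ext P
    simp only [coeff_mul, coeff_psiFun, Finset.smul_sum, Finset.sum_mul_sum]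
    simp only [← Finset.sum_product', Finset.sum_sigma']
    refine Finset.sum_bij' (fun x _ => ⟨(wt x.2.1, wt x.2.2), x.2⟩) (fun x _ => ⟨x.2.1 + x.2.2, x.2⟩)
      ?_ ?_ ?_ ?_ ?_
    · rintro ⟨k, a, b⟩ h
      simp only [Finset.mem_sigma, mem_fiber, Finset.HasAntidiagonal.mem_antidiagonal,
        Finset.mem_product, and_self, and_true] at h ⊢
      rw [← map_add, h.2, h.1]
    · rintro ⟨Q, a, b⟩ h
      simp only [Finset.mem_sigma, mem_fiber, Finset.HasAntidiagonal.mem_antidiagonal,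
        Finset.mem_product, and_true] at h ⊢
      rw [map_add, h.2.1, h.2.2, h.1]
    · rintro ⟨k, a, b⟩ h
      simp only [Finset.mem_sigma, Finset.HasAntidiagonal.mem_antidiagonal] at h
      simp only [h.2]
    · rintro ⟨⟨Q, Q'⟩, a, b⟩ h
      simp only [Finset.mem_sigma, mem_fiber, Finset.mem_product] at h
      simp only [h.2.1, h.2.2]
    · rintro ⟨k, a, b⟩ h
      simp only [Finset.mem_sigma, Finset.HasAntidiagonal.mem_antidiagonal] at h
      dsimp only
      rw [← h.2, cpow_add, smul_mul_smul_comm]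

theorem coeff_psi (c : Fin n × ℕ → ℂ) (F : MvPowerSeries (Fin n × ℕ) A) (P : Fin n →₀ ℕ) :
    coeff P (psi c F) = ∑ k ∈ fiber P, cpow c k • coeff k F := rfl

theorem Vanish.psi {F : MvPowerSeries (Fin n × ℕ) A} (h : Vanish 1 F) (c : Fin n × ℕ → ℂ) :
    Vanish 1 (psi c F) := by
  rw [vanish_one_iff, coeff_psi]
  refine Finset.sum_eq_zero fun k hk => ?_
  have h1 := degree_le_degree_wt k
  rw [mem_fiber.1 hk, map_zero] at h1
  rw [h k (by omega), smul_zero]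

theorem psi_pexp {F : MvPowerSeries (Fin n × ℕ) A} (h : Vanish 1 F) (c : Fin n × ℕ → ℂ) :
    psi c (pexp F) = pexp (psi c F) := by
  ext P
  rw [coeff_psi, coeff_pexp (h.psi c) (Nat.lt_succ_self _)]
  have h1 : ∀ k ∈ fiber P, cpow c k • coeff k (pexp F) = ∑ j ∈ Finset.range (P.degree + 1),
      ((Nat.factorial j : ℂ)⁻¹) • cpow c k • coeff k (F ^ j) := by
    intro k hk
    have h2 := degree_le_degree_wt k
    rw [mem_fiber.1 hk] at h2
    rw [coeff_pexp h (show k.degree < P.degree + 1 by omega), Finset.smul_sum]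
    exact Finset.sum_congr rfl fun j _ => smul_comm _ _ _
  rw [Finset.sum_congr rfl h1, Finset.sum_comm]
  refine Finset.sum_congr rfl fun j _ => ?_
  rw [← map_pow, coeff_psi, Finset.smul_sum]

variable {K : Type} [Ring K] [Algebra ℂ K]

/-- The vectors `l m_i`, `l = j + 1`. -/
def multVec (m : Fin n → Lat) : Fin n × ℕ → Lat := fun s => (s.2 + 1) • m s.1

theorem ktot_multVec (m : Fin n → Lat) (k : (Fin n × ℕ) →₀ ℕ) :
    ktot (multVec m) k = totalVector m (wt k) := by
  have hadd : ∀ P Q : Fin n →₀ ℕ, totalVector m (P + Q) = totalVector m P + totalVector m Q := by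
    intro P Q
    simp only [totalVector, Finsupp.add_apply, add_smul, Finset.sum_add_distrib]
  induction k using Finsupp.induction_linear with
  | zero => simp [totalVector]
  | add f g hf hg => rw [map_add, map_add, hf, hg, hadd]
  | single s a =>
    rw [wt_single, Finsupp.linearCombination_single, totalVector, Finset.sum_eq_single s.1]
    · rw [Finsupp.single_eq_same, multVec, smul_smul]
    · intro i _ hi
      rw [Finsupp.single_eq_of_ne hi, zero_smul]
    · simp

/-- The consistency of the specialized logarithms. -/
theorem coeff_psi_logSeries_prod {m : Fin n → Lat} (hm : ∀ i, m i ≠ 0) {b : Fin n × ℕ → K}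
    (hb : ∀ s t, b s * b t = b t * b s) (c : Fin n × ℕ → ℂ) {l : List Lat} (hl : ∀ d ∈ l, 0 < yy d)
    (hs : l.Pairwise fun d d' => slope d < slope d') (P : Fin n →₀ ℕ)
    (hc : ∀ Q ≤ P, totalVector m Q ≠ 0 →
      ∃ d ∈ l, InRay d (totalVector m Q) ∨ InRay (-d) (totalVector m Q)) :
    coeff P ((l.map fun d => pexp (psi c (logSeries (multVec m) b (-d)))).prod *
      (l.map fun d => pexp (psi c (logSeries (multVec m) b d))).prod) = coeff P 1 := by
  have hd0 : ∀ d ∈ l, d ≠ 0 := by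
    rintro d hd rfl
    have := hl 0 hd
    simp [yy] at this
  have hw : ∀ s, multVec m s ≠ 0 := by
    intro s h
    rcases smul_eq_zero.1 h with h | h
    · omega
    · exact hm _ h
  have h1 : (l.map fun d => pexp (psi c (logSeries (multVec m) b (-d)))).prod *
      (l.map fun d => pexp (psi c (logSeries (multVec m) b d))).prod
      = psi c ((l.map fun d => pexp (logSeries (multVec m) b (-d))).prod *
        (l.map fun d => pexp (logSeries (multVec m) b d)).prod) := by
    rw [map_mul, map_list_prod, map_list_prod, List.map_map, List.map_map]
    congr 2
    · exact List.map_congr_left fun d hd =>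
        (psi_pexp (vanish_logSeries _ b (neg_ne_zero.2 (hd0 d hd))) c).symm
    · exact List.map_congr_left fun d hd => (psi_pexp (vanish_logSeries _ b (hd0 d hd)) c).symm
  rw [h1, ← map_one (psi c), coeff_psi, coeff_psi]
  refine Finset.sum_congr rfl fun k hk => ?_
  rw [coeff_logSeries_prod hw hb hl hs k fun j hj => ?_]
  rw [ktot_multVec]
  exact hc _ ((wt_mono hj).trans (mem_fiber.1 hk).le)

end Specialize

/-! ### Power series of operators -/

section Operators

open MvPowerSeries

variable {n : ℕ} {K : Type} [Ring K] [Algebra ℂ K]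

/-- The ring of power series with coefficients in the operators on Laurent polynomials. -/
abbrev OpSer (K : Type) [Ring K] [Algebra ℂ K] (n : ℕ) : Type :=
  MvPowerSeries (Fin n) (Module.End ℂ (AddMonoidAlgebra K Lat))

/-- The function underlying the action of power series of operators on series. -/
def opFun (F : OpSer K n) (v : Ser K n) : Ser K n :=
  fun P => ∑ x ∈ Finset.HasAntidiagonal.antidiagonal P, coeff x.1 F (coeff x.2 v)

theorem coeff_opFun (F : OpSer K n) (v : Ser K n) (P : Fin n →₀ ℕ) :
    coeff P (opFun F v) = ∑ x ∈ Finset.HasAntidiagonal.antidiagonal P, coeff x.1 F (coeff x.2 v) := rfl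

/-- The action of power series of operators on series. -/
def op : OpSer K n →+* Module.End ℂ (Ser K n) where
  toFun F :=
    { toFun := opFun F
      map_add' := fun v v' => by
        ext1 P
        simp only [map_add, coeff_opFun, Finset.sum_add_distrib]
      map_smul' := fun c v => by
        ext1 P
        rw [coeff_opFun]
        change _ = c • coeff P (opFun F v)
        rw [coeff_opFun, Finset.smul_sum]
        exact Finset.sum_congr rfl fun x _ => map_smul (coeff x.1 F) c (coeff x.2 v) }
  map_zero' := by
    ext1 v
    ext1 P
    exact Finset.sum_eq_zero fun x _ => rfl
  map_one' := by
    classical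
    ext1 v
    ext1 P
    change coeff P (opFun 1 v) = coeff P v
    rw [coeff_opFun, Finset.sum_eq_single (0, P)]
    · rw [coeff_zero_one]; rfl
    · intro x hx hne
      rw [coeff_one, if_neg]
      · rfl
      · intro h
        rw [Finset.HasAntidiagonal.mem_antidiagonal, h, zero_add] at hx
        exact hne (Prod.ext h hx)
    · intro h
      exact (h (Finset.HasAntidiagonal.mem_antidiagonal.2 (zero_add P))).elim
  map_add' F G := by
    ext1 v
    ext1 P
    change coeff P (opFun (F + G) v) = coeff P (opFun F v + opFun G v)
    simp only [map_add, coeff_opFun, LinearMap.add_apply, Finset.sum_add_distrib]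
  map_mul' F G := by
    classical
    ext1 v
    ext1 P
    change coeff P (opFun (F * G) v) = coeff P (opFun F (opFun G v))
    simp only [coeff_opFun, coeff_mul, LinearMap.sum_apply, map_sum, Module.End.mul_apply]
    rw [Finset.sum_sigma', Finset.sum_sigma']
    refine Finset.sum_nbij' (fun ⟨⟨_i, j⟩, ⟨k, l⟩⟩ ↦ ⟨(k, l + j), (l, j)⟩)
      (fun ⟨⟨i, _j⟩, ⟨k, l⟩⟩ ↦ ⟨(i + k, l), (i, k)⟩) ?_ ?_ ?_ ?_ ?_
    · rintro ⟨⟨i, j⟩, k, l⟩ h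
      simp only [Finset.mem_sigma, Finset.HasAntidiagonal.mem_antidiagonal] at h ⊢
      rw [← h.1, ← h.2, add_assoc]
      exact ⟨rfl, trivial⟩
    · rintro ⟨⟨i, j⟩, k, l⟩ h
      simp only [Finset.mem_sigma, Finset.HasAntidiagonal.mem_antidiagonal] at h ⊢
      rw [← h.1, ← h.2, add_assoc]
      exact ⟨rfl, trivial⟩
    · rintro ⟨⟨i, j⟩, k, l⟩ h
      simp only [Finset.mem_sigma, Finset.HasAntidiagonal.mem_antidiagonal] at h
      simp only [h.2]
    · rintro ⟨⟨i, j⟩, k, l⟩ h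
      simp only [Finset.mem_sigma, Finset.HasAntidiagonal.mem_antidiagonal] at h
      simp only [h.2]
    · rintro ⟨⟨i, j⟩, k, l⟩ h
      rfl

theorem coeff_op (F : OpSer K n) (v : Ser K n) (P : Fin n →₀ ℕ) :
    coeff P (op F v) = ∑ x ∈ Finset.HasAntidiagonal.antidiagonal P, coeff x.1 F (coeff x.2 v) := rfl

theorem coeff_op_C (F : OpSer K n) (u : AddMonoidAlgebra K Lat) (P : Fin n →₀ ℕ) :
    coeff P (op F (C u)) = coeff P F u := by
  rw [coeff_op, Finset.sum_eq_single (P, 0)]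
  · rw [coeff_zero_C]
  · intro x hx hne
    rw [coeff_C, if_neg, map_zero]
    intro h
    rw [Finset.HasAntidiagonal.mem_antidiagonal, h, add_zero] at hx
    exact hne (Prod.ext hx h)
  · intro h
    exact (h (Finset.HasAntidiagonal.mem_antidiagonal.2 (add_zero P))).elim

theorem sexp_op {F : OpSer K n} (hF : Vanish 1 F) : sexp (op F) = op (pexp F) := by
  ext1 v
  ext1 P
  change ∑ j ∈ Finset.range (P.degree + 1), ((Nat.factorial j : ℂ)⁻¹) •
    coeff P ((op F ^ j) v) = _
  have h1 : ∀ x ∈ Finset.HasAntidiagonal.antidiagonal P, coeff x.1 (pexp F) (coeff x.2 v)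
      = ∑ j ∈ Finset.range (P.degree + 1), ((Nat.factorial j : ℂ)⁻¹) •
        coeff x.1 (F ^ j) (coeff x.2 v) := by
    intro x hx
    have h2 := congrArg Finsupp.degree (Finset.HasAntidiagonal.mem_antidiagonal.1 hx)
    rw [map_add] at h2
    rw [coeff_pexp hF (show x.1.degree < P.degree + 1 by omega), LinearMap.sum_apply]
    rfl
  rw [coeff_op, Finset.sum_congr rfl h1, Finset.sum_comm]
  refine Finset.sum_congr rfl fun j _ => ?_
  rw [← map_pow, coeff_op, Finset.smul_sum]

/-- The series of operators of the element `(B, g ∂_q)`. -/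
def actSer (B : Ser K n) (g : Ser ℂ n) (q : Lat) : OpSer K n := fun P =>
  LinearMap.mulLeft ℂ (coeff P B) + LinearMap.mulLeft ℂ (coeff P (scal (K := K) g)) * dLaurent q

theorem coeff_actSer (B : Ser K n) (g : Ser ℂ n) (q : Lat) (P : Fin n →₀ ℕ)
    (u : AddMonoidAlgebra K Lat) :
    coeff P (actSer B g q) u = coeff P B * u + coeff P (scal (K := K) g) * dLaurent q u := rfl

theorem act_eq_op (B : Ser K n) (g : Ser ℂ n) (q : Lat) : act B g q = op (actSer B g q) := by
  ext1 v
  ext1 P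
  rw [coeff_op]
  simp only [coeff_actSer, Finset.sum_add_distrib]
  change coeff P (B * v + scal g * dSer q v) = _
  rw [map_add, coeff_mul, coeff_mul]
  rfl

theorem coeff_scal (g : Ser ℂ n) (P : Fin n →₀ ℕ) (q : Lat) :
    (coeff P (scal (K := K) g)).coeff q = algebraMap ℂ K ((coeff P g).coeff q) := by
  rw [scal, coeff_map]
  rfl

end Operators

/-! ### The logarithms of the initial walls -/

section InitialLogs

open MvPowerSeries

variable {n : ℕ} {K : Type} [Ring K] [Algebra ℂ K]

/-- The series `∑_{j ≥ 1} (-1)^(j-1)/j β_j t_i^j z^(j m)`. -/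
def logMono (β : ℕ → K) (i : Fin n) (m : Lat) : Ser K n := fun P =>
  ∑ j ∈ Finset.Icc 1 P.degree, if P = Finsupp.single i j then
    ((-1 : ℂ) ^ (j - 1) / (j : ℂ)) • AddMonoidAlgebra.single (j • m) (β j) else 0

theorem coeff_logMono (β : ℕ → K) (i : Fin n) (m : Lat) (P : Fin n →₀ ℕ) :
    coeff P (logMono β i m) = ∑ j ∈ Finset.Icc 1 P.degree, if P = Finsupp.single i j then
      ((-1 : ℂ) ^ (j - 1) / (j : ℂ)) • AddMonoidAlgebra.single (j • m) (β j) else 0 := rfl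

theorem coeff_logMono_single (β : ℕ → K) (i : Fin n) (m : Lat) (j : ℕ) :
    coeff (Finsupp.single i (j + 1)) (logMono β i m) = ((-1 : ℂ) ^ j / ((j : ℂ) + 1)) •
      AddMonoidAlgebra.single ((j + 1) • m) (β (j + 1)) := by
  rw [coeff_logMono, Finset.sum_eq_single (j + 1)]
  · rw [if_pos rfl, Nat.add_sub_cancel, Nat.cast_succ]
  · intro l _ hl
    rw [if_neg]
    intro h
    exact hl (Finsupp.single_injective i h).symm
  · intro h
    exact (h (by simp)).elim

theorem coeff_logMono_of_ne (β : ℕ → K) (i : Fin n) (m : Lat) {P : Fin n →₀ ℕ}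
    (h : ∀ j, P ≠ Finsupp.single i (j + 1)) : coeff P (logMono β i m) = 0 := by
  rw [coeff_logMono]
  refine Finset.sum_eq_zero fun j hj => if_neg ?_
  obtain ⟨l, rfl⟩ := Nat.exists_eq_add_of_le' (Finset.mem_Icc.1 hj).1
  exact h l

theorem mono_pow (a : K) (P : Fin n →₀ ℕ) (p : Lat) (j : ℕ) :
    (mono a P p : Ser K n) ^ j = mono (a ^ j) (j • P) (j • p) := by
  induction j with
  | zero => simp [mono]; rfl
  | succ j ih => rw [pow_succ, ih, mono_mul, pow_succ, succ_nsmul, succ_nsmul]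

theorem slog_one_add_mono (a : K) (i : Fin n) (m : Lat) :
    slog (1 + mono a (Finsupp.single i 1) m) = logMono (fun j => a ^ j) i m := by
  classical
  ext1 P
  change ∑ j ∈ Finset.Icc 1 P.degree, _ = _
  rw [coeff_logMono]
  refine Finset.sum_congr rfl fun j _ => ?_
  rw [add_sub_cancel_left, mono_pow, mono, coeff_monomial, Finsupp.smul_single, smul_eq_mul, mul_one]
  split_ifs
  · rfl
  · exact smul_zero _

theorem logMono_zero (i : Fin n) (m : Lat) : logMono (0 : ℕ → K) i m = 0 := by
  ext1 P
  rw [coeff_logMono]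
  refine Finset.sum_eq_zero fun j _ => ?_
  split_ifs <;> simp

/-- The logarithm of the function of an initial line, as a series of operators. -/
def initSer (m : Fin n → Lat) (β : Fin n → ℕ → K) (i : Fin n) : OpSer K n :=
  actSer (logMono (β i) i (m i)) (logMono 1 i (m i)) (normal (m i))

/-- The scalars `c_{i, l} = (-1)^(l-1)/l^2`. -/
def multScalar (s : Fin n × ℕ) : ℂ := (-1) ^ s.2 / ((s.2 : ℂ) + 1) ^ 2

/-- The elements `l β_{i, l}`. -/
def multElem (β : Fin n → ℕ → K) (s : Fin n × ℕ) : K := (s.2 + 1) • β s.1 (s.2 + 1)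

theorem coeff_initSer_single (m : Fin n → Lat) (β : Fin n → ℕ → K) (i : Fin n) (j : ℕ) :
    coeff (Finsupp.single i (j + 1)) (initSer m β i)
      = multScalar (i, j) • elem (multVec m (i, j)) (multElem β (i, j)) := by
  refine end_ext fun q κ => ?_
  rw [initSer, coeff_actSer, coeff_logMono_single]
  have h1 : coeff (Finsupp.single i (j + 1)) (scal (K := K) (logMono 1 i (m i)))
      = ((-1 : ℂ) ^ j / ((j : ℂ) + 1)) • AddMonoidAlgebra.single ((j + 1) • m i) 1 := by
    rw [scal, coeff_map, coeff_logMono_single, AddMonoidAlgebra.smul_single, Pi.one_apply,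
      AddMonoidAlgebra.mapRingHom_single, AddMonoidAlgebra.smul_single, smul_eq_mul, mul_one,
      Algebra.algebraMap_eq_smul_one]
  have h2 : ((j : ℂ) + 1) ≠ 0 := Nat.cast_add_one_ne_zero j
  rw [h1, dLaurent_single, pairing_normal, LinearMap.smul_apply, elem_single, smul_mul_assoc,
    smul_mul_assoc, mul_smul_comm, AddMonoidAlgebra.single_mul_single,
    AddMonoidAlgebra.single_mul_single, one_mul, ← smul_add, AddMonoidAlgebra.smul_single,
    ← AddMonoidAlgebra.single_add, AddMonoidAlgebra.smul_single, AddMonoidAlgebra.smul_single]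
  congr 1
  have h3 : wedge (multVec m (i, j)) q = (j + 1 : ℕ) * wedge (m i) q := by
    change ((j + 1) • (m i).1) * q.2 - ((j + 1) • (m i).2) * q.1 = _
    rw [wedge, nsmul_eq_mul, nsmul_eq_mul]
    ring
  have h4 : multElem β (i, j) * κ + wedge (multVec m (i, j)) q • κ
      = ((j : ℂ) + 1) • (β i (j + 1) * κ + wedge (m i) q • κ) := by
    rw [h3, mul_smul, smul_add, multElem, ← Nat.cast_succ, Nat.cast_smul_eq_nsmul,
      Nat.cast_smul_eq_nsmul, smul_mul_assoc, Nat.cast_smul_eq_nsmul]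
  rw [h4, smul_smul, multScalar]
  congr 1
  field_simp

theorem coeff_initSer_of_ne (m : Fin n → Lat) (β : Fin n → ℕ → K) (i : Fin n) {P : Fin n →₀ ℕ}
    (h : ∀ j, P ≠ Finsupp.single i (j + 1)) : coeff P (initSer m β i) = 0 := by
  refine LinearMap.ext fun u => ?_
  rw [initSer, coeff_actSer, coeff_logMono_of_ne _ _ _ h, scal, coeff_map,
    coeff_logMono_of_ne _ _ _ h, map_zero, zero_mul, zero_mul, add_zero]
  rfl

end InitialLogs

/-! ### Splitting off the initial lines -/

section Splitting

open MvPowerSeries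

theorem exists_eq_single_of_degree_eq_one {σ : Type} {k : σ →₀ ℕ} (h : k.degree = 1) :
    ∃ s, k = Finsupp.single s 1 := by
  classical
  obtain ⟨s, hs⟩ : ∃ s, k s ≠ 0 := by
    by_contra! h'
    rw [show k = 0 from Finsupp.ext h', map_zero] at h
    omega
  have h1 : Finsupp.single s 1 ≤ k := Finsupp.single_le_iff.2 (Nat.one_le_iff_ne_zero.2 hs)
  obtain ⟨c, rfl⟩ := le_iff_exists_add.1 h1
  rw [map_add, Finsupp.degree_single] at h
  have h2 : c = 0 := (Finsupp.degree_eq_zero_iff _).1 (by omega)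
  exact ⟨s, by rw [h2, add_zero]⟩

theorem IsPrimitive.ne_zero {p : Lat} (hp : IsPrimitive p) : p ≠ 0 := by
  rintro rfl
  simp [IsPrimitive] at hp

theorem IsPrimitive.neg {p : Lat} (hp : IsPrimitive p) : IsPrimitive (-p) := by
  simpa [IsPrimitive] using hp

theorem IsPrimitive.eq_of_nsmul_eq {p q : Lat} (hp : IsPrimitive p) (hq : IsPrimitive q) {l l' : ℕ}
    (hl : 1 ≤ l) (h : l • p = l' • q) : l = l' ∧ p = q := by
  have h1 : ((l : ℤ) * p.1 = l' * q.1) := by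
    have := congrArg Prod.fst h
    simpa using this
  have h2 : ((l : ℤ) * p.2 = l' * q.2) := by
    have := congrArg Prod.snd h
    simpa using this
  have h3 : l = l' := by
    have h4 : Int.gcd (l * p.1) (l * p.2) = l := by
      rw [Int.gcd_mul_left, hp]; simp
    have h5 : Int.gcd (l' * q.1) (l' * q.2) = l' := by
      rw [Int.gcd_mul_left, hq]; simp
    rw [← h4, h1, h2, h5]
  subst h3
  have hl0 : (l : ℤ) ≠ 0 := by omega
  exact ⟨rfl, Prod.ext (mul_left_cancel₀ hl0 h1) (mul_left_cancel₀ hl0 h2)⟩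

theorem IsPrimitive.inRay_nsmul {d p : Lat} (hd : IsPrimitive d) (hp : IsPrimitive p) {l : ℕ}
    (hl : 1 ≤ l) : InRay d (l • p) ↔ p = d := by
  constructor
  · rintro ⟨l', hl', h⟩
    exact (hp.eq_of_nsmul_eq hd hl h).2
  · rintro rfl
    exact ⟨l, hl, rfl⟩

theorem InRay.eq_of_prim {d d' p : Lat} (h : InRay d p) (h' : InRay d' p) (hd : IsPrimitive d)
    (hd' : IsPrimitive d') : d = d' := by
  obtain ⟨l, hl, rfl⟩ := h
  exact (hd'.inRay_nsmul hd hl).1 h'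

theorem commute_of_coeff {σ A : Type} [Ring A] {F G : MvPowerSeries σ A}
    (h : ∀ j k, Commute (coeff j F) (coeff k G)) : Commute F G := by
  classical
  ext k
  rw [coeff_mul, coeff_mul]
  refine Eq.trans ?_ (Finsupp.sum_antidiagonal_swap k fun a b => coeff a G * coeff b F).symm
  exact Finset.sum_congr rfl fun x _ => h _ _

variable {K : Type} [Ring K] [Algebra ℂ K]

theorem commute_elem {p p' : Lat} {b b' : K} (hp : wedge p p' = 0) (hb : b * b' = b' * b) :
    Commute (elem p b) (elem p' b') := by
  have h := elem_commutator p p' b b' hb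
  rw [hp, zero_smul] at h
  exact sub_eq_zero.1 h

section

variable {σ : Type}

open Classical in
/-- The coefficient of the logarithm of the ray in the direction `d`. -/
def rayCoef (w : σ → Lat) (d : Lat) (k : σ →₀ ℕ) : ℂ :=
  if InRay d (ktot w k) then
    ((countM (k.toMultiset.map w) : ℂ) - if k.degree = 1 then 1 else 0) / kfact k
  else 0

open Classical in
/-- The coefficient of the logarithm of the lines parallel to `d`. -/
def lineCoef (w : σ → Lat) (d : Lat) (k : σ →₀ ℕ) : ℤ :=
  if k.degree = 1 then if InRay d (ktot w k) then 1 else if InRay (-d) (ktot w k) then -1 else 0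
  else 0

theorem kfact_of_degree_eq_one {k : σ →₀ ℕ} (h : k.degree = 1) : kfact k = 1 := by
  rw [kfact]
  refine Finset.prod_eq_one fun s hs => ?_
  have h1 := Finsupp.le_degree s k
  rw [h] at h1
  interval_cases k s <;> rfl

theorem logCoef_eq_add (w : σ → Lat) (d : Lat) (k : σ →₀ ℕ) :
    logCoef w d k = lineCoef w d k + rayCoef w d k := by
  classical
  unfold logCoef lineCoef rayCoef
  by_cases h1 : InRay d (ktot w k)
  · by_cases h2 : k.degree = 1
    · simp [h1, h2, kfact_of_degree_eq_one h2]
    · simp [h1, h2]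
  · by_cases h2 : k.degree = 1
    · by_cases h3 : InRay (-d) (ktot w k) <;> simp [h1, h2, h3]
    · simp [h1, h2]

/-- The logarithm of the ray in the direction `d`. -/
def raySeries (w : σ → Lat) (b : σ → K) (d : Lat) :
    MvPowerSeries σ (Module.End ℂ (AddMonoidAlgebra K Lat)) := fun k =>
  rayCoef w d k • elem (ktot w k) (ktot b k)

/-- The logarithm of the lines parallel to `d`. -/
def lineSeries (w : σ → Lat) (b : σ → K) (d : Lat) :
    MvPowerSeries σ (Module.End ℂ (AddMonoidAlgebra K Lat)) := fun k =>
  lineCoef w d k • elem (ktot w k) (ktot b k)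

theorem coeff_raySeries (w : σ → Lat) (b : σ → K) (d : Lat) (k : σ →₀ ℕ) :
    coeff k (raySeries w b d) = rayCoef w d k • elem (ktot w k) (ktot b k) := rfl

theorem coeff_lineSeries (w : σ → Lat) (b : σ → K) (d : Lat) (k : σ →₀ ℕ) :
    coeff k (lineSeries w b d) = lineCoef w d k • elem (ktot w k) (ktot b k) := rfl

theorem logSeries_eq_add (w : σ → Lat) (b : σ → K) (d : Lat) :
    logSeries w b d = lineSeries w b d + raySeries w b d := by
  ext1 k
  rw [map_add, coeff_logSeries, coeff_raySeries, coeff_lineSeries, logCoef_eq_add, add_smul,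
    Int.cast_smul_eq_zsmul]

theorem vanish_raySeries (w : σ → Lat) (b : σ → K) {d : Lat} (hd : d ≠ 0) :
    Vanish 1 (raySeries w b d) := by
  rw [vanish_one_iff, coeff_raySeries, rayCoef, map_zero, if_neg (not_inRay_zero hd), zero_smul]

theorem vanish_lineSeries (w : σ → Lat) (b : σ → K) (d : Lat) : Vanish 1 (lineSeries w b d) := by
  rw [vanish_one_iff, coeff_lineSeries, lineCoef, if_neg (by simp), zero_smul]

theorem ktot_commute {b : σ → K} (hb : ∀ s t, b s * b t = b t * b s) (j k : σ →₀ ℕ) :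
    ktot b j * ktot b k = ktot b k * ktot b j := by
  have h : ∀ (j : σ →₀ ℕ) (x : K), (∀ s, Commute (b s) x) → Commute (ktot b j) x := by
    intro j x hx
    rw [Finsupp.linearCombination_apply]
    exact Commute.sum_left _ _ _ fun s _ => (hx s).smul_left _
  exact h j _ fun s => (h k _ fun t => hb t s).symm

theorem InRay.wedge_eq_zero {d p : Lat} (h : InRay d p) : wedge d p = 0 := by
  obtain ⟨l, -, rfl⟩ := h
  change d.1 * (l • d.2) - d.2 * (l • d.1) = 0
  rw [nsmul_eq_mul, nsmul_eq_mul]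
  ring

theorem wedge_eq_zero_of_parallel {d p q : Lat} (hd : d ≠ 0) (hp : wedge d p = 0)
    (hq : wedge d q = 0) : wedge p q = 0 := by
  simp only [wedge] at *
  by_cases h1 : d.1 = 0
  · have h2 : d.2 ≠ 0 := fun h2 => hd (Prod.ext h1 h2)
    refine (mul_eq_zero.1 (?_ : d.2 * (p.1 * q.2 - p.2 * q.1) = 0)).resolve_left h2
    linear_combination p.2 * hq - q.2 * hp
  · refine (mul_eq_zero.1 (?_ : d.1 * (p.1 * q.2 - p.2 * q.1) = 0)).resolve_left h1
    linear_combination p.1 * hq - q.1 * hp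

theorem InRay.wedge_eq_zero' {d p : Lat} (h : InRay (-d) p) : wedge d p = 0 := by
  have := h.wedge_eq_zero
  simp only [wedge, Prod.fst_neg, Prod.snd_neg] at this ⊢
  linear_combination -this

theorem commute_lineSeries_raySeries (w : σ → Lat) {b : σ → K} (hb : ∀ s t, b s * b t = b t * b s)
    {d : Lat} (hd : d ≠ 0) : Commute (lineSeries w b d) (raySeries w b d) := by
  classical
  refine commute_of_coeff fun j k => ?_
  rw [coeff_lineSeries, coeff_raySeries]
  by_cases hk : InRay d (ktot w k)
  · by_cases hj : wedge d (ktot w j) = 0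
    · exact ((commute_elem (wedge_eq_zero_of_parallel hd hj hk.wedge_eq_zero)
        (ktot_commute hb j k)).smul_left _).smul_right _
    · rw [lineCoef, if_neg fun h : InRay d _ => hj h.wedge_eq_zero,
        if_neg fun h : InRay (-d) _ => hj h.wedge_eq_zero', ite_self, zero_smul]
      exact Commute.zero_left _
  · rw [rayCoef, if_neg hk, zero_smul]
    exact Commute.zero_right _

end

/-- The sign with which a path around the origin crosses the line `ℝ p` in the half line through
`d`. -/
def crossSign (d p : Lat) : ℤ := if p = d then 1 else if p = -d then -1 else 0

variable {n : ℕ}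

theorem multElem_commute {β : Fin n → ℕ → K} (hβ : ∀ i j l l', β i l * β j l' = β j l' * β i l)
    (s t : Fin n × ℕ) : multElem β s * multElem β t = multElem β t * multElem β s := by
  simp only [multElem, smul_mul_assoc, mul_smul_comm, hβ s.1 t.1]
  rw [smul_comm]

theorem psi_lineSeries {m : Fin n → Lat} (hm : ∀ i, IsPrimitive (m i)) (β : Fin n → ℕ → K) {d : Lat}
    (hd : IsPrimitive d) : psi multScalar (lineSeries (multVec m) (multElem β) d)
      = ∑ i, crossSign d (m i) • initSer m β i := by
  classical
  ext1 P
  rw [coeff_psi, map_sum]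
  have hz : ∀ (z : ℤ) (F : OpSer K n), coeff P (z • F) = z • coeff P F := fun z F => map_zsmul _ _ _
  by_cases hP : ∃ i j, P = Finsupp.single i (j + 1)
  · obtain ⟨i, j, rfl⟩ := hP
    rw [Finset.sum_eq_single (Finsupp.single (i, j) 1), Finset.sum_eq_single i, hz,
      coeff_initSer_single, coeff_lineSeries]
    · have h1 : lineCoef (multVec m) d (Finsupp.single (i, j) 1) = crossSign d (m i) := by
        rw [lineCoef, if_pos (by simp), Finsupp.linearCombination_single, one_smul, multVec,
          crossSign]
        simp only [hd.inRay_nsmul (hm i) (Nat.succ_pos j), hd.neg.inRay_nsmul (hm i) (Nat.succ_pos j)]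
      rw [h1, Finsupp.linearCombination_single, Finsupp.linearCombination_single, one_smul, one_smul,
        cpow, Finsupp.prod_single_index (by simp), pow_one, smul_comm]
    · intro i' _ hi'
      rw [hz, coeff_initSer_of_ne, smul_zero]
      intro j' h
      have := DFunLike.congr_fun h i
      rw [Finsupp.single_eq_same, Finsupp.single_eq_of_ne hi'.symm] at this
      omega
    · simp
    · intro k hk hne
      rw [coeff_lineSeries, lineCoef, if_neg, zero_smul, smul_zero]
      intro h1
      obtain ⟨⟨i', j'⟩, rfl⟩ := exists_eq_single_of_degree_eq_one h1
      rw [mem_fiber, wt_single, one_mul] at hk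
      have h2 := DFunLike.congr_fun hk i
      rw [Finsupp.single_eq_same] at h2
      by_cases hi : i = i'
      · subst hi
        rw [Finsupp.single_eq_same] at h2
        exact hne (by rw [show j' = j by omega])
      · rw [Finsupp.single_eq_of_ne hi] at h2
        omega
    · intro h
      refine (h (mem_fiber.2 ?_)).elim
      rw [wt_single, one_mul]
  · rw [Finset.sum_eq_zero, Finset.sum_eq_zero]
    · intro i _
      rw [hz, coeff_initSer_of_ne, smul_zero]
      exact fun j h => hP ⟨i, j, h⟩
    · intro k hk
      rw [coeff_lineSeries, lineCoef, if_neg, zero_smul, smul_zero]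
      intro h1
      obtain ⟨⟨i', j'⟩, rfl⟩ := exists_eq_single_of_degree_eq_one h1
      rw [mem_fiber, wt_single, one_mul] at hk
      exact hP ⟨i', j', hk.symm⟩

theorem vanish_initSer (m : Fin n → Lat) (β : Fin n → ℕ → K) (i : Fin n) :
    Vanish 1 (initSer m β i) := by
  rw [vanish_one_iff, coeff_initSer_of_ne]
  intro j h
  have := congrArg Finsupp.degree h
  simp at this

theorem commute_initSer {m : Fin n → Lat} {β : Fin n → ℕ → K}
    (hβ : ∀ i j l l', β i l * β j l' = β j l' * β i l) {i j : Fin n} (h : wedge (m i) (m j) = 0) :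
    Commute (initSer m β i) (initSer m β j) := by
  refine commute_of_coeff fun P Q => ?_
  by_cases hP : ∃ l, P = Finsupp.single i (l + 1)
  · by_cases hQ : ∃ l, Q = Finsupp.single j (l + 1)
    · obtain ⟨l, rfl⟩ := hP
      obtain ⟨l', rfl⟩ := hQ
      rw [coeff_initSer_single, coeff_initSer_single]
      refine ((commute_elem ?_ (multElem_commute hβ _ _)).smul_left _).smul_right _
      change ((l + 1) • (m i).1) * ((l' + 1) • (m j).2) - ((l + 1) • (m i).2) * ((l' + 1) • (m j).1) = 0
      simp only [wedge] at h
      simp only [nsmul_eq_mul]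
      linear_combination ((l + 1 : ℕ) : ℤ) * ((l' + 1 : ℕ) : ℤ) * h
    · rw [coeff_initSer_of_ne m β j fun l h => hQ ⟨l, h⟩]
      exact Commute.zero_right _
  · rw [coeff_initSer_of_ne m β i fun l h => hP ⟨l, h⟩]
    exact Commute.zero_left _

/-- The logarithm of the ray in the direction `d`, specialized. -/
def rayLog (m : Fin n → Lat) (β : Fin n → ℕ → K) (d : Lat) : OpSer K n :=
  psi multScalar (raySeries (multVec m) (multElem β) d)

theorem vanish_rayLog (m : Fin n → Lat) (β : Fin n → ℕ → K) {d : Lat} (hd : d ≠ 0) :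
    Vanish 1 (rayLog m β d) :=
  (vanish_raySeries _ _ hd).psi _

/-- The factorization of the specialized functions into those of the lines and of the ray. -/
theorem pexp_psi_logSeries {m : Fin n → Lat} (hm : ∀ i, IsPrimitive (m i)) {β : Fin n → ℕ → K}
    (hβ : ∀ i j l l', β i l * β j l' = β j l' * β i l) {d : Lat} (hd : IsPrimitive d) :
    pexp (psi multScalar (logSeries (multVec m) (multElem β) d)) =
      (((List.finRange n).filter fun i => m i = d ∨ m i = -d).map fun i =>
        pexp (crossSign d (m i) • initSer m β i)).prod * pexp (rayLog m β d) := by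
  rw [logSeries_eq_add, map_add, pexp_add_of_commute ((vanish_lineSeries _ _ _).psi _)
    ((vanish_raySeries _ _ hd.ne_zero).psi _)
    ((commute_lineSeries_raySeries _ (multElem_commute hβ) hd.ne_zero).map (psi multScalar)),
    psi_lineSeries hm β hd]
  congr 1
  have hzs : ∀ (z : ℤ) (F : OpSer K n), Vanish 1 F → Vanish 1 (z • F) := fun z F h P hP => by
    have : coeff P (z • F) = z • coeff P F := map_zsmul _ _ _
    rw [this, h P hP, smul_zero]
  have h1 : ∑ i, crossSign d (m i) • initSer m β i
      = (((List.finRange n).filter fun i => m i = d ∨ m i = -d).map fun i =>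
        crossSign d (m i) • initSer m β i).sum := by
    rw [← List.sum_toFinset _ ((List.nodup_finRange n).filter _)]
    refine (Finset.sum_subset (Finset.subset_univ _) fun i _ hi => ?_).symm
    rw [crossSign, if_neg, if_neg]
    · exact zero_smul ℤ _
    · intro h; exact hi (by simp [h])
    · intro h; exact hi (by simp [h])
  rw [h1, pexp_list_sum, List.map_map]
  · rfl
  · intro x hx
    obtain ⟨i, -, rfl⟩ := List.mem_map.1 hx
    exact hzs _ _ (vanish_initSer m β i)
  · intro x hx y hy
    obtain ⟨i, hi, rfl⟩ := List.mem_map.1 hx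
    obtain ⟨j, hj, rfl⟩ := List.mem_map.1 hy
    have hi' := (List.mem_filter.1 hi).2
    have hj' := (List.mem_filter.1 hj).2
    simp only [decide_eq_true_eq] at hi' hj'
    refine ((commute_initSer hβ ?_).smul_left _).smul_right _
    rcases hi' with h | h <;> rcases hj' with h' | h' <;> rw [h, h'] <;>
      simp only [wedge, Prod.fst_neg, Prod.snd_neg] <;> ring

end Splitting

/-! ### Uniqueness of the rays -/

section Uniqueness

open MvPowerSeries

variable {n : ℕ} {K : Type} [Ring K] [Algebra ℂ K]

/-- The operator shifts the exponents by positive multiples of `d`. -/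
def OpRay (d : Lat) (T : Module.End ℂ (AddMonoidAlgebra K Lat)) : Prop :=
  ∀ (q : Lat) (κ : K) (x : Lat), (T (AddMonoidAlgebra.single q κ)).coeff x ≠ 0 → InRay d (x - q)

theorem opRay_zero (d : Lat) : OpRay d (0 : Module.End ℂ (AddMonoidAlgebra K Lat)) :=
  fun _ _ _ h => (h rfl).elim

theorem OpRay.smul {d : Lat} {T : Module.End ℂ (AddMonoidAlgebra K Lat)} (h : OpRay d T) (c : ℂ) :
    OpRay d (c • T) := by
  intro q κ x hx
  refine h q κ x fun h0 => hx ?_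
  change c • (T (AddMonoidAlgebra.single q κ)).coeff x = 0
  rw [h0, smul_zero]

theorem OpRay.sub {d : Lat} {T T' : Module.End ℂ (AddMonoidAlgebra K Lat)} (h : OpRay d T)
    (h' : OpRay d T') : OpRay d (T - T') := by
  intro q κ x hx
  by_contra hn
  refine hx ?_
  change (T (AddMonoidAlgebra.single q κ)).coeff x - (T' (AddMonoidAlgebra.single q κ)).coeff x = 0
  rw [not_not.1 fun h0 => hn (h q κ x h0), not_not.1 fun h0 => hn (h' q κ x h0), sub_zero]

theorem laurent_coeff_sum {X : Type} (S : Finset X) (f : X → AddMonoidAlgebra K Lat) (x : Lat) :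
    (∑ s ∈ S, f s).coeff x = ∑ s ∈ S, (f s).coeff x := by
  classical
  induction S using Finset.induction_on with
  | empty => simp
  | insert a S ha ih =>
    rw [Finset.sum_insert ha, Finset.sum_insert ha, ← ih]
    rfl

theorem coeff_sum_apply {X : Type} (S : Finset X) (T : X → Module.End ℂ (AddMonoidAlgebra K Lat))
    (v : AddMonoidAlgebra K Lat) (x : Lat) :
    ((∑ s ∈ S, T s) v).coeff x = ∑ s ∈ S, (T s v).coeff x := by
  rw [LinearMap.sum_apply, laurent_coeff_sum]

theorem opRay_sum {X : Type} {d : Lat} (S : Finset X)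
    (T : X → Module.End ℂ (AddMonoidAlgebra K Lat)) (h : ∀ s ∈ S, OpRay d (T s)) :
    OpRay d (∑ s ∈ S, T s) := by
  intro q κ x hx
  rw [coeff_sum_apply] at hx
  obtain ⟨s, hs, h1⟩ := Finset.exists_ne_zero_of_sum_ne_zero hx
  exact h s hs q κ x h1

theorem opRay_elem {d p : Lat} (h : InRay d p) (b : K) : OpRay d (elem p b) := by
  classical
  intro q κ x hx
  rw [elem_single] at hx
  by_cases hq : x = p + q
  · rwa [hq, add_sub_cancel_right]
  · exact (hx (by simp [Ne.symm hq])).elim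

theorem opRay_coeff_rayLog (m : Fin n → Lat) (β : Fin n → ℕ → K) (d : Lat) (P : Fin n →₀ ℕ) :
    OpRay d (coeff P (rayLog m β d)) := by
  classical
  rw [rayLog, coeff_psi]
  refine opRay_sum _ _ fun k _ => OpRay.smul ?_ _
  rw [coeff_raySeries]
  by_cases h : InRay d (ktot (multVec m) k)
  · exact (opRay_elem h _).smul _
  · rw [rayCoef, if_neg h, zero_smul]
    exact opRay_zero d

/-- The exponents of the monomials of the series are positive multiples of `d`. -/
def SerRay (d : Lat) (F : Ser K n) : Prop := ∀ P q, (coeff P F).coeff q ≠ 0 → InRay d q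

theorem SerRay.mul {d : Lat} {F G : Ser K n} (hF : SerRay d F) (hG : SerRay d G) :
    SerRay d (F * G) := by
  classical
  intro P q hq
  rw [coeff_mul] at hq
  rw [laurent_coeff_sum] at hq
  obtain ⟨x, -, hx⟩ := Finset.exists_ne_zero_of_sum_ne_zero hq
  have h2 := AddMonoidAlgebra.support_coeff_mul_subset (coeff x.1 F) (coeff x.2 G) (Finsupp.mem_support_iff.2 hx)
  obtain ⟨a, ha, b, hb, rfl⟩ := Finset.mem_add.1 h2
  obtain ⟨l, hl, rfl⟩ := hF x.1 a (Finsupp.mem_support_iff.1 ha)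
  obtain ⟨l', hl', rfl⟩ := hG x.2 b (Finsupp.mem_support_iff.1 hb)
  exact ⟨l + l', by omega, (add_smul _ _ _).symm⟩

theorem SerRay.slog {d : Lat} {F : Ser K n} (hF : SerRay d (F - 1)) : SerRay d (slog F) := by
  classical
  have hpow : ∀ j, SerRay d ((F - 1) ^ (j + 1)) := by
    intro j
    induction j with
    | zero => rwa [zero_add, pow_one]
    | succ j ih => rw [pow_succ]; exact ih.mul hF
  intro P q hq
  change (∑ j ∈ Finset.Icc 1 P.degree, ((-1 : ℂ) ^ (j - 1) / (j : ℂ)) •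
    coeff P ((F - 1) ^ j)).coeff q ≠ 0 at hq
  rw [laurent_coeff_sum] at hq
  obtain ⟨j, hj, hx⟩ := Finset.exists_ne_zero_of_sum_ne_zero hq
  obtain ⟨l, rfl⟩ := Nat.exists_eq_add_of_le' (Finset.mem_Icc.1 hj).1
  refine hpow l P q fun h0 => hx ?_
  change ((-1 : ℂ) ^ (l + 1 - 1) / ((l + 1 : ℕ) : ℂ)) • (coeff P ((F - 1) ^ (l + 1))).coeff q = 0
  rw [h0, smul_zero]

theorem coeff_zero_slog (F : Ser K n) : coeff 0 (slog F) = 0 := by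
  change ∑ j ∈ Finset.Icc 1 (0 : Fin n →₀ ℕ).degree,
    ((-1 : ℂ) ^ (j - 1) / (j : ℂ)) • coeff 0 ((F - 1) ^ j) = 0
  rw [map_zero, Finset.Icc_eq_empty (by omega), Finset.sum_empty]

theorem opRay_coeff_actSer {d : Lat} {B : Ser K n} {g : Ser ℂ n} (hB : SerRay d B)
    (hg : SerRay d g) (q : Lat) (P : Fin n →₀ ℕ) : OpRay d (coeff P (actSer B g q)) := by
  intro x κ y hy
  rw [coeff_actSer, dLaurent_single, AddMonoidAlgebra.smul_single] at hy
  by_contra hn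
  refine hy ?_
  have h1 : (coeff P B).coeff (y - x) = 0 := not_not.1 fun h => hn (hB P _ h)
  have h2 : (coeff P (scal (K := K) g)).coeff (y - x) = 0 := by
    rw [coeff_scal, not_not.1 fun h => hn (hg P _ h), map_zero]
  change (coeff P B * _).coeff y + (coeff P (scal (K := K) g) * _).coeff y = 0
  rw [AddMonoidAlgebra.coeff_mul_single_apply, AddMonoidAlgebra.coeff_mul_single_apply,
    ← sub_eq_add_neg, h1, h2, zero_mul, zero_mul, add_zero]

theorem vanish_actSer {B : Ser K n} {g : Ser ℂ n} (hB : coeff 0 B = 0) (hg : coeff 0 g = 0)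
    (q : Lat) : Vanish 1 (actSer B g q) := by
  rw [vanish_one_iff]
  refine LinearMap.ext fun u => ?_
  rw [coeff_actSer, hB, scal, coeff_map, hg, map_zero, zero_mul, zero_mul, add_zero]
  rfl

theorem eq_zero_of_sum_opRay_eq_zero {l : List Lat} (hn : l.Nodup) (hp : ∀ d ∈ l, IsPrimitive d)
    {T : Lat → Module.End ℂ (AddMonoidAlgebra K Lat)} (hT : ∀ d ∈ l, OpRay d (T d))
    (h : (l.map T).sum = 0) : ∀ d ∈ l, T d = 0 := by
  classical
  intro d hd
  refine end_ext fun q κ => ?_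
  ext x
  by_contra hne
  have hray := hT d hd q κ x hne
  rw [← List.sum_toFinset T hn] at h
  have h1 := coeff_sum_apply l.toFinset T (AddMonoidAlgebra.single q κ) x
  rw [h, Finset.sum_eq_single d] at h1
  · exact hne h1.symm
  · intro d' hd' hdd
    by_contra h2
    have hd'' := List.mem_toFinset.1 hd'
    exact hdd ((hT d' hd'' q κ x h2).eq_of_prim hray (hp d' hd'') (hp d hd))
  · intro h2
    exact (h2 (List.mem_toFinset.2 hd)).elim

/-- Ordered products of exponentials determine the logarithms if these are supported on distinct
rays. -/
theorem coeff_eq_of_coeff_prod_eq {N : ℕ} {l : List Lat} (hn : l.Nodup)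
    (hp : ∀ d ∈ l, IsPrimitive d) {U a c : Lat → OpSer K n} (hU : ∀ d ∈ l, coeff 0 (U d) = 1)
    (ha : ∀ d ∈ l, Vanish 1 (a d)) (hc : ∀ d ∈ l, Vanish 1 (c d))
    (haR : ∀ d ∈ l, ∀ P, OpRay d (coeff P (a d))) (hcR : ∀ d ∈ l, ∀ P, OpRay d (coeff P (c d)))
    (h : ∀ P : Fin n →₀ ℕ, P.degree ≤ N → coeff P (l.map fun d => U d * pexp (a d)).prod
      = coeff P (l.map fun d => U d * pexp (c d)).prod) :
    ∀ d ∈ l, ∀ P : Fin n →₀ ℕ, P.degree ≤ N → coeff P (a d) = coeff P (c d) := by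
  have h0 : ∀ d ∈ l, ∀ x, coeff 0 x = 0 → coeff 0 (U d * pexp x) = 1 := by
    intro d hd x hx
    rw [coeff_mul_of_vanish_left (vanish_zero _) (map_zero _), hU d hd,
      coeff_zero_pexp, one_mul]
  have key : ∀ D ≤ N + 1, ∀ d ∈ l, Vanish D (a d - c d) := by
    intro D
    induction D with
    | zero => exact fun _ d _ => vanish_zero _
    | succ D ih =>
      intro hD
      have ih' := ih (by omega)
      have h1 : ∀ d ∈ l, Vanish D (U d * pexp (a d) - U d * pexp (c d)) ∧
          ∀ P : Fin n →₀ ℕ, P.degree = D → coeff P (U d * pexp (a d) - U d * pexp (c d))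
            = coeff P (a d) - coeff P (c d) := by
        intro d hd
        obtain ⟨h2, h3⟩ := pexp_difference (ha d hd) (hc d hd) (ih' d hd)
        rw [← mul_sub]
        refine ⟨by simpa using (vanish_zero (U d)).mul h2, fun P hP => ?_⟩
        rw [coeff_mul_of_vanish_right h2 hP, hU d hd, one_mul, h3 P hP, map_sub]
      obtain ⟨-, h2⟩ := list_prod_difference (D := D) (fun d => U d * pexp (a d))
        (fun d => U d * pexp (c d)) l (fun d hd => h0 d hd _ (vanish_one_iff.1 (ha d hd)))
        (fun d hd => h0 d hd _ (vanish_one_iff.1 (hc d hd))) fun d hd => (h1 d hd).1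
      intro d hd P hP
      by_cases hPD : P.degree = D
      · have h3 := h2 P hPD
        rw [map_sub, h P (by omega), sub_self] at h3
        have h4 : (l.map fun d => coeff P (a d) - coeff P (c d)).sum = 0 := by
          rw [h3]
          exact congrArg List.sum (List.map_congr_left fun d hd => ((h1 d hd).2 P hPD).symm)
        rw [map_sub]
        exact eq_zero_of_sum_opRay_eq_zero hn hp (fun d hd => (haR d hd P).sub (hcR d hd P)) h4 d hd
      · exact ih' d hd P (by omega)
  intro d hd P hP
  have := key (N + 1) le_rfl d hd P (by omega)
  rwa [map_sub, sub_eq_zero] at this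

end Uniqueness

/-! ### A circle around the origin -/

section Circle

open Real

/-- A circle around the origin whose starting point has irrational slope. -/
def circlePath (τ : ℝ) : ℝ × ℝ :=
  (cos (2 * π * τ) - √2 * sin (2 * π * τ), √2 * cos (2 * π * τ) + sin (2 * π * τ))

theorem sqrt_two_mul_self : √2 * √2 = (2 : ℝ) := mul_self_sqrt (by norm_num)

theorem circlePath_eq_iff (τ s : ℝ) (d : Lat) : circlePath τ = s • toPlane d ↔
    3 * cos (2 * π * τ) = s * xx d ∧ 3 * sin (2 * π * τ) = s * yy d := by
  have h2 := sqrt_two_mul_self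
  rw [circlePath, toPlane, Prod.smul_mk, Prod.mk.injEq, smul_eq_mul, smul_eq_mul, xx, yy]
  constructor
  · rintro ⟨h, h'⟩
    constructor
    · linear_combination h + √2 * h' - cos (2 * π * τ) * h2
    · linear_combination h' - √2 * h - sin (2 * π * τ) * h2
  · rintro ⟨h, h'⟩
    constructor
    · linear_combination h / 3 - √2 * h' / 3 + (s * d.1 / 3) * h2
    · linear_combination h' / 3 + √2 * h / 3 + (s * d.2 / 3) * h2

theorem circlePath_ne_zero (τ : ℝ) : circlePath τ ≠ 0 := by
  intro h
  have h1 := (circlePath_eq_iff τ 0 0).1 (by rw [h, zero_smul])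
  have h2 := sin_sq_add_cos_sq (2 * π * τ)
  rw [zero_mul, zero_mul] at h1
  nlinarith [h1.1, h1.2]

theorem hasDerivAt_circlePath (τ : ℝ) : HasDerivAt circlePath
    (2 * π * (-sin (2 * π * τ) - √2 * cos (2 * π * τ)),
      2 * π * (-√2 * sin (2 * π * τ) + cos (2 * π * τ))) τ := by
  have h0 : HasDerivAt (fun τ : ℝ => 2 * π * τ) (2 * π) τ := by
    simpa using (hasDerivAt_id τ).const_mul (2 * π)
  have hc := h0.cos
  have hs := h0.sin
  refine HasDerivAt.prodMk ?_ ?_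
  · exact (hc.sub (hs.const_mul √2)).congr_deriv (by ring)
  · exact ((hc.const_mul √2).add hs).congr_deriv (by ring)

theorem deriv_circlePath_ne_zero (τ : ℝ) : deriv circlePath τ ≠ 0 := by
  rw [(hasDerivAt_circlePath τ).deriv]
  intro h
  have h1 := congrArg Prod.fst h
  have h2 := congrArg Prod.snd h
  simp only [Prod.fst_zero, Prod.snd_zero, mul_eq_zero, pi_ne_zero, or_false, OfNat.ofNat_ne_zero,
    false_or] at h1 h2
  have h3 := sin_sq_add_cos_sq (2 * π * τ)
  have h4 := sqrt_two_mul_self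
  have h5 : 3 * sin (2 * π * τ) = 0 := by
    linear_combination -h1 - √2 * h2 - sin (2 * π * τ) * h4
  have h6 : 3 * cos (2 * π * τ) = 0 := by
    linear_combination h2 - √2 * h1 - cos (2 * π * τ) * h4
  nlinarith

variable {r n : ℕ}

theorem crossingSpeed_circlePath {τ s : ℝ} {d : Lat} (h : circlePath τ = s • toPlane d)
    {w : Wall r n} {z : ℤ} (hw : w.dir = z • d) :
    crossingSpeed circlePath τ w = 2 * π * (s * z * ((d.1 : ℝ) ^ 2 + (d.2 : ℝ) ^ 2)) := by
  have h1 := congrArg Prod.fst h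
  have h2 := congrArg Prod.snd h
  simp only [circlePath, toPlane, Prod.smul_mk, smul_eq_mul] at h1 h2
  rw [crossingSpeed, (hasDerivAt_circlePath τ).deriv, normal, hw]
  simp only [Prod.smul_fst, Prod.smul_snd, smul_eq_mul, Int.cast_neg, Int.cast_mul]
  linear_combination 2 * π * z * d.1 * h1 + 2 * π * z * d.2 * h2

/-- The time at which the circle meets the half line through `d`. -/
def crossTime (d : Lat) : ℝ :=
  (π / 2 - arctan (slope d)) / (2 * π) + if 0 < yy d then 0 else 1 / 2

theorem two_pi_mul_crossTime (d : Lat) :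
    2 * π * crossTime d = π / 2 - arctan (slope d) + if 0 < yy d then 0 else π := by
  have := pi_ne_zero
  rw [crossTime]
  split_ifs
  · rw [add_zero, add_zero]
    field_simp
  · field_simp

theorem crossTime_mem (d : Lat) : crossTime d ∈ Set.Ioo (0 : ℝ) 1 := by
  have h1 := two_pi_mul_crossTime d
  have h2 := arctan_lt_pi_div_two (slope d)
  have h3 := neg_pi_div_two_lt_arctan (slope d)
  have hp := pi_pos
  constructor
  · by_contra! h
    have : 2 * π * crossTime d ≤ 0 := by nlinarith
    split_ifs at h1 <;> linarith
  · by_contra! h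
    have : 2 * π ≤ 2 * π * crossTime d := by nlinarith
    split_ifs at h1 <;> linarith

theorem exists_circlePath_crossTime {d : Lat} (hd : d ≠ 0) :
    ∃ s : ℝ, 0 < s ∧ circlePath (crossTime d) = s • toPlane d := by
  have hy := yy_ne_zero hd
  have hc := cos_arctan_pos (slope d)
  have hsin : sin (arctan (slope d)) * yy d = cos (arctan (slope d)) * xx d := by
    have h1 := tan_mul_cos hc.ne'
    rw [tan_arctan, slope] at h1
    rw [slope, ← h1]
    field_simp
  by_cases h : 0 < yy d
  · refine ⟨3 * cos (arctan (slope d)) / yy d, by positivity, ?_⟩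
    rw [circlePath_eq_iff, two_pi_mul_crossTime, if_pos h, add_zero, cos_pi_div_two_sub,
      sin_pi_div_two_sub]
    constructor
    · field_simp
      linear_combination hsin
    · field_simp
  · have h' : 0 < -yy d := by
      rcases lt_or_gt_of_ne hy with h1 | h1
      · linarith
      · exact (h h1).elim
    refine ⟨3 * cos (arctan (slope d)) / -yy d, by positivity, ?_⟩
    rw [circlePath_eq_iff, two_pi_mul_crossTime, if_neg h, cos_add_pi, sin_add_pi,
      cos_pi_div_two_sub, sin_pi_div_two_sub]
    constructor
    · field_simp
      linear_combination -hsin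
    · field_simp

theorem eq_crossTime {d : Lat} (hd : d ≠ 0) {τ s : ℝ} (hτ : τ ∈ Set.Ioo (0 : ℝ) 1) (hs : 0 ≤ s)
    (h : circlePath τ = s • toPlane d) : τ = crossTime d := by
  obtain ⟨s', hs', h'⟩ := exists_circlePath_crossTime hd
  obtain ⟨h1, h2⟩ := (circlePath_eq_iff _ _ _).1 h
  obtain ⟨h1', h2'⟩ := (circlePath_eq_iff _ _ _).1 h'
  have e1 := sin_sq_add_cos_sq (2 * π * τ)
  have e2 := sin_sq_add_cos_sq (2 * π * crossTime d)
  have hyy := yy_ne_zero hd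
  have hpos : 0 < xx d ^ 2 + yy d ^ 2 := by positivity
  have h3 : s ^ 2 = s' ^ 2 := by
    have : (s ^ 2 - s' ^ 2) * (xx d ^ 2 + yy d ^ 2) = 0 := by
      have a1 : s ^ 2 * (xx d ^ 2 + yy d ^ 2) = 9 := by
        rw [mul_add, ← mul_pow, ← mul_pow, ← h1, ← h2]; linear_combination 9 * e1
      have a2 : s' ^ 2 * (xx d ^ 2 + yy d ^ 2) = 9 := by
        rw [mul_add, ← mul_pow, ← mul_pow, ← h1', ← h2']; linear_combination 9 * e2
      rw [sub_mul, a1, a2, sub_self]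
    exact sub_eq_zero.1 ((mul_eq_zero.1 this).resolve_right hpos.ne')
  have h4 : s = s' := (pow_left_inj₀ hs hs'.le two_ne_zero).1 h3
  subst h4
  have hcos : cos (2 * π * τ) = cos (2 * π * crossTime d) := by linarith
  have hsin : sin (2 * π * τ) = sin (2 * π * crossTime d) := by linarith
  have h5 : cos (2 * π * τ - 2 * π * crossTime d) = 1 := by
    rw [cos_sub, hcos, hsin]; linear_combination e2
  have hm := crossTime_mem d
  have hp := pi_pos
  have h6 := (cos_eq_one_iff_of_lt_of_lt (by nlinarith [hτ.1, hm.2]) (by nlinarith [hτ.2, hm.1])).1 h5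
  have h7 : 2 * π * (τ - crossTime d) = 0 := by linear_combination h6
  have h8 := (mul_eq_zero.1 h7).resolve_left (by positivity)
  linarith

theorem circlePath_mem_support_iff (w : Wall r n) {τ : ℝ} (hτ : τ ∈ Set.Ioo (0 : ℝ) 1) :
    circlePath τ ∈ w.support ↔ τ = crossTime w.dir ∨ w.isLine ∧ τ = crossTime (-w.dir) := by
  have hneg : toPlane (-w.dir) = -toPlane w.dir := by simp [toPlane]
  have hd := w.prim.ne_zero
  constructor
  · rintro ⟨s, hs, h⟩
    rcases le_or_gt 0 s with h0 | h0
    · exact Or.inl (eq_crossTime hd hτ h0 h)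
    · refine Or.inr ⟨hs.resolve_right h0.not_ge, ?_⟩
      refine eq_crossTime (neg_ne_zero.2 hd) hτ (neg_nonneg.2 h0.le) ?_
      rw [hneg, smul_neg, neg_smul, neg_neg, h]
  · rintro (rfl | ⟨hl, rfl⟩)
    · obtain ⟨s, hs, h⟩ := exists_circlePath_crossTime hd
      exact ⟨s, Or.inr hs.le, h⟩
    · obtain ⟨s, hs, h⟩ := exists_circlePath_crossTime (neg_ne_zero.2 hd)
      refine ⟨-s, Or.inl hl, ?_⟩
      rw [h, hneg, smul_neg, neg_smul]

theorem crossTime_neg {d : Lat} (hd : 0 < yy d) : crossTime (-d) = crossTime d + 1 / 2 := by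
  rw [crossTime, crossTime, slope_neg, yy_neg, if_pos hd, if_neg (by linarith), add_zero]

theorem crossTime_lt_half {d : Lat} (hd : 0 < yy d) : crossTime d < 1 / 2 := by
  have := (crossTime_mem (-d)).2
  rw [crossTime_neg hd] at this
  linarith

theorem crossTime_lt {d d' : Lat} (hd : 0 < yy d) (hd' : 0 < yy d') (h : slope d < slope d') :
    crossTime d' < crossTime d := by
  have h1 := arctan_strictMono h
  rw [crossTime, crossTime, if_pos hd, if_pos hd', add_zero, add_zero]
  have hp := pi_pos
  gcongr

theorem circlePath_not_mem_support (w : Wall r n) : circlePath 0 ∉ w.support := by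
  rintro ⟨s, -, h⟩
  obtain ⟨h1, h2⟩ := (circlePath_eq_iff _ _ _).1 h
  have hy := yy_ne_zero w.prim.ne_zero
  rw [mul_zero, sin_zero, mul_zero] at h2
  have hs := (mul_eq_zero.1 h2.symm).resolve_right hy
  rw [mul_zero, cos_zero, hs, zero_mul] at h1
  norm_num at h1

theorem norm_sq_pos {d : Lat} (hd : d ≠ 0) : 0 < (d.1 : ℝ) ^ 2 + (d.2 : ℝ) ^ 2 := by
  by_cases h1 : d.1 = 0
  · have h2 : (d.2 : ℝ) ≠ 0 := Int.cast_ne_zero.2 fun h2 => hd (Prod.ext h1 h2)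
    positivity
  · have h2 : (d.1 : ℝ) ≠ 0 := Int.cast_ne_zero.2 h1
    positivity

theorem isGenericLoop_circlePath (D : Set (Wall r n)) : IsGenericLoop D circlePath := by
  refine ⟨?_, ?_, fun τ _ => ⟨circlePath_ne_zero τ, deriv_circlePath_ne_zero τ⟩,
    fun w _ => circlePath_not_mem_support w, fun w _ τ _ hτ => ?_⟩
  · unfold circlePath
    fun_prop
  · simp [circlePath]
  · obtain ⟨s, -, h⟩ := hτ
    rw [crossingSpeed_circlePath h (z := 1) (one_smul ℤ _).symm]
    have hs : s ≠ 0 := by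
      rintro rfl
      exact circlePath_ne_zero τ (by rw [h, zero_smul])
    have := norm_sq_pos w.prim.ne_zero
    have hp := pi_pos
    simp only [Int.cast_one, mul_one]
    positivity

end Circle

/-! ### The path ordered product along the circle -/

section Directions

theorem exists_zsmul_of_wedge_eq_zero {d p : Lat} (hd : IsPrimitive d) (h : wedge d p = 0) :
    ∃ t : ℤ, p = t • d := by
  obtain ⟨u, v, huv⟩ := Int.isCoprime_iff_gcd_eq_one.2 hd
  simp only [wedge] at h
  refine ⟨u * p.1 + v * p.2, Prod.ext ?_ ?_⟩
  · simp only [Prod.smul_fst, smul_eq_mul]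
    linear_combination -p.1 * huv - v * h
  · simp only [Prod.smul_snd, smul_eq_mul]
    linear_combination -p.2 * huv + u * h

theorem IsPrimitive.eq_or_eq_neg {d d' : Lat} (hd : IsPrimitive d) (hd' : IsPrimitive d')
    (h : wedge d d' = 0) : d' = d ∨ d' = -d := by
  obtain ⟨t, rfl⟩ := exists_zsmul_of_wedge_eq_zero hd h
  have h1 : Int.gcd (t * d.1) (t * d.2) = 1 := hd'
  rw [Int.gcd_mul_left, hd, mul_one, Int.natAbs_eq_iff] at h1
  rcases h1 with rfl | rfl
  · left; simp
  · right; simp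

theorem exists_primitive_inRay {p : Lat} (hp : p ≠ 0) : ∃ d, IsPrimitive d ∧ InRay d p := by
  have hg : 0 < Int.gcd p.1 p.2 := by
    rw [Int.gcd_pos_iff]
    by_contra! h
    exact hp (Prod.ext h.1 h.2)
  refine ⟨(p.1 / Int.gcd p.1 p.2, p.2 / Int.gcd p.1 p.2), Int.gcd_ediv_gcd_ediv_gcd hg,
    Int.gcd p.1 p.2, hg, Prod.ext ?_ ?_⟩
  · change _ = Int.gcd p.1 p.2 • (p.1 / (Int.gcd p.1 p.2 : ℤ))
    rw [nsmul_eq_mul]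
    exact (Int.mul_ediv_cancel' (Int.gcd_dvd_left _ _)).symm
  · change _ = Int.gcd p.1 p.2 • (p.2 / (Int.gcd p.1 p.2 : ℤ))
    rw [nsmul_eq_mul]
    exact (Int.mul_ediv_cancel' (Int.gcd_dvd_right _ _)).symm

theorem slope_injOn {d d' : Lat} (hd : IsPrimitive d) (hd' : IsPrimitive d') (hy : 0 < yy d)
    (hy' : 0 < yy d') (h : slope d = slope d') : d' = d := by
  refine (hd.eq_or_eq_neg hd' ((slope_eq_iff hd.ne_zero hd'.ne_zero).1 h)).resolve_right ?_
  rintro rfl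
  rw [yy_neg] at hy'
  linarith

/-- Finitely many primitive directions are covered by the half lines through the vectors `± d`, where
`d` runs over a list of directions in a half plane which is sorted by slope. -/
theorem exists_sorted_directions {S : Set Lat} (hS : S.Finite) (hp : ∀ d ∈ S, IsPrimitive d) :
    ∃ l : List Lat, (∀ d ∈ l, IsPrimitive d ∧ 0 < yy d) ∧
      l.Pairwise (fun d d' => slope d < slope d') ∧ ∀ d ∈ S, d ∈ l ∨ -d ∈ l := by
  classical
  let up : Lat → Lat := fun d => if 0 < yy d then d else -d
  let T : Finset Lat := hS.toFinset.image up
  have hT : ∀ d ∈ T, IsPrimitive d ∧ 0 < yy d := by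
    intro d hd
    obtain ⟨d', hd', rfl⟩ := Finset.mem_image.1 hd
    have h1 := hp d' (hS.mem_toFinset.1 hd')
    simp only [up]
    split_ifs with h
    · exact ⟨h1, h⟩
    · refine ⟨h1.neg, ?_⟩
      rw [yy_neg]
      rcases lt_or_gt_of_ne (yy_ne_zero h1.ne_zero) with h2 | h2
      · linarith
      · exact (h h2).elim
  let rel : Lat → Lat → Prop := fun d d' => slope d ≤ slope d'
  have : Std.Total rel := ⟨fun a b => le_total (slope a) (slope b)⟩
  have : IsTrans Lat rel := ⟨fun a b c => le_trans⟩
  have hmem : ∀ d, d ∈ T.toList.insertionSort rel ↔ d ∈ T := fun d => by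
    rw [List.mem_insertionSort, Finset.mem_toList]
  have hnd : (T.toList.insertionSort rel).Nodup :=
    (List.perm_insertionSort rel _).nodup_iff.2 T.nodup_toList
  refine ⟨T.toList.insertionSort rel, fun d hd => hT d ((hmem d).1 hd), ?_, fun d hd => ?_⟩
  · refine ((List.pairwise_insertionSort rel T.toList).and hnd).imp_of_mem ?_
    rintro a b ha hb ⟨h1, h2⟩
    refine lt_of_le_of_ne h1 fun h => h2 ?_
    have ha' := hT a ((hmem a).1 ha)
    have hb' := hT b ((hmem b).1 hb)
    exact slope_injOn hb'.1 ha'.1 hb'.2 ha'.2 h.symm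
  · have h1 : up d ∈ T := Finset.mem_image_of_mem _ (hS.mem_toFinset.2 hd)
    rw [← hmem] at h1
    simp only [up] at h1
    split_ifs at h1
    · exact Or.inl h1
    · exact Or.inr h1

theorem neg_ne_self {d : Lat} (hd : d ≠ 0) : d ≠ -d := by
  intro h
  have h1 := congrArg Prod.fst h
  have h2 := congrArg Prod.snd h
  simp only [Prod.fst_neg, Prod.snd_neg] at h1 h2
  exact hd (Prod.ext (by simp; omega) (by simp; omega))

/-- The directions `-d` and `d`, in the order opposite to that in which the circle meets them. -/
def allDirs (l : List Lat) : List Lat := l.map (fun d => -d) ++ l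

variable {l : List Lat}

theorem mem_allDirs {d : Lat} : d ∈ allDirs l ↔ -d ∈ l ∨ d ∈ l := by
  rw [allDirs, List.mem_append, List.mem_map]
  constructor
  · rintro (⟨e, he, rfl⟩ | h)
    · left; rwa [neg_neg]
    · exact Or.inr h
  · rintro (h | h)
    · exact Or.inl ⟨-d, h, neg_neg d⟩
    · exact Or.inr h

theorem neg_mem_allDirs {d : Lat} : -d ∈ allDirs l ↔ d ∈ allDirs l := by
  rw [mem_allDirs, mem_allDirs, neg_neg, or_comm]

theorem allDirs_prim (hl : ∀ d ∈ l, IsPrimitive d ∧ 0 < yy d) : ∀ d ∈ allDirs l, IsPrimitive d := by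
  intro d hd
  rcases mem_allDirs.1 hd with h | h
  · rw [← neg_neg d]; exact (hl _ h).1.neg
  · exact (hl d h).1

theorem pairwise_allDirs (hl : ∀ d ∈ l, IsPrimitive d ∧ 0 < yy d)
    (hs : l.Pairwise fun d d' => slope d < slope d') :
    (allDirs l).Pairwise fun d d' => crossTime d' < crossTime d := by
  rw [allDirs, List.pairwise_append]
  refine ⟨?_, ?_, ?_⟩
  · rw [List.pairwise_map]
    refine hs.imp_of_mem fun {a b} ha hb h => ?_
    rw [crossTime_neg (hl a ha).2, crossTime_neg (hl b hb).2]
    have := crossTime_lt (hl a ha).2 (hl b hb).2 h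
    linarith
  · exact hs.imp_of_mem fun {a b} ha hb h => crossTime_lt (hl a ha).2 (hl b hb).2 h
  · intro a ha b hb
    obtain ⟨a, ha', rfl⟩ := List.mem_map.1 ha
    rw [crossTime_neg (hl a ha').2]
    have h1 := crossTime_lt_half (hl b hb).2
    have h2 := (crossTime_mem a).1
    linarith

theorem nodup_allDirs (hl : ∀ d ∈ l, IsPrimitive d ∧ 0 < yy d)
    (hs : l.Pairwise fun d d' => slope d < slope d') : (allDirs l).Nodup :=
  (pairwise_allDirs hl hs).imp fun h h' => by rw [h'] at h; exact lt_irrefl _ h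

end Directions

section Crossings

open MvPowerSeries

variable {r n : ℕ} {m : Fin n → Lat} {hm : ∀ i, IsPrimitive (m i)} {A : Fin n → Mat r}

theorem Wall.TrivialMod.mono {w : Wall r n} {k k' : ℕ} (h : w.TrivialMod k) (hk : k' ≤ k) :
    w.TrivialMod k' := fun P hP => h P (hP.trans hk)

theorem coeff_initialWall_f (p : Lat) (hp : IsPrimitive p) (B : Mat r) (i j : Fin n) :
    coeff (Finsupp.single j 1) (initialWall p hp B i).f
      = if j = i then AddMonoidAlgebra.single p 1 else 0 := by
  classical
  change coeff (Finsupp.single j 1) (1 + mono 1 (Finsupp.single i 1) p : Ser ℂ n) = _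
  rw [map_add, coeff_one, if_neg (by simp), zero_add, mono, coeff_monomial]
  simp only [Finsupp.single_left_inj one_ne_zero]

theorem initialWall_injective : Function.Injective fun i => initialWall (m i) (hm i) (A i) i := by
  intro i j h
  by_contra hij
  have h1 := congrArg (fun w : Wall r n => coeff (Finsupp.single i 1) w.f) h
  simp only [coeff_initialWall_f, if_true, if_neg hij] at h1
  have h2 := congrArg (fun x : AddMonoidAlgebra ℂ Lat => x.coeff (m i)) h1
  simp at h2

theorem not_trivialMod_initialWall (i : Fin n) {N : ℕ} (hN : 1 ≤ N) :
    ¬ (initialWall (m i) (hm i) (A i) i).TrivialMod N := by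
  classical
  intro h
  have h1 := (h (Finsupp.single i 1) (by simpa using hN)).2
  rw [coeff_initialWall_f, if_pos rfl, coeff_one, if_neg (by simp)] at h1
  have h2 := congrArg (fun x : AddMonoidAlgebra ℂ Lat => x.coeff (m i)) h1
  simp at h2

variable (hm A)

open Classical in
/-- The added ray in the direction `d`, if there is one that is non-trivial modulo the `(N + 1)`-st
power of the ideal. -/
def rayList (D : Set (Wall r n)) (N : ℕ) (d : Lat) : List (Wall r n) :=
  if h : ∃ w ∈ D \ initialDiagram m hm A, w.dir = d ∧ ¬ w.TrivialMod N then [h.choose] else []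

/-- The non-trivial walls whose support contains the half line through `d`. -/
def dirWalls (D : Set (Wall r n)) (N : ℕ) (d : Lat) : List (Wall r n) :=
  ((List.finRange n).filter fun i => m i = d ∨ m i = -d).map
    (fun i => initialWall (m i) (hm i) (A i) i) ++ rayList hm A D N d

/-- The crossings of the circle with the non-trivial walls. -/
def crossings (D : Set (Wall r n)) (N : ℕ) (l : List Lat) : List (ℝ × Wall r n) :=
  ((allDirs l).flatMap fun d => (dirWalls hm A D N d).map fun w => (crossTime d, w)).reverse

variable {hm A} {D : Set (Wall r n)}

theorem mem_rayList (hD : IsCompletion (initialDiagram m hm A) D) {N : ℕ} {d : Lat} {w : Wall r n} :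
    w ∈ rayList hm A D N d ↔ w ∈ D \ initialDiagram m hm A ∧ w.dir = d ∧ ¬ w.TrivialMod N := by
  rw [rayList]
  split_ifs with h
  · rw [List.mem_singleton]
    have h1 := h.choose_spec
    constructor
    · rintro rfl
      exact h1
    · rintro ⟨hw, hd, -⟩
      refine hD.support_inj w hw _ h1.1 ?_
      rw [Wall.support, Wall.support, hd, h1.2.1]
      simp only [eq_false (hD.isRay w hw), eq_false (hD.isRay _ h1.1)]
  · simp only [List.not_mem_nil, false_iff]
    exact fun hw => h ⟨w, hw⟩

theorem nodup_rayList (N : ℕ) (d : Lat) : (rayList hm A D N d).Nodup := by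
  rw [rayList]
  split_ifs <;> simp

theorem mem_dirWalls (hD : IsCompletion (initialDiagram m hm A) D) {N : ℕ} (hN : 1 ≤ N) {d : Lat}
    {w : Wall r n} : w ∈ dirWalls hm A D N d ↔
      w ∈ D ∧ ¬ w.TrivialMod N ∧ (w.dir = d ∨ w.isLine ∧ w.dir = -d) := by
  rw [dirWalls, List.mem_append, mem_rayList hD, List.mem_map]
  constructor
  · rintro (⟨i, hi, rfl⟩ | ⟨hw, hd, ht⟩)
    · refine ⟨hD.subset ⟨i, rfl⟩, not_trivialMod_initialWall i hN, ?_⟩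
      have h1 := (List.mem_filter.1 hi).2
      simp only [decide_eq_true_eq] at h1
      exact h1.imp id fun h => ⟨trivial, h⟩
    · exact ⟨hw.1, ht, Or.inl hd⟩
  · rintro ⟨hw, ht, hd⟩
    by_cases h0 : w ∈ initialDiagram m hm A
    · obtain ⟨i, rfl⟩ := h0
      refine Or.inl ⟨i, List.mem_filter.2 ⟨List.mem_finRange i, ?_⟩, rfl⟩
      simp only [decide_eq_true_eq]
      exact hd.imp id fun h => h.2
    · exact Or.inr ⟨⟨hw, h0⟩, hd.resolve_right fun h => hD.isRay w ⟨hw, h0⟩ h.1, ht⟩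

theorem nodup_dirWalls (hD : IsCompletion (initialDiagram m hm A) D) (N : ℕ) (d : Lat) :
    (dirWalls hm A D N d).Nodup := by
  rw [dirWalls, List.nodup_append']
  refine ⟨((List.nodup_finRange n).filter _).map initialWall_injective, nodup_rayList N d, ?_⟩
  intro w hw hw'
  obtain ⟨i, -, rfl⟩ := List.mem_map.1 hw
  exact ((mem_rayList hD).1 hw').1.2 ⟨i, rfl⟩

theorem isCrossingList_crossings (hD : IsCompletion (initialDiagram m hm A) D) {N : ℕ} (hN : 1 ≤ N)
    {l : List Lat} (hl : ∀ d ∈ l, IsPrimitive d ∧ 0 < yy d)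
    (hs : l.Pairwise fun d d' => slope d < slope d')
    (hc : ∀ w ∈ D, ¬ w.TrivialMod N → w.dir ∈ allDirs l) :
    IsCrossingList D circlePath N (crossings hm A D N l) := by
  have hpw := pairwise_allDirs hl hs
  refine ⟨?_, ?_, fun τ w => ?_⟩
  · rw [crossings, List.nodup_reverse, List.nodup_flatMap]
    refine ⟨fun d _ => (nodup_dirWalls hD N d).map fun w w' h => (Prod.ext_iff.1 h).2, ?_⟩
    refine hpw.imp fun {d d'} h => ?_
    intro x hx hx'
    obtain ⟨w, -, rfl⟩ := List.mem_map.1 hx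
    obtain ⟨w', -, h'⟩ := List.mem_map.1 hx'
    exact h.ne (Prod.ext_iff.1 h').1
  · rw [crossings, List.pairwise_reverse, List.pairwise_flatMap]
    refine ⟨fun d _ => ?_, hpw.imp fun {d d'} h => ?_⟩
    · rw [List.pairwise_map]
      exact List.pairwise_of_forall fun _ _ => le_rfl
    · intro x hx y hy
      obtain ⟨w, -, rfl⟩ := List.mem_map.1 hx
      obtain ⟨w', -, rfl⟩ := List.mem_map.1 hy
      exact h.le
  · rw [crossings, List.mem_reverse, List.mem_flatMap]
    constructor
    · rintro ⟨d, hd, h⟩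
      obtain ⟨w', hw, h⟩ := List.mem_map.1 h
      obtain ⟨rfl, rfl⟩ := Prod.ext_iff.1 h
      obtain ⟨h1, h2, h3⟩ := (mem_dirWalls hD hN).1 hw
      refine ⟨crossTime_mem d, h1, h2, ?_⟩
      refine (circlePath_mem_support_iff w' (crossTime_mem d)).2 ?_
      rcases h3 with h3 | ⟨h3, h4⟩
      · left; rw [h3]
      · right; exact ⟨h3, by rw [h4, neg_neg]⟩
    · rintro ⟨hτ, hw, ht, hsupp⟩
      have hdir := hc w hw ht
      rcases (circlePath_mem_support_iff w hτ).1 hsupp with rfl | ⟨h1, rfl⟩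
      · exact ⟨w.dir, hdir, List.mem_map.2 ⟨w, (mem_dirWalls hD hN).2 ⟨hw, ht, Or.inl rfl⟩, rfl⟩⟩
      · refine ⟨-w.dir, neg_mem_allDirs.2 hdir, List.mem_map.2 ⟨w, ?_, rfl⟩⟩
        exact (mem_dirWalls hD hN).2 ⟨hw, ht, Or.inr ⟨h1, (neg_neg _).symm⟩⟩

open Classical in
theorem sign_crossTime {d : Lat} (hd : d ≠ 0) {w : Wall r n} (h : w.dir = d ∨ w.dir = -d) :
    (if 0 < crossingSpeed circlePath (crossTime d) w then (1 : ℤ) else -1) = crossSign d w.dir := by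
  obtain ⟨s, hs, h1⟩ := exists_circlePath_crossTime hd
  have h2 := norm_sq_pos hd
  have hp := Real.pi_pos
  rcases h with h | h
  · rw [crossSign, if_pos h, if_pos]
    rw [crossingSpeed_circlePath h1 (z := 1) (by rw [h, one_smul])]
    simp only [Int.cast_one, mul_one]
    positivity
  · have h3 : ¬ w.dir = d := by rw [h]; exact (neg_ne_self hd).symm
    rw [crossSign, if_neg h3, if_pos h]
    refine if_neg ?_
    rw [crossingSpeed_circlePath h1 (z := -1) (by rw [h, neg_smul, one_smul]), not_lt]
    have : 0 < 2 * Real.pi * (s * ((d.1 : ℝ) ^ 2 + (d.2 : ℝ) ^ 2)) := by positivity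
    push_cast
    linarith

theorem pathProduct_crossings (hD : IsCompletion (initialDiagram m hm A) D) {N : ℕ} (hN : 1 ≤ N)
    {l : List Lat} (hl : ∀ d ∈ l, IsPrimitive d ∧ 0 < yy d) :
    pathProduct circlePath (crossings hm A D N l) = ((allDirs l).map fun d =>
      ((dirWalls hm A D N d).map fun w => w.theta (crossSign d w.dir)).prod).prod := by
  rw [pathProduct, crossings, List.map_reverse, List.reverse_reverse, List.map_flatMap,
    List.flatMap_def, List.prod_flatten, List.map_map]
  congr 1
  refine List.map_congr_left fun d hd => ?_
  rw [Function.comp_apply, List.map_map]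
  congr 1
  refine List.map_congr_left fun w hw => ?_
  rw [← sign_crossTime (allDirs_prim hl d hd).ne_zero
    (((mem_dirWalls hD hN).1 hw).2.2.imp id fun h => h.2)]
  rfl

end Crossings

/-! ### The logarithms of the rays -/

section Rays

open MvPowerSeries

variable {r n : ℕ} {m : Fin n → Lat} {hm : ∀ i, IsPrimitive (m i)} {A : Fin n → Mat r}
  {D : Set (Wall r n)} {K : Type} [Ring K] [Algebra ℂ K]

theorem exists_covering_directions (hD : IsCompletion (initialDiagram m hm A) D) (N : ℕ) :
    ∃ l : List Lat, (∀ d ∈ l, IsPrimitive d ∧ 0 < yy d) ∧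
      l.Pairwise (fun d d' => slope d < slope d') ∧
      (∀ w ∈ D, ¬ w.TrivialMod N → w.dir ∈ allDirs l) ∧
      ∀ Q : Fin n →₀ ℕ, Q.degree ≤ N → totalVector m Q ≠ 0 →
        ∃ d ∈ l, InRay d (totalVector m Q) ∨ InRay (-d) (totalVector m Q) := by
  classical
  let dirOf : Lat → Lat := fun p => if h : p ≠ 0 then (exists_primitive_inRay h).choose else (1, 0)
  have hdir : ∀ p, IsPrimitive (dirOf p) := by
    intro p
    simp only [dirOf]
    split_ifs with h
    · exact (exists_primitive_inRay h).choose_spec.1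
    · simp [IsPrimitive]
  have hray : ∀ p, p ≠ 0 → InRay (dirOf p) p := by
    intro p h
    simp only [dirOf, dif_pos h]
    exact (exists_primitive_inRay h).choose_spec.2
  have hfin : {Q : Fin n →₀ ℕ | Q.degree ≤ N}.Finite := Finsupp.finite_of_degree_le N
  obtain ⟨l, h1, h2, h3⟩ := exists_sorted_directions
    (S := Wall.dir '' {w ∈ D | ¬ w.TrivialMod N} ∪
      (fun Q => dirOf (totalVector m Q)) '' {Q : Fin n →₀ ℕ | Q.degree ≤ N})
    (((hD.finite N).image _).union (hfin.image _)) (by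
      rintro d (⟨w, -, rfl⟩ | ⟨Q, -, rfl⟩)
      · exact w.prim
      · exact hdir _)
  refine ⟨l, h1, h2, fun w hw ht => ?_, fun Q hQ h0 => ?_⟩
  · exact mem_allDirs.2 (h3 _ (Or.inl ⟨w, ⟨hw, ht⟩, rfl⟩)).symm
  · have h4 := hray _ h0
    rcases h3 _ (Or.inr ⟨Q, hQ, rfl⟩) with h | h
    · exact ⟨_, h, Or.inl h4⟩
    · exact ⟨_, h, Or.inr (by rwa [neg_neg])⟩

/-- The product of the functions of the initial lines through `d`. -/
def lineProd (m : Fin n → Lat) (β : Fin n → ℕ → K) (d : Lat) : OpSer K n :=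
  (((List.finRange n).filter fun i => m i = d ∨ m i = -d).map fun i =>
    pexp (crossSign d (m i) • initSer m β i)).prod

theorem coeff_zero_lineProd (m : Fin n → Lat) (β : Fin n → ℕ → K) (d : Lat) :
    coeff 0 (lineProd m β d) = 1 := by
  refine coeff_zero_list_prod fun x hx => ?_
  obtain ⟨i, -, rfl⟩ := List.mem_map.1 hx
  exact coeff_zero_pexp _

variable (p : Ambient r n →* Module.End ℂ (Ser K n)) (E : Wall r n → OpSer K n)
  (hp : ∀ w ε, p (w.theta ε) = op (pexp (ε • E w)))

include hp in
theorem map_prod_dirWalls (hD : IsCompletion (initialDiagram m hm A) D) {β : Fin n → ℕ → K}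
    (hE : ∀ i, E (initialWall (m i) (hm i) (A i) i) = initSer m β i) (N : ℕ) (d : Lat) :
    p ((dirWalls hm A D N d).map fun w => w.theta (crossSign d w.dir)).prod
      = op (lineProd m β d * pexp ((rayList hm A D N d).map E).sum) := by
  rw [map_list_prod, List.map_map, dirWalls, List.map_append, List.prod_append, map_mul, lineProd,
    map_list_prod, List.map_map, List.map_map]
  congr 1
  · congr 1
    refine List.map_congr_left fun i _ => ?_
    simp only [Function.comp_apply, hp, hE]
    rfl
  · have h1 : ∀ w ∈ rayList hm A D N d, w.dir = d := fun w hw => ((mem_rayList hD).1 hw).2.1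
    have h2 : rayList hm A D N d = [] ∨ ∃ w, rayList hm A D N d = [w] := by
      rw [rayList]
      split_ifs
      · exact Or.inr ⟨_, rfl⟩
      · exact Or.inl rfl
    rcases h2 with h2 | ⟨w, h2⟩
    · rw [h2, List.map_nil, List.map_nil, List.prod_nil, List.sum_nil, pexp_zero, map_one]
    · have h3 := h1 w (by rw [h2]; exact List.mem_singleton.2 rfl)
      have h4 : (1 : ℤ) • E w = E w := one_smul ℤ _
      rw [h2, List.map_singleton, List.map_singleton, List.prod_singleton, List.sum_singleton,
        Function.comp_apply, hp, crossSign, if_pos h3, h4]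

include hp in
/-- The logarithms of the rays of the completion are the explicit ones. -/
theorem coeff_ray_eq (hD : IsCompletion (initialDiagram m hm A) D) {β : Fin n → ℕ → K}
    (hβ : ∀ i j l l', β i l * β j l' = β j l' * β i l)
    (hE : ∀ i, E (initialWall (m i) (hm i) (A i) i) = initSer m β i)
    (hV : ∀ w, Vanish 1 (E w)) (hR : ∀ w P, OpRay w.dir (coeff P (E w)))
    (hid : ∀ k Θ, IsIdMod k Θ → ∀ v P, P.degree ≤ k → coeff P (p Θ v) = coeff P v)
    {w : Wall r n} (hw : w ∈ D \ initialDiagram m hm A) (P : Fin n →₀ ℕ) :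
    coeff P (E w) = coeff P (rayLog m β w.dir) := by
  obtain ⟨k, hk⟩ := hD.nontrivial w hw
  obtain ⟨N, hPN, hkN, hN⟩ : ∃ N, P.degree ≤ N ∧ k ≤ N ∧ 1 ≤ N :=
    ⟨P.degree + k + 1, by omega, by omega, by omega⟩
  have hwN : ¬ w.TrivialMod N := fun h => hk (h.mono hkN)
  obtain ⟨l, hl, hs, hcw, hcv⟩ := exists_covering_directions hD N
  have hprim := allDirs_prim hl
  have hmem := hcw w hw.1 hwN
  have hray : (rayList hm A D N w.dir).map E = [E w] := by
    have h1 : w ∈ rayList hm A D N w.dir := (mem_rayList hD).2 ⟨hw, rfl, hwN⟩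
    rw [rayList] at h1 ⊢
    split_ifs at h1 ⊢
    · rw [← List.mem_singleton.1 h1, List.map_singleton]
    · simp at h1
  have hsum : ∀ d (Q : Fin n →₀ ℕ), coeff Q ((rayList hm A D N d).map E).sum = 0 ∨
      ∃ w', w'.dir = d ∧ ((rayList hm A D N d).map E).sum = E w' := by
    intro d Q
    have h1 : ∀ w ∈ rayList hm A D N d, w.dir = d := fun w hw => ((mem_rayList hD).1 hw).2.1
    rw [rayList] at h1 ⊢
    split_ifs at h1 ⊢ with h
    · exact Or.inr ⟨_, h1 _ (List.mem_singleton.2 rfl), by simp⟩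
    · left; simp
  have h1 := coeff_eq_of_coeff_prod_eq (N := N) (nodup_allDirs hl hs) hprim (U := lineProd m β)
    (a := fun d => ((rayList hm A D N d).map E).sum) (c := rayLog m β)
    (fun d _ => coeff_zero_lineProd m β d)
    (fun d _ => Vanish.list_sum fun x hx => by
      obtain ⟨w', -, rfl⟩ := List.mem_map.1 hx
      exact hV w')
    (fun d hd => vanish_rayLog m β (hprim d hd).ne_zero)
    (fun d _ Q => by
      rcases hsum d Q with h | ⟨w', rfl, h⟩
      · rw [h]; exact opRay_zero d
      · rw [h]; exact hR w' Q)
    (fun d _ Q => opRay_coeff_rayLog m β d Q) ?_ w.dir hmem P hPN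
  · rwa [hray, List.sum_singleton] at h1
  · intro Q hQ
    have e1 : p (pathProduct circlePath (crossings hm A D N l)) = op ((allDirs l).map fun d =>
        lineProd m β d * pexp ((rayList hm A D N d).map E).sum).prod := by
      rw [pathProduct_crossings hD hN hl, map_list_prod, map_list_prod, List.map_map, List.map_map]
      congr 1
      exact List.map_congr_left fun d _ => map_prod_dirWalls p E hp hD hE N d
    have e2 := hid N _ (hD.consistent circlePath (isGenericLoop_circlePath D) N _
      (isCrossingList_crossings hD hN hl hs hcw))
    rw [e1] at e2
    have e3 : coeff Q ((allDirs l).map fun d =>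
        lineProd m β d * pexp ((rayList hm A D N d).map E).sum).prod = coeff Q 1 := by
      refine LinearMap.ext fun u => ?_
      rw [← coeff_op_C, e2 _ _ hQ, ← coeff_op_C, map_one, Module.End.one_apply]
    have e4 := coeff_psi_logSeries_prod (fun i => (hm i).ne_zero) (multElem_commute hβ) multScalar
      (fun d hd => (hl d hd).2) hs Q fun Q' hQ' h0 => hcv Q' ((Finsupp.degree_mono hQ').trans hQ) h0
    rw [e3, ← e4, allDirs, List.map_append, List.prod_append, List.map_map]
    congr 2
    · congr 1
      refine List.map_congr_left fun d hd => ?_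
      exact pexp_psi_logSeries hm hβ (hl d hd).1.neg
    · congr 1
      exact List.map_congr_left fun d hd => pexp_psi_logSeries hm hβ (hl d hd).1

end Rays

/-! ### Tuples of partitions -/

section Partitions

variable {n : ℕ} {P : Fin n →₀ ℕ}

theorem ktot_eq_sum_map {σ M : Type} [AddCommMonoid M] (f : σ → M) (k : σ →₀ ℕ) :
    ktot f k = (k.toMultiset.map f).sum := by
  induction k using Finsupp.induction_linear with
  | zero => simp
  | add a b ha hb => rw [map_add, map_add, Multiset.map_add, Multiset.sum_add, ha, hb]
  | single s a =>
    rw [Finsupp.linearCombination_single, Finsupp.toMultiset_single, Multiset.map_nsmul,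
      Multiset.sum_nsmul, Multiset.map_singleton, Multiset.sum_singleton]

theorem multiset_map_sum {X Y : Type} (f : X → Y) (F : Fin n → Multiset X) :
    (∑ i, F i).map f = ∑ i, (F i).map f := map_sum (Multiset.mapAddMonoidHom f) _ _

theorem multiset_sum_sum {M : Type} [AddCommMonoid M] (F : Fin n → Multiset M) :
    (∑ i, F i).sum = ∑ i, (F i).sum := map_sum (Multiset.sumAddMonoidHom (M := M)) _ _

/-- The exponent `k_{i, l}` in the variables `s_{i, l}` of a tuple of partitions. -/
def expOf (κ : PartitionTuple P) : (Fin n × ℕ) →₀ ℕ :=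
  Multiset.toFinsupp (∑ i, (κ i).parts.map fun l => (i, l - 1))

theorem toMultiset_expOf (κ : PartitionTuple P) :
    (expOf κ).toMultiset = ∑ i, (κ i).parts.map fun l => (i, l - 1) :=
  Multiset.toFinsupp_toMultiset _

theorem expOf_apply (κ : PartitionTuple P) (i : Fin n) (j : ℕ) : expOf κ (i, j) = κ.num i (j + 1) := by
  classical
  rw [expOf, Multiset.toFinsupp_apply, Multiset.count_sum', Finset.sum_eq_single i]
  · rw [Multiset.count_map, PartitionTuple.num, Multiset.count_eq_card_filter_eq]
    congr 1
    refine Multiset.filter_congr fun l hl => ?_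
    have := (κ i).parts_pos hl
    simp only [Prod.mk.injEq, true_and]
    omega
  · intro i' _ hi
    rw [Multiset.count_eq_zero, Multiset.mem_map]
    rintro ⟨l, -, h⟩
    exact hi (Prod.ext_iff.1 h).1
  · simp

theorem num_eq_zero (κ : PartitionTuple P) {i : Fin n} {l : ℕ} (h : P i < l) : κ.num i l = 0 := by
  rw [PartitionTuple.num, Multiset.count_eq_zero]
  intro hl
  have := Multiset.single_le_sum (fun x _ => Nat.zero_le x) l hl
  rw [(κ i).parts_sum] at this
  omega

@[to_additive]
theorem prod_expOf {M : Type} [CommMonoid M] (κ : PartitionTuple P) (g : Fin n × ℕ → ℕ → M)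
    (hg : ∀ s, g s 0 = 1) :
    (expOf κ).prod g = ∏ i, ∏ l ∈ Finset.Icc 1 (P i), g (i, l - 1) (κ.num i l) := by
  classical
  have h1 : (expOf κ).support ⊆ Finset.univ ×ˢ Finset.range P.degree := by
    rintro ⟨i, j⟩ h
    rw [Finsupp.mem_support_iff, expOf_apply] at h
    refine Finset.mem_product.2 ⟨Finset.mem_univ _, Finset.mem_range.2 ?_⟩
    by_contra! h2
    have h3 : P i ≤ P.degree := Finsupp.le_degree i P
    exact h (num_eq_zero κ (by omega))
  rw [Finsupp.prod_of_support_subset _ h1 g fun s _ => hg s, Finset.prod_product]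
  refine Finset.prod_congr rfl fun i _ => ?_
  have h3 : P i ≤ P.degree := Finsupp.le_degree i P
  refine (Finset.prod_subset_one_on_sdiff (s₁ := (Finset.Icc 1 (P i)).image fun l => l - 1) (f := fun j =>
    g (i, j) (κ.num i (j + 1))) (g := fun j => g (i, j) (expOf κ (i, j))) ?_ ?_ ?_).symm.trans ?_
  · intro j hj
    obtain ⟨l, hl, rfl⟩ := Finset.mem_image.1 hj
    have := Finset.mem_Icc.1 hl
    exact Finset.mem_range.2 (by omega)
  · intro j hj
    obtain ⟨h4, h5⟩ := Finset.mem_sdiff.1 hj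
    rw [expOf_apply, num_eq_zero κ, hg]
    by_contra! h6
    exact h5 (Finset.mem_image.2 ⟨j + 1, Finset.mem_Icc.2 ⟨by omega, h6⟩, rfl⟩)
  · intro j _
    rw [expOf_apply]
  · rw [Finset.prod_image]
    · refine Finset.prod_congr rfl fun l hl => ?_
      have := Finset.mem_Icc.1 hl
      rw [show l - 1 + 1 = l by omega]
    · intro l hl l' hl' h
      have := Finset.mem_Icc.1 hl
      have := Finset.mem_Icc.1 hl'
      simp only at h
      omega

theorem wt_expOf (κ : PartitionTuple P) : wt (expOf κ) = P := by
  classical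
  rw [wt, ktot_eq_sum_map, toMultiset_expOf, multiset_map_sum, multiset_sum_sum]
  have h : ∀ i, (((κ i).parts.map fun l => (i, l - 1)).map
      fun s : Fin n × ℕ => Finsupp.single s.1 (s.2 + 1)).sum = Finsupp.single i (P i) := by
    intro i
    rw [Multiset.map_map]
    have h1 : (κ i).parts.map ((fun s : Fin n × ℕ => Finsupp.single s.1 (s.2 + 1)) ∘
        fun l => (i, l - 1)) = (κ i).parts.map fun l => Finsupp.singleAddHom i l := by
      refine Multiset.map_congr rfl fun l hl => ?_
      have := (κ i).parts_pos hl
      simp only [Function.comp_apply, Finsupp.singleAddHom_apply]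
      rw [Nat.sub_add_cancel this]
    rw [h1, ← map_multiset_sum, (κ i).parts_sum, Finsupp.singleAddHom_apply]
  rw [Finset.sum_congr rfl fun i _ => h i, Finsupp.univ_sum_single]

theorem expOf_injective : Function.Injective (expOf : PartitionTuple P → _) := by
  intro κ κ' h
  funext i
  refine Nat.Partition.ext ?_
  ext l
  rcases l with _ | j
  · rw [Multiset.count_eq_zero_of_notMem, Multiset.count_eq_zero_of_notMem]
    · exact fun h => absurd ((κ' i).parts_pos h) (lt_irrefl _)
    · exact fun h => absurd ((κ i).parts_pos h) (lt_irrefl _)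
  · have := DFunLike.congr_fun h (i, j)
    rwa [expOf_apply, expOf_apply] at this

theorem exists_expOf_eq {k : (Fin n × ℕ) →₀ ℕ} (hk : wt k = P) : ∃ κ : PartitionTuple P, expOf κ = k := by
  classical
  have hsum : ∀ i, ((k.toMultiset.filter fun s => s.1 = i).map fun s => s.2 + 1).sum = P i := by
    intro i
    rw [← hk, wt, ktot_eq_sum_map]
    generalize k.toMultiset = M
    induction M using Multiset.induction_on with
    | empty => simp
    | cons s M ih =>
      rw [Multiset.map_cons, Multiset.sum_cons, Finsupp.add_apply, ← ih, Multiset.filter_cons]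
      by_cases hs : s.1 = i
      · simp [hs]
      · simp [hs]
  refine ⟨fun i => ⟨(k.toMultiset.filter fun s => s.1 = i).map fun s => s.2 + 1, ?_, hsum i⟩, ?_⟩
  · intro l hl
    obtain ⟨s, -, rfl⟩ := Multiset.mem_map.1 hl
    exact Nat.succ_pos _
  · ext ⟨i, j⟩
    rw [expOf_apply, PartitionTuple.num]
    change Multiset.count (j + 1) ((k.toMultiset.filter fun s => s.1 = i).map fun s => s.2 + 1) = _
    rw [Multiset.count_map, Multiset.filter_filter, ← Finsupp.count_toMultiset,
      Multiset.count_eq_card_filter_eq]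
    congr 1
    refine Multiset.filter_congr fun s _ => ?_
    rw [Prod.ext_iff]
    simp only [Nat.add_right_cancel_iff]
    exact ⟨fun h => ⟨h.2.symm, h.1⟩, fun h => ⟨h.2, h.1.symm⟩⟩

theorem sum_fiber {M : Type} [AddCommMonoid M] (f : ((Fin n × ℕ) →₀ ℕ) → M) :
    ∑ k ∈ fiber P, f k = ∑ κ : PartitionTuple P, f (expOf κ) := by
  refine (Finset.sum_bij (fun κ _ => expOf κ) (fun κ _ => mem_fiber.2 (wt_expOf κ))
    (fun κ _ κ' _ h => expOf_injective h) (fun k hk => ?_) fun _ _ => rfl).symm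
  obtain ⟨κ, rfl⟩ := exists_expOf_eq (mem_fiber.1 hk)
  exact ⟨κ, Finset.mem_univ _, rfl⟩

theorem cpow_div_kfact_expOf (κ : PartitionTuple P) :
    cpow multScalar (expOf κ) / kfact (expOf κ) = partitionWeight κ := by
  have h1 : cpow multScalar (expOf κ) / kfact (expOf κ)
      = (expOf κ).prod fun s a => multScalar s ^ a / (Nat.factorial a : ℂ) := by
    rw [cpow, kfact, Finsupp.prod, Finsupp.prod, Finsupp.prod, Nat.cast_prod, Finset.prod_div_distrib]
  rw [h1, prod_expOf κ _ fun s => by simp, partitionWeight]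
  refine Finset.prod_congr rfl fun i _ => Finset.prod_congr rfl fun l hl => ?_
  obtain ⟨j, rfl⟩ := Nat.exists_eq_add_of_le' (Finset.mem_Icc.1 hl).1
  rw [multScalar, Nat.add_sub_cancel, Nat.cast_succ]

theorem ktot_multElem_expOf {r : ℕ} (A : Fin n → Mat r) (κ : PartitionTuple P) :
    ktot (multElem fun i j => A i ^ j) (expOf κ) = matrixWeight A κ := by
  rw [Finsupp.linearCombination_apply, sum_expOf κ (fun s a => a • multElem (fun i j => A i ^ j) s)
    fun s => zero_smul _ _, matrixWeight]
  refine Finset.sum_congr rfl fun i _ => Finset.sum_congr rfl fun l hl => ?_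
  obtain ⟨j, rfl⟩ := Nat.exists_eq_add_of_le' (Finset.mem_Icc.1 hl).1
  rw [multElem, Nat.add_sub_cancel, smul_smul, ← Nat.cast_smul_eq_nsmul ℂ]
  push_cast
  rw [mul_comm]

theorem map_multVec_expOf (m : Fin n → Lat) (κ : PartitionTuple P) :
    (expOf κ).toMultiset.map (multVec m) = Finset.univ.val.map (weightVectors m κ) := by
  classical
  rw [toMultiset_expOf, multiset_map_sum, ← Finset.univ_sigma_univ]
  have h1 : (Finset.univ.sigma fun i : Fin n => (Finset.univ : Finset (κ i).parts.ToType)).val.map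
      (weightVectors m κ) = ∑ i, Finset.univ.val.map fun x : (κ i).parts.ToType => x.1 • m i := by
    change ((Finset.univ.val.bind fun i : Fin n => Finset.univ.val.map (Sigma.mk i)).map
      (weightVectors m κ)) = _
    rw [Multiset.map_bind, Multiset.bind, Multiset.join]
    refine congrArg Multiset.sum (Multiset.map_congr rfl fun i _ => ?_)
    rw [Multiset.map_map]
    rfl
  rw [h1]
  refine Finset.sum_congr rfl fun i _ => ?_
  have h2 : (Finset.univ.val.map fun x : (κ i).parts.ToType => x.1 • m i)
      = (Finset.univ.val.map fun x : (κ i).parts.ToType => x.1).map fun l => l • m i := by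
    rw [Multiset.map_map]
    rfl
  rw [h2, Multiset.map_univ_coe, Multiset.map_map]
  refine Multiset.map_congr rfl fun l hl => ?_
  have := (κ i).parts_pos hl
  rw [Function.comp_apply, multVec, Nat.sub_add_cancel this]

theorem cpow_mul_rayCoef_expOf {m : Fin n → Lat} (hm : ∀ i, m i ≠ 0) {d : Lat} (hd : d ≠ 0)
    (h : InRay d (totalVector m P)) (κ : PartitionTuple P) :
    cpow multScalar (expOf κ) * rayCoef (multVec m) d (expOf κ)
      = tropicalCount (weightVectors m κ) * partitionWeight κ := by
  classical
  have h1 : ktot (multVec m) (expOf κ) = totalVector m P := by rw [ktot_multVec, wt_expOf]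
  have hw : ∀ x, weightVectors m κ x ≠ 0 := by
    intro x h2
    rcases smul_eq_zero.1 h2 with h2 | h2
    · exact absurd ((κ x.1).parts_pos (Multiset.coe_mem (x := x.2))) (by omega)
    · exact hm _ h2
  have hmap := map_multVec_expOf m κ
  have hout : ∑ x, weightVectors m κ x ≠ 0 := by
    intro h2
    have h3 : (Finset.univ.val.map (weightVectors m κ)).sum = 0 := h2
    rw [← hmap, ← ktot_eq_sum_map, h1] at h3
    exact not_inRay_zero hd (h3 ▸ h)
  have hcard : (expOf κ).degree = Fintype.card ((i : Fin n) × (κ i).parts.ToType) := by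
    have h2 := congrArg Multiset.card hmap
    rw [Multiset.card_map, Multiset.card_map, Finsupp.card_toMultiset] at h2
    exact h2
  rw [rayCoef, if_pos (h1.symm ▸ h), hmap, countM_eq_tropicalCount hw hout, hcard,
    ← cpow_div_kfact_expOf]
  push_cast
  ring

end Partitions

/-! ### The explicit formula -/

section Formula

open MvPowerSeries

variable {r n : ℕ} {m : Fin n → Lat} {hm : ∀ i, IsPrimitive (m i)} {A : Fin n → Mat r}
  {D : Set (Wall r n)} {K : Type} [Ring K] [Algebra ℂ K]

theorem sexp_zsmul_act {B : Ser K n} {g : Ser ℂ n} (hB : coeff 0 B = 0) (hg : coeff 0 g = 0)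
    (q : Lat) (ε : ℤ) : sexp (ε • act B g q) = op (pexp (ε • actSer B g q)) := by
  have h : ε • op (actSer B g q) = op (ε • actSer B g q) := (map_zsmul op ε _).symm
  rw [act_eq_op, h, sexp_op]
  intro P hP
  have h1 : coeff P (ε • actSer B g q) = ε • coeff P (actSer B g q) := map_zsmul _ _ _
  rw [h1, vanish_actSer hB hg q P hP, smul_zero]

theorem serRay_slog_M (w : Wall r n) : SerRay w.dir (slog w.M) :=
  SerRay.slog fun P q h => (w.M_mem P q h).2

theorem serRay_slog_f (w : Wall r n) : SerRay w.dir (slog w.f) :=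
  SerRay.slog fun P q h => (w.f_mem P q h).2

theorem slog_initialWall_f (i : Fin n) :
    slog (initialWall (m i) (hm i) (A i) i).f = logMono 1 i (m i) := by
  refine (slog_one_add_mono 1 i (m i)).trans ?_
  congr 1
  funext j
  exact one_pow j

theorem coeff_act_slog_M (hA : ∀ i j, A i * A j = A j * A i)
    (hD : IsCompletion (initialDiagram m hm A) D) {w : Wall r n}
    (hw : w ∈ D \ initialDiagram m hm A) (P : Fin n →₀ ℕ) :
    coeff P (actSer (slog w.M) (slog w.f) (normal w.dir))
      = coeff P (rayLog m (fun i j => A i ^ j) w.dir) := by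
  refine coeff_ray_eq (MonoidHom.fst _ _)
    (fun w => actSer (slog w.M) (slog w.f) (normal w.dir)) (fun w ε => ?_) hD ?_ (fun i => ?_)
    (fun w => ?_) (fun w P => ?_) (fun k Θ h => h.1) hw P
  · exact sexp_zsmul_act (coeff_zero_slog _) (coeff_zero_slog _) _ _
  · exact fun i j l l' => Commute.pow_pow (hA i j) l l'
  · rw [slog_initialWall_f, initSer]
    congr 1
    exact slog_one_add_mono (A i) i (m i)
  · exact vanish_actSer (coeff_zero_slog _) (coeff_zero_slog _) _
  · exact opRay_coeff_actSer (serRay_slog_M w) (serRay_slog_f w) _ _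

theorem coeff_act_slog_f (hD : IsCompletion (initialDiagram m hm A) D) {w : Wall r n}
    (hw : w ∈ D \ initialDiagram m hm A) (P : Fin n →₀ ℕ) :
    coeff P (actSer 0 (slog w.f) (normal w.dir)) = coeff P (rayLog m (0 : Fin n → ℕ → ℂ) w.dir) := by
  refine coeff_ray_eq (MonoidHom.snd _ _)
    (fun w => actSer 0 (slog w.f) (normal w.dir)) (fun w ε => ?_) hD (fun i j l l' => rfl)
    (fun i => ?_) (fun w => ?_) (fun w P => ?_) (fun k Θ h => h.2) hw P
  · exact sexp_zsmul_act (map_zero _) (coeff_zero_slog _) _ _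
  · rw [slog_initialWall_f, initSer]
    congr 1
    exact (logMono_zero i (m i)).symm
  · exact vanish_actSer (map_zero _) (coeff_zero_slog _) _
  · exact opRay_coeff_actSer (fun P q h => (h (by simp)).elim) (serRay_slog_f w) _ _

theorem coeff_rayLog_single (hm : ∀ i, m i ≠ 0) (β : Fin n → ℕ → K) {d : Lat} (hd : d ≠ 0)
    {P : Fin n →₀ ℕ} (h : InRay d (totalVector m P)) (q : Lat) (κ : K) :
    coeff P (rayLog m β d) (AddMonoidAlgebra.single q κ) = ∑ k : PartitionTuple P,
      ((tropicalCount (weightVectors m k) : ℂ) * partitionWeight k) •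
        AddMonoidAlgebra.single (totalVector m P + q)
          (ktot (multElem β) (expOf k) * κ + wedge (totalVector m P) q • κ) := by
  rw [rayLog, coeff_psi, sum_fiber, LinearMap.sum_apply]
  refine Finset.sum_congr rfl fun k _ => ?_
  rw [coeff_raySeries, smul_smul, cpow_mul_rayCoef_expOf hm hd h, LinearMap.smul_apply, elem_single,
    ktot_multVec, wt_expOf]

theorem coeff_rayLog_eq_zero (β : Fin n → ℕ → K) {d : Lat} {P : Fin n →₀ ℕ}
    (h : ¬ InRay d (totalVector m P)) : coeff P (rayLog m β d) = 0 := by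
  rw [rayLog, coeff_psi]
  refine Finset.sum_eq_zero fun k hk => ?_
  rw [coeff_raySeries, rayCoef, ktot_multVec, mem_fiber.1 hk, if_neg h, zero_smul, smul_zero]

theorem finsum_inRay {M : Type} [AddCommMonoid M] {d p : Lat} (hd : d ≠ 0) {l : ℕ} (hl : 1 ≤ l)
    (h : p = l • d) (f : ℕ → M) : ∑ᶠ (l' : ℕ) (_ : 1 ≤ l' ∧ p = l' • d), f l' = f l := by
  classical
  simp only [finsum_eq_if]
  rw [finsum_eq_single _ l, if_pos ⟨hl, h⟩]
  rintro l' hne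
  rw [if_neg]
  rintro ⟨-, h'⟩
  rw [h] at h'
  have h1 : ((l : ℤ) - l') • d = 0 := by
    rw [sub_smul, natCast_zsmul, natCast_zsmul, h', sub_self]
  rcases smul_eq_zero.1 h1 with h1 | h1
  · omega
  · exact hd h1

theorem finsum_not_inRay {M : Type} [AddCommMonoid M] {d p : Lat} (h : ¬ InRay d p) (f : ℕ → M) :
    ∑ᶠ (l' : ℕ) (_ : 1 ≤ l' ∧ p = l' • d), f l' = 0 := by
  classical
  simp only [finsum_eq_if]
  exact finsum_eq_zero_of_forall_eq_zero fun l' => if_neg fun h' => h ⟨l', h'⟩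

theorem slog_M_eq (hA : ∀ i j, A i * A j = A j * A i)
    (hD : IsCompletion (initialDiagram m hm A) D) {w : Wall r n}
    (hw : w ∈ D \ initialDiagram m hm A) : slog w.M = tropicalMatrixSeries m A w.dir := by
  ext1 P
  have h1 := congrArg (fun T => T (AddMonoidAlgebra.single 0 1)) (coeff_act_slog_M hA hD hw P)
  simp only [coeff_actSer, dLaurent_single] at h1
  have h2 : pairing 0 (normal w.dir) = 0 := by simp [pairing]
  rw [h2, zero_smul, mul_zero, add_zero, ← AddMonoidAlgebra.one_def, mul_one,
    AddMonoidAlgebra.one_def] at h1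
  change _ = ∑ᶠ (l : ℕ) (_ : 1 ≤ l ∧ totalVector m P = l • w.dir), _
  by_cases h : InRay w.dir (totalVector m P)
  · rw [h1, coeff_rayLog_single (fun i => (hm i).ne_zero) _ w.prim.ne_zero h]
    obtain ⟨l, hl, hP⟩ := h
    rw [finsum_inRay w.prim.ne_zero hl hP]
    refine Finset.sum_congr rfl fun k _ => ?_
    rw [wedge_zero_right, zero_smul, add_zero, add_zero, mul_one, ktot_multElem_expOf,
      AddMonoidAlgebra.smul_single]
  · rw [h1, coeff_rayLog_eq_zero _ h, finsum_not_inRay h]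
    rfl

theorem slog_f_eq (hD : IsCompletion (initialDiagram m hm A) D) {w : Wall r n}
    (hw : w ∈ D \ initialDiagram m hm A) : slog w.f = tropicalScalarSeries m w.dir := by
  ext1 P
  let q : Lat := normal w.dir
  have hq : wedge w.dir q ≠ 0 := by
    intro h0
    have h1 := norm_sq_pos w.prim.ne_zero
    have h2 : ((wedge w.dir q : ℤ) : ℝ) = (w.dir.1 : ℝ) ^ 2 + (w.dir.2 : ℝ) ^ 2 := by
      simp only [wedge, q, normal]; push_cast; ring
    rw [h0, Int.cast_zero] at h2
    linarith
  have hq' : ((wedge w.dir q : ℤ) : ℂ) ≠ 0 := Int.cast_ne_zero.2 hq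
  have hscal : coeff P (scal (K := ℂ) (slog w.f)) = coeff P (slog w.f) := by
    ext x
    rw [coeff_scal]
    rfl
  have h1 := congrArg (fun T => T (AddMonoidAlgebra.single q 1)) (coeff_act_slog_f hD hw P)
  simp only [coeff_actSer, dLaurent_single] at h1
  rw [map_zero, zero_mul, zero_add, hscal, pairing_normal, AddMonoidAlgebra.smul_single] at h1
  have h2 : coeff P (slog w.f) = coeff P (rayLog m (0 : Fin n → ℕ → ℂ) w.dir)
      (AddMonoidAlgebra.single q 1) * AddMonoidAlgebra.single (-q) ((wedge w.dir q : ℂ)⁻¹) := by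
    rw [← h1, mul_assoc, AddMonoidAlgebra.single_mul_single, add_neg_cancel, zsmul_one,
      mul_inv_cancel₀ hq', ← AddMonoidAlgebra.one_def, mul_one]
  change _ = ∑ᶠ (l : ℕ) (_ : 1 ≤ l ∧ totalVector m P = l • w.dir), _
  by_cases h : InRay w.dir (totalVector m P)
  · rw [h2, coeff_rayLog_single (fun i => (hm i).ne_zero) _ w.prim.ne_zero h, Finset.sum_mul]
    obtain ⟨l, hl, hP⟩ := h
    rw [finsum_inRay w.prim.ne_zero hl hP]
    refine Finset.sum_congr rfl fun k _ => ?_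
    have h3 : ktot (multElem (0 : Fin n → ℕ → ℂ)) (expOf k) = 0 := by
      rw [Finsupp.linearCombination_apply]
      refine Finset.sum_eq_zero fun s _ => ?_
      simp [multElem]
    have h4 : wedge (totalVector m P) q = l * wedge w.dir q := by
      rw [hP]
      change (l • w.dir.1) * q.2 - (l • w.dir.2) * q.1 = _
      rw [wedge, nsmul_eq_mul, nsmul_eq_mul]
      ring
    rw [h3, h4, zero_mul, zero_add, smul_mul_assoc, AddMonoidAlgebra.single_mul_single,
      add_neg_cancel_right, AddMonoidAlgebra.smul_single, zsmul_one, smul_eq_mul]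
    congr 1
    push_cast
    field_simp
  · rw [h2, coeff_rayLog_eq_zero _ h, finsum_not_inRay h, LinearMap.zero_apply, zero_mul]

end Formula

end ExtVertex

end

theorem mainTheorem4 {r n : ℕ} (m : Fin n → ExtVertex.Lat)
    (hm : ∀ i, ExtVertex.IsPrimitive (m i))
    (A : Fin n → ExtVertex.Mat r) (hA : ∀ i j, A i * A j = A j * A i)
    (D : Set (ExtVertex.Wall r n))
    (hD : ExtVertex.IsCompletion (ExtVertex.initialDiagram m hm A) D)
    (d : ExtVertex.Wall r n) (hd : d ∈ D \ ExtVertex.initialDiagram m hm A) :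
    ExtVertex.slog d.M = ExtVertex.tropicalMatrixSeries m A d.dir ∧
      ExtVertex.slog d.f = ExtVertex.tropicalScalarSeries m d.dir := by
  exact ⟨ExtVertex.slog_M_eq hA hD hd, ExtVertex.slog_f_eq hD hd⟩
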